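/- Let $d\ge 1$, $k_0>0$, and let $R:\mathbb R^d\to\mathbb R$ be continuous, even, bounded and integrable, with power spectrum $\hat R(\xi)=\int_{\mathbb R^d} R(x)e^{-i\xi\cdot x}\,dx\ge 0$. Assume that $\hat R$ has an integrable radially symmetric majorant, that $s\mapsto R(\tau+se)$ is integrable for all $\tau\in\mathbb R^d$ and all unit vectors $e$, and, if $d\ge 3$, that $(1+|\xi|^2)^{(d-2)/2}\hat R(\xi)$ is bounded. Let either $\eta(\varepsilon)=1$ (kinetic regime) or $\eta(\varepsilon)=(\ln|\ln\varepsilon|)^{-1}$ (diffusive regime). Below, $\varepsilon\in(0,1)$ is such that $\eta=\eta(\varepsilon)>0$. Let $u_0^\varepsilon\in L^2(\mathbb R^d;\mathbb C)$ have an integrable Fourier transform $\widehat{u_0^\varepsilon}$, and let $u^\varepsilon$ be a solution (a continuous $L^2(\mathbb R^d;\mathbb C)$-valued process with locally bounded moments, solving the associated martingale problem) of the Itô–Schrödinger equation $$du^\varepsilon=\frac{i\eta}{2k_0\varepsilon}\Delta_x u^\varepsilon\,dz-\frac{k_0^2R(0)}{8\eta^2}u^\varepsilon\,dz+\frac{ik_0}{2\eta}u^\varepsilon\,dB,\qquad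 u^\varepsilon(0,\cdot)=u_0^\varepsilon ,$$ with $B$ a real centered Gaussian field with $\mathbb E[B(z,x)B(z',y)]=\min(z,z')R(x-y)$. Let $\hat u^\varepsilon(z,\cdot)$ denote the Fourier transform in $x$. For $p,q\ge 0$ and $v=(\xi_1,\dots,\xi_p,\zeta_1,\dots,\zeta_q)\in\mathbb R^{(p+q)d}$ let $$\widehat{\tilde\mu^\varepsilon_{p,q}}(z,v)=\mathbb E\Big[\prod_{j=1}^p\big(\hat u^\varepsilon(z,\xi_j)-\mathbb E\hat u^\varepsilon(z,\xi_j)\big)\prod_{l=1}^q\big(\hat u^\varepsilon(z,\zeta_l)-\mathbb E\hat u^\varepsilon(z,\zeta_l)\big)^*\Big],$$ $$\hat\mu^\varepsilon_{p,q}(0,v)=\prod_{j=1}^p\widehat{u_0^\varepsilon}(\xi_j)\prod_{l=1}^q\widehat{u_0^\varepsilon}(\zeta_l)^*,\qquad \Pi^\varepsilon_{p,q}(z,v)=\exp\Big(-\frac{iz\eta}{2k_0\varepsilon}\Big(\sum_{j=1}^p|\xi_j|^2-\sum_{l=1}^q|\zeta_l|^2\Big)\Big).$$ Let $\mathcal M_B$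 be the space of finite complex Borel measures on $\mathbb R^{(p+q)d}$, with norm $\|\cdot\|$ the sum of the total variations of the real and imaginary parts, and let $\|\cdot\|$ also denote the corresponding operator norm. For $1\le j\le p$, $1\le l\le q$ let $U^\varepsilon_{j,l}(z)$ be the solution operator on $\mathcal M_B$ of $\partial_zU^\varepsilon_{j,l}=L^1_{j,l}(z)U^\varepsilon_{j,l}$, $U^\varepsilon_{j,l}(0)=\mathbb I$ (the derivative being taken in total variation along each orbit), where $$L^1_{j,l}(z)\rho(v)=\frac{k_0^2}{4\eta^2}\int_{\mathbb R^d}\hat R(k)\,\rho(v-A_{j,l}k)\,e^{\frac{iz\eta}{k_0\varepsilon}k\cdot(\xi_j-\zeta_l)}\frac{dk}{(2\pi)^d}$$ and $v-A_{j,l}k$ is obtained from $v$ by subtracting $k$ from $\xi_j$ and from $\zeta_l$. These solution operators exist. Let $U_\eta(z)=e^{-C_0z/\eta^2}$ with $C_0=k_0^2R(0)/4$, and let $$\tilde N^\varepsilon_{p,q}(z)=\begin{cases}0,&p\ne q,\\ \displaystyle\sum_{\pi}\prod_{j=1}^pU_\eta(z)\big(U^\varepsilon_{j,\pi(j)}(z)-\mathbb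 I\big),&p=q,\end{cases}$$ the sum running over all permutations $\pi$ of $\{1,\dots,p\}$. Then there are linear operators $\tilde E^\varepsilon_{p,q}(z)$ on $\mathcal M_B$, not depending on $u_0^\varepsilon$ or on the solution, such that for every such $\varepsilon$, $u_0^\varepsilon$, $u^\varepsilon$ and every $z\ge 0$ the expectations above are finite for almost every argument, $\widehat{\tilde\mu^\varepsilon_{p,q}}(z,\cdot)$ is integrable, and, as measures (functions of $v$ being identified with the measures of which they are the densities), $$\widehat{\tilde\mu^\varepsilon_{p,q}}(z,v)=\Pi^\varepsilon_{p,q}(z,v)\big[\tilde N^\varepsilon_{p,q}(z)\hat\mu^\varepsilon_{p,q}(0)+\tilde E^\varepsilon_{p,q}(z)\hat\mu^\varepsilon_{p,q}(0)\big](z,v);$$ moreover, for every $z\ge 0$ there is $\varepsilon_0=\varepsilon_0(p,q,z)>0$ (depending also on $d$, $k_0$, $R$ and the regime) such that $$\sup_{0\le z'\le z}\|\tilde E^\varepsilon_{p,q}(z')\|\le\varepsilon^{1/3}\qquad\text{for }0<\varepsilon<\varepsilon_0 .$$ -/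

import Mathlib

open MeasureTheory ProbabilityTheory Filter Topology Set
open scoped NNReal ENNReal SchwartzMap FourierTransform Laplacian ComplexConjugate
open scoped RealInnerProductSpace

namespace ItoSchrodinger

noncomputable section

/-- The lateral space `ℝ^d`. -/
abbrev Lat (d : ℕ) : Type := EuclideanSpace ℝ (Fin d)

/-- The space `ℝ^(pd+qd)` of dual variables `v = (ξ_1, …, ξ_p, ζ_1, …, ζ_q)`;
`v (Sum.inl j)` is `ξ_j` and `v (Sum.inr l)` is `ζ_l`. -/
abbrev Dual (d p q : ℕ) : Type := Fin p ⊕ Fin q → Lat d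

/-! ### The covariance function -/

/-- Power spectrum `R̂(ξ) = ∫ R(x) e^{-i ξ·x} dx`. It is real because `R` is even, so only the real
part is kept. -/
def powerSpectrum {d : ℕ} (R : Lat d → ℝ) (ξ : Lat d) : ℝ :=
  (∫ x : Lat d, Complex.exp (-Complex.I * (⟪ξ, x⟫ : ℝ)) * (R x : ℂ)).re

/-- Standing assumptions on the lateral covariance function `R` of the random medium. -/
structure IsCovariance {d : ℕ} (R : Lat d → ℝ) : Prop where
  continuous : Continuous R
  even : ∀ x, R (-x) = R x
  integrable : Integrable R
  bounded : ∃ C : ℝ, ∀ x, |R x| ≤ C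
  spectrum_nonneg : ∀ ξ, 0 ≤ powerSpectrum R ξ
  /-- `R̂` has an integrable radially symmetric majorant. -/
  radial_majorant : ∃ ρ : ℝ → ℝ, Integrable (fun ξ : Lat d => ρ ‖ξ‖) ∧
    ∀ ξ, powerSpectrum R ξ ≤ ρ ‖ξ‖
  integrable_lines : ∀ e τ : Lat d, ‖e‖ = 1 → Integrable (fun s : ℝ => R (τ + s • e))
  spectrum_decay : 3 ≤ d →
    ∃ C : ℝ, ∀ ξ : Lat d, Real.sqrt (1 + ‖ξ‖ ^ 2) ^ (d - 2) * powerSpectrum R ξ ≤ C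

/-! ### The random wave process -/

/-- The (bilinear) pairing `∫ w(x) φ(x) dx`. -/
def pairing {d : ℕ} (w : Lp ℂ 2 (volume : Measure (Lat d))) (φ : 𝓢(Lat d, ℂ)) : ℂ :=
  ∫ x, w x * φ x

/-- Drift of `∫ u(z,x) φ(x) dx`, at `u(z,·) = w`, for the equation
`du = (iη/(2k₀ε)) Δu dz - (k₀² R(0)/(8η²)) u dz + (i k₀/(2η)) u dB`. -/
def drift {d : ℕ} (k₀ ε η : ℝ) (R : Lat d → ℝ) (w : Lp ℂ 2 (volume : Measure (Lat d)))
    (φ : 𝓢(Lat d, ℂ)) : ℂ :=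
  (Complex.I * η / (2 * k₀ * ε)) * pairing w (Δ φ)
    - (k₀ ^ 2 * R 0 / (8 * η ^ 2) : ℝ) * pairing w φ

/-- The generator of the equation
`du = (iη/(2k₀ε)) Δu dz - (k₀² R(0)/(8η²)) u dz + (i k₀/(2η)) u dB` (Itô sense), where `B` is a
real centered Gaussian field with `E[B(z,x) B(z',y)] = min(z,z') R(x-y)`, applied to the cylinder
function `w ↦ f (∫ w φ_1, …, ∫ w φ_n)`. The noise moves the vector `(∫ u φ_j)_j` by
`(k₀/(2η)) ∫ (i u(x) φ_j(x))_j dB(x)`, which gives the second order term. -/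
def generator {d : ℕ} (k₀ ε η : ℝ) (R : Lat d → ℝ) {n : ℕ} (f : (Fin n → ℂ) → ℝ)
    (φ : Fin n → 𝓢(Lat d, ℂ)) (w : Lp ℂ 2 (volume : Measure (Lat d))) : ℝ :=
  fderiv ℝ f (fun j => pairing w (φ j)) (fun j => drift k₀ ε η R w (φ j))
    + (1 / 2) * (k₀ ^ 2 / (4 * η ^ 2)) * ∫ x, ∫ y, R (x - y) *
        fderiv ℝ (fderiv ℝ f) (fun j => pairing w (φ j))
          (fun j => Complex.I * w x * φ j x) (fun j => Complex.I * w y * φ j y)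

/-- `u` is a solution, in the sense of the martingale problem (equivalently: in law), of the
Itô-Schrödinger equation
`du = (iη/(2k₀ε)) Δu dz - (k₀² R(0)/(8η²)) u dz + (i k₀/(2η)) u dB`, `u(0,·) = u₀`:
a continuous adapted process with values in `L²(ℝ^d; ℂ)`, with locally bounded moments, such that
`F(u(z)) - ∫_0^z (𝓛F)(u(s)) ds` is a martingale for each smooth cylinder function `F`. -/
structure IsSolution {d : ℕ} (k₀ ε η : ℝ) (R : Lat d → ℝ)
    (u₀ : Lp ℂ 2 (volume : Measure (Lat d)))
    {Ω : Type*} {mΩ : MeasurableSpace Ω} (P : Measure Ω) (ℱ : Filtration ℝ≥0 mΩ)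
    (u : ℝ≥0 → Ω → Lp ℂ 2 (volume : Measure (Lat d))) : Prop where
  adapted : StronglyAdapted ℱ u
  continuous : ∀ ω, Continuous (fun z => u z ω)
  initial : ∀ᵐ ω ∂P, u 0 ω = u₀
  moments : ∀ (n : ℕ) (Z : ℝ≥0), ∃ C : ℝ≥0, ∀ z ≤ Z, ∫⁻ ω, ‖u z ω‖ₑ ^ n ∂P ≤ C
  martingale : ∀ (n : ℕ) (φ : Fin n → 𝓢(Lat d, ℂ)) (f : (Fin n → ℂ) → ℝ),
    ContDiff ℝ (⊤ : ℕ∞) f → HasCompactSupport f →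
    Martingale (fun (z : ℝ≥0) ω => f (fun j => pairing (u z ω) (φ j))
      - ∫ s in (0 : ℝ)..z, generator k₀ ε η R f φ (u s.toNNReal ω)) ℱ P

/-! ### Fourier transforms and moments -/

/-- Fourier transform `f̂(ξ) = ∫ f(x) e^{-iξ·x} dx` of a square integrable function (in the sense of
Plancherel), expressed through Mathlib's transform, which has kernel `e^{-2π i ξ·x}`. -/
def fourierL2 {d : ℕ} (f : Lp ℂ 2 (volume : Measure (Lat d))) (ξ : Lat d) : ℂ :=
  (𝓕 f : Lp ℂ 2 (volume : Measure (Lat d))) ((2 * Real.pi)⁻¹ • ξ)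

/-- `uhat` is a jointly measurable version of the random field `(ξ, ω) ↦ û(ξ; ω)`. -/
def IsFourierField {d : ℕ} {Ω : Type*} [MeasurableSpace Ω] (P : Measure Ω)
    (u : Ω → Lp ℂ 2 (volume : Measure (Lat d))) (uhat : Lat d → Ω → ℂ) : Prop :=
  Measurable (Function.uncurry uhat) ∧
    ∀ᵐ ω ∂P, (fun ξ => uhat ξ ω) =ᵐ[volume] fourierL2 (u ω)

/-- The random variable `∏_j (û(ξ_j) - E û(ξ_j)) ∏_l (û(ζ_l) - E û(ζ_l))^*`. -/
def centeredProduct {d : ℕ} {Ω : Type*} [MeasurableSpace Ω] (P : Measure Ω)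
    (uhat : Lat d → Ω → ℂ) (p q : ℕ) (v : Dual d p q) (ω : Ω) : ℂ :=
  (∏ j : Fin p, (uhat (v (Sum.inl j)) ω - ∫ ω', uhat (v (Sum.inl j)) ω' ∂P)) *
    ∏ l : Fin q, conj (uhat (v (Sum.inr l)) ω - ∫ ω', uhat (v (Sum.inr l)) ω' ∂P)

/-- The centered moment of order `(p,q)` in the Fourier variables. -/
def centeredMoment {d : ℕ} {Ω : Type*} [MeasurableSpace Ω] (P : Measure Ω)
    (uhat : Lat d → Ω → ℂ) (p q : ℕ) (v : Dual d p q) : ℂ :=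
  ∫ ω, centeredProduct P uhat p q v ω ∂P

/-- The initial data `∏_j û₀(ξ_j) ∏_l û₀(ζ_l)^*` of the moments. -/
def initialMoment {d : ℕ} (u₀ : Lp ℂ 2 (volume : Measure (Lat d))) (p q : ℕ)
    (v : Dual d p q) : ℂ :=
  (∏ j : Fin p, fourierL2 u₀ (v (Sum.inl j))) * ∏ l : Fin q, conj (fourierL2 u₀ (v (Sum.inr l)))

/-- The free space phase
`Π(z,v) = exp(-(izη/(2k₀ε)) (∑_j |ξ_j|² - ∑_l |ζ_l|²))`. -/
def phase {d : ℕ} (k₀ ε η : ℝ) (p q : ℕ) (z : ℝ) (v : Dual d p q) : ℂ :=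
  Complex.exp (-Complex.I * (z * η / (2 * k₀ * ε) *
    (∑ j : Fin p, ‖v (Sum.inl j)‖ ^ 2 - ∑ l : Fin q, ‖v (Sum.inr l)‖ ^ 2) : ℝ))

/-! ### Operators on finite complex measures -/

/-- The norm of a finite complex measure: the total variation of its real part plus the total
variation of its imaginary part. -/
def tvNorm {X : Type*} [MeasurableSpace X] (ρ : ComplexMeasure X) : ℝ :=
  ((ComplexMeasure.re ρ).totalVariation univ).toReal
    + ((ComplexMeasure.im ρ).totalVariation univ).toReal

/-- The complex measure `g(v) ρ(dv)`. -/
def mulDensity {X : Type*} [MeasurableSpace X] (g : X → ℂ) (ρ : ComplexMeasure X) :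
    ComplexMeasure X :=
  ρ.withDensity g (ContinuousLinearMap.mul ℝ ℂ)

/-- The shift `v + A_{j,l} k`: the vector `k` is added to `ξ_j` and to `ζ_l`. -/
def pairShift {d p q : ℕ} (j : Fin p) (l : Fin q) (k : Lat d) (v : Dual d p q) : Dual d p q :=
  fun m => if m = Sum.inl j ∨ m = Sum.inr l then v m + k else v m

/-- The operator `L¹_{j,l}(z)`,
`L¹_{j,l}(z) ρ (v) =
  (k₀²/(4η²)) ∫ R̂(k) ρ(v - A_{j,l} k) e^{(izη/(k₀ε)) k·(ξ_j - ζ_l)} dk / (2π)^d`.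
The density `ρ(v - A_{j,l} k)` is that of the image of `ρ` under `v ↦ v + A_{j,l} k`, and
`ξ_j - ζ_l` is not changed by this shift. -/
def pairScattering {d p q : ℕ} (k₀ ε η : ℝ) (R : Lat d → ℝ) (j : Fin p) (l : Fin q) (z : ℝ)
    (ρ : ComplexMeasure (Dual d p q)) : ComplexMeasure (Dual d p q) :=
  ((k₀ ^ 2 / (4 * η ^ 2) : ℝ) : ℂ) •
    (mulDensity
      (fun kv : Lat d × Dual d p q => Complex.exp (Complex.I *
        (z * η / (k₀ * ε) * ⟪kv.1, kv.2 (Sum.inl j) - kv.2 (Sum.inr l)⟫ : ℝ)))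
      (VectorMeasure.prod
        ((volume : Measure (Lat d)).withDensityᵥ
          (fun k => ((powerSpectrum R k / (2 * Real.pi) ^ d : ℝ) : ℂ)))
        ρ (ContinuousLinearMap.mul ℝ ℂ))).map
    (fun kv => pairShift j l kv.1 kv.2)

/-- `U` is the solution operator of `∂_z U = L(z) U`, `U(0) = 𝕀`, on finite complex measures:
each `U(z)`, `z ≥ 0`, is linear and bounded, and for each `ρ` the curve `z ↦ U(z) ρ` is
differentiable in total variation and solves the equation. -/
structure IsSolutionOperator {X : Type*} [MeasurableSpace X]
    (L : ℝ → ComplexMeasure X → ComplexMeasure X)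
    (U : ℝ → Module.End ℂ (ComplexMeasure X)) : Prop where
  initial : U 0 = 1
  bounded : ∀ z, 0 ≤ z → ∃ C : ℝ, ∀ ρ, tvNorm (U z ρ) ≤ C * tvNorm ρ
  evolution : ∀ z, 0 ≤ z → ∀ ρ,
    Tendsto (fun h : ℝ => tvNorm (((h⁻¹ : ℝ) : ℂ) • (U (z + h) ρ - U z ρ) - L z (U z ρ)))
      (𝓝[{h : ℝ | h ≠ 0 ∧ 0 ≤ z + h}] 0) (𝓝 0)

/-- The solution operator `U_{j,l}` of `∂_z U = L¹_{j,l}(z) U`, `U(0) = 𝕀`. -/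
def pairPropagator {d p q : ℕ} (k₀ ε η : ℝ) (R : Lat d → ℝ) (j : Fin p) (l : Fin q) :
    ℝ → Module.End ℂ (ComplexMeasure (Dual d p q)) :=
  Classical.epsilon (IsSolutionOperator (pairScattering k₀ ε η R j l))

/-- The damping factor `U_η(z) = e^{-C₀ z/η²}`, with `C₀ = k₀² R(0)/4`. -/
def damping {d : ℕ} (k₀ η : ℝ) (R : Lat d → ℝ) (z : ℝ) : ℝ :=
  Real.exp (-(k₀ ^ 2 / 4 * R 0) * z / η ^ 2)

/-- The operator `Ñ_{p,q}(z)`: zero if `p ≠ q` (there are then no bijections), and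
`∑_π ∏_j U_η(z) (U_{j,π(j)}(z) - 𝕀)`, summed over the permutations `π`, if `p = q`. -/
def centeredOperator {d : ℕ} (k₀ ε η : ℝ) (R : Lat d → ℝ) (p q : ℕ) (z : ℝ) :
    Module.End ℂ (ComplexMeasure (Dual d p q)) :=
  ∑ π : Fin p ≃ Fin q,
    (List.ofFn fun j : Fin p =>
      ((damping k₀ η R z : ℝ) : ℂ) • (pairPropagator k₀ ε η R j (π j) z - 1)).prod

end

end ItoSchrodinger

/-! Remove from each factor of a moment its free phase and its damping. Tested against products of
functions of the dual variables, the moments of the factors in a set `T` then obey a closed linear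
equation, whose generator is a sum over pairs of distinct factors in `T` (`momentOp`). A pair
exchanges a frequency `k`, distributed as the power spectrum, and carries a phase `e^{iczθ}` with `c
= η/(k₀ε)` large. For a wave factor and a conjugate one `θ = k·(ξ_j - ζ_l)`, and the operator is
exactly `pairScattering`; for two factors of the same type `θ` contains in addition `±|k|²`.

The moment equation comes from the martingale problem. A product of amplitudes is a polynomial
cylinder function of the wave (`conjSign_pairing_waveTest`), to which the Dynkin formula extends by
a cutoff (`IsSolution.dynkin`). The spectral representation of `R` turns the second order term into
frequency exchanges (`cylGenerator_signProd`), and letting the test functions carry the free phase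
cancels the Laplacian (`IsSolution.hasDerivWithinAt_momentFn_rots`). The frequency exchanges
preserve the norms of the test functions, so a Picard iteration gives uniqueness and identifies the
moments with the flow on finite measures (`IsSolution.freeMoment_eq`). A single factor has no
partner, so the mean field is only damped.

The rest is combinatorial. Write `U_S` for the flow generated by the pairs in `S`, and define `E_M`
by Moebius inversion, `U_S = ∑_{M ⊆ S} E_M`; thus `E_M` is the part of the evolution in which
precisely the pairs of `M` act. Centering a product is an alternating sum over the sets `T` of
factors that are not replaced by their mean, and this sum keeps exactly those `M` which meet every
factor (`centeredFlow_eq`). Suppose such an `M` consists of pairs (wave, conjugate wave), no two of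
which share a factor. Then it is a perfect matching, hence a permutation, and `p = q`
(`resonant_covering_eq`). Its pairs commute, so `E_M` is the product of the `U_{j,π(j)} - 1`
(`exactFlow_list`). These terms, with their damping, are `centeredOperator`.

Every other `E_M` is small, by induction on `M` (`norm_exactFlow_le_of_not_resonant`). It solves
`E_M' = ∑_e L_e (E_M + E_{M∖e})`, and each source `L_e E_{M∖e}` has a small time integral: by
induction if `M∖e` is not resonant, and otherwise because `L_e` oscillates. A pair of equal types
oscillates by itself. A pair (wave, conjugate wave) does not oscillate where `ξ_j = ζ_l`, but it
does after a pair sharing one factor with it has shifted `ξ_j - ζ_l`; integration by parts brings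
these two pairs together.

Quantitatively, the time integral of `e^{icrθ}` is at most a constant times `|cθ|^{-α}`, and
`|θ|^{-α}` is integrable against the spectrum uniformly in the frequencies as soon as `2α < 1`
(`exists_lintegral_inner_le`, `oscillationBound_spec`). This is where the radial majorant enters:
the small denominators are integrated over spheres first. The choice `α = 2/5` gives an error
`ε^{2/5}`, times constants that are exponentials of a quantity of order `η^{-2}`. Even for `η =
(ln|ln ε|)^{-1}` these are beaten by `ε^{-1/15}`, and `2/5 - 1/15 = 1/3`. -/

set_option linter.unusedSectionVars false

namespace ItoSchrodinger

/-! ### Linear evolution equations with a strongly continuous bounded generator -/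

section Flow

variable {E : Type*} [NormedAddCommGroup E] [NormedSpace ℂ E]

/-- A strongly continuous family of operators bounded by `K`. -/
structure StrongFamily (L : ℝ → E →L[ℂ] E) (K : ℝ) : Prop where
  cont : ∀ x, Continuous fun z => L z x
  bound : ∀ z, ‖L z‖ ≤ K

variable {L : ℝ → E →L[ℂ] E} {K : ℝ}

lemma StrongFamily.nonneg (hL : StrongFamily L K) : 0 ≤ K := (norm_nonneg _).trans (hL.bound 0)

lemma StrongFamily.norm_apply_le (hL : StrongFamily L K) (z : ℝ) (x : E) : ‖L z x‖ ≤ K * ‖x‖ :=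
  (L z).le_of_opNorm_le (hL.bound z) x

/-- Applying a locally bounded strongly convergent family to a convergent family. -/
lemma tendsto_apply_of_bound {ι : Type*} {l : Filter ι} {A : ι → E →L[ℂ] E} {A₀ : E →L[ℂ] E}
    {x : ι → E} {x₀ : E} {C : ℝ} (hA : Tendsto (fun i => A i x₀) l (𝓝 (A₀ x₀)))
    (hb : ∀ᶠ i in l, ‖A i‖ ≤ C) (hx : Tendsto x l (𝓝 x₀)) :
    Tendsto (fun i => A i (x i)) l (𝓝 (A₀ x₀)) := by
  have h1 : Tendsto (fun i => A i (x i - x₀)) l (𝓝 0) := by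
    have hx' : Tendsto (fun i => C * ‖x i - x₀‖) l (𝓝 0) := by
      have := (tendsto_iff_norm_sub_tendsto_zero.1 hx).const_mul C
      simpa using this
    refine squeeze_zero_norm' ?_ hx'
    filter_upwards [hb] with i hi
    exact (A i).le_of_opNorm_le hi _
  have h2 := h1.add hA
  simpa using h2

lemma StrongFamily.continuous_apply (hL : StrongFamily L K) {X : Type*} [TopologicalSpace X]
    {t : X → ℝ} {x : X → E} (ht : Continuous t) (hx : Continuous x) :
    Continuous fun z => L (t z) (x z) := by
  rw [continuous_iff_continuousAt]
  intro z
  exact tendsto_apply_of_bound (((hL.cont (x z)).comp ht).continuousAt)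
    (Eventually.of_forall fun i => hL.bound (t i)) hx.continuousAt

/-- Product rule for a strongly differentiable family of operators applied to a curve. -/
lemma hasDerivAt_apply {A : ℝ → E →L[ℂ] E} {A' : E} {x : ℝ → E} {x' : E} {z C : ℝ}
    (hA : HasDerivAt (fun s => A s (x z)) A' z) (hb : ∀ᶠ s in 𝓝 z, ‖A s‖ ≤ C)
    (hc : Tendsto (fun s => A s x') (𝓝 z) (𝓝 (A z x')))
    (hx : HasDerivAt x x' z) :
    HasDerivAt (fun s => A s (x s)) (A' + A z x') z := by
  rw [hasDerivAt_iff_tendsto_slope] at *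
  have h1 : Tendsto (fun s => A s (slope x z s)) (𝓝[≠] z) (𝓝 (A z x')) :=
    tendsto_apply_of_bound (hc.mono_left nhdsWithin_le_nhds) (hb.filter_mono nhdsWithin_le_nhds) hx
  refine (hA.add h1).congr fun s => ?_
  have : ((s - z)⁻¹ : ℝ) • (x s - x z) = (((s - z)⁻¹ : ℝ) : ℂ) • (x s - x z) :=
    (Complex.coe_smul _ _).symm
  simp only [slope_def_module, this, map_smul, map_sub]
  rw [Complex.coe_smul, ← smul_add]
  congr 1
  abel

/-- The terms of the Dyson series. -/
noncomputable def dyson (L : ℝ → E →L[ℂ] E) : ℕ → ℝ → E → E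
  | 0, _, x => x
  | n + 1, z, x => ∫ s in (0 : ℝ)..z, L s (dyson L n s x)

/-- The solution `U(z)x` of `u' = L(z) u`, `u(0) = x`. -/
noncomputable def flowFun (L : ℝ → E →L[ℂ] E) (z : ℝ) (x : E) : E := ∑' n, dyson L n z x

variable [CompleteSpace E]

lemma StrongFamily.continuous_dyson (hL : StrongFamily L K) (n : ℕ) (x : E) :
    Continuous fun z => dyson L n z x := by
  induction n with
  | zero => exact continuous_const
  | succ n ih =>
    exact intervalIntegral.continuous_primitive
      (fun a b => (hL.continuous_apply continuous_id ih).intervalIntegrable a b) 0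

lemma StrongFamily.hasDerivAt_dyson (hL : StrongFamily L K) (n : ℕ) (x : E) (z : ℝ) :
    HasDerivAt (fun z => dyson L (n + 1) z x) (L z (dyson L n z x)) z := by
  have hc := hL.continuous_apply continuous_id (hL.continuous_dyson n x)
  exact intervalIntegral.integral_hasDerivAt_right (hc.intervalIntegrable _ _)
    (hc.stronglyMeasurableAtFilter _ _) hc.continuousAt

/-- The factorial is the volume of the simplex of ordered times. Negative `z` are included so that
the flow has two-sided derivatives everywhere. -/
lemma StrongFamily.norm_dyson_le (hL : StrongFamily L K) (n : ℕ) (x : E) (z : ℝ) :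
    ‖dyson L n z x‖ ≤ (K * |z|) ^ n / n.factorial * ‖x‖ := by
  induction n generalizing z with
  | zero => simp [dyson]
  | succ n ih =>
    have h0 := hL.nonneg
    have h1 : ‖dyson L (n + 1) z x‖ ≤ ∫ s in uIoc 0 z, K * ((K * |s|) ^ n / n.factorial * ‖x‖) := by
      rw [dyson, intervalIntegral.norm_intervalIntegral_eq]
      refine norm_integral_le_of_norm_le ?_ (Eventually.of_forall fun s => ?_)
      · have : Continuous fun s : ℝ => K * ((K * |s|) ^ n / n.factorial * ‖x‖) := by fun_prop
        exact (this.integrableOn_uIcc (a := 0) (b := z)).mono_set uIoc_subset_uIcc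
      · exact (hL.norm_apply_le _ _).trans (mul_le_mul_of_nonneg_left (ih s) h0)
    refine h1.trans (le_of_eq ?_)
    have h2 := integral_pow_abs_sub_uIoc (a := 0) (b := z) n
    simp only [sub_zero] at h2
    have h3 : ∀ s : ℝ, K * ((K * |s|) ^ n / n.factorial * ‖x‖)
        = (K * (K ^ n / n.factorial * ‖x‖)) * |s| ^ n := fun s => by rw [mul_pow]; ring
    simp_rw [h3]
    rw [integral_const_mul, h2, Nat.factorial_succ, mul_pow]
    push_cast
    field_simp
    ring

lemma summable_dyson_bound (K z c : ℝ) :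
    Summable fun n : ℕ => (K * |z|) ^ n / n.factorial * c :=
  (Real.summable_pow_div_factorial _).mul_right _

lemma StrongFamily.summable_dyson (hL : StrongFamily L K) (x : E) (z : ℝ) :
    Summable fun n => dyson L n z x :=
  Summable.of_norm_bounded (summable_dyson_bound K z ‖x‖) fun n => hL.norm_dyson_le n x z

lemma StrongFamily.norm_flowFun_le (hL : StrongFamily L K) (x : E) (z : ℝ) :
    ‖flowFun L z x‖ ≤ Real.exp (K * |z|) * ‖x‖ := by
  have h := tsum_of_norm_bounded
    ((summable_dyson_bound K z ‖x‖).hasSum) fun n => hL.norm_dyson_le n x z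
  rw [tsum_mul_right] at h
  rwa [Real.exp_eq_exp_ℝ, NormedSpace.exp_eq_tsum_div]

/-- The Dyson series may be differentiated term by term on a bounded interval: the derivative of the
term `n + 1` is `L z` applied to the term `n`, so the differentiated series is dominated by `K`
times an exponential series and sums to `L z` of the whole. -/
lemma StrongFamily.hasDerivAt_flowFun (hL : StrongFamily L K) (x : E) (z : ℝ) :
    HasDerivAt (fun z => flowFun L z x) (L z (flowFun L z x)) z := by
  have h0 := hL.nonneg
  let g' : ℕ → ℝ → E := fun n z => match n with
    | 0 => 0
    | n + 1 => L z (dyson L n z x)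
  set T := |z| + 1
  have hT : 0 < T := by positivity
  let u : ℕ → ℝ := fun n => match n with
    | 0 => 0
    | n + 1 => K * ((K * |T|) ^ n / n.factorial * ‖x‖)
  have hu : Summable u := by
    rw [← summable_nat_add_iff 1]
    exact (summable_dyson_bound K T ‖x‖).mul_left K
  have hd := hasDerivAt_tsum_of_isPreconnected (g := fun n z => dyson L n z x) (g' := g')
    (t := Ioo (-T) T) (y₀ := 0) (y := z) hu isOpen_Ioo isPreconnected_Ioo
    (fun n y _ => by
      cases n with
      | zero => exact hasDerivAt_const _ _
      | succ n => exact hL.hasDerivAt_dyson n x y)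
    (fun n y hy => by
      cases n with
      | zero => simp [g', u]
      | succ n =>
        have hy' : |y| ≤ |T| := (abs_lt.2 hy).le.trans (le_abs_self T)
        refine (hL.norm_apply_le _ _).trans (mul_le_mul_of_nonneg_left ?_ h0)
        refine (hL.norm_dyson_le n x y).trans ?_
        gcongr)
    ⟨by linarith, hT⟩ (hL.summable_dyson x 0)
    (abs_lt.1 (lt_add_one _))
  have hs : Summable fun n => g' n z := by
    rw [← summable_nat_add_iff 1]
    exact (hL.summable_dyson x z).map (L z) (L z).continuous
  have he : ∑' n, g' n z = L z (flowFun L z x) := by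
    rw [hs.tsum_eq_zero_add, flowFun, (L z).map_tsum (hL.summable_dyson x z)]
    simp [g']
  rw [he] at hd
  exact hd

lemma StrongFamily.flowFun_zero (hL : StrongFamily L K) (x : E) : flowFun L 0 x = x := by
  rw [flowFun, (hL.summable_dyson x 0).tsum_eq_zero_add]
  simp [dyson]

lemma StrongFamily.dyson_add (hL : StrongFamily L K) (n : ℕ) (z : ℝ) (x y : E) :
    dyson L n z (x + y) = dyson L n z x + dyson L n z y := by
  induction n generalizing z with
  | zero => rfl
  | succ n ih =>
    simp only [dyson, ih, map_add]
    exact intervalIntegral.integral_add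
      ((hL.continuous_apply continuous_id (hL.continuous_dyson n x)).intervalIntegrable _ _)
      ((hL.continuous_apply continuous_id (hL.continuous_dyson n y)).intervalIntegrable _ _)

lemma dyson_smul (L : ℝ → E →L[ℂ] E) (n : ℕ) (z : ℝ) (c : ℂ) (x : E) :
    dyson L n z (c • x) = c • dyson L n z x := by
  induction n generalizing z with
  | zero => rfl
  | succ n ih =>
    simp only [dyson, ih, map_smul]
    exact intervalIntegral.integral_smul _ _

/-- The solution operator of `u' = L(z) u`. -/
noncomputable def StrongFamily.flow (hL : StrongFamily L K) (z : ℝ) : E →L[ℂ] E :=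
  LinearMap.mkContinuous
    { toFun := flowFun L z
      map_add' := fun x y => by
        simp only [flowFun, hL.dyson_add]
        exact (hL.summable_dyson x z).tsum_add (hL.summable_dyson y z)
      map_smul' := fun c x => by
        simp only [flowFun, dyson_smul, RingHom.id_apply]
        exact (hL.summable_dyson x z).tsum_const_smul c }
    (Real.exp (K * |z|)) fun x => hL.norm_flowFun_le x z

lemma StrongFamily.norm_flow_le (hL : StrongFamily L K) (z : ℝ) :
    ‖hL.flow z‖ ≤ Real.exp (K * |z|) :=
  LinearMap.mkContinuous_norm_le _ (Real.exp_pos _).le _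

lemma StrongFamily.hasDerivAt_flow (hL : StrongFamily L K) (x : E) (z : ℝ) :
    HasDerivAt (fun z => hL.flow z x) (L z (hL.flow z x)) z := hL.hasDerivAt_flowFun x z

lemma StrongFamily.flow_zero (hL : StrongFamily L K) : hL.flow 0 = 1 := by
  ext x; exact hL.flowFun_zero x

lemma StrongFamily.continuous_flow (hL : StrongFamily L K) (x : E) :
    Continuous fun z => hL.flow z x :=
  continuous_iff_continuousAt.2 fun z => (hL.hasDerivAt_flow x z).continuousAt

/-- Two solutions of `u' = L(z) u` on `[0, T]` with the same initial value agree. -/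
lemma StrongFamily.unique (hL : StrongFamily L K) {f g : ℝ → E} {T : ℝ}
    (hf : ∀ z ∈ Icc 0 T, HasDerivWithinAt f (L z (f z)) (Ici 0) z)
    (hg : ∀ z ∈ Icc 0 T, HasDerivWithinAt g (L z (g z)) (Ici 0) z)
    (h0 : f 0 = g 0) : EqOn f g (Icc 0 T) := by
  have hK : ∀ z ∈ Ico 0 T, LipschitzOnWith (Real.toNNReal K) (fun x => L z x) univ := by
    intro z _
    refine LipschitzWith.lipschitzOnWith ?_
    refine (L z).lipschitz.weaken ?_
    rw [← NNReal.coe_le_coe, Real.coe_toNNReal _ hL.nonneg]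
    exact hL.bound z
  have hsub : ∀ z ∈ Ico 0 T, Ici z ⊆ Ici (0 : ℝ) := fun z hz => Ici_subset_Ici.2 hz.1
  exact ODE_solution_unique_of_mem_Icc_right hK
    (fun z hz => (hf z hz).continuousWithinAt.mono Icc_subset_Ici_self)
    (fun z hz => (hf z (Ico_subset_Icc_self hz)).mono (hsub z hz)) (fun _ _ => mem_univ _)
    (fun z hz => (hg z hz).continuousWithinAt.mono Icc_subset_Ici_self)
    (fun z hz => (hg z (Ico_subset_Icc_self hz)).mono (hsub z hz)) (fun _ _ => mem_univ _) h0

/-- A curve solving `u' = L(z) u` is the orbit of its initial value. -/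
lemma StrongFamily.eq_flow (hL : StrongFamily L K) {f : ℝ → E}
    (hf : ∀ z, 0 ≤ z → HasDerivWithinAt f (L z (f z)) (Ici 0) z) {z : ℝ} (hz : 0 ≤ z) :
    f z = hL.flow z (f 0) :=
  hL.unique (T := z) (fun s hs => hf s hs.1)
    (fun s _ => (hL.hasDerivAt_flow (f 0) s).hasDerivWithinAt)
    (by rw [hL.flow_zero]; rfl) ⟨hz, le_rfl⟩

/-- The operator `x ↦ ∫_a^b L(r) x dr`. -/
noncomputable def StrongFamily.integralOp (hL : StrongFamily L K) (a b : ℝ) : E →L[ℂ] E :=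
  LinearMap.mkContinuous
    { toFun := fun x => ∫ r in a..b, L r x
      map_add' := fun x y => by
        simp only [map_add]
        exact intervalIntegral.integral_add ((hL.cont x).intervalIntegrable _ _)
          ((hL.cont y).intervalIntegrable _ _)
      map_smul' := fun c x => by
        simp only [map_smul, RingHom.id_apply]
        exact intervalIntegral.integral_smul _ _ }
    (K * |b - a|) fun x => by
      have := intervalIntegral.norm_integral_le_of_norm_le_const (a := a) (b := b)
        (f := fun r => L r x) (C := K * ‖x‖) fun r _ => hL.norm_apply_le r x
      simp only [LinearMap.coe_mk, AddHom.coe_mk]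
      linarith

lemma StrongFamily.integralOp_apply (hL : StrongFamily L K) (a b : ℝ) (x : E) :
    hL.integralOp a b x = ∫ r in a..b, L r x := rfl

lemma StrongFamily.norm_integralOp_le (hL : StrongFamily L K) (a b : ℝ) :
    ‖hL.integralOp a b‖ ≤ K * |b - a| :=
  LinearMap.mkContinuous_norm_le _ (mul_nonneg hL.nonneg (abs_nonneg _)) _

/-- Integration by parts: an oscillating family integrated against a differentiable curve. -/
lemma StrongFamily.norm_integral_apply_le (hL : StrongFamily L K) {x x' : ℝ → E} {a b κ₀ κ₁ : ℝ}
    (hab : a ≤ b) (hx : ∀ z, HasDerivAt x (x' z) z) (hx' : Continuous x')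
    (h0 : ‖∫ r in a..b, L r (x a)‖ ≤ κ₀)
    (h1 : ∀ t ∈ Icc a b, ‖∫ r in t..b, L r (x' t)‖ ≤ κ₁) :
    ‖∫ r in a..b, L r (x r)‖ ≤ κ₀ + (b - a) * κ₁ := by
  have hxc : Continuous x := continuous_iff_continuousAt.2 fun z => (hx z).continuousAt
  -- The boundary function is `t ↦ (∫_t^b L) x(t)`: it vanishes at `b`, and its derivative is `-L(t)
  -- x(t)` plus the same small primitive applied to `x'`.
  have hd : ∀ t, HasDerivAt (fun t => hL.integralOp t b (x t))
      (-(L t (x t)) + hL.integralOp t b (x' t)) t := by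
    intro t
    have h1 : ∀ y, HasDerivAt (fun s => hL.integralOp s b y) (-(L t y)) t := fun y =>
      intervalIntegral.integral_hasDerivAt_left ((hL.cont y).intervalIntegrable _ _)
        ((hL.cont y).stronglyMeasurableAtFilter _ _) (hL.cont y).continuousAt
    refine hasDerivAt_apply (C := K * (|b - t| + 1)) (h1 _) ?_ (h1 _).continuousAt (hx t)
    have : ∀ᶠ s in 𝓝 t, |b - s| < |b - t| + 1 :=
      (by fun_prop : Continuous fun s => |b - s|).continuousAt.eventually_lt continuousAt_const
        (lt_add_one _)
    filter_upwards [this] with s hs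
    exact (hL.norm_integralOp_le s b).trans (mul_le_mul_of_nonneg_left hs.le hL.nonneg)
  have hc1 : Continuous fun t => L t (x t) := hL.continuous_apply continuous_id hxc
  have hc2 : Continuous fun t => hL.integralOp t b (x' t) := by
    rw [continuous_iff_continuousAt]
    intro t
    refine tendsto_apply_of_bound (C := K * (|b - t| + 1)) ?_ ?_ hx'.continuousAt
    · exact (intervalIntegral.integral_hasDerivAt_left ((hL.cont (x' t)).intervalIntegrable _ _)
        ((hL.cont _).stronglyMeasurableAtFilter _ _) (hL.cont _).continuousAt).continuousAt
    · have : ∀ᶠ s in 𝓝 t, |b - s| < |b - t| + 1 :=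
        (by fun_prop : Continuous fun s => |b - s|).continuousAt.eventually_lt continuousAt_const
          (lt_add_one _)
      filter_upwards [this] with s hs
      exact (hL.norm_integralOp_le s b).trans (mul_le_mul_of_nonneg_left hs.le hL.nonneg)
  have key := intervalIntegral.integral_eq_sub_of_hasDerivAt (a := a) (b := b) (fun t _ => hd t)
    ((hc1.neg.add hc2).intervalIntegrable _ _)
  rw [intervalIntegral.integral_add (f := fun t => -(L t (x t))) (hc1.neg.intervalIntegrable _ _)
    (hc2.intervalIntegrable _ _), intervalIntegral.integral_neg] at key
  have e1 : hL.integralOp b b (x b) = 0 := by simp [StrongFamily.integralOp_apply]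
  rw [e1, zero_sub] at key
  have e2 : ∫ r in a..b, L r (x r) = hL.integralOp a b (x a)
      + ∫ t in a..b, hL.integralOp t b (x' t) := by
    have := congrArg (fun y => -y) key
    simp only [neg_add, neg_neg] at this
    rw [← this]; abel
  rw [e2]
  refine (norm_add_le _ _).trans (add_le_add h0 ?_)
  have := intervalIntegral.norm_integral_le_of_norm_le_const (a := a) (b := b)
    (f := fun t => hL.integralOp t b (x' t)) (C := κ₁) fun t ht => by
      rw [uIoc_of_le hab] at ht
      exact h1 t ⟨ht.1.le, ht.2⟩
  rw [abs_of_nonneg (sub_nonneg.2 hab)] at this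
  linarith

/-- Duhamel estimate for `y' = L y + F` with small primitive of `F`. -/
lemma StrongFamily.norm_le_of_forced (hL : StrongFamily L K) {y F : ℝ → E} {Z κ : ℝ}
    (hy : ∀ z, HasDerivAt y (L z (y z) + F z) z) (hF : Continuous F) (h0 : y 0 = 0)
    (hG : ∀ z ∈ Icc 0 Z, ‖∫ s in (0 : ℝ)..z, F s‖ ≤ κ) {z : ℝ} (hz : z ∈ Icc 0 Z) :
    ‖y z‖ ≤ κ * (1 + K * z * Real.exp (K * z)) := by
  have hyc : Continuous y := continuous_iff_continuousAt.2 fun z => (hy z).continuousAt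
  have hLy : Continuous fun t => L t (y t) := hL.continuous_apply continuous_id hyc
  have hκ : 0 ≤ κ := (norm_nonneg _).trans (hG z hz)
  have hK := hL.nonneg
  -- Only the primitive of `F` is small, not `F` itself. Gronwall is therefore applied to `∫ L y`,
  -- which differs from `y` by this primitive.
  have hint : ∀ s, y s = (∫ t in (0 : ℝ)..s, L t (y t)) + ∫ t in (0 : ℝ)..s, F t := by
    intro s
    rw [← intervalIntegral.integral_add (hLy.intervalIntegrable _ _) (hF.intervalIntegrable _ _),
      intervalIntegral.integral_eq_sub_of_hasDerivAt (fun t _ => hy t)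
        ((hLy.add hF).intervalIntegrable _ _), h0, sub_zero]
  have hw : ∀ s ∈ Icc 0 z, ‖∫ t in (0 : ℝ)..s, L t (y t)‖ ≤ gronwallBound 0 K (K * κ) (s - 0) := by
    refine norm_le_gronwallBound_of_norm_deriv_right_le
      (f' := fun t => L t (y t)) ?_ ?_ ?_ ?_
    · exact (intervalIntegral.continuous_primitive
        (fun a b => hLy.intervalIntegrable a b) 0).continuousOn
    · intro s _
      exact (intervalIntegral.integral_hasDerivAt_right (hLy.intervalIntegrable _ _)
        (hLy.stronglyMeasurableAtFilter _ _) hLy.continuousAt).hasDerivWithinAt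
    · simp
    · intro s hs
      refine (hL.norm_apply_le _ _).trans ?_
      have h1 : ‖y s‖ ≤ ‖∫ t in (0 : ℝ)..s, L t (y t)‖ + κ := by
        rw [hint s]
        exact (norm_add_le _ _).trans
          (add_le_add_right (hG s ⟨hs.1, hs.2.le.trans hz.2⟩) _)
      calc K * ‖y s‖ ≤ K * (‖∫ t in (0 : ℝ)..s, L t (y t)‖ + κ) := by gcongr
        _ = _ := by ring
  have h1 := hw z ⟨hz.1, le_rfl⟩
  rw [sub_zero] at h1
  have h2 : gronwallBound 0 K (K * κ) z ≤ κ * (K * z * Real.exp (K * z)) := by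
    have hz0 := hz.1
    by_cases h : K = 0
    · subst h
      simp [gronwallBound_K0]
    · rw [gronwallBound_of_K_ne_0 h]
      have h3 : Real.exp (K * z) - 1 ≤ K * z * Real.exp (K * z) := by
        have := Real.add_one_le_exp (-(K * z))
        have h4 : Real.exp (K * z) * Real.exp (-(K * z)) = 1 := by
          rw [← Real.exp_add]; simp
        nlinarith [Real.exp_pos (K * z)]
      have h5 : K * κ / K = κ := by field_simp
      simp only [h5, zero_mul, zero_add]
      exact mul_le_mul_of_nonneg_left h3 hκ
  have h3 : ‖y z‖ ≤ ‖∫ t in (0 : ℝ)..z, L t (y t)‖ + ‖∫ t in (0 : ℝ)..z, F t‖ := by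
    conv_lhs => rw [hint z]
    exact norm_add_le _ _
  have h4 := hG z hz
  nlinarith

end Flow

/-! ### The Banach space of finite complex measures -/

section Measures

variable {X : Type*} [MeasurableSpace X]

lemma complexMeasure_re_apply (ρ : ComplexMeasure X) (A : Set X) :
    ComplexMeasure.re ρ A = (ρ A).re := rfl

lemma complexMeasure_im_apply (ρ : ComplexMeasure X) (A : Set X) :
    ComplexMeasure.im ρ A = (ρ A).im := rfl

/-- One half of the equivalence of `tvNorm` with the variation norm. The former is not homogeneous
under complex scalars, so the normed space structure is built on the latter, at the price of a
factor `2` in the final bounds. -/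
lemma variation_le_totalVariation (ρ : ComplexMeasure X) :
    ρ.variation ≤ (ComplexMeasure.re ρ).totalVariation + (ComplexMeasure.im ρ).totalVariation := by
  refine VectorMeasure.variation_le_of_forall_enorm_le fun A _ => ?_
  have h1 := (ComplexMeasure.re ρ).enorm_le_totalVariation A
  have h2 := (ComplexMeasure.im ρ).enorm_le_totalVariation A
  have h3 : ‖ρ A‖ₑ ≤ ‖(ρ A).re‖ₑ + ‖(ρ A).im‖ₑ := by
    rw [← ofReal_norm, ← ofReal_norm, ← ofReal_norm, ← ENNReal.ofReal_add (norm_nonneg _)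
      (norm_nonneg _)]
    exact ENNReal.ofReal_le_ofReal (Complex.norm_le_abs_re_add_abs_im _)
  exact h3.trans (add_le_add h1 h2)

instance isFiniteMeasure_variation (ρ : ComplexMeasure X) : IsFiniteMeasure ρ.variation :=
  isFiniteMeasure_of_le _ (variation_le_totalVariation ρ)

/-- The total variation norm. -/
noncomputable instance : Norm (ComplexMeasure X) := ⟨fun ρ => ρ.variation.real univ⟩

lemma norm_def (ρ : ComplexMeasure X) : ‖ρ‖ = ρ.variation.real univ := rfl

lemma norm_apply_le_norm (ρ : ComplexMeasure X) (A : Set X) : ‖ρ A‖ ≤ ‖ρ‖ :=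
  (VectorMeasure.norm_measure_le_variation (μ := ρ)).trans (measureReal_mono (subset_univ A))

noncomputable instance : NormedAddCommGroup (ComplexMeasure X) :=
  AddGroupNorm.toNormedAddCommGroup
    { toFun := fun ρ => ‖ρ‖
      map_zero' := by simp [norm_def]
      add_le' := fun ρ ρ' => by
        have h := measureReal_mono (μ := ρ.variation + ρ'.variation) (subset_univ (univ : Set X))
        rw [norm_def, norm_def, norm_def, ← measureReal_add_apply]
        exact ENNReal.toReal_mono (measure_ne_top _ _) (VectorMeasure.variation_add_le univ)
      neg' := fun ρ => by simp [norm_def]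
      eq_zero_of_map_eq_zero' := fun ρ h => by
        rw [norm_def, measureReal_eq_zero_iff, Measure.measure_univ_eq_zero] at h
        exact VectorMeasure.variation_eq_zero.1 h }

lemma norm_complexMeasure_smul {𝕜 : Type*} [NormedField 𝕜] [NormedSpace 𝕜 ℂ] (c : 𝕜)
    (ρ : ComplexMeasure X) : ‖c • ρ‖ = ‖c‖ * ‖ρ‖ := by
  rw [norm_def, norm_def, VectorMeasure.variation_smul, measureReal_nnreal_smul_apply]
  rfl

noncomputable instance : NormedSpace ℂ (ComplexMeasure X) where
  norm_smul_le c ρ := (norm_complexMeasure_smul c ρ).le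

lemma norm_le_tvNorm (ρ : ComplexMeasure X) : ‖ρ‖ ≤ tvNorm ρ := by
  rw [norm_def, tvNorm, ← measureReal_def, ← measureReal_def, ← measureReal_add_apply]
  exact ENNReal.toReal_mono (measure_ne_top _ _) (variation_le_totalVariation ρ univ)

lemma tvNorm_le (ρ : ComplexMeasure X) : tvNorm ρ ≤ 2 * ‖ρ‖ := by
  have h1 : (ComplexMeasure.re ρ).variation ≤ ρ.variation := by
    refine VectorMeasure.variation_le_of_forall_enorm_le fun A _ => ?_
    refine le_trans ?_ (VectorMeasure.enorm_measure_le_variation ρ A)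
    rw [← ofReal_norm, ← ofReal_norm]
    exact ENNReal.ofReal_le_ofReal (Complex.abs_re_le_norm _)
  have h2 : (ComplexMeasure.im ρ).variation ≤ ρ.variation := by
    refine VectorMeasure.variation_le_of_forall_enorm_le fun A _ => ?_
    refine le_trans ?_ (VectorMeasure.enorm_measure_le_variation ρ A)
    rw [← ofReal_norm, ← ofReal_norm]
    exact ENNReal.ofReal_le_ofReal (Complex.abs_im_le_norm _)
  rw [tvNorm, SignedMeasure.totalVariation_eq_variation, SignedMeasure.totalVariation_eq_variation,
    two_mul]
  exact add_le_add (ENNReal.toReal_mono (measure_ne_top _ _) (h1 univ))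
    (ENNReal.toReal_mono (measure_ne_top _ _) (h2 univ))

/-- The variation is a supremum of sums over finite partitions, and for one fixed partition the
Cauchy estimate passes to the limit set by set. -/
lemma tendsto_complexMeasure_of_uniform {ρ : ℕ → ComplexMeasure X} {m : ComplexMeasure X}
    (hc : CauchySeq ρ) (hm : ∀ A, Tendsto (fun n => ρ n A) atTop (𝓝 (m A))) :
    Tendsto ρ atTop (𝓝 m) := by
  rw [Metric.tendsto_atTop]
  intro ε hε
  obtain ⟨N, hN⟩ := Metric.cauchySeq_iff.1 hc (ε / 2) (by positivity)
  refine ⟨N, fun n hn => ?_⟩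
  rw [dist_eq_norm]
  refine lt_of_le_of_lt ?_ (half_lt_self hε)
  refine ENNReal.toReal_le_of_le_ofReal (by positivity) ?_
  by_contra h
  obtain ⟨P, hP1, hP2, -, hP⟩ := VectorMeasure.exists_lt_sum_of_lt_variation _ MeasurableSet.univ
    (not_le.1 h)
  have hlim : Tendsto (fun k => ∑ p ∈ P, ‖(ρ n - ρ k) p‖ₑ) atTop
      (𝓝 (∑ p ∈ P, ‖(ρ n - m) p‖ₑ)) := by
    refine tendsto_finsetSum _ fun p _ => ?_
    exact ((tendsto_const_nhds.sub (hm p))).enorm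
  refine absurd (le_of_tendsto hlim (eventually_atTop.2 ⟨N, fun k hk => ?_⟩)) (not_le.2 hP)
  refine (VectorMeasure.le_variation _ MeasurableSet.univ hP1 hP2).trans ?_
  have := (hN n hn k hk).le
  rw [dist_eq_norm, norm_def] at this
  rw [← ENNReal.ofReal_toReal (measure_ne_top (ρ n - ρ k).variation univ)]
  exact ENNReal.ofReal_le_ofReal this

noncomputable instance : CompleteSpace (ComplexMeasure X) := by
  refine Metric.complete_of_cauchySeq_tendsto fun ρ hc => ?_
  have hu : ∀ ε > 0, ∃ N, ∀ n ≥ N, ∀ k ≥ N, ∀ A, ‖ρ n A - ρ k A‖ ≤ ε := by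
    intro ε hε
    obtain ⟨N, hN⟩ := Metric.cauchySeq_iff.1 hc ε hε
    refine ⟨N, fun n hn k hk A => ?_⟩
    have := (hN n hn k hk).le
    rw [dist_eq_norm] at this
    exact (norm_apply_le_norm (ρ n - ρ k) A).trans this
  have hA : ∀ A, ∃ y, Tendsto (fun n => ρ n A) atTop (𝓝 y) := by
    intro A
    refine cauchySeq_tendsto_of_complete (Metric.cauchySeq_iff'.2 fun ε hε => ?_)
    obtain ⟨N, hN⟩ := hu (ε / 2) (by positivity)
    exact ⟨N, fun n hn => by
      rw [dist_eq_norm]; exact (hN n hn N le_rfl A).trans_lt (half_lt_self hε)⟩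
  choose m hm using hA
  have hum : ∀ ε > 0, ∃ N, ∀ n ≥ N, ∀ A, ‖ρ n A - m A‖ ≤ ε := by
    intro ε hε
    obtain ⟨N, hN⟩ := hu ε hε
    refine ⟨N, fun n hn A => ?_⟩
    exact le_of_tendsto ((tendsto_const_nhds.sub (hm A)).norm)
      (eventually_atTop.2 ⟨N, fun k hk => hN n hn k hk A⟩)
  have hfin : ∀ f : ℕ → Set X, (∀ i, MeasurableSet (f i)) → Pairwise (Function.onFun Disjoint f) →
      ∀ s : Finset ℕ, ∑ i ∈ s, m (f i) = m (⋃ i ∈ s, f i) := by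
    intro f hf hd s
    refine tendsto_nhds_unique (tendsto_finsetSum s fun i _ => hm (f i)) ?_
    refine (hm _).congr fun n => ?_
    exact (ρ n).of_biUnion_finset (fun i _ j _ hij => hd hij) fun i _ => hf i
  refine ⟨⟨m, ?_, ?_, ?_⟩, tendsto_complexMeasure_of_uniform hc hm⟩
  · exact tendsto_nhds_unique (hm ∅) (by simp)
  · intro A hA
    refine tendsto_nhds_unique (hm A) ?_
    simp only [VectorMeasure.not_measurable _ hA]
    exact tendsto_const_nhds
  -- Countable additivity survives in the limit because the convergence is uniform over all sets: a
  -- single `ρ N` approximates `m` on the finite unions and on the full union simultaneously.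
  · intro f hf hd
    rw [HasSum, SummationFilter.unconditional_filter, Metric.tendsto_nhds]
    intro ε hε
    obtain ⟨N, hN⟩ := hum (ε / 4) (by positivity)
    have hs := (ρ N).m_iUnion hf hd
    rw [HasSum, SummationFilter.unconditional_filter, Metric.tendsto_nhds] at hs
    filter_upwards [hs (ε / 4) (by positivity)] with s hs
    have hN' := (ρ N).of_biUnion_finset (s := s) (f := f) (fun i _ j _ hij => hd hij)
      (fun i _ => hf i)
    have hs' : dist (∑ i ∈ s, ρ N (f i)) (ρ N (⋃ i, f i)) < ε / 4 := hs
    rw [← hN', dist_eq_norm] at hs'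
    rw [hfin f hf hd, dist_eq_norm]
    have h1 := hN N le_rfl (⋃ i ∈ s, f i)
    have h2 := hN N le_rfl (⋃ i, f i)
    have h3 : m (⋃ i ∈ s, f i) - m (⋃ i, f i) = -(ρ N (⋃ i ∈ s, f i) - m (⋃ i ∈ s, f i))
      + ((ρ N (⋃ i ∈ s, f i) - ρ N (⋃ i, f i)) + (ρ N (⋃ i, f i) - m (⋃ i, f i))) := by ring
    rw [h3]
    refine (norm_add_le _ _).trans_lt ?_
    rw [norm_neg]
    have := norm_add_le (ρ N (⋃ i ∈ s, f i) - ρ N (⋃ i, f i)) (ρ N (⋃ i, f i) - m (⋃ i, f i))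
    linarith

/-! ### Integration against a complex measure -/

/-- The integral of `F` with respect to the complex measure `ρ`. -/
noncomputable def cint (ρ : ComplexMeasure X) (F : X → ℂ) : ℂ :=
  VectorMeasure.integral ρ F (ContinuousLinearMap.mul ℝ ℂ)

lemma integrable_of_bounded {μ : Measure X} [IsFiniteMeasure μ] {F : X → ℂ} (hF : Measurable F)
    {C : ℝ} (hC : ∀ x, ‖F x‖ ≤ C) : Integrable F μ :=
  Integrable.of_bound hF.aestronglyMeasurable C (Eventually.of_forall hC)

lemma norm_cint_le (ρ : ComplexMeasure X) {F : X → ℂ} {C : ℝ} (hC : ∀ x, ‖F x‖ ≤ C) :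
    ‖cint ρ F‖ ≤ C * ‖ρ‖ := by
  have h := VectorMeasure.norm_integral_le_of_norm_le_const (μ := ρ)
    (B := ContinuousLinearMap.mul ℝ ℂ) (Eventually.of_forall hC)
  simpa [cint, norm_def] using h

lemma cint_indicator_one (ρ : ComplexMeasure X) {A : Set X} (hA : MeasurableSet A) (c : ℂ) :
    cint ρ (A.indicator fun _ => c) = c * ρ A := by
  rw [cint, VectorMeasure.integral_indicator hA, VectorMeasure.integral_const]
  simp [VectorMeasure.restrict_apply _ hA]

/-- Together with the polar representation this reduces integrals against complex measures to
Bochner integrals, for which Fubini and dominated convergence are at hand. Simple functions come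
first, then bounded convergence on both sides. -/
lemma cint_withDensity {μ : Measure X} {g : X → ℂ} (hg : Integrable g μ) {F : X → ℂ}
    (hF : Measurable F) {C : ℝ} (hC : ∀ x, ‖F x‖ ≤ C) :
    cint (μ.withDensityᵥ g) F = ∫ x, F x * g x ∂μ := by
  have hsimple : ∀ f : SimpleFunc X ℂ,
      cint (μ.withDensityᵥ g) f = ∫ x, f x * g x ∂μ := by
    intro f
    have hfi : ∀ f : SimpleFunc X ℂ, Integrable (fun x => f x * g x) μ := fun f => by
      obtain ⟨C, hC⟩ := f.exists_forall_norm_le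
      exact hg.bdd_mul f.measurable.aestronglyMeasurable (Eventually.of_forall hC)
    have hfv : ∀ f : SimpleFunc X ℂ, (μ.withDensityᵥ g).Integrable f := fun f => by
      obtain ⟨C, hC⟩ := f.exists_forall_norm_le
      exact integrable_of_bounded f.measurable hC
    induction f using SimpleFunc.induction with
    | const c hs =>
      rename_i s
      have h1 : ⇑(SimpleFunc.piecewise s hs (SimpleFunc.const X c) (SimpleFunc.const X 0))
          = s.indicator fun _ => c := by
        ext x; simp [Set.indicator, Set.piecewise]
      rw [h1, cint_indicator_one _ hs, withDensityᵥ_apply hg hs, ← integral_const_mul,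
        ← integral_indicator hs]
      congr 1
      ext x
      by_cases hx : x ∈ s <;> simp [hx]
    | add hd hf hg' =>
      rename_i f g'
      rw [SimpleFunc.coe_add, cint, VectorMeasure.integral_add (hfv f) (hfv g')]
      simp only [cint] at hf hg'
      rw [hf, hg', ← integral_add (hfi f) (hfi g')]
      congr 1
      ext x
      simp [add_mul]
  have hsm : StronglyMeasurable F := hF.stronglyMeasurable
  have hC0 : ∀ x, ‖F x‖ ≤ |C| := fun x => (hC x).trans (le_abs_self C)
  have hlim : ∀ x, Tendsto (fun n => hsm.approxBounded |C| n x) atTop (𝓝 (F x)) :=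
    fun x => hsm.tendsto_approxBounded_of_norm_le (hC0 x)
  have hb : ∀ n x, ‖hsm.approxBounded |C| n x‖ ≤ |C| :=
    fun n x => hsm.norm_approxBounded_le (abs_nonneg C) n x
  have t1 : Tendsto (fun n => cint (μ.withDensityᵥ g) (hsm.approxBounded |C| n)) atTop
      (𝓝 (cint (μ.withDensityᵥ g) F)) := by
    refine VectorMeasure.tendsto_integral_of_dominated_convergence (fun _ => |C|) ?_ ?_ ?_ ?_
    · exact fun n => (SimpleFunc.measurable _).aestronglyMeasurable
    · exact integrable_const _
    · exact fun n => Eventually.of_forall (hb n)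
    · exact Eventually.of_forall hlim
  have t2 : Tendsto (fun n => ∫ x, hsm.approxBounded |C| n x * g x ∂μ) atTop
      (𝓝 (∫ x, F x * g x ∂μ)) := by
    refine tendsto_integral_of_dominated_convergence (fun x => |C| * ‖g x‖) ?_ ?_ ?_ ?_
    · exact fun n => (SimpleFunc.measurable _).aestronglyMeasurable.mul hg.aestronglyMeasurable
    · exact hg.norm.const_mul _
    · exact fun n => Eventually.of_forall fun x => by
        rw [norm_mul]; exact mul_le_mul_of_nonneg_right (hb n x) (norm_nonneg _)
    · exact Eventually.of_forall fun x => (hlim x).mul_const _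
  refine tendsto_nhds_unique t1 (t2.congr fun n => (hsimple _).symm)

/-- Polar representation of a complex measure. -/
lemma exists_density (ρ : ComplexMeasure X) :
    ∃ g : X → ℂ, Measurable g ∧ Integrable g ρ.variation ∧ ρ = ρ.variation.withDensityᵥ g := by
  have hac : ∀ A, MeasurableSet A → ρ.variation A = 0 → ρ A = 0 := by
    intro A hA h
    have := VectorMeasure.enorm_measure_le_variation ρ A
    rw [h] at this
    simpa using this
  have h1 : ComplexMeasure.re ρ ≪ᵥ ρ.variation.toENNRealVectorMeasure := by
    refine VectorMeasure.AbsolutelyContinuous.mk fun A hA h => ?_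
    rw [Measure.toENNRealVectorMeasure_apply_measurable hA] at h
    rw [complexMeasure_re_apply, hac A hA h, Complex.zero_re]
  have h2 : ComplexMeasure.im ρ ≪ᵥ ρ.variation.toENNRealVectorMeasure := by
    refine VectorMeasure.AbsolutelyContinuous.mk fun A hA h => ?_
    rw [Measure.toENNRealVectorMeasure_apply_measurable hA] at h
    rw [complexMeasure_im_apply, hac A hA h, Complex.zero_im]
  have e1 := SignedMeasure.withDensityᵥ_rnDeriv_eq _ _ h1
  have e2 := SignedMeasure.withDensityᵥ_rnDeriv_eq _ _ h2
  set a := (ComplexMeasure.re ρ).rnDeriv ρ.variation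
  set b := (ComplexMeasure.im ρ).rnDeriv ρ.variation
  have ma : Measurable a := SignedMeasure.measurable_rnDeriv _ _
  have mb : Measurable b := SignedMeasure.measurable_rnDeriv _ _
  have ia : Integrable a ρ.variation := SignedMeasure.integrable_rnDeriv _ _
  have ib : Integrable b ρ.variation := SignedMeasure.integrable_rnDeriv _ _
  have ig : Integrable (fun x => (a x : ℂ) + (b x : ℂ) * Complex.I) ρ.variation :=
    ia.ofReal.add (ib.ofReal.mul_const _)
  refine ⟨fun x => a x + b x * Complex.I, by fun_prop, ig, ?_⟩
  ext A hA
  have ia' : Integrable (fun x => (a x : ℂ)) (ρ.variation.restrict A) := ia.ofReal.integrableOn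
  have ib' : Integrable (fun x => (b x : ℂ) * Complex.I) (ρ.variation.restrict A) :=
    (ib.ofReal.mul_const _).integrableOn
  rw [withDensityᵥ_apply ig hA, integral_add ia' ib', integral_mul_const, integral_complex_ofReal,
    integral_complex_ofReal, ← withDensityᵥ_apply ia hA, ← withDensityᵥ_apply ib hA, e1, e2, complexMeasure_re_apply,
    complexMeasure_im_apply]
  apply Complex.ext <;> simp

lemma cint_eq_integral (ρ : ComplexMeasure X) : ∃ g : X → ℂ, Measurable g ∧
    Integrable g ρ.variation ∧ ρ = ρ.variation.withDensityᵥ g ∧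
    ∀ F : X → ℂ, Measurable F → ∀ C : ℝ, (∀ x, ‖F x‖ ≤ C) →
      cint ρ F = ∫ x, F x * g x ∂ρ.variation := by
  obtain ⟨g, hg, ig, e⟩ := exists_density ρ
  refine ⟨g, hg, ig, e, fun F hF C hC => ?_⟩
  conv_lhs => rw [e]
  exact cint_withDensity ig hF hC

lemma cint_add (ρ ρ' : ComplexMeasure X) {F : X → ℂ} (hF : Measurable F) {C : ℝ}
    (hC : ∀ x, ‖F x‖ ≤ C) : cint (ρ + ρ') F = cint ρ F + cint ρ' F :=
  VectorMeasure.integral_add_vectorMeasure (integrable_of_bounded hF hC)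
    (integrable_of_bounded hF hC)

lemma cint_smul (c : ℂ) (ρ : ComplexMeasure X) {F : X → ℂ} (hF : Measurable F) {C : ℝ}
    (hC : ∀ x, ‖F x‖ ≤ C) : cint (c • ρ) F = c * cint ρ F := by
  obtain ⟨g, hg, ig, e, h⟩ := cint_eq_integral ρ
  have e' : c • ρ = ρ.variation.withDensityᵥ (c • g) := by
    rw [withDensityᵥ_smul, ← e]
  rw [h F hF C hC, e', cint_withDensity (ig.smul c) hF hC, ← integral_const_mul]
  congr 1
  ext x
  simp only [Pi.smul_apply, smul_eq_mul]
  ring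

/-- Complex measures are separated by bounded measurable functions. -/
lemma ext_cint {ρ ρ' : ComplexMeasure X}
    (h : ∀ F : X → ℂ, Measurable F → (∀ x, ‖F x‖ ≤ 1) → cint ρ F = cint ρ' F) : ρ = ρ' := by
  ext A hA
  have h1 := h (A.indicator fun _ => 1) (measurable_const.indicator hA) fun x => by
    by_cases hx : x ∈ A <;> simp [hx]
  simpa [cint_indicator_one _ hA] using h1

/-- The total variation norm is the dual norm. -/
lemma norm_le_of_cint_le {ρ : ComplexMeasure X} {C : ℝ}
    (h : ∀ F : X → ℂ, Measurable F → (∀ x, ‖F x‖ ≤ 1) → ‖cint ρ F‖ ≤ C) : ‖ρ‖ ≤ C := by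
  obtain ⟨g, hg, ig, e, hI⟩ := cint_eq_integral ρ
  -- The test function is the conjugate phase of the density; the convention `0⁻¹ = 0` makes it
  -- vanish where the density does.
  set F : X → ℂ := fun x => (‖g x‖⁻¹ : ℝ) * conj (g x) with hF
  have hF1 : ∀ x, ‖F x‖ ≤ 1 := fun x => by
    simp only [hF, norm_mul, Complex.norm_real, norm_inv, norm_norm, RCLike.norm_conj]
    exact inv_mul_le_one
  have hFm : Measurable F := by
    have : Measurable fun x => conj (g x) := Complex.continuous_conj.measurable.comp hg
    exact (Complex.measurable_ofReal.comp hg.norm.inv).mul this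
  have h1 := h F hFm hF1
  have h2 : ∀ x, F x * g x = (‖g x‖ : ℂ) := fun x => by
    simp only [hF]
    rw [mul_assoc, Complex.conj_mul']
    by_cases hx : ‖g x‖ = 0
    · simp [hx]
    · have : (‖g x‖ : ℂ) ≠ 0 := by exact_mod_cast hx
      push_cast
      field_simp
  have h3 : ‖ρ‖ = ∫ x, ‖g x‖ ∂ρ.variation := by
    rw [norm_def]
    conv_lhs => rw [e, Measure.variation_withDensityᵥ ig]
    rw [measureReal_def, withDensity_apply _ MeasurableSet.univ, Measure.restrict_univ,
      integral_norm_eq_lintegral_enorm ig.aestronglyMeasurable]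
  rw [hI F hFm 1 hF1] at h1
  simp_rw [h2] at h1
  rw [integral_complex_ofReal, Complex.norm_real, Real.norm_of_nonneg
    (integral_nonneg fun _ => norm_nonneg _), ← h3] at h1
  exact h1

lemma cint_mulDensity (ρ : ComplexMeasure X) {φ F : X → ℂ} (hφ : Measurable φ) {Cφ : ℝ}
    (hCφ : ∀ x, ‖φ x‖ ≤ Cφ) (hF : Measurable F) {C : ℝ} (hC : ∀ x, ‖F x‖ ≤ C) :
    cint (mulDensity φ ρ) F = cint ρ (fun x => F x * φ x) := by
  obtain ⟨g, hg, ig, e, h⟩ := cint_eq_integral ρ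
  have i1 : Integrable (fun x => φ x * g x) ρ.variation :=
    ig.bdd_mul hφ.aestronglyMeasurable (Eventually.of_forall hCφ)
  have e' : mulDensity φ ρ = ρ.variation.withDensityᵥ (fun x => φ x * g x) := by
    ext A hA
    rw [mulDensity, VectorMeasure.withDensity_apply (integrable_of_bounded hφ hCφ),
      withDensityᵥ_apply i1 hA, ← VectorMeasure.integral_indicator hA]
    have hm : Measurable (A.indicator φ) := hφ.indicator hA
    have hb : ∀ x, ‖A.indicator φ x‖ ≤ Cφ := fun x => by
      refine (norm_indicator_le_norm_self _ _).trans (hCφ x)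
    refine (h _ hm Cφ hb).trans ?_
    rw [← integral_indicator hA]
    congr 1
    ext x
    by_cases hx : x ∈ A <;> simp [hx]
  have hb : ∀ x, ‖F x * φ x‖ ≤ |C| * |Cφ| := fun x => by
    rw [norm_mul]
    exact mul_le_mul ((hC x).trans (le_abs_self _)) ((hCφ x).trans (le_abs_self _))
      (norm_nonneg _) (abs_nonneg _)
  rw [e', cint_withDensity i1 hF hC, h (fun x => F x * φ x) (hF.mul hφ) _ hb]
  congr 1
  ext x
  ring

lemma cint_map {Y : Type*} [MeasurableSpace Y] (ρ : ComplexMeasure X) {T : X → Y}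
    (hT : Measurable T) {F : Y → ℂ} (hF : Measurable F) {C : ℝ} (hC : ∀ x, ‖F x‖ ≤ C) :
    cint (ρ.map T) F = cint ρ (fun x => F (T x)) :=
  VectorMeasure.integral_map hT hF.aestronglyMeasurable
    (integrable_of_bounded (hF.comp hT) fun _ => hC _)

/-- The product has density `h ⊗ g` with respect to `ν × |ρ|`, as is checked on rectangles; the
formula is then Fubini. -/
lemma cint_prod {Y : Type*} [MeasurableSpace Y] {ν : Measure Y} [SFinite ν] {h : Y → ℂ}
    (hh : Integrable h ν)
    (ρ : ComplexMeasure X) {F : Y × X → ℂ} (hF : Measurable F) {C : ℝ} (hC : ∀ x, ‖F x‖ ≤ C) :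
    cint (VectorMeasure.prod (ν.withDensityᵥ h) ρ (ContinuousLinearMap.mul ℝ ℂ)) F =
      cint ρ (fun x => ∫ y, F (y, x) * h y ∂ν) := by
  obtain ⟨g, hg, ig, e, hI⟩ := cint_eq_integral ρ
  have i1 : Integrable (fun x : Y × X => h x.1 * g x.2) (ν.prod ρ.variation) := hh.mul_prod ig
  have e' : VectorMeasure.prod (ν.withDensityᵥ h) ρ (ContinuousLinearMap.mul ℝ ℂ)
      = (ν.prod ρ.variation).withDensityᵥ (fun x : Y × X => h x.1 * g x.2) := by
    refine VectorMeasure.prod_eq_of_forall_apply_prod fun s t hs ht => ?_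
    rw [withDensityᵥ_apply i1 (hs.prod ht), withDensityᵥ_apply hh hs]
    conv_rhs => rw [e, withDensityᵥ_apply ig ht]
    rw [setIntegral_prod_mul]
    rfl
  have hm : Measurable fun x => ∫ y, F (y, x) * h y ∂ν := by
    obtain ⟨h', hh', ee⟩ := hh.aestronglyMeasurable
    have : (fun x => ∫ y, F (y, x) * h y ∂ν) = fun x => ∫ y, F (y, x) * h' y ∂ν := by
      ext x
      refine integral_congr_ae ?_
      filter_upwards [ee] with y hy
      rw [hy]
    rw [this]
    have : StronglyMeasurable fun p : X × Y => F (p.2, p.1) * h' p.2 :=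
      ((hF.comp measurable_swap).mul (hh'.measurable.comp measurable_snd)).stronglyMeasurable
    exact this.integral_prod_right.measurable
  have hb : ∀ x, ‖∫ y, F (y, x) * h y ∂ν‖ ≤ |C| * ∫ y, ‖h y‖ ∂ν := fun x => by
    rw [← integral_const_mul]
    refine norm_integral_le_of_norm_le (hh.norm.const_mul _) (Eventually.of_forall fun y => ?_)
    rw [norm_mul]
    exact mul_le_mul_of_nonneg_right ((hC _).trans (le_abs_self _)) (norm_nonneg _)
  rw [e', cint_withDensity i1 hF hC, hI _ hm _ hb, integral_prod_symm]
  · refine integral_congr_ae (Eventually.of_forall fun x => ?_)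
    simp only
    rw [← integral_mul_const]
    congr 1
    ext y
    ring
  · exact i1.bdd_mul hF.aestronglyMeasurable (Eventually.of_forall hC)

end Measures

/-! ### Alternating sums over subsets -/

section Moebius

variable {α : Type*} [DecidableEq α] {A : Type*} [AddCommGroup A] [Module ℂ A]

/-- The alternating sum `∑_{t ⊆ M} (-1)^{|M \ t|} f t`. -/
def altSum (f : Finset α → A) (M : Finset α) : A :=
  ∑ t ∈ M.powerset, (-1 : ℂ) ^ (M \ t).card • f t

lemma altSum_empty (f : Finset α → A) : altSum f ∅ = f ∅ := by simp [altSum]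

/-- `altSum` is an iterated finite difference, and this is one difference, in the direction `a`.
Most identities below follow from it. -/
lemma altSum_insert (f : Finset α → A) {a : α} {M : Finset α} (ha : a ∉ M) :
    altSum f (insert a M) = altSum (fun t => f (insert a t)) M - altSum f M := by
  rw [altSum, Finset.sum_powerset_insert ha, altSum, altSum, sub_eq_neg_add, ← Finset.sum_neg_distrib]
  congr 1
  · refine Finset.sum_congr rfl fun t ht => ?_
    have hat : a ∉ t := fun h => ha (Finset.mem_powerset.1 ht h)
    rw [Finset.insert_sdiff_of_notMem _ hat, Finset.card_insert_of_notMem (by simp [ha]), pow_succ]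
    simp
  · refine Finset.sum_congr rfl fun t ht => ?_
    have : insert a M \ insert a t = M \ t := by
      ext x
      simp only [Finset.mem_sdiff, Finset.mem_insert]
      constructor
      · rintro ⟨h1 | h1, h2⟩
        · exact absurd (Or.inl h1) h2
        · exact ⟨h1, fun h => h2 (Or.inr h)⟩
      · rintro ⟨h1, h2⟩
        refine ⟨Or.inr h1, ?_⟩
        rintro (rfl | h)
        · exact ha h1
        · exact h2 h
    rw [this]

lemma altSum_const (c : A) {M : Finset α} (hM : M.Nonempty) : altSum (fun _ => c) M = 0 := by
  obtain ⟨a, ha⟩ := hM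
  rw [← Finset.insert_erase ha, altSum_insert _ (Finset.notMem_erase _ _), sub_self]

lemma altSum_map {B : Type*} [AddCommGroup B] [Module ℂ B] (L : A →ₗ[ℂ] B) (f : Finset α → A)
    (M : Finset α) : L (altSum f M) = altSum (fun t => L (f t)) M := by
  simp [altSum, map_sum]

/-- Moebius inversion over the subsets of a finite set. -/
lemma sum_altSum (f : Finset α → A) (S : Finset α) : ∑ M ∈ S.powerset, altSum f M = f S := by
  induction S using Finset.induction_on generalizing f with
  | empty => simp [altSum_empty]
  | insert a s ha ih =>
    rw [Finset.sum_powerset_insert ha, ← Finset.sum_add_distrib]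
    have : ∀ M ∈ s.powerset, altSum f M + altSum f (insert a M)
        = altSum (fun t => f (insert a t)) M := fun M hM => by
      rw [altSum_insert _ fun h => ha (Finset.mem_powerset.1 hM h)]
      abel
    rw [Finset.sum_congr rfl this, ih]

/-- The sum over the elements of the running subset. -/
lemma altSum_sum_mem (g : α → Finset α → A) (M : Finset α) :
    altSum (fun t => ∑ e ∈ t, g e t) M
      = ∑ e ∈ M, (altSum (g e) M + altSum (g e) (M.erase e)) := by
  have h1 : altSum (fun t => ∑ e ∈ t, g e t) M
      = ∑ e ∈ M, altSum (fun t => if e ∈ t then g e t else 0) M := by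
    simp only [altSum]
    rw [Finset.sum_comm]
    refine Finset.sum_congr rfl fun t ht => ?_
    rw [← Finset.smul_sum, ← Finset.sum_filter]
    congr 1
    refine Finset.sum_congr ?_ fun _ _ => rfl
    ext e
    simp only [Finset.mem_filter]
    exact ⟨fun h => ⟨Finset.mem_powerset.1 ht h, h⟩, fun h => h.2⟩
  rw [h1]
  refine Finset.sum_congr rfl fun e he => ?_
  -- The difference in the direction `e` of `1_{e ∈ t} g` keeps only the sets that contain `e`; on
  -- the right the same difference of `g` needs the term on `M ∖ e` added back.
  conv_lhs => rw [← Finset.insert_erase he]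
  conv_rhs => enter [1]; rw [← Finset.insert_erase he]
  rw [altSum_insert _ (Finset.notMem_erase _ _), altSum_insert _ (Finset.notMem_erase _ _)]
  simp only [Finset.mem_insert_self, if_true, sub_add_cancel]
  have : altSum (fun t => if e ∈ t then g e t else 0) (M.erase e) = 0 := by
    refine Finset.sum_eq_zero fun t ht => ?_
    have : e ∉ t := fun h => Finset.notMem_erase _ _ (Finset.mem_powerset.1 ht h)
    simp [this]
  rw [this, sub_zero]

end Moebius

/-! ### Superposition of evolutions -/

section Superposition

variable {E : Type*} [NormedAddCommGroup E] [NormedSpace ℂ E] [CompleteSpace E]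
  {α : Type*} [DecidableEq α] {L : α → ℝ → E →L[ℂ] E} {K : ℝ}

lemma strongFamily_sum (hL : ∀ e, StrongFamily (L e) K) (S : Finset α) :
    StrongFamily (fun z => ∑ e ∈ S, L e z) (S.card * K) where
  cont x := by
    simp only [_root_.sum_apply]
    exact continuous_finsetSum _ fun e _ => (hL e).cont x
  bound z := by
    refine (norm_sum_le _ _).trans ?_
    refine (Finset.sum_le_card_nsmul _ _ K fun e _ => (hL e).bound z).trans ?_
    simp

/-- The evolution generated by `∑_{e ∈ S} L_e`. -/
noncomputable def setFlow (hL : ∀ e, StrongFamily (L e) K) (S : Finset α) (z : ℝ) : E →L[ℂ] E :=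
  (strongFamily_sum hL S).flow z

/-- The part of the evolution in which exactly the interactions in `M` occur. -/
noncomputable def exactFlow (hL : ∀ e, StrongFamily (L e) K) (M : Finset α) (z : ℝ) : E →L[ℂ] E :=
  altSum (fun S => setFlow hL S z) M

variable (hL : ∀ e, StrongFamily (L e) K)

lemma norm_setFlow_le (S : Finset α) {z : ℝ} (hz : 0 ≤ z) :
    ‖setFlow hL S z‖ ≤ Real.exp (S.card * K * z) := by
  have := (strongFamily_sum hL S).norm_flow_le z
  rwa [abs_of_nonneg hz] at this

lemma hasDerivAt_setFlow (S : Finset α) (x : E) (z : ℝ) :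
    HasDerivAt (fun z => setFlow hL S z x) (∑ e ∈ S, L e z (setFlow hL S z x)) z := by
  have := (strongFamily_sum hL S).hasDerivAt_flow x z
  rwa [_root_.sum_apply] at this

lemma setFlow_zero (S : Finset α) : setFlow hL S 0 = 1 := (strongFamily_sum hL S).flow_zero

lemma setFlow_empty {z : ℝ} (hz : 0 ≤ z) : setFlow hL ∅ z = 1 := by
  ext x
  have := (strongFamily_sum hL ∅).eq_flow (f := fun _ => x) (fun z _ => by
    simpa using (hasDerivAt_const z x).hasDerivWithinAt) hz
  exact this.symm

lemma exactFlow_apply (M : Finset α) (z : ℝ) (x : E) :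
    exactFlow hL M z x = altSum (fun S => setFlow hL S z x) M := by
  simp [exactFlow, altSum]

/-- The latest interaction `e` has either acted before, and then all of `M` had already occurred, or
it acts for the first time, and then exactly `M ∖ e` had occurred. This triangular system drives the
induction on `M`. -/
lemma hasDerivAt_exactFlow (M : Finset α) (x : E) (z : ℝ) :
    HasDerivAt (fun z => exactFlow hL M z x)
      (∑ e ∈ M, L e z (exactFlow hL M z x + exactFlow hL (M.erase e) z x)) z := by
  have h1 : HasDerivAt (fun z => altSum (fun S => setFlow hL S z x) M)
      (altSum (fun S => ∑ e ∈ S, L e z (setFlow hL S z x)) M) z := by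
    simp only [altSum]
    exact HasDerivAt.fun_sum fun S _ => (hasDerivAt_setFlow hL S x z).const_smul _
  rw [altSum_sum_mem (fun e S => L e z (setFlow hL S z x))] at h1
  simp only [exactFlow_apply]
  refine h1.congr_deriv (Finset.sum_congr rfl fun e _ => ?_)
  rw [map_add]
  congr 1
  · exact (altSum_map ((L e z : E →L[ℂ] E) : E →ₗ[ℂ] E) _ _).symm
  · exact (altSum_map ((L e z : E →L[ℂ] E) : E →ₗ[ℂ] E) _ _).symm

lemma continuous_exactFlow (M : Finset α) (x : E) : Continuous fun z => exactFlow hL M z x :=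
  continuous_iff_continuousAt.2 fun z => (hasDerivAt_exactFlow hL M x z).continuousAt

lemma exactFlow_zero {M : Finset α} (hM : M.Nonempty) : exactFlow hL M 0 = 0 := by
  simp only [exactFlow, setFlow_zero]
  exact altSum_const _ hM

lemma exactFlow_empty {z : ℝ} (hz : 0 ≤ z) : exactFlow hL ∅ z = 1 := by
  rw [exactFlow, altSum_empty, setFlow_empty hL hz]

lemma sum_exactFlow (S : Finset α) (z : ℝ) :
    ∑ M ∈ S.powerset, exactFlow hL M z = setFlow hL S z := sum_altSum _ S

lemma norm_exactFlow_le (M : Finset α) {z : ℝ} (hz : 0 ≤ z) (hK : 0 ≤ K) :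
    ‖exactFlow hL M z‖ ≤ 2 ^ M.card * Real.exp (M.card * K * z) := by
  refine (norm_sum_le _ _).trans ?_
  refine (Finset.sum_le_card_nsmul _ _ (Real.exp (M.card * K * z)) fun S hS => ?_).trans ?_
  · rw [norm_smul, norm_pow, norm_neg, norm_one, one_pow, one_mul]
    refine (norm_setFlow_le hL S hz).trans (Real.exp_le_exp.2 ?_)
    gcongr
    exact Finset.mem_powerset.1 hS
  · rw [Finset.card_powerset]; simp

/-- Operators commuting with the generator commute with the evolution. -/
lemma setFlow_comm {B : E →L[ℂ] E} {S : Finset α}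
    (hB : ∀ e ∈ S, ∀ z x, B (L e z x) = L e z (B x)) {z : ℝ} (hz : 0 ≤ z) (x : E) :
    B (setFlow hL S z x) = setFlow hL S z (B x) := by
  have h := (strongFamily_sum hL S).eq_flow (f := fun z => B (setFlow hL S z x)) (fun z _ => by
    have h1 := (B.restrictScalars ℝ).hasFDerivAt.comp_hasDerivAt z (hasDerivAt_setFlow hL S x z)
    refine (h1.congr_deriv ?_).hasDerivWithinAt
    simp only [ContinuousLinearMap.coe_restrictScalars', map_sum, _root_.sum_apply]
    exact Finset.sum_congr rfl fun e he => hB e he z _) hz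
  rw [setFlow_zero] at h
  exact h

/-- By commutation the product of the two flows solves the equation of the joint flow, and solutions
are unique. -/
lemma setFlow_insert_of_comm {f : α} {S : Finset α} (hf : f ∉ S)
    (hc : ∀ e ∈ S, ∀ s t x, L f s (L e t x) = L e t (L f s x)) {z : ℝ} (hz : 0 ≤ z) :
    setFlow hL (insert f S) z = setFlow hL {f} z * setFlow hL S z := by
  ext x
  have hcomm : ∀ e ∈ S, ∀ z, 0 ≤ z → ∀ t x,
      setFlow hL {f} z (L e t x) = L e t (setFlow hL {f} z x) := fun e he z hz t x =>
    (setFlow_comm hL (B := L e t) (S := {f}) (fun g hg s y => by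
      rw [Finset.mem_singleton.1 hg]; exact (hc e he s t y).symm) hz x).symm
  have h := (strongFamily_sum hL (insert f S)).eq_flow
    (f := fun z => setFlow hL {f} z (setFlow hL S z x)) (fun z hz => by
      have hK : 0 ≤ K := (hL f).nonneg
      have h1 := hasDerivAt_apply (A := fun z => setFlow hL {f} z) (C := Real.exp (K * (|z| + 1)))
        (hasDerivAt_setFlow hL {f} (setFlow hL S z x) z) (by
          have : ∀ᶠ s in 𝓝 z, |s| < |z| + 1 :=
            continuous_abs.continuousAt.eventually_lt continuousAt_const (lt_add_one _)
          filter_upwards [this] with s hs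
          have := (strongFamily_sum hL {f}).norm_flow_le s
          refine this.trans (Real.exp_le_exp.2 ?_)
          simp only [Finset.card_singleton, Nat.cast_one, one_mul]
          gcongr)
        (hasDerivAt_setFlow hL {f} _ z).continuousAt (hasDerivAt_setFlow hL S x z)
      refine (h1.congr_deriv ?_).hasDerivWithinAt
      rw [_root_.sum_apply, Finset.sum_insert hf, Finset.sum_singleton, map_sum]
      congr 1
      exact Finset.sum_congr rfl fun e he => hcomm e he z hz z _) hz
  simp only [setFlow_zero] at h
  exact h.symm

/-- An interaction that commutes with the others occurs independently of them, and "it occurs at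
least once" is its flow minus the identity. -/
lemma exactFlow_insert_of_comm {f : α} {M : Finset α} (hf : f ∉ M)
    (hc : ∀ e ∈ M, ∀ s t x, L f s (L e t x) = L e t (L f s x)) {z : ℝ} (hz : 0 ≤ z) :
    exactFlow hL (insert f M) z = (setFlow hL {f} z - 1) * exactFlow hL M z := by
  rw [exactFlow, altSum_insert _ hf, sub_mul, one_mul]
  congr 1
  rw [exactFlow, altSum, altSum, Finset.mul_sum]
  refine Finset.sum_congr rfl fun S hS => ?_
  have hS' := Finset.mem_powerset.1 hS
  rw [setFlow_insert_of_comm hL (fun h => hf (hS' h)) (fun e he => hc e (hS' he)) hz,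
    mul_smul_comm]

/-- For pairwise commuting interactions the exact part of the evolution factorizes. -/
lemma exactFlow_list (l : List α) (hl : l.Nodup)
    (hc : ∀ e ∈ l, ∀ f ∈ l, e ≠ f → ∀ s t x, L e s (L f t x) = L f t (L e s x))
    {z : ℝ} (hz : 0 ≤ z) :
    exactFlow hL l.toFinset z = (l.map fun e => setFlow hL {e} z - 1).prod := by
  induction l with
  | nil => simpa using exactFlow_empty hL hz
  | cons a l ih =>
    rw [List.nodup_cons] at hl
    rw [List.toFinset_cons, exactFlow_insert_of_comm hL (by simpa using hl.1) (fun e he => ?_) hz,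
      List.map_cons, List.prod_cons, ih hl.2 fun e he f hf => hc e (by simp [he]) f (by simp [hf])]
    have he' : e ∈ l := by simpa using he
    exact hc a (by simp) e (by simp [he']) fun h => hl.1 (h ▸ he')

/-- A set of interactions is resonant if all of them are non-oscillating and no two of them are in
conflict. -/
def Resonant (bad : α → Prop) (conf : α → α → Prop) (M : Finset α) : Prop :=
  (∀ e ∈ M, ¬ bad e) ∧ ∀ e ∈ M, ∀ f ∈ M, e ≠ f → ¬ conf e f

end Superposition

/-! ### Smallness of the non-resonant parts of the evolution -/

section Oscillation

variable {E : Type*} [NormedAddCommGroup E] [NormedSpace ℂ E] [CompleteSpace E]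
  {α : Type*} [DecidableEq α] {L : α → ℝ → E →L[ℂ] E} {K : ℝ}

/-- Smallness of the time integrals of the oscillating interactions on `[0, Z]`. -/
structure Oscillating (L : α → ℝ → E →L[ℂ] E) (bad : α → Prop) (conf : α → α → Prop)
    (Z κ : ℝ) : Prop where
  symm : ∀ e f, conf e f → conf f e
  small_bad : ∀ e, bad e → ∀ a b, 0 ≤ a → a ≤ b → b ≤ Z → ∀ x, ‖∫ r in a..b, L e r x‖ ≤ κ * ‖x‖
  small_conf : ∀ e f, ¬ bad e → ¬ bad f → conf e f → ∀ a b, 0 ≤ a → a ≤ b → b ≤ Z →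
    ∀ t x, ‖∫ r in a..b, L e r (L f t x)‖ ≤ κ * ‖x‖
  comm : ∀ e f, ¬ bad e → ¬ bad f → e ≠ f → ¬ conf e f →
    ∀ s t x, L e s (L f t x) = L f t (L e s x)

variable (hL : ∀ e, StrongFamily (L e) K)
  {bad : α → Prop} {conf : α → α → Prop} {Z κ : ℝ}

/-- The oscillation of `L_e` is felt after an evolution by a conflicting interaction. -/
lemma norm_integral_setFlow_sub_one_le (h : Oscillating L bad conf Z κ) (hκ : 0 ≤ κ) {e f : α}
    (he : ¬ bad e) (hf : ¬ bad f) (hef : conf e f) {a b t : ℝ} (ha : 0 ≤ a) (hab : a ≤ b)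
    (hb : b ≤ Z) (ht0 : 0 ≤ t) (ht : t ≤ Z) (y : E) :
    ‖∫ r in a..b, L e r ((setFlow hL {f} t - 1) y)‖ ≤ Z * Real.exp (K * Z) * κ * ‖y‖ := by
  have hK : 0 ≤ K := (hL e).nonneg
  have hc : Continuous fun s => L f s (setFlow hL {f} s y) :=
    (hL f).continuous_apply continuous_id (strongFamily_sum hL {f} |>.continuous_flow y)
  -- Writing `U_f(t) - 1` as an integral exposes a factor `L_f(s)` at the left, and `∫ L_e(r) L_f(s)
  -- dr` is small for each fixed `s`.
  have h1 : (setFlow hL {f} t - 1) y = ∫ s in (0 : ℝ)..t, L f s (setFlow hL {f} s y) := by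
    have hd : ∀ s, HasDerivAt (fun z => setFlow hL {f} z y) (L f s (setFlow hL {f} s y)) s :=
      fun s => by simpa using hasDerivAt_setFlow hL {f} y s
    rw [intervalIntegral.integral_eq_sub_of_hasDerivAt (fun s _ => hd s)
      (hc.intervalIntegrable _ _), setFlow_zero]
    rfl
  have h2 : ∫ r in a..b, L e r ((setFlow hL {f} t - 1) y)
      = ∫ s in (0 : ℝ)..t, (hL e).integralOp a b (L f s (setFlow hL {f} s y)) := by
    rw [← StrongFamily.integralOp_apply (hL e) a b, h1]
    exact (((hL e).integralOp a b).intervalIntegral_comp_comm (hc.intervalIntegrable _ _)).symm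
  rw [h2]
  have h3 := intervalIntegral.norm_integral_le_of_norm_le_const (a := 0) (b := t)
    (f := fun s => (hL e).integralOp a b (L f s (setFlow hL {f} s y)))
    (C := κ * (Real.exp (K * Z) * ‖y‖)) fun s hs => by
      rw [uIoc_of_le ht0] at hs
      refine (h.small_conf e f he hf hef a b ha hab hb s _).trans ?_
      gcongr
      refine ((setFlow hL {f} s).le_opNorm y).trans ?_
      gcongr
      refine (norm_setFlow_le hL {f} hs.1.le).trans (Real.exp_le_exp.2 ?_)
      simp only [Finset.card_singleton, Nat.cast_one, one_mul]
      exact mul_le_mul_of_nonneg_left (hs.2.trans ht) hK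
  refine h3.trans ?_
  rw [sub_zero, abs_of_nonneg ht0]
  calc κ * (Real.exp (K * Z) * ‖y‖) * t ≤ κ * (Real.exp (K * Z) * ‖y‖) * Z := by gcongr
    _ = _ := by ring

/-- The non-resonant parts of the evolution are small. -/
theorem norm_exactFlow_le_of_not_resonant (h : Oscillating L bad conf Z κ) (hκ : 0 ≤ κ)
    (hK1 : 1 ≤ K) (hZ1 : 1 ≤ Z) (M : Finset α) (hM : ¬ Resonant bad conf M) {z : ℝ}
    (hz : z ∈ Icc 0 Z) :
    ‖exactFlow hL M z‖ ≤ κ * Real.exp (K * Z) ^ (6 * (M.card + 1) ^ 2) := by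
  -- All constants (`2`, `K`, `Z`, `K Z`, and `n + 1 ≤ B ^ n`) are absorbed in powers of `B`, so
  -- that the induction only has to follow one exponent.
  set B := Real.exp (K * Z) with hB
  have hKZ : 1 ≤ K * Z := one_le_mul_of_one_le_of_one_le hK1 hZ1
  have hB2 : 2 ≤ B := by
    have := Real.add_one_le_exp (K * Z)
    linarith
  have hKZB : K * Z ≤ B := by
    have := Real.add_one_le_exp (K * Z)
    linarith
  have hB1 : 1 ≤ B := by linarith
  have hB0 : 0 ≤ B := by linarith
  have hZB : Z ≤ B := le_trans (by nlinarith) hKZB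
  have hKB : K ≤ B := le_trans (by nlinarith) hKZB
  have hK0 : 0 ≤ K := by linarith
  have hZ0 : 0 ≤ Z := by linarith
  have hpow : ∀ {i j : ℕ}, i ≤ j → B ^ i ≤ B ^ j := fun hij => pow_le_pow_right₀ hB1 hij
  have hcard : ∀ n : ℕ, ((n + 1 : ℕ) : ℝ) ≤ B ^ n := fun n => by
    calc ((n + 1 : ℕ) : ℝ) ≤ 2 ^ n := by exact_mod_cast (Nat.lt_two_pow_self : n < 2 ^ n)
      _ ≤ B ^ n := pow_le_pow_left₀ (by norm_num) hB2 n
  have hN : ∀ M : Finset α, ∀ s, 0 ≤ s → s ≤ Z → ∀ x,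
      ‖exactFlow hL M s x‖ ≤ B ^ (2 * M.card) * ‖x‖ := by
    intro M s hs0 hs x
    refine (exactFlow hL M s).le_of_opNorm_le ((norm_exactFlow_le hL M hs0 hK0).trans ?_) x
    have e1 : Real.exp (M.card * K * s) ≤ B ^ M.card := by
      rw [hB, ← Real.exp_nat_mul]
      refine Real.exp_le_exp.2 ?_
      rw [mul_assoc]
      gcongr
    calc (2 : ℝ) ^ M.card * Real.exp (M.card * K * s) ≤ B ^ M.card * B ^ M.card := by
          gcongr
      _ = B ^ (2 * M.card) := by rw [two_mul, pow_add]
  clear_value B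
  obtain ⟨n, hn⟩ : ∃ n, M.card = n := ⟨_, rfl⟩
  induction n generalizing M z with
  | zero =>
    rw [Finset.card_eq_zero] at hn
    subst hn
    -- The empty set is resonant, so there is nothing to prove at the base.
    exact absurd ⟨by simp, by simp⟩ hM
  | succ n ih =>
    refine ContinuousLinearMap.opNorm_le_bound _ (by positivity) fun x => ?_
    have hcM : ∀ e ∈ M, (M.erase e).card = n := fun e he => by
      rw [Finset.card_erase_of_mem he, hn]; rfl
    -- the derivative of the exact part with one interaction removed
    have hD : ∀ e ∈ M, ∀ s, 0 ≤ s → s ≤ Z →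
        ∀ g ∈ M.erase e, ‖exactFlow hL (M.erase e) s x + exactFlow hL ((M.erase e).erase g) s x‖
          ≤ B ^ (2 * n + 1) * ‖x‖ := by
      intro e he s hs0 hs g hg
      refine (norm_add_le _ _).trans ?_
      have h1 := hN (M.erase e) s hs0 hs x
      have h2 := hN ((M.erase e).erase g) s hs0 hs x
      rw [hcM e he] at h1
      have h3 : B ^ (2 * ((M.erase e).erase g).card) ≤ B ^ (2 * n) := hpow (by
        have := Finset.card_erase_le (s := M.erase e) (a := g)
        rw [hcM e he] at this
        omega)
      calc _ ≤ B ^ (2 * n) * ‖x‖ + B ^ (2 * n) * ‖x‖ := by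
            refine add_le_add h1 (h2.trans ?_)
            gcongr
        _ = 2 * (B ^ (2 * n) * ‖x‖) := by ring
        _ ≤ B * (B ^ (2 * n) * ‖x‖) := by gcongr
        _ = _ := by ring
    -- each source term has a small time integral
    have key : ∀ e ∈ M, ∀ s ∈ Icc 0 Z,
        ‖∫ r in (0 : ℝ)..s, L e r (exactFlow hL (M.erase e) r x)‖
          ≤ κ * B ^ (6 * (n + 1) ^ 2 + n + 5) * ‖x‖ := by
      intro e he s hs
      -- The first case treated is that of a non-resonant `M ∖ e`: the source is already small by
      -- induction, and only the length of the interval is lost.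
      by_cases hres : Resonant bad conf (M.erase e)
      swap
      · have h1 := intervalIntegral.norm_integral_le_of_norm_le_const (a := 0) (b := s)
          (f := fun r => L e r (exactFlow hL (M.erase e) r x))
          (C := K * (κ * B ^ (6 * (n + 1) ^ 2) * ‖x‖)) fun r hr => by
            rw [uIoc_of_le hs.1] at hr
            refine ((hL e).norm_apply_le _ _).trans ?_
            gcongr
            refine (exactFlow hL (M.erase e) r).le_of_opNorm_le ?_ x
            have := ih (M.erase e) hres (z := r) ⟨hr.1.le, hr.2.trans hs.2⟩ (hcM e he)
            rwa [hcM e he] at this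
        refine h1.trans ?_
        rw [sub_zero, abs_of_nonneg hs.1]
        calc K * (κ * B ^ (6 * (n + 1) ^ 2) * ‖x‖) * s
            ≤ K * (κ * B ^ (6 * (n + 1) ^ 2) * ‖x‖) * Z := by gcongr; exact hs.2
          _ = (K * Z) * (κ * B ^ (6 * (n + 1) ^ 2) * ‖x‖) := by ring
          _ ≤ B * (κ * B ^ (6 * (n + 1) ^ 2) * ‖x‖) := by gcongr
          _ = κ * B ^ (6 * (n + 1) ^ 2 + 1) * ‖x‖ := by ring
          _ ≤ _ := by gcongr κ * ?_ * ‖x‖; exact hpow (by omega)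
      have hx' : Continuous fun r => ∑ g ∈ M.erase e, L g r (exactFlow hL (M.erase e) r x
          + exactFlow hL ((M.erase e).erase g) r x) :=
        continuous_finsetSum _ fun g _ => (hL g).continuous_apply continuous_id
          ((continuous_exactFlow hL _ x).add (continuous_exactFlow hL _ x))
      by_cases hbe : bad e
      -- A bad `e` oscillates by itself, so integration by parts against the slowly varying curve
      -- `E_{M∖e}` suffices.
      · have h1 := (hL e).norm_integral_apply_le hs.1
          (fun r => hasDerivAt_exactFlow hL (M.erase e) x r) hx'
          (h.small_bad e hbe 0 s le_rfl hs.1 hs.2 _)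
          (fun t ht => (h.small_bad e hbe t s ht.1 ht.2 hs.2 _).trans
            (mul_le_mul_of_nonneg_left (show _ ≤ (n : ℝ) * (K * (B ^ (2 * n + 1) * ‖x‖)) from
              (norm_sum_le _ _).trans ((Finset.sum_le_card_nsmul _ _ _ fun g hg =>
                ((hL g).norm_apply_le _ _).trans (mul_le_mul_of_nonneg_left
                  (hD e he t ht.1 (ht.2.trans hs.2) g hg) hK0)).trans (by
                    rw [hcM e he, nsmul_eq_mul]))) hκ))
        refine h1.trans ?_
        have h2 := hN (M.erase e) 0 le_rfl hZ0 x
        rw [hcM e he] at h2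
        calc κ * ‖exactFlow hL (M.erase e) 0 x‖
              + (s - 0) * (κ * (n * (K * (B ^ (2 * n + 1) * ‖x‖))))
            ≤ κ * (B ^ (2 * n) * ‖x‖) + Z * (κ * (B ^ n * (K * (B ^ (2 * n + 1) * ‖x‖)))) := by
              have h5 : (n : ℝ) ≤ B ^ n := le_trans (by push_cast; linarith) (hcard n)
              have h6 : s - 0 ≤ Z := by linarith [hs.2]
              gcongr
          _ = κ * (B ^ (2 * n) * ‖x‖) + (K * Z) * (κ * (B ^ (3 * n + 1) * ‖x‖)) := by ring
          _ ≤ κ * (B ^ (3 * n + 2) * ‖x‖) + B * (κ * (B ^ (3 * n + 1) * ‖x‖)) := by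
              have := hpow (show 2 * n ≤ 3 * n + 2 by omega)
              gcongr
          _ = 2 * (κ * (B ^ (3 * n + 2) * ‖x‖)) := by ring
          _ ≤ B * (κ * (B ^ (3 * n + 2) * ‖x‖)) := by gcongr
          _ = κ * B ^ (3 * n + 3) * ‖x‖ := by ring
          _ ≤ _ := by gcongr κ * ?_ * ‖x‖; exact hpow (by nlinarith)
      · -- `e` conflicts with some `f` in the resonant set `M \ e`
        obtain ⟨f, hf, hef⟩ : ∃ f ∈ M.erase e, conf e f := by
          by_contra hcon
          push Not at hcon
          refine hM ⟨fun g hg => ?_, fun g hg k hk hgk => ?_⟩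
          · by_cases hge : g = e
            · exact hge ▸ hbe
            · exact hres.1 g (Finset.mem_erase.2 ⟨hge, hg⟩)
          · by_cases hge : g = e
            · subst hge
              exact hcon k (Finset.mem_erase.2 ⟨hgk.symm, hk⟩)
            · by_cases hke : k = e
              · subst hke
                exact fun hc => hcon g (Finset.mem_erase.2 ⟨hge, hg⟩) (h.symm _ _ hc)
              · exact hres.2 g (Finset.mem_erase.2 ⟨hge, hg⟩) k (Finset.mem_erase.2 ⟨hke, hk⟩) hgk
        have hbf := hres.1 f hf
        have hcomm : ∀ g ∈ (M.erase e).erase f, ∀ s t x, L f s (L g t x) = L g t (L f s x) :=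
          fun g hg => h.comm f g hbf (hres.1 g (Finset.mem_of_mem_erase hg))
            (Finset.ne_of_mem_erase hg).symm (hres.2 f hf g (Finset.mem_of_mem_erase hg)
              (Finset.ne_of_mem_erase hg).symm)
        -- Inside the resonant set `M ∖ e` the interaction `f` commutes with all the others, so `U_f
        -- - 1` splits off as the leftmost factor, where `L_e` meets it.
        have hfac : ∀ t, 0 ≤ t → exactFlow hL (M.erase e) t
            = (setFlow hL {f} t - 1) * exactFlow hL ((M.erase e).erase f) t := fun t ht => by
          conv_lhs => rw [← Finset.insert_erase hf]
          exact exactFlow_insert_of_comm hL (Finset.notMem_erase _ _) hcomm ht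
        have hfac' : ∀ g ∈ (M.erase e).erase f, ∀ t, 0 ≤ t → exactFlow hL ((M.erase e).erase g) t
            = (setFlow hL {f} t - 1) * exactFlow hL (((M.erase e).erase f).erase g) t :=
          fun g hg t ht => by
            have : f ∈ (M.erase e).erase g :=
              Finset.mem_erase.2 ⟨(Finset.ne_of_mem_erase hg).symm, hf⟩
            conv_lhs => rw [← Finset.insert_erase this]
            rw [exactFlow_insert_of_comm hL (Finset.notMem_erase _ _) _ ht]
            · rw [Finset.erase_right_comm]
            · intro k hk
              rw [Finset.erase_right_comm] at hk
              exact hcomm k (Finset.mem_of_mem_erase hk)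
        have hsum : ∀ t, 0 ≤ t → t ≤ s → ∀ g ∈ M.erase e,
            ‖∫ r in t..s, L e r (L g t (exactFlow hL (M.erase e) t x
              + exactFlow hL ((M.erase e).erase g) t x))‖
              ≤ κ * B ^ (2 * n + 5) * ‖x‖ := by
          intro t ht0 hts g hg
          -- The derivative of the curve may produce `L_f` itself, and then the conflict estimate
          -- applies at once. Otherwise it produces some `L_g` that commutes with `f`, and the
          -- factor `U_f - 1` can be moved back in front of it.
          by_cases hgf : g = f
          · subst hgf
            refine (h.small_conf e g hbe hbf hef t s ht0 hts hs.2 t _).trans ?_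
            calc _ ≤ κ * (B ^ (2 * n + 1) * ‖x‖) := by
                  gcongr
                  exact hD e he t ht0 (hts.trans hs.2) g hg
              _ = κ * B ^ (2 * n + 1) * ‖x‖ := by ring
              _ ≤ _ := by gcongr κ * ?_ * ‖x‖; exact hpow (by omega)
          · have hg' : g ∈ (M.erase e).erase f := Finset.mem_erase.2 ⟨hgf, hg⟩
            have e1 : L g t (exactFlow hL (M.erase e) t x
                + exactFlow hL ((M.erase e).erase g) t x)
                = (setFlow hL {f} t - 1) (L g t (exactFlow hL ((M.erase e).erase f) t x
                  + exactFlow hL (((M.erase e).erase f).erase g) t x)) := by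
              rw [hfac t ht0, hfac' g hg' t ht0, mul_apply_eq_comp,
                mul_apply_eq_comp, ← map_add, _root_.sub_apply,
                _root_.sub_apply, map_sub]
              congr 1
              exact setFlow_comm hL (B := L g t) (S := {f}) (fun k hk u y => by
                rw [Finset.mem_singleton.1 hk]; exact (hcomm g hg' u t y).symm) ht0 _
            rw [e1]
            refine (norm_integral_setFlow_sub_one_le hL h hκ hbe hbf hef ht0 hts hs.2 ht0
              (hts.trans hs.2) _).trans ?_
            have h7 : ‖L g t (exactFlow hL ((M.erase e).erase f) t x
                  + exactFlow hL (((M.erase e).erase f).erase g) t x)‖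
                ≤ K * (B * (B ^ (2 * n) * ‖x‖)) := by
              refine ((hL g).norm_apply_le _ _).trans ?_
              gcongr
              have c1 : ((M.erase e).erase f).card ≤ n := by
                have := Finset.card_erase_le (s := M.erase e) (a := f)
                rwa [hcM e he] at this
              have c2 : (((M.erase e).erase f).erase g).card ≤ n :=
                (Finset.card_erase_le).trans c1
              have h1 := hN ((M.erase e).erase f) t ht0 (hts.trans hs.2) x
              have h2 := hN (((M.erase e).erase f).erase g) t ht0 (hts.trans hs.2) x
              have h3 := hpow (show 2 * ((M.erase e).erase f).card ≤ 2 * n by omega)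
              have h4 := hpow (show 2 * (((M.erase e).erase f).erase g).card ≤ 2 * n by omega)
              calc _ ≤ B ^ (2 * n) * ‖x‖ + B ^ (2 * n) * ‖x‖ := by
                    refine (norm_add_le _ _).trans (add_le_add (h1.trans ?_) (h2.trans ?_)) <;>
                      gcongr
                _ = 2 * (B ^ (2 * n) * ‖x‖) := by ring
                _ ≤ _ := by gcongr
            rw [← hB]
            calc Z * B * κ * _ ≤ Z * B * κ * (K * (B * (B ^ (2 * n) * ‖x‖))) := by gcongr
              _ = (K * Z) * (κ * (B ^ (2 * n + 2) * ‖x‖)) := by ring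
              _ ≤ B * (κ * (B ^ (2 * n + 2) * ‖x‖)) := by gcongr
              _ = κ * B ^ (2 * n + 3) * ‖x‖ := by ring
              _ ≤ _ := by gcongr κ * ?_ * ‖x‖; exact hpow (by omega)
        -- No boundary term: `M ∖ e` contains `f`, so nothing has happened at time `0`. A boundary
        -- term could not be controlled here, since `e` alone need not oscillate.
        have h0 : exactFlow hL (M.erase e) 0 = 0 := exactFlow_zero hL ⟨f, hf⟩
        have h1 := (hL e).norm_integral_apply_le (κ₀ := 0)
          (κ₁ := n * (κ * B ^ (2 * n + 5) * ‖x‖)) hs.1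
          (fun r => hasDerivAt_exactFlow hL (M.erase e) x r) hx'
          (by simp [h0])
          (fun t ht => by
            simp only [map_sum]
            rw [intervalIntegral.integral_finsetSum fun g _ =>
              ((hL e).cont _).intervalIntegrable _ _]
            refine (norm_sum_le _ _).trans ((Finset.sum_le_card_nsmul _ _ _ fun g hg =>
              hsum t ht.1 ht.2 g hg).trans ?_)
            rw [hcM e he, nsmul_eq_mul])
        refine h1.trans ?_
        calc 0 + (s - 0) * (n * (κ * B ^ (2 * n + 5) * ‖x‖))
            ≤ B * (B ^ n * (κ * B ^ (2 * n + 5) * ‖x‖)) := by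
              have h5 : (n : ℝ) ≤ B ^ n := le_trans (by push_cast; linarith) (hcard n)
              have h6 : s - 0 ≤ B := by linarith [hs.2]
              rw [zero_add]
              gcongr
          _ = κ * B ^ (3 * n + 6) * ‖x‖ := by ring
          _ ≤ _ := by gcongr κ * ?_ * ‖x‖; exact hpow (by nlinarith)
    -- `E_M` starts from `0` and is forced by the sources whose time integrals have just been
    -- bounded; Duhamel transfers the bound to `E_M`.
    have hforced := (strongFamily_sum hL M).norm_le_of_forced
      (y := fun s => exactFlow hL M s x)
      (F := fun s => ∑ e ∈ M, L e s (exactFlow hL (M.erase e) s x)) (Z := Z)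
      (κ := (n + 1 : ℕ) * (κ * B ^ (6 * (n + 1) ^ 2 + n + 5) * ‖x‖))
      (fun s => by
        refine (hasDerivAt_exactFlow hL M x s).congr_deriv ?_
        rw [_root_.sum_apply, ← Finset.sum_add_distrib]
        exact Finset.sum_congr rfl fun e _ => map_add _ _ _)
      (continuous_finsetSum _ fun e _ => (hL e).continuous_apply continuous_id
        (continuous_exactFlow hL _ x))
      (by rw [exactFlow_zero hL (Finset.card_pos.1 (by omega))]; rfl)
      (fun s hs => by
        rw [intervalIntegral.integral_finsetSum (s := M)
          (f := fun e s => L e s (exactFlow hL (M.erase e) s x)) fun e _ =>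
          ((hL e).continuous_apply continuous_id
            (continuous_exactFlow hL _ x)).intervalIntegrable _ _]
        refine (norm_sum_le _ _).trans ((Finset.sum_le_card_nsmul _ _ _ fun e he =>
          key e he s hs).trans ?_)
        rw [hn, nsmul_eq_mul]) hz
    refine hforced.trans ?_
    have e1 : Real.exp (M.card * K * z) ≤ B ^ (n + 1) := by
      rw [hB, ← Real.exp_nat_mul, hn]
      refine Real.exp_le_exp.2 ?_
      rw [mul_assoc]
      gcongr
      exact hz.2
    have e2 : (M.card : ℝ) * K * z ≤ B ^ (n + 1) := by
      rw [hn, mul_assoc]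
      calc ((n + 1 : ℕ) : ℝ) * (K * z) ≤ B ^ n * (K * Z) := by
            gcongr
            · exact mul_nonneg hK0 hz.1
            · exact hcard n
            · exact hz.2
        _ ≤ B ^ n * B := by gcongr
        _ = _ := by ring
    have e3 : 1 + (M.card : ℝ) * K * z * Real.exp (M.card * K * z) ≤ B ^ (2 * n + 3) := by
      have h1 : (1 : ℝ) ≤ B ^ (2 * n + 2) := one_le_pow₀ hB1
      calc 1 + (M.card : ℝ) * K * z * Real.exp (M.card * K * z)
          ≤ B ^ (2 * n + 2) + B ^ (n + 1) * B ^ (n + 1) := by gcongr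
        _ = 2 * B ^ (2 * n + 2) := by ring
        _ ≤ B * B ^ (2 * n + 2) := by gcongr
        _ = _ := by ring
    -- One induction step costs the exponent `4 n + 8`, while `6 (card + 1)²` grows by `12 n + 18`.
    calc _ ≤ B ^ n * (κ * B ^ (6 * (n + 1) ^ 2 + n + 5) * ‖x‖) * B ^ (2 * n + 3) := by
          refine mul_le_mul (mul_le_mul_of_nonneg_right (hcard n) (by positivity)) e3 ?_
            (by positivity)
          have := mul_nonneg (mul_nonneg (Nat.cast_nonneg M.card : (0 : ℝ) ≤ _) hK0) hz.1
          positivity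
      _ = κ * B ^ (6 * (n + 1) ^ 2 + 4 * n + 8) * ‖x‖ := by ring
      _ ≤ _ := by
        gcongr κ * ?_ * ‖x‖
        rw [hn]
        exact hpow (by nlinarith)

end Oscillation

/-! ### Integral operators on complex measures -/

section KernelOp

variable {X Y : Type*} [MeasurableSpace X] [MeasurableSpace Y]

/-- The operator on complex measures with phase `φ`, transition map `T` and weight `w dν`. -/
noncomputable def kernelOp (ν : Measure Y) (w : Y → ℂ) (φ : Y × X → ℂ) (T : Y × X → X)
    (ρ : ComplexMeasure X) : ComplexMeasure X :=
  (mulDensity φ (VectorMeasure.prod (ν.withDensityᵥ w) ρ (ContinuousLinearMap.mul ℝ ℂ))).map T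

/-- The adjoint action on bounded functions. -/
noncomputable def kernelAdj (ν : Measure Y) (w : Y → ℂ) (φ : Y × X → ℂ) (T : Y × X → X)
    (F : X → ℂ) (x : X) : ℂ :=
  ∫ y, F (T (y, x)) * φ (y, x) * w y ∂ν

variable {ν : Measure Y} [SFinite ν] {w : Y → ℂ} {φ : Y × X → ℂ} {T : Y × X → X}

lemma cint_kernelOp (hw : Integrable w ν) (hφ : Measurable φ) (hφ1 : ∀ p, ‖φ p‖ ≤ 1)
    (hT : Measurable T) (ρ : ComplexMeasure X) {F : X → ℂ} (hF : Measurable F) {C : ℝ}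
    (hC : ∀ x, ‖F x‖ ≤ C) :
    cint (kernelOp ν w φ T ρ) F = cint ρ (kernelAdj ν w φ T F) := by
  have hb : ∀ p, ‖F (T p) * φ p‖ ≤ |C| := fun p => by
    rw [norm_mul]
    calc ‖F (T p)‖ * ‖φ p‖ ≤ |C| * 1 :=
          mul_le_mul ((hC _).trans (le_abs_self _)) (hφ1 p) (norm_nonneg _) (abs_nonneg _)
      _ = |C| := mul_one _
  rw [kernelOp, cint_map _ hT hF hC,
    cint_mulDensity _ hφ hφ1 (F := fun p => F (T p)) (hF.comp hT) fun p => hC _,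
    cint_prod (F := fun p => F (T p) * φ p) hw ρ ((hF.comp hT).mul hφ) hb]
  rfl

lemma measurable_kernelAdj (hw : Measurable w) (hφ : Measurable φ) (hT : Measurable T) {F : X → ℂ}
    (hF : Measurable F) : Measurable (kernelAdj ν w φ T F) := by
  have : StronglyMeasurable fun p : X × Y => F (T (p.2, p.1)) * φ (p.2, p.1) * w p.2 :=
    (((hF.comp (hT.comp measurable_swap)).mul (hφ.comp measurable_swap)).mul
      (hw.comp measurable_snd)).stronglyMeasurable
  exact this.integral_prod_right.measurable

lemma norm_kernelAdj_le (hw : Integrable w ν) (hφ1 : ∀ p, ‖φ p‖ ≤ 1) {F : X → ℂ} {C : ℝ}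
    (hC : ∀ x, ‖F x‖ ≤ C) (x : X) : ‖kernelAdj ν w φ T F x‖ ≤ C * ∫ y, ‖w y‖ ∂ν := by
  have hC0 : 0 ≤ C := (norm_nonneg _).trans (hC x)
  rw [← integral_const_mul]
  refine norm_integral_le_of_norm_le (hw.norm.const_mul _) (Eventually.of_forall fun y => ?_)
  rw [norm_mul, norm_mul]
  refine mul_le_mul_of_nonneg_right ?_ (norm_nonneg _)
  calc _ ≤ C * 1 := mul_le_mul (hC _) (hφ1 _) (norm_nonneg _) hC0
    _ = C := mul_one C

/-- Integration of a bounded measurable function, as a continuous functional. -/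
noncomputable def cintCLM {F : X → ℂ} (hF : Measurable F) {C : ℝ} (hC : ∀ x, ‖F x‖ ≤ C) :
    ComplexMeasure X →L[ℂ] ℂ :=
  LinearMap.mkContinuous
    { toFun := fun ρ => cint ρ F
      map_add' := fun ρ ρ' => cint_add ρ ρ' hF hC
      map_smul' := fun c ρ => cint_smul c ρ hF hC } C fun ρ => norm_cint_le ρ hC

lemma cintCLM_apply {F : X → ℂ} (hF : Measurable F) {C : ℝ} (hC : ∀ x, ‖F x‖ ≤ C)
    (ρ : ComplexMeasure X) : cintCLM hF hC ρ = cint ρ F := rfl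

/-- `kernelOp` as a bounded operator. -/
noncomputable def kernelCLM (hw : Integrable w ν) (hwm : Measurable w) (hφ : Measurable φ)
    (hφ1 : ∀ p, ‖φ p‖ ≤ 1) (hT : Measurable T) : ComplexMeasure X →L[ℂ] ComplexMeasure X :=
  LinearMap.mkContinuous
    { toFun := kernelOp ν w φ T
      map_add' := fun ρ ρ' => ext_cint fun F hF h1 => by
        rw [cint_add _ _ hF h1, cint_kernelOp hw hφ hφ1 hT _ hF h1,
          cint_kernelOp hw hφ hφ1 hT _ hF h1, cint_kernelOp hw hφ hφ1 hT _ hF h1,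
          cint_add _ _ (measurable_kernelAdj hwm hφ hT hF) (norm_kernelAdj_le hw hφ1 h1)]
      map_smul' := fun c ρ => ext_cint fun F hF h1 => by
        rw [RingHom.id_apply, cint_smul _ _ hF h1, cint_kernelOp hw hφ hφ1 hT _ hF h1,
          cint_kernelOp hw hφ hφ1 hT _ hF h1,
          cint_smul _ _ (measurable_kernelAdj hwm hφ hT hF) (norm_kernelAdj_le hw hφ1 h1)] }
    (∫ y, ‖w y‖ ∂ν) fun ρ => norm_le_of_cint_le fun F hF h1 => by
      simp only [LinearMap.coe_mk, AddHom.coe_mk]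
      rw [cint_kernelOp hw hφ hφ1 hT _ hF h1]
      refine (norm_cint_le ρ (norm_kernelAdj_le hw hφ1 h1)).trans ?_
      rw [one_mul]

lemma kernelCLM_apply (hw : Integrable w ν) (hwm : Measurable w) (hφ : Measurable φ)
    (hφ1 : ∀ p, ‖φ p‖ ≤ 1) (hT : Measurable T) (ρ : ComplexMeasure X) :
    kernelCLM hw hwm hφ hφ1 hT ρ = kernelOp ν w φ T ρ := rfl

lemma norm_kernelCLM_le (hw : Integrable w ν) (hwm : Measurable w) (hφ : Measurable φ)
    (hφ1 : ∀ p, ‖φ p‖ ≤ 1) (hT : Measurable T) :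
    ‖kernelCLM (ν := ν) hw hwm hφ hφ1 hT‖ ≤ ∫ y, ‖w y‖ ∂ν :=
  LinearMap.mkContinuous_norm_le _ (integral_nonneg fun _ => norm_nonneg _) _

/-- The oscillating factor `e^{irθ}`. -/
noncomputable def osc (r θ : ℝ) : ℂ := Complex.exp (Complex.I * (r * θ : ℝ))

lemma norm_osc (r θ : ℝ) : ‖osc r θ‖ = 1 := by
  rw [osc, mul_comm]; exact Complex.norm_exp_ofReal_mul_I _

@[fun_prop]
lemma continuous_osc : Continuous fun p : ℝ × ℝ => osc p.1 p.2 := by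
  unfold osc; fun_prop

@[fun_prop]
lemma Measurable.osc {β : Type*} [MeasurableSpace β] {f g : β → ℝ} (hf : Measurable f)
    (hg : Measurable g) : Measurable fun x => osc (f x) (g x) :=
  continuous_osc.measurable.comp (hf.prodMk hg)

/-- Strong continuity of a family of integral operators with oscillating phase. -/
lemma continuous_kernelOp_osc (hw : Integrable w ν) (hwm : Measurable w) {θ : Y × X → ℝ}
    (hθ : Measurable θ) (hT : Measurable T) (ρ : ComplexMeasure X) :
    Continuous fun r : ℝ => kernelOp ν w (fun p => osc r (θ p)) T ρ := by
  obtain ⟨g, hg, ig, -, hI⟩ := cint_eq_integral ρ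
  rw [continuous_iff_continuousAt]
  intro r₀
  have hm : ∀ r : ℝ, Measurable fun p => osc r (θ p) := fun r => by fun_prop
  have h1 : ∀ r p, ‖(fun p => osc r (θ p)) p‖ ≤ 1 := fun r p => (norm_osc _ _).le
  have hwg : Integrable (fun p : Y × X => w p.1 * g p.2) (ν.prod ρ.variation) := hw.mul_prod ig
  -- The phase rate `θ` is not assumed bounded, so the continuity is only strong: it comes from
  -- dominated convergence against the fixed density of `ρ`.
  have hlim : Tendsto (fun r => ∫ p : Y × X, ‖osc r (θ p) - osc r₀ (θ p)‖ * ‖w p.1 * g p.2‖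
      ∂(ν.prod ρ.variation)) (𝓝 r₀) (𝓝 0) := by
    have : (0 : ℝ) = ∫ p : Y × X, 0 ∂(ν.prod ρ.variation) := by simp
    rw [this]
    refine tendsto_integral_filter_of_dominated_convergence (fun p => 2 * ‖w p.1 * g p.2‖) ?_ ?_
      (hwg.norm.const_mul 2) ?_
    · refine Eventually.of_forall fun r => ?_
      exact (((hm r).sub (hm r₀)).norm.aestronglyMeasurable).mul hwg.norm.aestronglyMeasurable
    · refine Eventually.of_forall fun r => Eventually.of_forall fun p => ?_
      rw [norm_mul, norm_norm, norm_norm]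
      refine mul_le_mul_of_nonneg_right ?_ (norm_nonneg _)
      refine (norm_sub_le _ _).trans ?_
      rw [norm_osc, norm_osc]; norm_num
    · refine Eventually.of_forall fun p => ?_
      have hc : Continuous fun r => ‖osc r (θ p) - osc r₀ (θ p)‖ * ‖w p.1 * g p.2‖ := by fun_prop
      have := hc.tendsto r₀
      simpa using this
  rw [ContinuousAt, tendsto_iff_norm_sub_tendsto_zero]
  refine squeeze_zero (fun _ => norm_nonneg _) (fun r => ?_) hlim
  refine norm_le_of_cint_le fun F hF hF1 => ?_
  have e1 : cint (kernelOp ν w (fun p => osc r (θ p)) T ρ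
      - kernelOp ν w (fun p => osc r₀ (θ p)) T ρ) F
      = cint (kernelOp ν w (fun p => osc r (θ p)) T ρ) F
        - cint (kernelOp ν w (fun p => osc r₀ (θ p)) T ρ) F := by
    simp only [← cintCLM_apply hF hF1, map_sub]
  have e2 : ∀ r, cint (kernelOp ν w (fun p => osc r (θ p)) T ρ) F
      = ∫ p : Y × X, F (T p) * osc r (θ p) * (w p.1 * g p.2) ∂(ν.prod ρ.variation) := by
    intro r
    rw [cint_kernelOp hw (hm r) (h1 r) hT ρ hF hF1,
      hI _ (measurable_kernelAdj hwm (hm r) hT hF) _ (norm_kernelAdj_le hw (h1 r) hF1),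
      integral_prod_symm]
    · refine integral_congr_ae (Eventually.of_forall fun x => ?_)
      simp only [kernelAdj]
      rw [← integral_mul_const]
      congr 1; ext y; ring
    · refine hwg.bdd_mul (c := 1) ((hF.comp hT).mul (hm r)).aestronglyMeasurable
        (Eventually.of_forall fun p => ?_)
      rw [norm_mul, norm_osc, mul_one]; exact hF1 _
  have hi : ∀ r, Integrable (fun p : Y × X => F (T p) * osc r (θ p) * (w p.1 * g p.2))
      (ν.prod ρ.variation) := fun r => by
    refine hwg.bdd_mul (c := 1) ((hF.comp hT).mul (hm r)).aestronglyMeasurable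
        (Eventually.of_forall fun p => ?_)
    rw [norm_mul, norm_osc, mul_one]; exact hF1 _
  rw [e1, e2, e2, ← integral_sub (hi r) (hi r₀)]
  refine norm_integral_le_of_norm_le ?_ (Eventually.of_forall fun p => ?_)
  · refine hwg.norm.bdd_mul (c := 2) ((hm r).sub (hm r₀)).norm.aestronglyMeasurable
      (Eventually.of_forall fun p => ?_)
    rw [norm_norm]
    refine (norm_sub_le _ _).trans ?_
    rw [norm_osc, norm_osc]; norm_num
  · have : F (T p) * osc r (θ p) * (w p.1 * g p.2) - F (T p) * osc r₀ (θ p) * (w p.1 * g p.2)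
        = F (T p) * ((osc r (θ p) - osc r₀ (θ p)) * (w p.1 * g p.2)) := by ring
    rw [this, norm_mul, norm_mul]
    calc _ ≤ 1 * (‖osc r (θ p) - osc r₀ (θ p)‖ * ‖w p.1 * g p.2‖) := by
          gcongr; exact hF1 _
      _ = _ := one_mul _

/-- Bound for the time integral of an oscillating family of integral operators. -/
lemma norm_integral_le_of_osc (hw : Integrable w ν) (hwm : Measurable w) {ψ : Y × X → ℂ}
    {θ : Y × X → ℝ} (hψ : Measurable ψ) (hψ1 : ∀ p, ‖ψ p‖ ≤ 1) (hθ : Measurable θ)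
    (hT : Measurable T) (ρ : ComplexMeasure X) {A : ℝ → ComplexMeasure X} (hA : Continuous A)
    {a b κ : ℝ} (hab : a ≤ b)
    (hAF : ∀ F : X → ℂ, Measurable F → (∀ x, ‖F x‖ ≤ 1) → ∀ r,
      cint (A r) F = cint ρ (kernelAdj ν w (fun p => ψ p * osc r (θ p)) T F))
    (hκ : ∀ x, ∫ y, ‖∫ r in a..b, osc r (θ (y, x))‖ * ‖w y‖ ∂ν ≤ κ) :
    ‖∫ r in a..b, A r‖ ≤ κ * ‖ρ‖ := by
  obtain ⟨g, hg, ig, e, hI⟩ := cint_eq_integral ρ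
  have hwg : Integrable (fun p : Y × X => w p.1 * g p.2) (ν.prod ρ.variation) := hw.mul_prod ig
  have hn : ‖ρ‖ = ∫ x, ‖g x‖ ∂ρ.variation := by
    rw [norm_def]
    conv_lhs => rw [e, Measure.variation_withDensityᵥ ig]
    rw [measureReal_def, withDensity_apply _ MeasurableSet.univ, Measure.restrict_univ,
      integral_norm_eq_lintegral_enorm ig.aestronglyMeasurable]
  refine norm_le_of_cint_le fun F hF hF1 => ?_
  have hψr : ∀ r, Measurable fun p => ψ p * osc r (θ p) := fun r => by fun_prop
  have hψr1 : ∀ r p, ‖(fun p => ψ p * osc r (θ p)) p‖ ≤ 1 := fun r p => by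
    simp only [norm_mul, norm_osc, mul_one]; exact hψ1 p
  have e1 : cint (∫ r in a..b, A r) F = ∫ r in a..b, cint (A r) F :=
    ((cintCLM hF hF1).intervalIntegral_comp_comm (hA.intervalIntegrable _ _)).symm
  have e2 : ∀ r, cint (A r) F
      = ∫ p : Y × X, (F (T p) * ψ p * (w p.1 * g p.2)) * osc r (θ p) ∂(ν.prod ρ.variation) := by
    intro r
    rw [hAF F hF hF1 r, hI _ (measurable_kernelAdj hwm (hψr r) hT hF) _
      (norm_kernelAdj_le hw (hψr1 r) hF1), integral_prod_symm]
    · refine integral_congr_ae (Eventually.of_forall fun x => ?_)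
      simp only [kernelAdj]
      rw [← integral_mul_const]
      congr 1; ext y; ring
    · have := hwg.bdd_mul (c := 1) (f := fun p => F (T p) * (ψ p * osc r (θ p)))
        ((hF.comp hT).mul (hψr r)).aestronglyMeasurable (Eventually.of_forall fun p => by
          rw [norm_mul]
          calc _ ≤ (1 : ℝ) * 1 := mul_le_mul (hF1 _) (hψr1 r p) (norm_nonneg _) zero_le_one
            _ = 1 := one_mul 1)
      refine this.congr (Eventually.of_forall fun p => ?_)
      simp only
      ring
  have hG : Integrable (fun p : Y × X => F (T p) * ψ p * (w p.1 * g p.2))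
      (ν.prod ρ.variation) :=
    hwg.bdd_mul (c := 1) ((hF.comp hT).mul hψ).aestronglyMeasurable
      (Eventually.of_forall fun p => by
        rw [norm_mul]
        calc _ ≤ (1 : ℝ) * 1 := mul_le_mul (hF1 _) (hψ1 p) (norm_nonneg _) zero_le_one
          _ = 1 := one_mul 1)
  have hosc : Measurable fun q : ℝ × (Y × X) => osc q.1 (θ q.2) := by fun_prop
  -- By Fubini the time integral becomes the innermost one, where only the oscillating factor
  -- depends on `r`. Since `κ` is uniform in `x`, the outer integral then contributes `‖ρ‖`.
  have e3 : ∫ r in a..b, cint (A r) F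
      = ∫ p : Y × X, (F (T p) * ψ p * (w p.1 * g p.2)) * (∫ r in a..b, osc r (θ p))
        ∂(ν.prod ρ.variation) := by
    simp_rw [e2, intervalIntegral.integral_of_le hab]
    rw [integral_integral_swap]
    · exact integral_congr_ae (Eventually.of_forall fun p => integral_const_mul _ _)
    · have h1 : Integrable (fun q : ℝ × (Y × X) => F (T q.2) * ψ q.2 * (w q.2.1 * g q.2.2))
          ((volume.restrict (Ioc a b)).prod (ν.prod ρ.variation)) := hG.comp_snd _
      exact h1.mul_bdd (c := 1) hosc.aestronglyMeasurable
        (Eventually.of_forall fun q => (norm_osc _ _).le)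
  have hmI : Measurable fun p : Y × X => ∫ r in a..b, osc r (θ p) := by
    simp_rw [intervalIntegral.integral_of_le hab]
    have : StronglyMeasurable fun q : (Y × X) × ℝ => osc q.2 (θ q.1) :=
      (hosc.comp measurable_swap).stronglyMeasurable
    exact this.integral_prod_right.measurable
  have hbI : ∀ p : Y × X, ‖∫ r in a..b, osc r (θ p)‖ ≤ b - a := fun p => by
    have := intervalIntegral.norm_integral_le_of_norm_le_const (a := a) (b := b)
      (f := fun r => osc r (θ p)) (C := 1) fun r _ => (norm_osc _ _).le
    rwa [one_mul, abs_of_nonneg (sub_nonneg.2 hab)] at this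
  have hH : Integrable (fun p : Y × X => ‖∫ r in a..b, osc r (θ p)‖ * ‖w p.1 * g p.2‖)
      (ν.prod ρ.variation) :=
    hwg.norm.bdd_mul (c := b - a) hmI.norm.aestronglyMeasurable
      (Eventually.of_forall fun p => by rw [norm_norm]; exact hbI p)
  rw [e1, e3]
  calc ‖∫ p : Y × X, (F (T p) * ψ p * (w p.1 * g p.2)) * (∫ r in a..b, osc r (θ p))
        ∂(ν.prod ρ.variation)‖
      ≤ ∫ p : Y × X, ‖∫ r in a..b, osc r (θ p)‖ * ‖w p.1 * g p.2‖ ∂(ν.prod ρ.variation) := by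
        refine norm_integral_le_of_norm_le hH (Eventually.of_forall fun p => ?_)
        rw [norm_mul, norm_mul, norm_mul, mul_comm]
        refine mul_le_mul_of_nonneg_left ?_ (norm_nonneg _)
        calc ‖F (T p)‖ * ‖ψ p‖ * ‖w p.1 * g p.2‖ ≤ 1 * 1 * ‖w p.1 * g p.2‖ := by
              gcongr
              · exact hF1 _
              · exact hψ1 _
          _ = _ := by ring
    _ = ∫ x, (∫ y, ‖∫ r in a..b, osc r (θ (y, x))‖ * ‖w y‖ ∂ν) * ‖g x‖ ∂ρ.variation := by
        rw [integral_prod_symm _ hH]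
        refine integral_congr_ae (Eventually.of_forall fun x => ?_)
        simp only [norm_mul]
        rw [← integral_mul_const]
        congr 1; ext y; ring
    _ ≤ ∫ x, κ * ‖g x‖ ∂ρ.variation := by
        refine integral_mono_of_nonneg (Eventually.of_forall fun x => ?_) (ig.norm.const_mul κ)
          (Eventually.of_forall fun x => ?_)
        · exact mul_nonneg (integral_nonneg fun y => by positivity) (norm_nonneg _)
        · exact mul_le_mul_of_nonneg_right (hκ x) (norm_nonneg _)
    _ = κ * ‖ρ‖ := by rw [integral_const_mul, hn]

end KernelOp

/-! ### Composition of integral operators -/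

section Compose

variable {X Y Y' : Type*} [MeasurableSpace X] [MeasurableSpace Y] [MeasurableSpace Y']
  {ν : Measure Y} [SFinite ν] {ν' : Measure Y'} [SFinite ν'] {w : Y → ℂ} {w' : Y' → ℂ}
  {φ : Y × X → ℂ} {T : Y × X → X} {φ' : Y' × X → ℂ} {T' : Y' × X → X} {F : X → ℂ}

lemma integrable_kernelAdj_comp (hw : Integrable w ν) (hw' : Integrable w' ν')
    (hφ : Measurable φ) (hφ1 : ∀ p, ‖φ p‖ ≤ 1) (hT : Measurable T)
    (hφ' : Measurable φ') (hφ1' : ∀ p, ‖φ' p‖ ≤ 1) (hT' : Measurable T')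
    (hF : Measurable F) {C : ℝ} (hC : ∀ x, ‖F x‖ ≤ C) (x : X) :
    Integrable (fun p : Y × Y' => F (T (p.1, T' (p.2, x))) *
      (φ (p.1, T' (p.2, x)) * φ' (p.2, x)) * (w p.1 * w' p.2)) (ν.prod ν') := by
  have m1 : Measurable fun p : Y × Y' => (p.1, T' (p.2, x)) := by fun_prop
  refine (hw.mul_prod hw').bdd_mul (c := C) ?_ (Eventually.of_forall fun p => ?_)
  · exact ((hF.comp (hT.comp m1)).mul ((hφ.comp m1).mul
      (hφ'.comp (by fun_prop : Measurable fun p : Y × Y' => (p.2, x))))).aestronglyMeasurable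
  · rw [norm_mul, norm_mul]
    calc _ ≤ C * (1 * 1) := mul_le_mul (hC _)
          (mul_le_mul (hφ1 _) (hφ1' _) (norm_nonneg _) zero_le_one) (by positivity)
          ((norm_nonneg _).trans (hC x))
      _ = C := by ring

/-- Two successive transfers form a single one with parameter in the product space. The oscillation
estimate for one operator thereby applies to a composition as well. -/
lemma kernelAdj_kernelAdj (hw : Integrable w ν) (hw' : Integrable w' ν')
    (hφ : Measurable φ) (hφ1 : ∀ p, ‖φ p‖ ≤ 1) (hT : Measurable T)
    (hφ' : Measurable φ') (hφ1' : ∀ p, ‖φ' p‖ ≤ 1) (hT' : Measurable T')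
    (hF : Measurable F) {C : ℝ} (hC : ∀ x, ‖F x‖ ≤ C) :
    kernelAdj ν' w' φ' T' (kernelAdj ν w φ T F) =
      kernelAdj (ν.prod ν') (fun p => w p.1 * w' p.2)
        (fun p => φ (p.1.1, T' (p.1.2, p.2)) * φ' (p.1.2, p.2))
        (fun p => T (p.1.1, T' (p.1.2, p.2))) F := by
  ext x
  have hi := integrable_kernelAdj_comp hw hw' hφ hφ1 hT hφ' hφ1' hT' hF hC x
  simp only [kernelAdj]
  rw [integral_prod_symm _ hi]
  refine integral_congr_ae (Eventually.of_forall fun y' => ?_)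
  simp only
  rw [mul_assoc, ← integral_mul_const]
  congr 1; ext y; ring

/-- Commutation is checked pointwise: the transition maps commute, and the accumulated phase does
not depend on the order. -/
lemma kernelAdj_comm (hw : Integrable w ν) (hw' : Integrable w' ν')
    (hφ : Measurable φ) (hφ1 : ∀ p, ‖φ p‖ ≤ 1) (hT : Measurable T)
    (hφ' : Measurable φ') (hφ1' : ∀ p, ‖φ' p‖ ≤ 1) (hT' : Measurable T')
    (hTT : ∀ y y' x, T (y, T' (y', x)) = T' (y', T (y, x)))
    (hφφ : ∀ y y' x, φ (y, T' (y', x)) * φ' (y', x) = φ' (y', T (y, x)) * φ (y, x))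
    (hF : Measurable F) {C : ℝ} (hC : ∀ x, ‖F x‖ ≤ C) :
    kernelAdj ν' w' φ' T' (kernelAdj ν w φ T F) = kernelAdj ν w φ T (kernelAdj ν' w' φ' T' F) := by
  rw [kernelAdj_kernelAdj hw hw' hφ hφ1 hT hφ' hφ1' hT' hF hC,
    kernelAdj_kernelAdj hw' hw hφ' hφ1' hT' hφ hφ1 hT hF hC]
  ext x
  simp only [kernelAdj]
  rw [← integral_prod_swap]
  refine integral_congr_ae (Eventually.of_forall fun p => ?_)
  simp only [Prod.fst_swap, Prod.snd_swap]
  rw [hTT, hφφ]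
  ring

end Compose

/-! ### The interaction of two factors -/

section Edges

variable {d : ℕ} {ι : Type*} [Fintype ι] [DecidableEq ι]

/-- The transfer of the frequency `k` between the two factors `e`. -/
def edgeShift (σ : ι → ℝ) (e : ι × ι) (p : Lat d × (ι → Lat d)) : ι → Lat d := fun m =>
  p.2 m + (if m = e.1 then σ e.1 • p.1 else 0) - (if m = e.2 then σ e.2 • p.1 else 0)

/-- The rate of the phase of the interaction `e`. -/
noncomputable def edgePhase (σ : ι → ℝ) (e : ι × ι) (p : Lat d × (ι → Lat d)) : ℝ :=
  ⟪p.1, p.2 e.1 - p.2 e.2⟫ + (σ e.1 + σ e.2) / 2 * ‖p.1‖ ^ 2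

/-- The sign and multiplicity of the interaction `e`: an ordered pair of factors of opposite types
is counted once, a pair of factors of the same type is counted twice. -/
noncomputable def edgeCoef (σ : ι → ℝ) (e : ι × ι) : ℝ :=
  if σ e.1 = σ e.2 then -(1 / 2) else if σ e.1 = 1 then 1 else 0

lemma abs_edgeCoef_le (σ : ι → ℝ) (e : ι × ι) : |edgeCoef σ e| ≤ 1 := by
  unfold edgeCoef; split_ifs <;> norm_num [abs_of_pos]

lemma continuous_edgeShift (σ : ι → ℝ) (e : ι × ι) :
    Continuous (edgeShift (d := d) σ e) := by
  unfold edgeShift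
  refine continuous_pi fun m => ?_
  split_ifs <;> fun_prop

lemma continuous_edgePhase (σ : ι → ℝ) (e : ι × ι) :
    Continuous (edgePhase (d := d) σ e) := by
  unfold edgePhase
  fun_prop

/-- The operator of the interaction `e`. -/
noncomputable def edgeOp {w : Lat d → ℂ} (hw : Integrable w) (hwm : Measurable w) (σ : ι → ℝ)
    (g c : ℝ) (e : ι × ι) (z : ℝ) :
    ComplexMeasure (ι → Lat d) →L[ℂ] ComplexMeasure (ι → Lat d) :=
  ((g * edgeCoef σ e : ℝ) : ℂ) • kernelCLM (ν := volume) (φ := fun p => osc z (c * edgePhase σ e p))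
    hw hwm (by have := (continuous_edgePhase (d := d) σ e).measurable; fun_prop)
    (fun p => (norm_osc _ _).le) (continuous_edgeShift σ e).measurable

variable {w : Lat d → ℂ} (hw : Integrable w) (hwm : Measurable w) (σ : ι → ℝ) (g c : ℝ)

lemma edgeOp_apply (e : ι × ι) (z : ℝ) (ρ : ComplexMeasure (ι → Lat d)) :
    edgeOp hw hwm σ g c e z ρ = ((g * edgeCoef σ e : ℝ) : ℂ) •
      kernelOp volume w (fun p => osc z (c * edgePhase σ e p)) (edgeShift σ e) ρ := rfl

/-- The adjoint of the interaction `e`, without its coefficient. -/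
noncomputable def edgeAdj (w : Lat d → ℂ) (σ : ι → ℝ) (c : ℝ) (e : ι × ι) (z : ℝ) :
    ((ι → Lat d) → ℂ) → (ι → Lat d) → ℂ :=
  kernelAdj volume w (fun p => osc z (c * edgePhase σ e p)) (edgeShift σ e)

lemma measurable_osc_edgePhase (e : ι × ι) (z : ℝ) :
    Measurable fun p : Lat d × (ι → Lat d) => osc z (c * edgePhase σ e p) := by
  have := (continuous_edgePhase (d := d) σ e).measurable; fun_prop

lemma measurable_edgeAdj {w : Lat d → ℂ} (hwm : Measurable w) (e : ι × ι) (z : ℝ)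
    {F : (ι → Lat d) → ℂ} (hF : Measurable F) : Measurable (edgeAdj w σ c e z F) :=
  measurable_kernelAdj hwm (measurable_osc_edgePhase σ c e z)
    (continuous_edgeShift σ e).measurable hF

lemma norm_edgeAdj_le {w : Lat d → ℂ} (hw : Integrable w) (e : ι × ι) (z : ℝ)
    {F : (ι → Lat d) → ℂ} {C : ℝ} (hC : ∀ x, ‖F x‖ ≤ C) (x : ι → Lat d) :
    ‖edgeAdj w σ c e z F x‖ ≤ C * ∫ y, ‖w y‖ :=
  norm_kernelAdj_le hw (fun _ => (norm_osc _ _).le) hC x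

lemma cint_edgeOp (e : ι × ι) (z : ℝ) (ρ : ComplexMeasure (ι → Lat d)) {F : (ι → Lat d) → ℂ}
    (hF : Measurable F) {C : ℝ} (hC : ∀ x, ‖F x‖ ≤ C) :
    cint (edgeOp hw hwm σ g c e z ρ) F
      = ((g * edgeCoef σ e : ℝ) : ℂ) * cint ρ (edgeAdj w σ c e z F) := by
  rw [edgeOp, _root_.smul_apply, cint_smul _ _ hF hC, kernelCLM_apply,
    cint_kernelOp hw (measurable_osc_edgePhase σ c e z) (fun p => (norm_osc _ _).le)
      (continuous_edgeShift σ e).measurable _ hF hC]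
  rfl

lemma strongFamily_edgeOp {K : ℝ} (hg : 0 ≤ g) (hK : g * ∫ k, ‖w k‖ ≤ K) (e : ι × ι) :
    StrongFamily (edgeOp hw hwm σ g c e) K where
  cont ρ := by
    have := (continuous_kernelOp_osc (ν := volume) (θ := fun p => c * edgePhase σ e p) hw hwm
      (by have := (continuous_edgePhase (d := d) σ e).measurable; fun_prop)
      (continuous_edgeShift σ e).measurable ρ).const_smul ((g * edgeCoef σ e : ℝ) : ℂ)
    exact this
  bound z := by
    refine le_trans ?_ hK
    rw [edgeOp, norm_smul, Complex.norm_real, Real.norm_eq_abs, abs_mul, abs_of_nonneg hg]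
    refine mul_le_mul ?_ (norm_kernelCLM_le hw hwm _ _ _) (norm_nonneg _) hg
    exact mul_le_of_le_one_right hg (abs_edgeCoef_le σ e)

/-- Only the pairs (non conjugate factor, conjugate factor) may be resonant. -/
def IsBad (σ : ι → ℝ) (e : ι × ι) : Prop := ¬ (σ e.1 = 1 ∧ σ e.2 = -1)

/-- Two distinct pairs with a common factor. -/
def Conflict (e f : ι × ι) : Prop := e ≠ f ∧ (e.1 = f.1 ∨ e.2 = f.2)

/-- The four factors are distinct (by type, or because the pairs do not conflict), so neither
transfer changes the frequencies that enter the phase of the other. -/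
lemma edgeOp_comm {e f : ι × ι} (he : ¬ IsBad σ e) (hf : ¬ IsBad σ f) (hne : e ≠ f)
    (hc : ¬ Conflict e f) (s t : ℝ) (ρ : ComplexMeasure (ι → Lat d)) :
    edgeOp hw hwm σ g c e s (edgeOp hw hwm σ g c f t ρ)
      = edgeOp hw hwm σ g c f t (edgeOp hw hwm σ g c e s ρ) := by
  obtain ⟨he1, he2⟩ := not_not.1 he
  obtain ⟨hf1, hf2⟩ := not_not.1 hf
  have hm := measurable_osc_edgePhase (d := d) σ c
  have hS := fun e => (continuous_edgeShift (d := d) σ e).measurable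
  have ho1 : ∀ e r (p : Lat d × (ι → Lat d)), ‖osc r (c * edgePhase σ e p)‖ ≤ 1 :=
    fun _ _ _ => (norm_osc _ _).le
  have hmix : ∀ i j, σ i = 1 → σ j = -1 → i ≠ j := fun i j hi hj hij => by
    rw [hij, hj] at hi; norm_num at hi
  have h1 : e.1 ≠ f.1 := fun h => hc ⟨hne, Or.inl h⟩
  have h2 : e.2 ≠ f.2 := fun h => hc ⟨hne, Or.inr h⟩
  have h3 := hmix _ _ he1 hf2
  have h4 := hmix _ _ hf1 he2
  refine ext_cint fun F hF hF1 => ?_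
  rw [cint_edgeOp _ _ _ _ _ _ _ _ hF hF1, cint_edgeOp _ _ _ _ _ _ _ _ hF hF1,
    cint_edgeOp _ _ _ _ _ _ _ _ (measurable_edgeAdj σ c hwm e s hF)
      (norm_edgeAdj_le σ c hw e s hF1),
    cint_edgeOp _ _ _ _ _ _ _ _ (measurable_edgeAdj σ c hwm f t hF)
      (norm_edgeAdj_le σ c hw f t hF1), mul_left_comm]
  congr 3
  unfold edgeAdj
  refine kernelAdj_comm hw hw (hm e s) (ho1 e s) (hS e) (hm f t) (ho1 f t) (hS f) ?_ ?_ hF hF1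
  · intro y y' x
    ext1 m
    simp only [edgeShift]
    abel
  · intro y y' x
    have e1 : edgePhase σ e (y, edgeShift σ f (y', x)) = edgePhase σ e (y, x) := by
      simp [edgePhase, edgeShift, h1, h2, h3, h4.symm]
    have e2 : edgePhase σ f (y', edgeShift σ e (y, x)) = edgePhase σ f (y', x) := by
      simp [edgePhase, edgeShift, h1.symm, h2.symm, h3.symm, h4]
    simp only [e1, e2]
    ring

/-- Bounds of the oscillatory integrals. -/
structure OscillationBound (w : Lat d → ℂ) (c Z κ : ℝ) : Prop where
  single : ∀ s : ℝ, s = 1 ∨ s = -1 → ∀ a b, 0 ≤ a → a ≤ b → b ≤ Z → ∀ x : Lat d,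
    ∫ k, ‖∫ r in a..b, osc r (c * (⟪k, x⟫ + s * ‖k‖ ^ 2))‖ * ‖w k‖ ≤ κ
  double : ∀ s : ℝ, s = 1 ∨ s = -1 → ∀ a b, 0 ≤ a → a ≤ b → b ≤ Z → ∀ x : Lat d,
    ∫ p : Lat d × Lat d, ‖∫ r in a..b, osc r (c * ⟪p.1, x + s • p.2⟫)‖ * ‖w p.1 * w p.2‖ ≤ κ

/-- For equal types the phase contains `σ |k|²`, and `single` applies. For two good pairs with one
common factor, the earlier transfer `k'` moves the frequency difference of the later pair by `±k'`,
and `double` applies. The factor `g + g²` covers both cases. -/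
lemma oscillating_edgeOp (hg : 0 ≤ g) {Z κ : ℝ} (hκ : 0 ≤ κ)
    (hσ : ∀ i, σ i = 1 ∨ σ i = -1) (h : OscillationBound w c Z κ) :
    Oscillating (fun e : ι × ι => edgeOp hw hwm σ g c e) (IsBad σ) Conflict Z ((g + g ^ 2) * κ) where
  symm e f h := ⟨h.1.symm, h.2.imp Eq.symm Eq.symm⟩
  small_bad e he a b ha hab hb ρ := by
    -- A bad pair of opposite types is a pair in the wrong order; it has coefficient zero. What
    -- remains are pairs of equal types.
    by_cases hc0 : edgeCoef σ e = 0
    · simp only [edgeOp, hc0, mul_zero, Complex.ofReal_zero, zero_smul]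
      simp only [_root_.zero_apply, intervalIntegral.integral_zero, norm_zero]
      positivity
    have hs : σ e.1 = σ e.2 := by
      by_contra hne
      apply hc0
      rw [edgeCoef, if_neg hne, if_neg]
      intro h1
      refine he ⟨h1, ?_⟩
      rcases hσ e.2 with h2 | h2
      · exact absurd (h1.trans h2.symm) hne
      · exact h2
    have hph : ∀ p : Lat d × (ι → Lat d), edgePhase σ e p
        = ⟪p.1, p.2 e.1 - p.2 e.2⟫ + σ e.1 * ‖p.1‖ ^ 2 := fun p => by
      rw [edgePhase, ← hs]; ring
    have hθ := (continuous_edgePhase (d := d) σ e).measurable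
    have hm := measurable_osc_edgePhase (d := d) σ c e
    have h1 : ‖∫ r in a..b, kernelOp volume w (fun p => osc r (c * edgePhase σ e p))
        (edgeShift σ e) ρ‖ ≤ κ * ‖ρ‖ := by
      refine norm_integral_le_of_osc (ν := volume) (ψ := fun _ => 1)
        (θ := fun p => c * edgePhase σ e p) hw hwm measurable_const (fun _ => by simp)
        (by fun_prop) (continuous_edgeShift σ e).measurable ρ ?_ hab ?_ ?_
      · exact continuous_kernelOp_osc hw hwm (by fun_prop) (continuous_edgeShift σ e).measurable ρ
      · intro F hF hF1 r
        simp only [one_mul]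
        exact cint_kernelOp hw (hm r) (fun _ => (norm_osc _ _).le)
          (continuous_edgeShift σ e).measurable ρ hF hF1
      · intro v
        simp only [hph]
        exact h.single _ (hσ e.1) a b ha hab hb _
    have h2 : ∫ r in a..b, edgeOp hw hwm σ g c e r ρ = ((g * edgeCoef σ e : ℝ) : ℂ) •
        ∫ r in a..b, kernelOp volume w (fun p => osc r (c * edgePhase σ e p))
          (edgeShift σ e) ρ := by
      simp only [edgeOp_apply]
      exact intervalIntegral.integral_smul _ _
    rw [h2, norm_smul, Complex.norm_real, Real.norm_eq_abs, abs_mul, abs_of_nonneg hg]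
    calc g * |edgeCoef σ e| * _ ≤ g * 1 * (κ * ‖ρ‖) := by
          gcongr
          exact abs_edgeCoef_le σ e
      _ ≤ (g + g ^ 2) * κ * ‖ρ‖ := by
          rw [mul_one, ← mul_assoc]
          gcongr
          nlinarith
  small_conf e f he hf hef a b ha hab hb t ρ := by
    obtain ⟨he1, he2⟩ := not_not.1 he
    obtain ⟨hf1, hf2⟩ := not_not.1 hf
    have hm := measurable_osc_edgePhase (d := d) σ c
    have hS := fun e => (continuous_edgeShift (d := d) σ e).measurable
    have hP := fun e => (continuous_edgePhase (d := d) σ e).measurable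
    have hSe := hS e
    have hSf := hS f
    have hPe := hP e
    have hPf := hP f
    have ho1 : ∀ e r (p : Lat d × (ι → Lat d)), ‖osc r (c * edgePhase σ e p)‖ ≤ 1 :=
      fun _ _ _ => (norm_osc _ _).le
    have hadj : ∀ F : (ι → Lat d) → ℂ, Measurable F → (∀ x, ‖F x‖ ≤ 1) → ∀ r,
        cint (kernelOp volume w (fun p => osc r (c * edgePhase σ e p)) (edgeShift σ e)
          (kernelOp volume w (fun p => osc t (c * edgePhase σ f p)) (edgeShift σ f) ρ)) F
        = cint ρ (kernelAdj (volume.prod volume) (fun p : Lat d × Lat d => w p.1 * w p.2)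
          (fun p => osc t (c * edgePhase σ f (p.1.2, p.2)) *
            osc r (c * edgePhase σ e (p.1.1, edgeShift σ f (p.1.2, p.2))))
          (fun p => edgeShift σ e (p.1.1, edgeShift σ f (p.1.2, p.2))) F) := by
      intro F hF hF1 r
      rw [cint_kernelOp hw (hm e r) (ho1 e r) (hS e) _ hF hF1,
        cint_kernelOp hw (hm f t) (ho1 f t) (hS f) _
          (measurable_kernelAdj hwm (hm e r) (hS e) hF) (norm_kernelAdj_le hw (ho1 e r) hF1),
        kernelAdj_kernelAdj hw hw (hm e r) (ho1 e r) (hS e) (hm f t) (ho1 f t) (hS f) hF hF1]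
      congr 1
      ext x
      simp only [kernelAdj]
      congr 1
      ext y
      ring
    have hθm : Measurable fun p : (Lat d × Lat d) × (ι → Lat d) =>
        c * edgePhase σ e (p.1.1, edgeShift σ f (p.1.2, p.2)) := by fun_prop
    have key : ‖∫ r in a..b, kernelOp volume w (fun p => osc r (c * edgePhase σ e p))
        (edgeShift σ e) (kernelOp volume w (fun p => osc t (c * edgePhase σ f p))
          (edgeShift σ f) ρ)‖ ≤ κ * ‖ρ‖ := by
      refine norm_integral_le_of_osc (ν := (volume : Measure (Lat d)).prod volume)
        (w := fun p : Lat d × Lat d => w p.1 * w p.2)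
        (ψ := fun p => osc t (c * edgePhase σ f (p.1.2, p.2)))
        (θ := fun p => c * edgePhase σ e (p.1.1, edgeShift σ f (p.1.2, p.2)))
        (T := fun p => edgeShift σ e (p.1.1, edgeShift σ f (p.1.2, p.2)))
        (hw.mul_prod hw) (by fun_prop) (by fun_prop) (fun _ => (norm_osc _ _).le) hθm (by fun_prop)
        ρ ?_ hab hadj ?_
      · exact continuous_kernelOp_osc hw hwm (by fun_prop) (hS e) _
      · intro v
        obtain ⟨hne, hsh⟩ := hef
        have hmix : ∀ i j, σ i = 1 → σ j = -1 → i ≠ j := fun i j hi hj hij => by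
          rw [hij, hj] at hi; norm_num at hi
        have hee := hmix _ _ he1 he2
        have hef := hmix _ _ he1 hf2
        have hfe := hmix _ _ hf1 he2
        rcases hsh with h1 | h1
        · have h2 : e.2 ≠ f.2 := fun h2 => hne (Prod.ext h1 h2)
          have hph : ∀ p : Lat d × Lat d, edgePhase σ e (p.1, edgeShift σ f (p.2, v))
              = ⟪p.1, (v e.1 - v e.2) + (1 : ℝ) • p.2⟫ := fun p => by
            simp only [edgePhase, edgeShift, he1, he2, hf1, hf2, if_pos h1, if_neg hef,
              if_neg hfe.symm, if_neg h2]
            rw [show v e.1 + (1 : ℝ) • p.2 - 0 - (v e.2 + 0 - 0)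
              = (v e.1 - v e.2) + (1 : ℝ) • p.2 by abel]
            ring
          simp only [hph]
          exact h.double 1 (Or.inl rfl) a b ha hab hb _
        · have h2 : e.1 ≠ f.1 := fun h2 => hne (Prod.ext h2 h1)
          have hph : ∀ p : Lat d × Lat d, edgePhase σ e (p.1, edgeShift σ f (p.2, v))
              = ⟪p.1, (v e.1 - v e.2) + (-1 : ℝ) • p.2⟫ := fun p => by
            simp only [edgePhase, edgeShift, he1, he2, hf1, hf2, if_pos h1, if_neg hef,
              if_neg hfe.symm, if_neg h2]
            rw [show v e.1 + 0 - 0 - (v e.2 + 0 - (-1 : ℝ) • p.2)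
              = (v e.1 - v e.2) + (-1 : ℝ) • p.2 by abel]
            ring
          simp only [hph]
          exact h.double (-1) (Or.inr rfl) a b ha hab hb _
    have h2 : ∀ r, edgeOp hw hwm σ g c e r (edgeOp hw hwm σ g c f t ρ)
        = (((g * edgeCoef σ e : ℝ) : ℂ) * ((g * edgeCoef σ f : ℝ) : ℂ)) •
          kernelOp volume w (fun p => osc r (c * edgePhase σ e p))
        (edgeShift σ e) (kernelOp volume w (fun p => osc t (c * edgePhase σ f p))
          (edgeShift σ f) ρ) := fun r => by
      rw [edgeOp_apply hw hwm σ g c f, map_smul, edgeOp_apply, smul_smul, mul_comm]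
    simp only [h2]
    rw [intervalIntegral.integral_smul, norm_smul, norm_mul, Complex.norm_real, Complex.norm_real,
      Real.norm_eq_abs, Real.norm_eq_abs, abs_mul, abs_mul, abs_of_nonneg hg]
    calc g * |edgeCoef σ e| * (g * |edgeCoef σ f|) * _ ≤ g * 1 * (g * 1) * (κ * ‖ρ‖) := by
          gcongr
          · exact abs_edgeCoef_le σ e
          · exact abs_edgeCoef_le σ f
      _ ≤ (g + g ^ 2) * κ * ‖ρ‖ := by
          rw [mul_one, ← mul_assoc]
          gcongr
          nlinarith
  comm e f he hf hne hc s t ρ := edgeOp_comm hw hwm σ g c he hf hne hc s t ρ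

end Edges

/-! ### Negative powers -/

section InvPow

/-- `|x|^{-α}`, with value `∞` at `x = 0`. -/
noncomputable def invPow (α x : ℝ) : ℝ≥0∞ := ENNReal.ofReal |x| ^ (-α)

lemma measurable_invPow (α : ℝ) : Measurable (invPow α) := by
  unfold invPow; fun_prop

@[fun_prop]
lemma Measurable.invPow {β : Type*} [MeasurableSpace β] {f : β → ℝ} (hf : Measurable f) (α : ℝ) :
    Measurable fun x => invPow α (f x) := (measurable_invPow α).comp hf

lemma invPow_mul (α x y : ℝ) : invPow α (x * y) = invPow α x * invPow α y := by
  rw [invPow, abs_mul, ENNReal.ofReal_mul (abs_nonneg _),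
    ENNReal.mul_rpow_of_ne_top ENNReal.ofReal_ne_top ENNReal.ofReal_ne_top]
  rfl

lemma invPow_anti {α : ℝ} (hα : 0 ≤ α) {x y : ℝ} (h : |x| ≤ |y|) : invPow α y ≤ invPow α x := by
  rw [invPow, invPow, ENNReal.rpow_neg, ENNReal.rpow_neg]
  exact ENNReal.inv_le_inv.2 (ENNReal.rpow_le_rpow (ENNReal.ofReal_le_ofReal h) hα)

lemma invPow_sq (α x : ℝ) : invPow α (x ^ 2) = invPow (2 * α) x := by
  rw [invPow, invPow, abs_pow, ENNReal.ofReal_pow (abs_nonneg _), ← ENNReal.rpow_natCast,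
    ← ENNReal.rpow_mul]
  congr 1; push_cast; ring

lemma invPow_ne_top {α x : ℝ} (hx : x ≠ 0) : invPow α x ≠ ⊤ :=
  ENNReal.rpow_ne_top_of_ne_zero (by simpa using hx) ENNReal.ofReal_ne_top

lemma invPow_zero {α : ℝ} (hα : 0 < α) : invPow α 0 = ⊤ := by
  simp [invPow, hα]

lemma invPow_one (α : ℝ) : invPow α 1 = 1 := by simp [invPow]

lemma invPow_le_one {α x : ℝ} (hα : 0 ≤ α) (hx : 1 ≤ |x|) : invPow α x ≤ 1 := by
  rw [← invPow_one α]; exact invPow_anti hα (by simpa using hx)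

lemma invPow_abs (α x : ℝ) : invPow α |x| = invPow α x := by simp [invPow]

lemma invPow_add (α β : ℝ) {x : ℝ} (hx : x ≠ 0) :
    invPow (α + β) x = invPow α x * invPow β x := by
  rw [invPow, invPow, invPow, ← ENNReal.rpow_add _ _ (by simpa using hx) ENNReal.ofReal_ne_top]
  congr 1; ring

/-- The smaller of `|x|`, `|y|` has its square below `|x y|`. The doubled exponent is the origin of
the condition `2 α < 1`. -/
lemma invPow_mul_le {α : ℝ} (hα : 0 ≤ α) (x y : ℝ) :
    invPow α (x * y) ≤ invPow (2 * α) x + invPow (2 * α) y := by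
  rw [← invPow_sq, ← invPow_sq]
  rcases le_total |x| |y| with h | h
  · refine (invPow_anti hα ?_).trans le_self_add
    rw [abs_pow, abs_mul, sq]; gcongr
  · refine (invPow_anti hα ?_).trans le_add_self
    rw [abs_pow, abs_mul, sq]; gcongr

lemma lintegral_ball_invPow_lt_top {d : ℕ} (hd : 1 ≤ d) {γ : ℝ} (hγ : γ < 1) :
    ∫⁻ k in Metric.ball (0 : Lat d) 1, invPow γ ‖k‖ < ⊤ := by
  have : Nontrivial (Lat d) := by
    have : Nonempty (Fin d) := ⟨⟨0, hd⟩⟩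
    infer_instance
  have h1 : IntegrableOn (fun k : Lat d => ‖k‖ ^ (-γ)) (Metric.ball 0 1) := by
    refine (integrableOn_fun_norm_addHaar (f := fun y : ℝ => y ^ (-γ)) (volume : Measure (Lat d))).2 ?_
    have h2 : IntegrableOn (fun y : ℝ => y ^ (((Module.finrank ℝ (Lat d) - 1 : ℕ) : ℝ) - γ))
        (Ioo 0 1) := (intervalIntegral.integrableOn_Ioo_rpow_iff zero_lt_one).2 (by
          have : (0 : ℝ) ≤ ((Module.finrank ℝ (Lat d) - 1 : ℕ) : ℝ) := Nat.cast_nonneg _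
          linarith)
    refine h2.congr_fun (fun y hy => ?_) measurableSet_Ioo
    simp only [smul_eq_mul]
    rw [sub_eq_add_neg, Real.rpow_add hy.1, Real.rpow_natCast]
  have h2 := h1.hasFiniteIntegral
  rw [hasFiniteIntegral_iff_norm] at h2
  refine lt_of_le_of_lt (le_of_eq ?_) h2
  refine lintegral_congr_ae ?_
  have : ∀ᵐ k : Lat d, k ≠ 0 := by
    have := measure_singleton (μ := (volume : Measure (Lat d))) 0
    exact compl_mem_ae_iff.2 this
  filter_upwards [ae_restrict_of_ae this] with k hk
  rw [invPow, ENNReal.ofReal_rpow_of_pos (by simpa using hk), abs_norm,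
    Real.norm_of_nonneg (by positivity)]

lemma lintegral_Icc_invPow_sub_le {γ : ℝ} (hγ0 : 0 ≤ γ) (hγ : γ < 1) :
    ∃ C : ℝ≥0∞, C ≠ ⊤ ∧ ∀ a : ℝ, ∫⁻ s in Icc (-1 : ℝ) 1, invPow γ (s - a) ≤ C := by
  have h1 : IntegrableOn (fun k : ℝ => ‖k‖ ^ (-γ)) (Metric.ball 0 1) := by
    refine (integrableOn_fun_norm_addHaar (f := fun y : ℝ => y ^ (-γ)) (volume : Measure ℝ)).2 ?_
    simp only [Module.finrank_self, tsub_self, pow_zero, one_smul]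
    exact (intervalIntegral.integrableOn_Ioo_rpow_iff zero_lt_one).2 (by linarith)
  have h2 := h1.hasFiniteIntegral
  rw [hasFiniteIntegral_iff_norm] at h2
  have h3 : ∫⁻ k in Metric.ball (0 : ℝ) 1, invPow γ k < ⊤ := by
    refine lt_of_le_of_lt (le_of_eq ?_) h2
    refine lintegral_congr_ae ?_
    have : ∀ᵐ k : ℝ, k ≠ 0 := compl_mem_ae_iff.2 (measure_singleton 0)
    filter_upwards [ae_restrict_of_ae this] with k hk
    rw [invPow, ENNReal.ofReal_rpow_of_pos (by simpa using hk), Real.norm_of_nonneg (by positivity),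
      Real.norm_eq_abs]
  refine ⟨_, (ENNReal.add_lt_top.2 ⟨h3, (ENNReal.ofReal_lt_top (r := 2))⟩).ne, fun a => ?_⟩
  calc ∫⁻ s in Icc (-1 : ℝ) 1, invPow γ (s - a)
      ≤ ∫⁻ s in Icc (-1 : ℝ) 1, ((Metric.ball (0 : ℝ) 1).indicator (invPow γ) (s - a) + 1) := by
        refine lintegral_mono fun s => ?_
        by_cases hs : s - a ∈ Metric.ball (0 : ℝ) 1
        · rw [indicator_of_mem hs]; exact le_self_add
        · rw [indicator_of_notMem hs, zero_add]
          refine invPow_le_one hγ0 ?_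
          simpa using hs
    _ = (∫⁻ s in Icc (-1 : ℝ) 1, (Metric.ball (0 : ℝ) 1).indicator (invPow γ) (s - a))
        + ENNReal.ofReal 2 := by
        rw [lintegral_add_right _ measurable_const]
        congr 1
        simp; norm_num
    _ ≤ (∫⁻ s, (Metric.ball (0 : ℝ) 1).indicator (invPow γ) (s - a)) + ENNReal.ofReal 2 := by
        gcongr; exact Measure.restrict_le_self
    _ = _ := by
        rw [lintegral_sub_right_eq_self (fun s => (Metric.ball (0 : ℝ) 1).indicator (invPow γ) s),
          lintegral_indicator Metric.isOpen_ball.measurableSet]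

/-- For `b ≥ 0` the difference of squares factors. For `b ≤ 0` the square root takes the value `0`,
and the formula holds because `u² - b ≥ u²`. -/
lemma invPow_sq_sub_le {α : ℝ} (hα : 0 ≤ α) (u b : ℝ) :
    invPow α (u ^ 2 - b) ≤ invPow (2 * α) (u - √b) + invPow (2 * α) (u + √b) := by
  refine le_trans (invPow_anti hα ?_) (invPow_mul_le hα _ _)
  rcases le_total 0 b with hb | hb
  · rw [show (u - √b) * (u + √b) = u ^ 2 - √b ^ 2 by ring, Real.sq_sqrt hb]
  · rw [Real.sqrt_eq_zero_of_nonpos hb, sub_zero, add_zero, ← sq, abs_of_nonneg (sq_nonneg u),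
      abs_of_nonneg (by nlinarith [sq_nonneg u])]
    linarith

/-- After completing the square, the linear and constant coefficients only move the two
singularities, whose integrals are bounded uniformly in their position. Only the leading coefficient
remains. -/
lemma lintegral_quadratic_le {α : ℝ} (hα0 : 0 ≤ α) (hα : 2 * α < 1) :
    ∃ C : ℝ≥0∞, C ≠ ⊤ ∧ ∀ A B D : ℝ, A ≠ 0 →
      ∫⁻ s in Icc (-1 : ℝ) 1, invPow α (A * s ^ 2 + B * s + D) ≤ C * invPow α A := by
  obtain ⟨C, hC, h⟩ := lintegral_Icc_invPow_sub_le (γ := 2 * α) (by linarith) hα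
  refine ⟨C + C, by simp [hC], fun A B D hA => ?_⟩
  set m := B / (2 * A) with hm
  set b := m ^ 2 - D / A with hb
  have e : ∀ s : ℝ, A * s ^ 2 + B * s + D = A * ((s + m) ^ 2 - b) := fun s => by
    rw [hb, hm]; field_simp; ring
  calc ∫⁻ s in Icc (-1 : ℝ) 1, invPow α (A * s ^ 2 + B * s + D)
      ≤ ∫⁻ s in Icc (-1 : ℝ) 1, invPow α A *
          (invPow (2 * α) (s - (√b - m)) + invPow (2 * α) (s - (-√b - m))) := by
        refine lintegral_mono fun s => ?_
        rw [e, invPow_mul]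
        gcongr
        refine (invPow_sq_sub_le hα0 _ _).trans (le_of_eq ?_)
        congr 2 <;> ring
    _ ≤ invPow α A * (C + C) := by
        rw [lintegral_const_mul _ (by fun_prop), lintegral_add_left (by fun_prop)]
        gcongr
        · exact h _
        · exact h _
    _ = _ := mul_comm _ _

end InvPow

/-! ### Small denominators of the form `k·y - t|k|` -/

section Sphere

variable {d : ℕ}

/-- Averaging over translations along a segment. -/
lemma lintegral_ball_le_segment {f : Lat d → ℝ≥0∞} (hf : Measurable f) {u : Lat d} (hu : ‖u‖ ≤ 1)
    {C : ℝ≥0∞} (hC : ∀ k ∈ Metric.ball (0 : Lat d) 2, ∫⁻ s in Icc (-1 : ℝ) 1, f (k + s • u) ≤ C) :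
    ∫⁻ k in Metric.ball (0 : Lat d) 1, f k ≤ C * volume (Metric.ball (0 : Lat d) 2) := by
  have h1 : ∀ s ∈ Icc (-1 : ℝ) 1, ∫⁻ k in Metric.ball (0 : Lat d) 1, f k
      ≤ ∫⁻ k in Metric.ball (0 : Lat d) 2, f (k + s • u) := by
    intro s hs
    rw [← lintegral_indicator Metric.isOpen_ball.measurableSet,
      ← lintegral_indicator Metric.isOpen_ball.measurableSet,
      ← lintegral_add_right_eq_self _ (s • u)]
    refine lintegral_mono fun k => ?_
    by_cases hk : k + s • u ∈ Metric.ball (0 : Lat d) 1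
    · rw [indicator_of_mem hk, indicator_of_mem]
      rw [mem_ball_zero_iff] at hk ⊢
      have h2 : ‖s • u‖ ≤ 1 := by
        rw [norm_smul]
        exact mul_le_one₀ (by rw [Real.norm_eq_abs]; exact abs_le.2 hs) (norm_nonneg _) hu
      calc ‖k‖ = ‖(k + s • u) - s • u‖ := by simp
        _ ≤ _ := norm_sub_le _ _
        _ < 2 := by linarith
    · rw [indicator_of_notMem hk]; exact zero_le
  have h2 : volume (Icc (-1 : ℝ) 1) = 2 := by rw [Real.volume_Icc]; norm_num
  calc ∫⁻ k in Metric.ball (0 : Lat d) 1, f k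
      ≤ 2 * ∫⁻ k in Metric.ball (0 : Lat d) 1, f k := by
        rw [two_mul]; exact le_self_add
    _ = ∫⁻ _ in Icc (-1 : ℝ) 1, ∫⁻ k in Metric.ball (0 : Lat d) 1, f k := by
        rw [lintegral_const, Measure.restrict_apply_univ, h2, mul_comm]
    _ ≤ ∫⁻ s in Icc (-1 : ℝ) 1, ∫⁻ k in Metric.ball (0 : Lat d) 2, f (k + s • u) :=
        setLIntegral_mono' measurableSet_Icc h1
    _ = ∫⁻ k in Metric.ball (0 : Lat d) 2, ∫⁻ s in Icc (-1 : ℝ) 1, f (k + s • u) :=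
        lintegral_lintegral_swap (by fun_prop)
    _ ≤ ∫⁻ _ in Metric.ball (0 : Lat d) 2, C :=
        setLIntegral_mono' Metric.isOpen_ball.measurableSet hC
    _ = _ := by rw [lintegral_const, Measure.restrict_apply_univ]

lemma exists_unit_orthogonal (hd : 2 ≤ d) (y : Lat d) : ∃ u : Lat d, ‖u‖ = 1 ∧ ⟪u, y⟫ = 0 := by
  have h1 : 0 < Module.finrank ℝ ((ℝ ∙ y)ᗮ : Submodule ℝ (Lat d)) := by
    have h2 := Submodule.finrank_add_finrank_orthogonal (ℝ ∙ y)
    have h3 : Module.finrank ℝ (ℝ ∙ y) ≤ 1 := finrank_span_le_card ({y} : Set (Lat d)) |>.trans (by simp)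
    have h4 : Module.finrank ℝ (Lat d) = d := by simp
    omega
  have : Nontrivial ((ℝ ∙ y)ᗮ : Submodule ℝ (Lat d)) := Module.finrank_pos_iff.1 h1
  obtain ⟨v, hv⟩ := exists_ne (0 : ((ℝ ∙ y)ᗮ : Submodule ℝ (Lat d)))
  have hv' : (v : Lat d) ≠ 0 := by simpa using hv
  refine ⟨‖(v : Lat d)‖⁻¹ • (v : Lat d), norm_smul_inv_norm hv', ?_⟩
  have := (Submodule.mem_orthogonal_singleton_iff_inner_left).1 v.2
  rw [real_inner_smul_left, this, mul_zero]

/-- Multiplication by the conjugate `k·y + t|k|`, which is at most `3‖y‖` on the ball, produces the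
quadratic form `(k·y)² - t²|k|²`. Along some unit direction its leading coefficient is at least
`‖y‖²/2` in absolute value: along `y` if `t` is small, along a vector orthogonal to `y` otherwise
(hence `2 ≤ d`). Averaging over segments in that direction leaves a one-dimensional quadratic. -/
lemma lintegral_ball_cone_le (hd : 2 ≤ d) {α : ℝ} (hα0 : 0 ≤ α) (hα : 2 * α < 1) :
    ∃ C : ℝ≥0∞, C ≠ ⊤ ∧ ∀ (y : Lat d) (t : ℝ), y ≠ 0 → |t| ≤ 2 * ‖y‖ →
      ∫⁻ k in Metric.ball (0 : Lat d) 1, invPow α (⟪k, y⟫ - t * ‖k‖) ≤ C * invPow α ‖y‖ := by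
  obtain ⟨C, hC, h⟩ := lintegral_quadratic_le hα0 hα
  refine ⟨C * invPow α (1 / 2) * invPow α (1 / 3) * volume (Metric.ball (0 : Lat d) 2), ?_,
    fun y t hy ht => ?_⟩
  · exact ENNReal.mul_ne_top (ENNReal.mul_ne_top (ENNReal.mul_ne_top hC
      (invPow_ne_top (by norm_num))) (invPow_ne_top (by norm_num))) measure_ball_lt_top.ne
  have hy0 : 0 < ‖y‖ := norm_pos_iff.2 hy
  -- a direction in which the quadratic form has a large coefficient
  obtain ⟨u, hu, hA⟩ : ∃ u : Lat d, ‖u‖ = 1 ∧ ‖y‖ ^ 2 / 2 ≤ |⟪u, y⟫ ^ 2 - t ^ 2| := by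
    rcases le_total (t ^ 2) (‖y‖ ^ 2 / 2) with h1 | h1
    · refine ⟨‖y‖⁻¹ • y, norm_smul_inv_norm hy, ?_⟩
      rw [real_inner_smul_left, real_inner_self_eq_norm_sq]
      rw [show ‖y‖⁻¹ * ‖y‖ ^ 2 = ‖y‖ by field_simp]
      rw [abs_of_nonneg (by nlinarith)]
      linarith
    · obtain ⟨u, hu, hu0⟩ := exists_unit_orthogonal hd y
      refine ⟨u, hu, ?_⟩
      rw [hu0, abs_sub_comm, abs_of_nonneg (by nlinarith)]
      linarith
  set A := ⟪u, y⟫ ^ 2 - t ^ 2 with hAdef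
  have hA0 : A ≠ 0 := by
    intro h0
    rw [h0, abs_zero] at hA
    nlinarith
  have hyA : invPow α A ≤ invPow α (1 / 2) * invPow (2 * α) ‖y‖ := by
    rw [← invPow_sq, ← invPow_mul]
    refine invPow_anti hα0 ?_
    rw [abs_of_nonneg (by positivity)]
    linarith
  calc ∫⁻ k in Metric.ball (0 : Lat d) 1, invPow α (⟪k, y⟫ - t * ‖k‖)
      ≤ ∫⁻ k in Metric.ball (0 : Lat d) 1,
          invPow α (⟪k, y⟫ ^ 2 - t ^ 2 * ‖k‖ ^ 2) * invPow α (1 / (3 * ‖y‖)) := by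
        refine setLIntegral_mono' Metric.isOpen_ball.measurableSet fun k hk => ?_
        rw [mem_ball_zero_iff] at hk
        rw [← invPow_mul]
        refine invPow_anti hα0 ?_
        rw [show ⟪k, y⟫ ^ 2 - t ^ 2 * ‖k‖ ^ 2 = (⟪k, y⟫ - t * ‖k‖) * (⟪k, y⟫ + t * ‖k‖) by ring,
          mul_assoc, abs_mul]
        refine mul_le_of_le_one_right (abs_nonneg _) ?_
        rw [abs_mul, abs_of_nonneg (by positivity : 0 ≤ 1 / (3 * ‖y‖)), mul_one_div,
          div_le_one (by positivity)]
        have h1 : |⟪k, y⟫| ≤ ‖y‖ := (abs_real_inner_le_norm k y).trans (by nlinarith)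
        have h2 : |t * ‖k‖| ≤ 2 * ‖y‖ := by
          rw [abs_mul, abs_norm]
          calc |t| * ‖k‖ ≤ (2 * ‖y‖) * 1 := by gcongr
            _ = _ := mul_one _
        exact (abs_add_le _ _).trans (by linarith)
    _ = (∫⁻ k in Metric.ball (0 : Lat d) 1, invPow α (⟪k, y⟫ ^ 2 - t ^ 2 * ‖k‖ ^ 2))
          * invPow α (1 / (3 * ‖y‖)) := lintegral_mul_const _ (by fun_prop)
    _ ≤ (C * invPow α A * volume (Metric.ball (0 : Lat d) 2)) * invPow α (1 / (3 * ‖y‖)) := by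
        gcongr
        refine lintegral_ball_le_segment (by fun_prop) hu.le fun k _ => ?_
        refine le_trans (le_of_eq ?_)
          (h A (2 * ⟪k, y⟫ * ⟪u, y⟫ - 2 * t ^ 2 * ⟪k, u⟫) (⟪k, y⟫ ^ 2 - t ^ 2 * ‖k‖ ^ 2) hA0)
        refine lintegral_congr fun s => ?_
        congr 1
        rw [inner_add_left, real_inner_smul_left, norm_add_sq_real, real_inner_smul_right,
          norm_smul, hu, hAdef, mul_one, Real.norm_eq_abs, sq_abs]
        ring
    _ ≤ (C * (invPow α (1 / 2) * invPow (2 * α) ‖y‖) * volume (Metric.ball (0 : Lat d) 2))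
          * invPow α (1 / (3 * ‖y‖)) := by gcongr
    _ = _ := by
        have e1 : invPow (2 * α) ‖y‖ * invPow α (1 / (3 * ‖y‖)) = invPow α (1 / 3) * invPow α ‖y‖ := by
          rw [← invPow_sq, ← invPow_mul, ← invPow_mul]
          congr 1
          field_simp
        rw [show C * (invPow α (1 / 2) * invPow (2 * α) ‖y‖) * volume (Metric.ball (0 : Lat d) 2)
          * invPow α (1 / (3 * ‖y‖)) = C * invPow α (1 / 2) * volume (Metric.ball (0 : Lat d) 2)
          * (invPow (2 * α) ‖y‖ * invPow α (1 / (3 * ‖y‖))) by ring, e1]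
        ring

end Sphere

/-! ### Polar coordinates and integrals over spheres -/

section Polar

variable {d : ℕ}

/-- The surface measure of the unit sphere. -/
noncomputable abbrev sphereMeasure (d : ℕ) : Measure (Metric.sphere (0 : Lat d) 1) :=
  (volume : Measure (Lat d)).toSphere

/-- The radial part of Lebesgue measure. -/
noncomputable abbrev radialMeasure (d : ℕ) : Measure (Ioi (0 : ℝ)) :=
  Measure.volumeIoiPow (Module.finrank ℝ (Lat d) - 1)

/-- Integration in polar coordinates. -/
lemma lintegral_eq_polar [Nontrivial (Lat d)] (f : Lat d → ℝ≥0∞) :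
    ∫⁻ k, f k = ∫⁻ p : Metric.sphere (0 : Lat d) 1 × Ioi (0 : ℝ), f ((p.2 : ℝ) • (p.1 : Lat d))
      ∂((sphereMeasure d).prod (radialMeasure d)) := by
  have h := (volume : Measure (Lat d)).measurePreserving_homeomorphUnitSphereProd
  rw [← h.lintegral_comp_emb (Homeomorph.measurableEmbedding _)]
  have h1 : ∫⁻ k, f k = ∫⁻ k in ({0}ᶜ : Set (Lat d)), f k := by
    rw [restrict_compl_singleton]
  rw [h1, ← lintegral_subtype_comap (measurableSet_singleton _).compl]
  refine lintegral_congr fun k => ?_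
  congr 1
  have := (homeomorphUnitSphereProd (Lat d)).symm_apply_apply k
  conv_lhs => rw [← this]
  rfl

lemma aemeasurable_polar [Nontrivial (Lat d)] {f : Lat d → ℝ≥0∞} (hf : AEMeasurable f) :
    AEMeasurable (fun p : Metric.sphere (0 : Lat d) 1 × Ioi (0 : ℝ) =>
      f ((p.2 : ℝ) • (p.1 : Lat d))) ((sphereMeasure d).prod (radialMeasure d)) := by
  have h := (volume : Measure (Lat d)).measurePreserving_homeomorphUnitSphereProd
  rw [← h.aemeasurable_comp_iff (Homeomorph.measurableEmbedding _)]
  have h1 : AEMeasurable (fun k : ({0}ᶜ : Set (Lat d)) => f k)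
      ((volume : Measure (Lat d)).comap (↑)) := by
    refine hf.comp_quasiMeasurePreserving ⟨measurable_subtype_coe, ?_⟩
    rw [map_comap_subtype_coe (measurableSet_singleton _).compl]
    exact Measure.restrict_le_self.absolutelyContinuous
  refine h1.congr (Eventually.of_forall fun k => ?_)
  have := (homeomorphUnitSphereProd (Lat d)).symm_apply_apply k
  simp only [Function.comp]
  conv_lhs => rw [← this]
  rfl

/-- A function homogeneous of degree `-α ≤ 0` is at least as large inside the ball as on the sphere
along each ray, so the ball integral dominates the sphere integral times `∫_0^1 r^n dr = 1/(n + 1)`.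
-/
lemma lintegral_sphere_le_ball [Nontrivial (Lat d)] {α : ℝ} (hα : 0 ≤ α) {F : Lat d → ℝ≥0∞}
    (hF : Measurable F) (hom : ∀ r : ℝ, 0 < r → ∀ k, F (r • k) = invPow α r * F k) :
    ∫⁻ ω, F ω ∂(sphereMeasure d) ≤ ENNReal.ofReal (((Module.finrank ℝ (Lat d) - 1 : ℕ) : ℝ) + 1) *
      ∫⁻ k in Metric.ball (0 : Lat d) 1, F k := by
  set n := Module.finrank ℝ (Lat d) - 1 with hn
  have h1 : (∫⁻ ω, F ω ∂(sphereMeasure d)) * ENNReal.ofReal (1 / ((n : ℝ) + 1))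
      ≤ ∫⁻ k in Metric.ball (0 : Lat d) 1, F k := by
    rw [← lintegral_indicator Metric.isOpen_ball.measurableSet, lintegral_eq_polar]
    have h2 : ENNReal.ofReal (1 / ((n : ℝ) + 1))
        = ∫⁻ r : Ioi (0 : ℝ), (Iio (⟨1, mem_Ioi.2 zero_lt_one⟩ : Ioi (0 : ℝ))).indicator 1 r
          ∂(radialMeasure d) := by
      rw [lintegral_indicator_one measurableSet_Iio, Measure.volumeIoiPow_apply_Iio, one_pow]
    rw [h2, ← lintegral_prod_mul (f := fun ω : Metric.sphere (0 : Lat d) 1 => F ω)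
      (hF.comp measurable_subtype_coe).aemeasurable
      (measurable_one.indicator measurableSet_Iio).aemeasurable]
    refine lintegral_mono fun p => ?_
    by_cases hp : p.2 ∈ Iio (⟨1, mem_Ioi.2 zero_lt_one⟩ : Ioi (0 : ℝ))
    · have hp1 : (p.2 : ℝ) < 1 := hp
      have hp0 : 0 < (p.2 : ℝ) := p.2.2
      rw [indicator_of_mem hp, indicator_of_mem, hom _ hp0, Pi.one_apply, mul_one]
      · refine le_mul_of_one_le_left' ?_
        rw [← invPow_one α]
        refine invPow_anti hα ?_
        rw [abs_of_pos hp0, abs_one]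
        exact hp1.le
      · rw [mem_ball_zero_iff, norm_smul, norm_eq_of_mem_sphere, mul_one, Real.norm_of_nonneg hp0.le]
        exact hp1
    · rw [indicator_of_notMem hp, mul_zero]; exact zero_le
  calc ∫⁻ ω, F ω ∂(sphereMeasure d)
      = ENNReal.ofReal ((n : ℝ) + 1) *
        ((∫⁻ ω, F ω ∂(sphereMeasure d)) * ENNReal.ofReal (1 / ((n : ℝ) + 1))) := by
        rw [mul_left_comm, ← ENNReal.ofReal_mul (by positivity), mul_one_div_cancel (by positivity),
          ENNReal.ofReal_one, mul_one]
    _ ≤ _ := by gcongr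

/-- For `|t| ≤ 2‖y‖` the denominator is extended to the ball as the homogeneous function `k·y -
t|k|`. For larger `|t|` it never falls below `|t|/2`. -/
lemma lintegral_sphere_cone_le (hd : 2 ≤ d) {α : ℝ} (hα0 : 0 < α) (hα : 2 * α < 1) :
    ∃ C : ℝ≥0∞, C ≠ ⊤ ∧ ∀ (y : Lat d) (t : ℝ),
      ∫⁻ ω : Metric.sphere (0 : Lat d) 1, invPow α (⟪(ω : Lat d), y⟫ - t) ∂(sphereMeasure d)
        ≤ C * invPow α (max ‖y‖ |t|) := by
  have : Nontrivial (Lat d) := by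
    have : Nonempty (Fin d) := ⟨⟨0, by omega⟩⟩
    infer_instance
  obtain ⟨C, hC, h⟩ := lintegral_ball_cone_le hd hα0.le hα
  set D := ENNReal.ofReal (((Module.finrank ℝ (Lat d) - 1 : ℕ) : ℝ) + 1) with hD
  have hne : invPow α (1 / 2) ≠ ⊤ := invPow_ne_top (by norm_num)
  have key : ∀ a b : ℝ, b / 2 ≤ a → 0 ≤ b → invPow α a ≤ invPow α (1 / 2) * invPow α b :=
    fun a b hab hb => by
      rw [← invPow_mul]
      refine invPow_anti hα0.le ?_
      rw [abs_of_nonneg (by positivity), abs_of_nonneg (by linarith)]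
      linarith
  refine ⟨(D * C + sphereMeasure d univ) * invPow α (1 / 2) + 1, ?_, fun y t => ?_⟩
  · refine (ENNReal.add_lt_top.2 ⟨ENNReal.mul_lt_top (ENNReal.add_lt_top.2
      ⟨ENNReal.mul_lt_top ENNReal.ofReal_lt_top hC.lt_top, measure_lt_top _ _⟩) hne.lt_top,
      ENNReal.one_lt_top⟩).ne
  rcases le_or_gt |t| (2 * ‖y‖) with h1 | h1
  -- Here `t = 0` too, and the right-hand side is infinite; this uses `α > 0`.
  · by_cases hy : y = 0
    · have ht : t = 0 := by simpa [hy] using h1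
      simp only [hy, ht, norm_zero, abs_zero, max_self, invPow_zero hα0]
      rw [ENNReal.mul_top (by positivity)]
      exact le_top
    have h2 : ∫⁻ ω : Metric.sphere (0 : Lat d) 1, invPow α (⟪(ω : Lat d), y⟫ - t) ∂(sphereMeasure d)
        ≤ D * (C * invPow α ‖y‖) := by
      refine le_trans (le_of_eq ?_) ((lintegral_sphere_le_ball hα0.le
        (F := fun k => invPow α (⟪k, y⟫ - t * ‖k‖)) (by fun_prop) fun r hr k => ?_).trans
        (mul_le_mul_right (h y t hy h1) _))
      · refine lintegral_congr fun ω => ?_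
        rw [norm_eq_of_mem_sphere, mul_one]
      · rw [← invPow_mul, real_inner_smul_left, norm_smul, Real.norm_of_nonneg hr.le]
        congr 1; ring
    refine h2.trans ?_
    have h3 := key ‖y‖ (max ‖y‖ |t|) (by
      rcases max_choice ‖y‖ |t| with h | h <;> rw [h] <;> linarith [norm_nonneg y])
      (le_max_of_le_left (norm_nonneg _))
    calc D * (C * invPow α ‖y‖) ≤ D * (C * (invPow α (1 / 2) * invPow α (max ‖y‖ |t|))) := by
          gcongr
      _ = D * C * invPow α (1 / 2) * invPow α (max ‖y‖ |t|) := by ring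
      _ ≤ _ := by
          gcongr
          exact le_trans (by gcongr; exact le_self_add) le_self_add
  · have hm : max ‖y‖ |t| = |t| := max_eq_right (by linarith [norm_nonneg y])
    rw [hm]
    calc ∫⁻ ω : Metric.sphere (0 : Lat d) 1, invPow α (⟪(ω : Lat d), y⟫ - t) ∂(sphereMeasure d)
        ≤ ∫⁻ _ : Metric.sphere (0 : Lat d) 1, invPow α (1 / 2) * invPow α |t|
            ∂(sphereMeasure d) := by
          refine lintegral_mono fun ω => ?_
          rw [← invPow_abs α (_ - _)]
          refine key _ _ ?_ (abs_nonneg _)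
          have h2 : |⟪(ω : Lat d), y⟫| ≤ ‖y‖ := by
            have := abs_real_inner_le_norm (ω : Lat d) y
            rwa [norm_eq_of_mem_sphere, one_mul] at this
          have h3 := abs_sub_abs_le_abs_sub t ⟪(ω : Lat d), y⟫
          rw [abs_sub_comm] at h3
          linarith
      _ = sphereMeasure d univ * invPow α (1 / 2) * invPow α |t| := by
          rw [lintegral_const]; ring
      _ ≤ _ := by
          gcongr
          exact le_trans (by gcongr; exact le_add_self) le_self_add

/-- A radial weight is constant on spheres, so the angular integral of the singular factor can be
taken first. Division by the area of the sphere turns the remaining radial integral back into an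
integral over the whole space. This is what the radial majorant of the spectrum is for. -/
lemma lintegral_radial_mul_le [Nontrivial (Lat d)] {n : ℝ → ℝ≥0∞}
    (hn : AEMeasurable fun k : Lat d => n ‖k‖) {H : Lat d → ℝ≥0∞} (hH : Measurable H)
    {b : ℝ → ℝ≥0∞} (hb : Measurable b) {C : ℝ≥0∞}
    (h : ∀ r : ℝ, 0 < r → ∫⁻ ω : Metric.sphere (0 : Lat d) 1, H (r • (ω : Lat d))
      ∂(sphereMeasure d) ≤ C * b r) :
    ∫⁻ k : Lat d, n ‖k‖ * H k ≤ C / sphereMeasure d univ * ∫⁻ k : Lat d, n ‖k‖ * b ‖k‖ := by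
  have hnorm : ∀ p : Metric.sphere (0 : Lat d) 1 × Ioi (0 : ℝ),
      ‖(p.2 : ℝ) • (p.1 : Lat d)‖ = p.2 := fun p => by
    rw [norm_smul, norm_eq_of_mem_sphere, mul_one, Real.norm_of_nonneg p.2.2.le]
  have hS0 : sphereMeasure d univ ≠ 0 := by
    rw [ne_eq, Measure.measure_univ_eq_zero]
    exact Measure.toSphere_ne_zero _
  have hSt : sphereMeasure d univ ≠ ⊤ := measure_ne_top _ _
  have h1 : ∫⁻ k : Lat d, n ‖k‖ * H k
      ≤ C * ∫⁻ r : Ioi (0 : ℝ), n r * b r ∂(radialMeasure d) := by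
    rw [lintegral_eq_polar, ← lintegral_prod_swap]
    refine (lintegral_prod_le _).trans ?_
    rw [← lintegral_const_mul'' ]
    · refine lintegral_mono fun r => ?_
      have e : ∀ ω : Metric.sphere (0 : Lat d) 1, ‖(r : ℝ) • (ω : Lat d)‖ = r := fun ω =>
        hnorm (ω, r)
      have hm : Measurable fun ω : Metric.sphere (0 : Lat d) 1 => H ((r : ℝ) • (ω : Lat d)) :=
        hH.comp (measurable_subtype_coe.const_smul (r : ℝ))
      simp only [Prod.swap_prod_mk, e]
      rw [lintegral_const_mul _ hm]
      calc _ ≤ n r * (C * b r) := by gcongr; exact h r r.2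
        _ = _ := by ring
    · have h2 := aemeasurable_polar (hn.mul (hb.comp measurable_norm).aemeasurable)
      simp only [Pi.mul_apply, Function.comp, hnorm] at h2
      exact (AEStronglyMeasurable.of_comp_snd (f := fun r : Ioi (0 : ℝ) => n r * b r)
        h2.aestronglyMeasurable (Measure.toSphere_ne_zero _)).aemeasurable
  have h2 : ∫⁻ k : Lat d, n ‖k‖ * b ‖k‖
      = sphereMeasure d univ * ∫⁻ r : Ioi (0 : ℝ), n r * b r ∂(radialMeasure d) := by
    have h3 := aemeasurable_polar (hn.mul (hb.comp measurable_norm).aemeasurable)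
    simp only [Pi.mul_apply, Function.comp, hnorm] at h3
    rw [lintegral_eq_polar]
    simp only [hnorm]
    rw [lintegral_prod _ h3]
    simp only [lintegral_const]
    rw [mul_comm]
  rw [h2, ← mul_assoc, ENNReal.div_mul_cancel hS0 hSt]
  exact h1

end Polar

/-! ### Small denominators against a radial weight -/

section Spectrum

variable {d : ℕ}

/-- A bounded integrable function has bounded integrals against integrable singularities. -/
lemma lintegral_mul_invPow_norm_sub_le (hd : 1 ≤ d) {γ : ℝ} (hγ0 : 0 ≤ γ) (hγ : γ < 1)
    {N : Lat d → ℝ≥0∞} {S : ℝ≥0∞} (hS : S ≠ ⊤) (hNS : ∀ k, N k ≤ S) (hN : ∫⁻ k, N k ≠ ⊤) :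
    ∃ C : ℝ≥0∞, C ≠ ⊤ ∧ ∀ a : Lat d, ∫⁻ k, N k * invPow γ ‖k - a‖ ≤ C := by
  refine ⟨S * (∫⁻ k in Metric.ball (0 : Lat d) 1, invPow γ ‖k‖) + ∫⁻ k, N k, ?_, fun a => ?_⟩
  · exact ENNReal.add_ne_top.2 ⟨ENNReal.mul_ne_top hS (lintegral_ball_invPow_lt_top hd hγ).ne, hN⟩
  calc ∫⁻ k, N k * invPow γ ‖k - a‖
      ≤ ∫⁻ k, (S * (Metric.ball (0 : Lat d) 1).indicator (fun k => invPow γ ‖k‖) (k - a)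
          + N k) := by
        refine lintegral_mono fun k => ?_
        by_cases hk : k - a ∈ Metric.ball (0 : Lat d) 1
        · rw [indicator_of_mem hk]
          exact le_trans (by gcongr; exact hNS k) le_self_add
        · rw [indicator_of_notMem hk, mul_zero, zero_add]
          refine mul_le_of_le_one_right' (invPow_le_one hγ0 ?_)
          simpa using hk
    _ = _ := by
        have hm : Measurable ((Metric.ball (0 : Lat d) 1).indicator fun k : Lat d =>
            invPow γ ‖k‖) := Measurable.indicator (by fun_prop) Metric.isOpen_ball.measurableSet
        rw [lintegral_add_left (by fun_prop), lintegral_const_mul _ (by fun_prop),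
          lintegral_sub_right_eq_self fun k =>
            (Metric.ball (0 : Lat d) 1).indicator (fun k => invPow γ ‖k‖) k,
          lintegral_indicator Metric.isOpen_ball.measurableSet]

lemma abs_inner_of_dim_one (k y : Lat 1) : |⟪k, y⟫| = ‖k‖ * ‖y‖ := by
  simp [EuclideanSpace.norm_eq, PiLp.inner_apply, Real.sqrt_sq_eq_abs, abs_mul, mul_comm]

/-- Uniform integrability of the small denominators of a single interaction. -/
lemma exists_lintegral_inner_le (hd : 1 ≤ d) {α : ℝ} (hα0 : 0 < α) (hα : 2 * α < 1)
    {n : ℝ → ℝ≥0∞} (hn : AEMeasurable fun k : Lat d => n ‖k‖) {S : ℝ≥0∞} (hS : S ≠ ⊤)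
    (hNS : ∀ r, n r ≤ S) (hN : ∫⁻ k : Lat d, n ‖k‖ ≠ ⊤) :
    ∃ C : ℝ≥0∞, C ≠ ⊤ ∧
      (∀ s : ℝ, s = 1 ∨ s = -1 → ∀ x : Lat d,
        ∫⁻ k : Lat d, n ‖k‖ * invPow α (⟪k, x⟫ + s * ‖k‖ ^ 2) ≤ C) ∧
      ∀ y : Lat d, ∫⁻ k : Lat d, n ‖k‖ * invPow α ⟪k, y⟫ ≤ C * invPow α ‖y‖ := by
  obtain ⟨C1, hC1, h1⟩ := lintegral_mul_invPow_norm_sub_le hd (by linarith) (by linarith) hS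
    (fun k : Lat d => hNS ‖k‖) hN (γ := α)
  obtain ⟨C2, hC2, h2⟩ := lintegral_mul_invPow_norm_sub_le hd (by linarith) hα hS
    (fun k : Lat d => hNS ‖k‖) hN
  have : Nontrivial (Lat d) := by
    have : Nonempty (Fin d) := ⟨⟨0, by omega⟩⟩
    infer_instance
  rcases Nat.lt_or_ge 1 d with hd2 | hd1
  · obtain ⟨C0, hC0, h0⟩ := lintegral_sphere_cone_le hd2 hα0 hα
    have hS0 : sphereMeasure d univ ≠ 0 := by
      rw [ne_eq, Measure.measure_univ_eq_zero]
      exact Measure.toSphere_ne_zero _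
    have hC0' : C0 / sphereMeasure d univ ≠ ⊤ := ENNReal.div_ne_top hC0 hS0
    refine ⟨C0 / sphereMeasure d univ * (C1 + C2), ENNReal.mul_ne_top hC0' (by simp [hC1, hC2]),
      fun s hs x => ?_, fun y => ?_⟩
    · have hs1 : |s| = 1 := by rcases hs with h | h <;> simp [h]
      -- On the sphere of radius `r` the phase is `r (ω·x + s r)`. The sphere estimate with `t = -s
      -- r` gives `r^{-α} max(‖x‖, r)^{-α} ≤ r^{-2α}`, which no longer depends on `x`.
      refine (lintegral_radial_mul_le hn (H := fun k => invPow α (⟪k, x⟫ + s * ‖k‖ ^ 2))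
        (by fun_prop) (b := fun r => invPow (2 * α) r) (by fun_prop) (C := C0)
        fun r hr => ?_).trans ?_
      · have e : ∀ ω : Metric.sphere (0 : Lat d) 1,
            invPow α (⟪r • (ω : Lat d), x⟫ + s * ‖r • (ω : Lat d)‖ ^ 2)
            = invPow α r * invPow α (⟪(ω : Lat d), x⟫ - (-(s * r))) := fun ω => by
          rw [← invPow_mul, real_inner_smul_left, norm_smul, norm_eq_of_mem_sphere,
            Real.norm_of_nonneg hr.le]
          congr 1; ring
        simp only [e]
        rw [lintegral_const_mul _ (by fun_prop)]
        calc _ ≤ invPow α r * (C0 * invPow α r) := by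
              gcongr
              refine (h0 x _).trans ?_
              gcongr
              refine invPow_anti hα0.le ?_
              rw [abs_neg, abs_mul, hs1, one_mul,
                abs_of_nonneg (le_max_of_le_left (norm_nonneg x))]
              exact le_max_right _ _
          _ = _ := by rw [two_mul, invPow_add _ _ hr.ne']; ring
      · gcongr
        have := h2 0
        simp only [sub_zero] at this
        exact this.trans le_add_self
    · refine (lintegral_radial_mul_le hn (H := fun k => invPow α ⟪k, y⟫)
        (by fun_prop) (b := fun r => invPow α r) (by fun_prop) (C := C0 * invPow α ‖y‖)
        fun r hr => ?_).trans ?_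
      · have e : ∀ ω : Metric.sphere (0 : Lat d) 1, invPow α ⟪r • (ω : Lat d), y⟫
            = invPow α r * invPow α (⟪(ω : Lat d), y⟫ - 0) := fun ω => by
          rw [← invPow_mul, real_inner_smul_left]
          congr 1; ring
        simp only [e]
        rw [lintegral_const_mul _ (by fun_prop)]
        calc _ ≤ invPow α r * (C0 * invPow α ‖y‖) := by
              gcongr
              refine (h0 y _).trans ?_
              gcongr
              exact (invPow_anti hα0.le (by simp))
          _ = _ := by ring
      · rw [mul_comm C0, mul_div_assoc, mul_comm (invPow α ‖y‖), mul_right_comm]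
        gcongr
        have := h1 0
        simp only [sub_zero] at this
        exact this.trans le_self_add
  -- On the line there is no sphere to average over, but the phase factors into `k` and `x + s k`.
  · obtain rfl : d = 1 := by omega
    refine ⟨C1 + (C2 + C2), by simp [hC1, hC2], fun s hs x => ?_, fun y => ?_⟩
    · have hs1 : s * s = 1 := by rcases hs with h | h <;> simp [h]
      calc ∫⁻ k : Lat 1, n ‖k‖ * invPow α (⟪k, x⟫ + s * ‖k‖ ^ 2)
          ≤ ∫⁻ k : Lat 1, (n ‖k‖ * invPow (2 * α) ‖k - 0‖
              + n ‖k‖ * invPow (2 * α) ‖k - (-(s • x))‖) := by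
            refine lintegral_mono fun k => ?_
            rw [← mul_add]
            gcongr
            refine le_trans (le_of_eq ?_) (invPow_mul_le hα0.le _ _)
            rw [← invPow_abs]
            congr 1
            have e1 : ⟪k, x⟫ + s * ‖k‖ ^ 2 = ⟪k, s • (k - (-(s • x)))⟫ := by
              rw [sub_neg_eq_add, smul_add, smul_smul, hs1, one_smul, inner_add_right,
                real_inner_smul_right, real_inner_self_eq_norm_sq, add_comm]
            rw [e1, abs_inner_of_dim_one, norm_smul, sub_zero]
            rcases hs with h | h <;> simp [h]
        _ ≤ C2 + C2 := by
            have hm : AEMeasurable fun k : Lat 1 => n ‖k‖ * invPow (2 * α) ‖k - 0‖ :=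
              hn.mul (by fun_prop)
            rw [lintegral_add_left' hm]
            exact add_le_add (h2 0) (h2 _)
        _ ≤ _ := le_add_self
    · calc ∫⁻ k : Lat 1, n ‖k‖ * invPow α ⟪k, y⟫
          = ∫⁻ k : Lat 1, (n ‖k‖ * invPow α ‖k - 0‖) * invPow α ‖y‖ := by
            refine lintegral_congr fun k => ?_
            rw [← invPow_abs α ⟪k, y⟫, abs_inner_of_dim_one, invPow_mul, sub_zero, mul_assoc]
        _ = (∫⁻ k : Lat 1, n ‖k‖ * invPow α ‖k - 0‖) * invPow α ‖y‖ :=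
            lintegral_mul_const'' _ (hn.mul (by fun_prop))
        _ ≤ _ := by
            gcongr
            exact (h1 0).trans le_self_add

end Spectrum
-- The power spectrum and Fourier inversion of the covariance
section Spectral

variable {d : ℕ} {R : Lat d → ℝ}

/-- The spectral density of the covariance. -/
noncomputable def spec (R : Lat d → ℝ) (k : Lat d) : ℝ := powerSpectrum R k / (2 * Real.pi) ^ d

lemma fourier_ofReal_eq (R : Lat d → ℝ) (ξ : Lat d) :
    𝓕 (fun x => (R x : ℂ)) ((2 * Real.pi)⁻¹ • ξ)
      = ∫ x : Lat d, Complex.exp (-Complex.I * (⟪ξ, x⟫ : ℝ)) * (R x : ℂ) := by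
  rw [Real.fourier_eq']
  refine integral_congr_ae (Eventually.of_forall fun x => ?_)
  simp only [smul_eq_mul]
  congr 2
  rw [real_inner_smul_right, real_inner_comm]
  have : (Real.pi : ℂ) ≠ 0 := Complex.ofReal_ne_zero.2 Real.pi_ne_zero
  push_cast
  field_simp

lemma fourier_im_eq_zero (hR : IsCovariance R) (ξ : Lat d) :
    (∫ x : Lat d, Complex.exp (-Complex.I * (⟪ξ, x⟫ : ℝ)) * (R x : ℂ)).im = 0 := by
  have h : conj (∫ x : Lat d, Complex.exp (-Complex.I * (⟪ξ, x⟫ : ℝ)) * (R x : ℂ))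
      = ∫ x : Lat d, Complex.exp (-Complex.I * (⟪ξ, x⟫ : ℝ)) * (R x : ℂ) := by
    rw [← integral_conj, ← integral_neg_eq_self]
    refine integral_congr_ae (Eventually.of_forall fun x => ?_)
    simp only [map_mul, Complex.conj_ofReal, hR.even, inner_neg_right, ← Complex.exp_conj, map_neg,
      Complex.conj_I]
    push_cast
    ring_nf
  exact Complex.conj_eq_iff_im.1 h

lemma powerSpectrum_eq (hR : IsCovariance R) (ξ : Lat d) :
    (powerSpectrum R ξ : ℂ) = 𝓕 (fun x => (R x : ℂ)) ((2 * Real.pi)⁻¹ • ξ) := by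
  rw [fourier_ofReal_eq]
  exact Complex.ext rfl (by rw [fourier_im_eq_zero hR]; simp)

lemma continuous_powerSpectrum (hR : IsCovariance R) : Continuous (powerSpectrum R) := by
  have h : Continuous (𝓕 (fun x => (R x : ℂ))) :=
    VectorFourier.fourierIntegral_continuous Real.continuous_fourierChar
      (by exact continuous_inner) hR.integrable.ofReal
  have h2 : powerSpectrum R = fun ξ => (𝓕 (fun x => (R x : ℂ)) ((2 * Real.pi)⁻¹ • ξ)).re := by
    ext ξ
    rw [← powerSpectrum_eq hR, Complex.ofReal_re]
  rw [h2]
  fun_prop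

lemma powerSpectrum_le (hR : IsCovariance R) (ξ : Lat d) : powerSpectrum R ξ ≤ ∫ x, |R x| := by
  refine (Complex.re_le_norm _).trans ?_
  refine norm_integral_le_of_norm_le hR.integrable.abs (Eventually.of_forall fun x => ?_)
  rw [norm_mul, Complex.norm_real, Real.norm_eq_abs, neg_mul, mul_comm Complex.I,
    ← neg_mul, ← Complex.ofReal_neg, Complex.norm_exp_ofReal_mul_I, one_mul]

lemma integrable_powerSpectrum (hR : IsCovariance R) : Integrable (powerSpectrum R) := by
  obtain ⟨ρ, hρ, h⟩ := hR.radial_majorant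
  refine hρ.mono' (continuous_powerSpectrum hR).aestronglyMeasurable
    (Eventually.of_forall fun ξ => ?_)
  rw [Real.norm_of_nonneg (hR.spectrum_nonneg ξ)]
  exact h ξ

lemma continuous_spec (hR : IsCovariance R) : Continuous (spec R) :=
  (continuous_powerSpectrum hR).div_const _

lemma spec_nonneg (hR : IsCovariance R) (k : Lat d) : 0 ≤ spec R k :=
  div_nonneg (hR.spectrum_nonneg k) (by positivity)

lemma integrable_spec (hR : IsCovariance R) : Integrable (spec R) :=
  (integrable_powerSpectrum hR).div_const _

lemma spec_le (hR : IsCovariance R) (k : Lat d) : spec R k ≤ powerSpectrum R k := by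
  refine div_le_self (hR.spectrum_nonneg k) (one_le_pow₀ ?_)
  linarith [Real.pi_gt_three]

lemma powerSpectrum_neg (k : Lat d) (hR : IsCovariance R) :
    powerSpectrum R (-k) = powerSpectrum R k := by
  rw [powerSpectrum, ← integral_neg_eq_self, powerSpectrum]
  simp only [inner_neg_right, inner_neg_left, neg_neg, hR.even]

lemma spec_neg (hR : IsCovariance R) (k : Lat d) : spec R (-k) = spec R k := by
  rw [spec, powerSpectrum_neg k hR, spec]

/-- Fourier inversion for the covariance. -/
lemma covariance_eq_integral (hR : IsCovariance R) (x : Lat d) :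
    (R x : ℂ) = ∫ k : Lat d, (spec R k : ℂ) * Complex.exp (Complex.I * (⟪k, x⟫ : ℝ)) := by
  have hpi : 0 < 2 * Real.pi := by positivity
  have e : 𝓕 (fun x => (R x : ℂ)) = fun k => (powerSpectrum R ((2 * Real.pi) • k) : ℂ) := by
    ext k
    rw [powerSpectrum_eq hR, smul_smul, inv_mul_cancel₀ hpi.ne', one_smul]
  have hint : Integrable (𝓕 (fun x => (R x : ℂ))) := by
    rw [e]
    exact ((integrable_powerSpectrum hR).comp_smul hpi.ne').ofReal
  have h := Continuous.fourierInv_fourier_eq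
    (Complex.continuous_ofReal.comp hR.continuous) hR.integrable.ofReal hint
  have h1 := congrFun h x
  simp only [Function.comp] at h1
  rw [← h1]
  rw [Real.fourierInv_eq']
  have hc := Measure.integral_comp_smul (volume : Measure (Lat d))
    (fun k => (spec R k : ℂ) * Complex.exp (Complex.I * (⟪k, x⟫ : ℝ))) (2 * Real.pi)
  have hfr : Module.finrank ℝ (Lat d) = d := by simp
  have hp0 : (2 * Real.pi) ^ d ≠ 0 := by positivity
  rw [hfr, abs_of_pos (by positivity)] at hc
  have h2 : ∫ k : Lat d, (spec R k : ℂ) * Complex.exp (Complex.I * (⟪k, x⟫ : ℝ))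
      = ((2 * Real.pi) ^ d : ℝ) • ∫ k : Lat d, (spec R ((2 * Real.pi) • k) : ℂ) *
        Complex.exp (Complex.I * (⟪(2 * Real.pi) • k, x⟫ : ℝ)) := by
    rw [hc, smul_smul, mul_inv_cancel₀ hp0, one_smul]
  rw [h2, ← integral_smul]
  refine integral_congr_ae (Eventually.of_forall fun k => ?_)
  have ek : 𝓕 (Complex.ofReal ∘ R) k = (powerSpectrum R ((2 * Real.pi) • k) : ℂ) := congrFun e k
  simp only [ek, smul_eq_mul, spec, Complex.real_smul, real_inner_smul_left]
  have hp0' : (2 * (Real.pi : ℂ)) ^ d ≠ 0 := by exact_mod_cast hp0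
  push_cast
  rw [mul_comm Complex.I]
  field_simp

end Spectral

/-! ### The oscillatory integrals against the power spectrum -/

section OscillationBound

variable {d : ℕ} {R : Lat d → ℝ}

lemma norm_integral_osc_le (a b : ℝ) {φ : ℝ} (hφ : φ ≠ 0) :
    ‖∫ r in a..b, osc r φ‖ ≤ 2 / |φ| := by
  have hc : Complex.I * (φ : ℂ) ≠ 0 :=
    mul_ne_zero Complex.I_ne_zero (Complex.ofReal_ne_zero.2 hφ)
  have e : ∀ r : ℝ, osc r φ = Complex.exp (Complex.I * φ * r) := fun r => by
    rw [osc]; push_cast; ring_nf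
  simp only [e]
  rw [integral_exp_mul_complex hc, norm_div, norm_mul, Complex.norm_I, one_mul, Complex.norm_real,
    Real.norm_eq_abs]
  gcongr
  refine (norm_sub_le _ _).trans ?_
  rw [← e, ← e, norm_osc, norm_osc]
  norm_num

/-- Interpolation between the length of the interval, used for `|φ| ≤ 1`, and the bound `2/|φ|`,
used for `|φ| ≥ 1`. A power `α < 1` keeps the singularity at `φ = 0` integrable. -/
lemma ofReal_norm_integral_osc_le {a b Z : ℝ} (ha : 0 ≤ a) (hab : a ≤ b) (hb : b ≤ Z)
    (hZ : 1 ≤ Z) {α : ℝ} (hα0 : 0 < α) (hα1 : α ≤ 1) (φ : ℝ) :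
    ENNReal.ofReal ‖∫ r in a..b, osc r φ‖ ≤ ENNReal.ofReal (2 * Z) * invPow α φ := by
  by_cases hφ : φ = 0
  · rw [hφ, invPow_zero hα0, ENNReal.mul_top (by simp; linarith)]
    exact le_top
  have hφ0 : 0 < |φ| := abs_pos.2 hφ
  have h1 : ‖∫ r in a..b, osc r φ‖ ≤ b - a := by
    have := intervalIntegral.norm_integral_le_of_norm_le_const (a := a) (b := b)
      (f := fun r => osc r φ) (C := 1) fun r _ => (norm_osc _ _).le
    rwa [one_mul, abs_of_nonneg (sub_nonneg.2 hab)] at this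
  have h2 := norm_integral_osc_le a b hφ
  rw [invPow, ENNReal.ofReal_rpow_of_pos hφ0, ← ENNReal.ofReal_mul (by positivity)]
  refine ENNReal.ofReal_le_ofReal ?_
  rcases le_total 1 |φ| with h | h
  · have h3 : |φ|⁻¹ ≤ |φ| ^ (-α) := by
      rw [← Real.rpow_neg_one]
      exact Real.rpow_le_rpow_of_exponent_le h (by linarith)
    calc _ ≤ 2 * |φ|⁻¹ := by rw [← div_eq_mul_inv]; exact h2
      _ ≤ 2 * |φ| ^ (-α) := by gcongr
      _ ≤ _ := by gcongr; linarith
  · have h3 : 1 ≤ |φ| ^ (-α) := Real.one_le_rpow_of_pos_of_le_one_of_nonpos hφ0 h (by linarith)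
    calc _ ≤ 2 * Z * 1 := by linarith
      _ ≤ _ := by gcongr

/-- The large parameter factors out of `|cθ|^{-α}`, and the remaining small denominators are
integrable uniformly in the frequencies. This is the only source of smallness in the theorem. -/
lemma oscillationBound_spec (hd : 1 ≤ d) (hR : IsCovariance R) {α : ℝ} (hα0 : 0 < α)
    (hα : 2 * α < 1) :
    ∃ C : ℝ, 0 ≤ C ∧ ∀ c Z : ℝ, 0 < c → 1 ≤ Z →
      OscillationBound (fun k => (spec R k : ℂ)) c Z (C * Z * c ^ (-α)) := by
  obtain ⟨ρ, hρ, hRρ⟩ := hR.radial_majorant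
  set S := ∫ x, |R x| with hS
  -- The majorant `ρ` is integrable but possibly unbounded. Capping it at the `L¹` norm of `R`,
  -- which also bounds the spectrum, gives a radial weight that is both integrable and bounded.
  set n : ℝ → ℝ≥0∞ := fun r => ENNReal.ofReal (min (ρ r) S) with hn
  have hnm : AEMeasurable fun k : Lat d => n ‖k‖ :=
    (hρ.aestronglyMeasurable.aemeasurable.min aemeasurable_const).ennreal_ofReal
  have hnS : ∀ r, n r ≤ ENNReal.ofReal S := fun r => ENNReal.ofReal_le_ofReal (min_le_right _ _)
  have hnfin : ∫⁻ k : Lat d, n ‖k‖ ≠ ⊤ := by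
    refine ne_top_of_le_ne_top (hasFiniteIntegral_iff_norm _ |>.1 hρ.hasFiniteIntegral).ne
      (lintegral_mono fun k => ENNReal.ofReal_le_ofReal ?_)
    exact (min_le_left _ _).trans (Real.le_norm_self _)
  have hw : ∀ k : Lat d, ENNReal.ofReal ‖(spec R k : ℂ)‖ ≤ n ‖k‖ := fun k => by
    rw [Complex.norm_real, Real.norm_of_nonneg (spec_nonneg hR k)]
    refine ENNReal.ofReal_le_ofReal ((spec_le hR k).trans (le_min (hRρ k) (powerSpectrum_le hR k)))
  obtain ⟨C, hC, h1, h2⟩ := exists_lintegral_inner_le hd hα0 hα hnm ENNReal.ofReal_ne_top hnS hnfin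
  obtain ⟨C1, hC1, h3⟩ := lintegral_mul_invPow_norm_sub_le hd hα0.le (by linarith)
    ENNReal.ofReal_ne_top (fun k : Lat d => hnS ‖k‖) hnfin
  have hwm : Measurable fun k : Lat d => (spec R k : ℂ) :=
    (Complex.continuous_ofReal.comp (continuous_spec hR)).measurable
  have hinv : ∀ c : ℝ, 0 < c → invPow α c = ENNReal.ofReal (c ^ (-α)) := fun c hc => by
    rw [invPow, abs_of_pos hc, ENNReal.ofReal_rpow_of_pos hc]
  have hIm : ∀ a b : ℝ, a ≤ b → Measurable fun φ => ∫ r in a..b, osc r φ := fun a b hab => by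
    simp_rw [intervalIntegral.integral_of_le hab]
    have : StronglyMeasurable fun q : ℝ × ℝ => osc q.2 q.1 := by
      have : Measurable fun q : ℝ × ℝ => osc q.2 q.1 := by fun_prop
      exact this.stronglyMeasurable
    exact this.integral_prod_right.measurable
  have hfin : ∀ (D : ℝ≥0∞) (Z c : ℝ), 0 < c → 1 ≤ Z → D ≤ C + C * C1 →
      ENNReal.ofReal (2 * Z) * invPow α c * D
        ≤ ENNReal.ofReal (2 * (C + C * C1).toReal * Z * c ^ (-α)) := fun D Z c hc hZ hD => by
    have : C + C * C1 ≠ ⊤ := ENNReal.add_ne_top.2 ⟨hC, ENNReal.mul_ne_top hC hC1⟩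
    rw [hinv c hc, ← ENNReal.ofReal_mul (by positivity)]
    refine (mul_le_mul_right hD _).trans (le_of_eq ?_)
    rw [← ENNReal.ofReal_toReal this, ← ENNReal.ofReal_mul (by positivity), ENNReal.toReal_ofReal
      ENNReal.toReal_nonneg]
    congr 1; ring
  refine ⟨2 * (C + C * C1).toReal, by positivity, fun c Z hc hZ => ⟨?_, ?_⟩⟩
  · intro s hs a b ha hab hb x
    have hI := hIm a b hab
    have hm : Measurable fun k : Lat d => ‖∫ r in a..b, osc r (c * (⟪k, x⟫ + s * ‖k‖ ^ 2))‖ *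
        ‖(spec R k : ℂ)‖ :=
      (hI.comp (by fun_prop : Measurable fun k : Lat d =>
        c * (⟪k, x⟫ + s * ‖k‖ ^ 2))).norm.mul hwm.norm
    rw [integral_eq_lintegral_of_nonneg_ae (Eventually.of_forall fun _ => by positivity)
      hm.aestronglyMeasurable]
    refine ENNReal.toReal_le_of_le_ofReal (by positivity) (le_trans ?_ (hfin C Z c hc hZ le_self_add))
    calc _ ≤ ∫⁻ k : Lat d, (ENNReal.ofReal (2 * Z) * invPow α c) *
          (n ‖k‖ * invPow α (⟪k, x⟫ + s * ‖k‖ ^ 2)) := by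
          refine lintegral_mono fun k => ?_
          rw [ENNReal.ofReal_mul (norm_nonneg _)]
          calc _ ≤ (ENNReal.ofReal (2 * Z) * invPow α (c * (⟪k, x⟫ + s * ‖k‖ ^ 2))) * n ‖k‖ :=
                mul_le_mul' (ofReal_norm_integral_osc_le ha hab hb hZ hα0 (by linarith) _) (hw k)
            _ = _ := by rw [invPow_mul]; ring
      _ = (ENNReal.ofReal (2 * Z) * invPow α c) *
          ∫⁻ k : Lat d, n ‖k‖ * invPow α (⟪k, x⟫ + s * ‖k‖ ^ 2) :=
          lintegral_const_mul' _ _ (ENNReal.mul_ne_top ENNReal.ofReal_ne_top (invPow_ne_top hc.ne'))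
      _ ≤ _ := by gcongr; exact h1 s hs x
  · intro s hs a b ha hab hb x
    have hI := hIm a b hab
    have hm : Measurable fun p : Lat d × Lat d => ‖∫ r in a..b, osc r (c * ⟪p.1, x + s • p.2⟫)‖ *
        ‖(spec R p.1 : ℂ) * (spec R p.2 : ℂ)‖ :=
      (hI.comp (by fun_prop : Measurable fun p : Lat d × Lat d =>
        c * ⟪p.1, x + s • p.2⟫)).norm.mul
        ((hwm.comp measurable_fst).mul (hwm.comp measurable_snd)).norm
    rw [integral_eq_lintegral_of_nonneg_ae (Eventually.of_forall fun _ => by positivity)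
      hm.aestronglyMeasurable]
    refine ENNReal.toReal_le_of_le_ofReal (by positivity)
      (le_trans ?_ (hfin (C * C1) Z c hc hZ le_add_self))
    -- The later frequency `k` is integrated first, at fixed earlier `k'`. It leaves `‖x + s
    -- k'‖^{-α}`, which is integrable in `k'` uniformly in `x`.
    rw [Measure.volume_eq_prod, lintegral_prod_symm _ hm.ennreal_ofReal.aemeasurable]
    have hne := ENNReal.mul_ne_top (ENNReal.ofReal_ne_top (r := 2 * Z))
      (invPow_ne_top (α := α) hc.ne')
    calc _ ≤ ∫⁻ k' : Lat d, (ENNReal.ofReal (2 * Z) * invPow α c) * (n ‖k'‖ *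
          (C * invPow α ‖k' - (-(s • x))‖)) := by
          refine lintegral_mono fun k' => ?_
          have hs' : ‖x + s • k'‖ = ‖k' - (-(s • x))‖ := by
            rcases hs with h | h
            · simp [h, add_comm]
            · rw [h, neg_one_smul, neg_one_smul, neg_neg, ← sub_eq_add_neg, norm_sub_rev]
          rw [← hs']
          calc _ ≤ ∫⁻ k : Lat d, (ENNReal.ofReal (2 * Z) * invPow α c * n ‖k'‖) *
                (n ‖k‖ * invPow α ⟪k, x + s • k'⟫) := by
                refine lintegral_mono fun k => ?_
                rw [ENNReal.ofReal_mul (norm_nonneg _), norm_mul,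
                  ENNReal.ofReal_mul (norm_nonneg _)]
                calc _ ≤ (ENNReal.ofReal (2 * Z) * invPow α (c * ⟪k, x + s • k'⟫)) *
                      (n ‖k‖ * n ‖k'‖) := mul_le_mul'
                      (ofReal_norm_integral_osc_le ha hab hb hZ hα0 (by linarith) _)
                      (mul_le_mul' (hw k) (hw k'))
                  _ = _ := by rw [invPow_mul]; ring
            _ = (ENNReal.ofReal (2 * Z) * invPow α c * n ‖k'‖) *
                ∫⁻ k : Lat d, n ‖k‖ * invPow α ⟪k, x + s • k'⟫ :=
                lintegral_const_mul' _ _ (ENNReal.mul_ne_top hne ENNReal.ofReal_ne_top)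
            _ ≤ (ENNReal.ofReal (2 * Z) * invPow α c * n ‖k'‖) * (C * invPow α ‖x + s • k'‖) := by
                gcongr; exact h2 _
            _ = _ := by ring
      _ = (ENNReal.ofReal (2 * Z) * invPow α c) * (C *
          ∫⁻ k' : Lat d, n ‖k'‖ * invPow α ‖k' - (-(s • x))‖) := by
          rw [lintegral_const_mul' _ _ hne, ← lintegral_const_mul' _ _ hC]
          congr 1
          refine lintegral_congr fun k' => ?_
          ring
      _ ≤ _ := by gcongr; exact h3 _

end OscillationBound
/-! ### The solution operators of the pair interactions -/

section SolutionOperator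

variable {X : Type*} [MeasurableSpace X] {L : ℝ → ComplexMeasure X →L[ℂ] ComplexMeasure X} {K : ℝ}

lemma isSolutionOperator_flow (hL : StrongFamily L K) :
    IsSolutionOperator (fun z ρ => L z ρ) (fun z => (hL.flow z).toLinearMap) where
  initial := by
    ext1 ρ
    simp [hL.flow_zero]
  bounded z _ := ⟨2 * ‖hL.flow z‖, fun ρ => by
    refine (tvNorm_le _).trans ?_
    rw [mul_assoc]
    refine mul_le_mul_of_nonneg_left ?_ zero_le_two
    exact ((hL.flow z).le_opNorm ρ).trans
      (mul_le_mul_of_nonneg_left (norm_le_tvNorm ρ) (norm_nonneg _))⟩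
  evolution z _ ρ := by
    have h := (hasDerivAt_iff_tendsto_slope_zero.1 (hL.hasDerivAt_flow ρ z))
    have h2 : Tendsto (fun t : ℝ => 2 * ‖t⁻¹ • (hL.flow (z + t) ρ - hL.flow z ρ)
        - L z (hL.flow z ρ)‖) (𝓝[≠] 0) (𝓝 0) := by
      simpa using (tendsto_iff_norm_sub_tendsto_zero.1 h).const_mul 2
    have h3 := h2.mono_left (nhdsWithin_mono 0
      (fun t ht => ht.1 : {h : ℝ | h ≠ 0 ∧ 0 ≤ z + h} ⊆ {0}ᶜ))
    refine squeeze_zero (fun t => ?_) (fun t => ?_) h3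
    · exact add_nonneg ENNReal.toReal_nonneg ENNReal.toReal_nonneg
    · exact tvNorm_le _

/-- `pairPropagator` is an unspecified choice of a solution operator. Uniqueness of the equation
makes it computable for `z ≥ 0`; for negative `z` nothing is known about it. -/
lemma IsSolutionOperator.eq_flow (hL : StrongFamily L K) {U : ℝ → Module.End ℂ (ComplexMeasure X)}
    (hU : IsSolutionOperator (fun z ρ => L z ρ) U) {z : ℝ} (hz : 0 ≤ z) (ρ : ComplexMeasure X) :
    U z ρ = hL.flow z ρ := by
  have h := hL.eq_flow (f := fun z => U z ρ) (fun z hz => ?_) hz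
  · rw [h, hU.initial]; rfl
  have h1 : Tendsto (fun t : ℝ => t⁻¹ • (U (z + t) ρ - U z ρ) - L z (U z ρ))
      (𝓝[{h : ℝ | h ≠ 0 ∧ 0 ≤ z + h}] 0) (𝓝 0) :=
    squeeze_zero_norm (fun t => norm_le_tvNorm _) (hU.evolution z hz ρ)
  have h2 : Tendsto (fun y : ℝ => y - z) (𝓝[Ici 0 \ {z}] z) (𝓝[{h : ℝ | h ≠ 0 ∧ 0 ≤ z + h}] 0) := by
    refine tendsto_nhdsWithin_of_tendsto_nhds_of_eventually_within _ ?_ ?_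
    · have : Tendsto (fun y : ℝ => y - z) (𝓝 z) (𝓝 (z - z)) :=
        (continuous_id.sub continuous_const).tendsto z
      rw [sub_self] at this
      exact this.mono_left nhdsWithin_le_nhds
    · filter_upwards [self_mem_nhdsWithin] with y hy
      exact ⟨sub_ne_zero.2 hy.2, by simpa using hy.1⟩
  rw [hasDerivWithinAt_iff_tendsto_slope, tendsto_iff_norm_sub_tendsto_zero]
  have h3 := (h1.comp h2).norm
  rw [norm_zero] at h3
  refine h3.congr fun y => ?_
  simp [slope, Function.comp]

end SolutionOperator

/-! ### The interactions of the moment equation and the operators `L¹_{j,l}` -/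

section Pairs

variable {d p q : ℕ} {R : Lat d → ℝ}

/-- The type of a factor: `1` for a wave factor, `-1` for a conjugate wave factor. -/
def factorSign (p q : ℕ) : Fin p ⊕ Fin q → ℝ := Sum.elim (fun _ => 1) (fun _ => -1)

lemma factorSign_eq (i : Fin p ⊕ Fin q) : factorSign p q i = 1 ∨ factorSign p q i = -1 := by
  rcases i with j | l
  · exact Or.inl rfl
  · exact Or.inr rfl

lemma not_isBad_iff (e : (Fin p ⊕ Fin q) × (Fin p ⊕ Fin q)) :
    ¬ IsBad (factorSign p q) e ↔ ∃ j l, e = (Sum.inl j, Sum.inr l) := by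
  rw [IsBad, not_not]
  rcases e with ⟨a | a, b | b⟩ <;> simp [factorSign] <;> norm_num

lemma measurable_spec (hR : IsCovariance R) : Measurable fun k => (spec R k : ℂ) :=
  (Complex.continuous_ofReal.comp (continuous_spec hR)).measurable

/-- The interaction `e` of the moment equation. -/
noncomputable def momentOp (hR : IsCovariance R) (k₀ ε η : ℝ) (p q : ℕ)
    (e : (Fin p ⊕ Fin q) × (Fin p ⊕ Fin q)) (z : ℝ) :
    ComplexMeasure (Dual d p q) →L[ℂ] ComplexMeasure (Dual d p q) :=
  edgeOp (integrable_spec hR).ofReal (measurable_spec hR) (factorSign p q) (k₀ ^ 2 / (4 * η ^ 2))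
    (η / (k₀ * ε)) e z

/-- A bound of the interactions. -/
noncomputable def momentBound (R : Lat d → ℝ) (k₀ η : ℝ) : ℝ :=
  1 + k₀ ^ 2 / (4 * η ^ 2) * ∫ k, ‖(spec R k : ℂ)‖

lemma one_le_momentBound (k₀ η : ℝ) : 1 ≤ momentBound R k₀ η := by
  have : 0 ≤ k₀ ^ 2 / (4 * η ^ 2) * ∫ k, ‖(spec R k : ℂ)‖ :=
    mul_nonneg (by positivity) (integral_nonneg fun _ => norm_nonneg _)
  rw [momentBound]; linarith

lemma strongFamily_momentOp (hR : IsCovariance R) (k₀ ε η : ℝ)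
    (e : (Fin p ⊕ Fin q) × (Fin p ⊕ Fin q)) :
    StrongFamily (momentOp hR k₀ ε η p q e) (momentBound R k₀ η) :=
  strongFamily_edgeOp _ _ _ _ _ (by positivity) (le_add_of_nonneg_left zero_le_one) e

/-- The two signs of a good pair cancel in the quadratic part of the phase, and subtracting `σ k =
-k` from the conjugate factor adds `k` to it, as `pairShift` does. -/
lemma pairScattering_eq (hR : IsCovariance R) (k₀ ε η : ℝ) (j : Fin p) (l : Fin q) (z : ℝ)
    (ρ : ComplexMeasure (Dual d p q)) :
    pairScattering k₀ ε η R j l z ρ = momentOp hR k₀ ε η p q (Sum.inl j, Sum.inr l) z ρ := by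
  have hs : factorSign p q (Sum.inl j) ≠ factorSign p q (Sum.inr l) := by
    simp only [factorSign, Sum.elim_inl, Sum.elim_inr]; norm_num
  have e1 : edgeCoef (factorSign p q) (Sum.inl j, Sum.inr l) = 1 := by
    rw [edgeCoef, if_neg hs, if_pos (show factorSign p q (Sum.inl j) = 1 from rfl)]
  have e2 : (fun kv : Lat d × Dual d p q => Complex.exp (Complex.I *
        (z * η / (k₀ * ε) * ⟪kv.1, kv.2 (Sum.inl j) - kv.2 (Sum.inr l)⟫ : ℝ)))
      = fun kv => osc z (η / (k₀ * ε) * edgePhase (factorSign p q) (Sum.inl j, Sum.inr l) kv) := by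
    ext kv
    rw [osc, edgePhase]
    congr 3
    simp only [factorSign, Sum.elim_inl, Sum.elim_inr]
    ring
  have e3 : (fun kv : Lat d × Dual d p q => pairShift j l kv.1 kv.2)
      = edgeShift (factorSign p q) (Sum.inl j, Sum.inr l) := by
    ext1 kv
    ext1 m
    rcases m with m | m
    · by_cases h : m = j <;> simp [pairShift, edgeShift, factorSign, h]
    · by_cases h : m = l <;> simp [pairShift, edgeShift, factorSign, h]
  rw [pairScattering, momentOp, edgeOp_apply, e1, mul_one, kernelOp, e2, e3]
  rfl

lemma isSolutionOperator_pairPropagator (hR : IsCovariance R) (k₀ ε η : ℝ) (j : Fin p)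
    (l : Fin q) : IsSolutionOperator (pairScattering k₀ ε η R j l)
      (pairPropagator (p := p) (q := q) k₀ ε η R j l) := by
  have h := isSolutionOperator_flow (strongFamily_momentOp hR k₀ ε η (Sum.inl j, Sum.inr l))
  have e : pairScattering k₀ ε η R j l
      = fun z ρ => momentOp hR k₀ ε η p q (Sum.inl j, Sum.inr l) z ρ := by
    ext1 z; ext1 ρ; exact pairScattering_eq hR k₀ ε η j l z ρ
  rw [← e] at h
  exact Classical.epsilon_spec (p := IsSolutionOperator (pairScattering k₀ ε η R j l)) ⟨_, h⟩

/-- Identifies the operators in the statement with the flow of a single interaction, the building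
block of the combinatorial expansion. -/
lemma pairPropagator_eq (hR : IsCovariance R) (k₀ ε η : ℝ) (j : Fin p) (l : Fin q) {z : ℝ}
    (hz : 0 ≤ z) : pairPropagator (p := p) (q := q) k₀ ε η R j l z
      = (setFlow (strongFamily_momentOp hR k₀ ε η) {(Sum.inl j, Sum.inr l)} z).toLinearMap := by
  have e : pairScattering k₀ ε η R j l = fun z ρ =>
      (∑ e ∈ {(Sum.inl j, Sum.inr l)}, momentOp hR k₀ ε η p q e z) ρ := by
    ext1 z; ext1 ρ; rw [Finset.sum_singleton]; exact pairScattering_eq hR k₀ ε η j l z ρ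
  have h := isSolutionOperator_pairPropagator (p := p) (q := q) hR k₀ ε η j l
  rw [e] at h
  ext1 ρ
  exact h.eq_flow (strongFamily_sum (strongFamily_momentOp hR k₀ ε η) _) hz ρ

end Pairs

/-! ### The expansion of the centered moments -/

section Covering

variable {α : Type*} [DecidableEq α] {A : Type*} [AddCommGroup A] [Module ℂ A]

/-- If some `a` lies outside `V`, the sets with and without `a` cancel in pairs. -/
lemma altSum_superset [Fintype α] (V : Finset α) (c : A) :
    altSum (fun T => if V ⊆ T then c else 0) Finset.univ = if V = Finset.univ then c else 0 := by
  split_ifs with hV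
  · rw [altSum, Finset.sum_eq_single Finset.univ]
    · simp
    · intro T _ hT
      rw [if_neg, smul_zero]
      rw [hV, Finset.univ_subset_iff]
      exact hT
    · simp
  · obtain ⟨a, ha⟩ : ∃ a, a ∉ V := by
      by_contra! h
      exact hV (Finset.eq_univ_iff_forall.2 h)
    rw [← Finset.insert_erase (Finset.mem_univ a), altSum_insert _ (Finset.notMem_erase _ _),
      sub_eq_zero]
    congr 1
    ext T
    have : V ⊆ insert a T ↔ V ⊆ T := by
      rw [Finset.subset_insert_iff, Finset.erase_eq_of_notMem ha]
    simp only [this]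

/-- The factors met by a set of pairs. -/
def vertices (M : Finset (α × α)) : Finset α := M.image Prod.fst ∪ M.image Prod.snd

lemma mem_vertices {M : Finset (α × α)} {a : α} :
    a ∈ vertices M ↔ ∃ e ∈ M, e.1 = a ∨ e.2 = a := by
  simp only [vertices, Finset.mem_union, Finset.mem_image]
  constructor
  · rintro (⟨e, he, h⟩ | ⟨e, he, h⟩)
    · exact ⟨e, he, Or.inl h⟩
    · exact ⟨e, he, Or.inr h⟩
  · rintro ⟨e, he, h | h⟩
    · exact Or.inl ⟨e, he, h⟩
    · exact Or.inr ⟨e, he, h⟩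

lemma subset_offDiag_iff [Fintype α] (M : Finset (α × α)) (T : Finset α) :
    M ⊆ T.offDiag ↔ M ⊆ (Finset.univ : Finset α).offDiag ∧ vertices M ⊆ T := by
  constructor
  · refine fun h => ⟨h.trans (Finset.offDiag_mono (Finset.subset_univ T)), fun a ha => ?_⟩
    obtain ⟨e, he, h1⟩ := mem_vertices.1 ha
    have := Finset.mem_offDiag.1 (h he)
    rcases h1 with rfl | rfl
    · exact this.1
    · exact this.2.1
  · rintro ⟨h1, h2⟩ e he
    have := Finset.mem_offDiag.1 (h1 he)
    exact Finset.mem_offDiag.2 ⟨h2 (mem_vertices.2 ⟨e, he, Or.inl rfl⟩),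
      h2 (mem_vertices.2 ⟨e, he, Or.inr rfl⟩), this.2.2⟩

/-- Inclusion-exclusion over the factors leaves the sets of pairs that meet all the factors. -/
lemma altSum_sum_offDiag [Fintype α] (f : Finset (α × α) → A) :
    altSum (fun T : Finset α => ∑ M ∈ T.offDiag.powerset, f M) Finset.univ
      = ∑ M ∈ (Finset.univ : Finset α).offDiag.powerset with vertices M = Finset.univ, f M := by
  have e : (fun T : Finset α => ∑ M ∈ T.offDiag.powerset, f M) = fun T =>
      ∑ M ∈ (Finset.univ : Finset α).offDiag.powerset, if vertices M ⊆ T then f M else 0 := by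
    ext T
    rw [← Finset.sum_filter]
    congr 1
    ext M
    rw [Finset.mem_filter, Finset.mem_powerset, Finset.mem_powerset, subset_offDiag_iff]
  rw [e]
  have e2 : altSum (fun T : Finset α => ∑ M ∈ (Finset.univ : Finset α).offDiag.powerset,
        if vertices M ⊆ T then f M else 0) Finset.univ
      = ∑ M ∈ (Finset.univ : Finset α).offDiag.powerset,
        altSum (fun T => if vertices M ⊆ T then f M else 0) Finset.univ := by
    simp only [altSum, Finset.smul_sum]
    exact Finset.sum_comm
  rw [e2, Finset.sum_filter]
  exact Finset.sum_congr rfl fun M _ => altSum_superset _ _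

end Covering

/-! ### Resonant covering sets are perfect matchings -/

section Matching

variable {p q : ℕ}

/-- The pairs of a bijection between the two types of factors. -/
def matching (π : Fin p ≃ Fin q) : List ((Fin p ⊕ Fin q) × (Fin p ⊕ Fin q)) :=
  List.ofFn fun j => (Sum.inl j, Sum.inr (π j))

lemma mem_matching {π : Fin p ≃ Fin q} {e : (Fin p ⊕ Fin q) × (Fin p ⊕ Fin q)} :
    e ∈ matching π ↔ ∃ j, (Sum.inl j, Sum.inr (π j)) = e := by
  simp [matching, List.mem_ofFn]

lemma nodup_matching (π : Fin p ≃ Fin q) : (matching π).Nodup := by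
  rw [matching, List.nodup_ofFn]
  intro j j' h
  simpa using h

open Classical in
/-- The resonant sets of pairs meeting all the factors are the matchings. -/
lemma resonant_covering_eq : {M ∈ (Finset.univ : Finset (Fin p ⊕ Fin q)).offDiag.powerset |
      vertices M = Finset.univ ∧ Resonant (IsBad (factorSign p q)) Conflict M}
    = Finset.univ.image fun π : Fin p ≃ Fin q => (matching π).toFinset := by
  ext M
  simp only [Finset.mem_filter, Finset.mem_powerset, Finset.mem_image, Finset.mem_univ, true_and]
  constructor
  · rintro ⟨-, hcov, hgood, hdis⟩
    have hmem : ∀ a, ∃ e ∈ M, e.1 = a ∨ e.2 = a := fun a => by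
      rw [← mem_vertices, hcov]; exact Finset.mem_univ a
    have huniq : ∀ e ∈ M, ∀ f ∈ M, (e.1 = f.1 ∨ e.2 = f.2) → e = f := fun e he f hf h => by
      by_contra hne
      exact hdis e he f hf hne ⟨hne, h⟩
    have h1 : ∀ j : Fin p, ∃ l : Fin q, (Sum.inl j, Sum.inr l) ∈ M := fun j => by
      obtain ⟨e, he, h⟩ := hmem (Sum.inl j)
      obtain ⟨j', l', rfl⟩ := (not_isBad_iff e).1 (hgood e he)
      rcases h with h | h
      · cases h; exact ⟨l', he⟩
      · cases h
    have h2 : ∀ l : Fin q, ∃ j : Fin p, (Sum.inl j, Sum.inr l) ∈ M := fun l => by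
      obtain ⟨e, he, h⟩ := hmem (Sum.inr l)
      obtain ⟨j', l', rfl⟩ := (not_isBad_iff e).1 (hgood e he)
      rcases h with h | h
      · cases h
      · cases h
        exact ⟨j', he⟩
    -- Covering gives every factor a partner of the other type; absence of conflicts makes the
    -- partner unique. Hence `f` is a bijection and `M` is its graph.
    choose f hf using h1
    have hbij : Function.Bijective f := by
      constructor
      · intro j j' h
        have := huniq _ (hf j) _ (hf j') (Or.inr (by rw [h]))
        simpa using congrArg Prod.fst this
      · intro l
        obtain ⟨j, hj⟩ := h2 l
        have := huniq _ (hf j) _ hj (Or.inl rfl)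
        exact ⟨j, by simpa using congrArg Prod.snd this⟩
    refine ⟨Equiv.ofBijective f hbij, ?_⟩
    ext e
    rw [List.mem_toFinset, mem_matching]
    constructor
    · rintro ⟨j, rfl⟩
      exact hf j
    · intro he
      obtain ⟨j, l, rfl⟩ := (not_isBad_iff e).1 (hgood e he)
      exact ⟨j, huniq _ (hf j) _ he (Or.inl rfl)⟩
  · rintro ⟨π, rfl⟩
    refine ⟨fun e he => ?_, ?_, fun e he => ?_, fun e he f hf hne hc => ?_⟩
    · obtain ⟨j, rfl⟩ := mem_matching.1 (List.mem_toFinset.1 he)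
      simp
    · refine Finset.eq_univ_iff_forall.2 fun a => mem_vertices.2 ?_
      rcases a with j | l
      · exact ⟨_, List.mem_toFinset.2 (mem_matching.2 ⟨j, rfl⟩), Or.inl rfl⟩
      · exact ⟨_, List.mem_toFinset.2 (mem_matching.2 ⟨π.symm l, rfl⟩), Or.inr (by simp)⟩
    · obtain ⟨j, rfl⟩ := mem_matching.1 (List.mem_toFinset.1 he)
      exact (not_isBad_iff _).2 ⟨j, π j, rfl⟩
    · obtain ⟨j, rfl⟩ := mem_matching.1 (List.mem_toFinset.1 he)
      obtain ⟨j', rfl⟩ := mem_matching.1 (List.mem_toFinset.1 hf)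
      rcases hc.2 with h | h
      · apply hne
        have : j = j' := by simpa using h
        rw [this]
      · apply hne
        have : j = j' := by simpa using h
        rw [this]

lemma injective_matching :
    Function.Injective fun π : Fin p ≃ Fin q => (matching π).toFinset := by
  intro π π' h
  ext j : 1
  have h1 : (Sum.inl j, Sum.inr (π j)) ∈ (matching π').toFinset := by
    rw [← show (matching π).toFinset = (matching π').toFinset from h, List.mem_toFinset]
    exact mem_matching.2 ⟨j, rfl⟩
  obtain ⟨j', hj'⟩ := mem_matching.1 (List.mem_toFinset.1 h1)
  simp only [Prod.mk.injEq, Sum.inl.injEq, Sum.inr.injEq] at hj'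
  rw [← hj'.2, hj'.1]

end Matching

/-! ### The error operator and its norm -/

section ErrorOperator

variable {d p q : ℕ} {R : Lat d → ℝ}

lemma list_prod_map_smul {α A : Type*} [Ring A] [Algebra ℂ A] (c : ℂ) (f : α → A) (l : List α) :
    (l.map fun x => c • f x).prod = c ^ l.length • (l.map f).prod := by
  induction l with
  | nil => simp
  | cons a l ih => simp [ih, pow_succ, smul_smul, mul_comm]

/-- The alternating sum of the moment evolutions over the sets of factors. -/
noncomputable def centeredFlow (hR : IsCovariance R) (k₀ ε η : ℝ) (p q : ℕ) (z : ℝ) :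
    ComplexMeasure (Dual d p q) →L[ℂ] ComplexMeasure (Dual d p q) :=
  altSum (fun T => setFlow (strongFamily_momentOp hR k₀ ε η) T.offDiag z) Finset.univ

/-- The damping of a product of `p + q` factors. -/
noncomputable def totalDamping (R : Lat d → ℝ) (k₀ η : ℝ) (p q : ℕ) (z : ℝ) : ℝ :=
  Real.exp (-((p + q : ℕ) * (k₀ ^ 2 * R 0 / (8 * η ^ 2)) * z))

/-- The part of the centered evolution which is not described by `centeredOperator`. -/
noncomputable def errorOp (hR : IsCovariance R) (k₀ ε η : ℝ) (p q : ℕ) (z : ℝ) :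
    Module.End ℂ (ComplexMeasure (Dual d p q)) :=
  ((totalDamping R k₀ η p q z : ℝ) : ℂ) • (centeredFlow hR k₀ ε η p q z).toLinearMap
    - centeredOperator k₀ ε η R p q z

lemma covariance_zero_nonneg (hR : IsCovariance R) : 0 ≤ R 0 := by
  have h := covariance_eq_integral hR 0
  have h2 : (R 0 : ℂ) = ((∫ k : Lat d, spec R k : ℝ) : ℂ) := by
    rw [h]
    simp only [inner_zero_right, Complex.ofReal_zero, mul_zero, Complex.exp_zero, mul_one]
    exact integral_ofReal
  rw [Complex.ofReal_injective h2]
  exact integral_nonneg (spec_nonneg hR)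

lemma totalDamping_le_one (hR : IsCovariance R) (k₀ η : ℝ) (p q : ℕ) {z : ℝ} (hz : 0 ≤ z) :
    totalDamping R k₀ η p q z ≤ 1 := by
  refine Real.exp_le_one_iff.2 (neg_nonpos.2 ?_)
  have := covariance_zero_nonneg hR
  positivity

/-- The pairs of a matching commute, so the ordered product of the `U_e - 1` is the exact part of
the evolution for that matching. The `p` factors `U_η` multiply to the damping of all `p + q = 2 p`
factors, each of which is damped at half the rate of `U_η`. -/
lemma centeredOperator_eq (hR : IsCovariance R) (k₀ ε η : ℝ) {z : ℝ} (hz : 0 ≤ z) :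
    centeredOperator k₀ ε η R p q z = ((totalDamping R k₀ η p q z : ℝ) : ℂ) •
      ∑ π : Fin p ≃ Fin q,
        (exactFlow (strongFamily_momentOp hR k₀ ε η) (matching π).toFinset z).toLinearMap := by
  rw [centeredOperator, Finset.smul_sum]
  refine Finset.sum_congr rfl fun π _ => ?_
  have hpq : p = q := by simpa using Fintype.card_congr π
  have hcomm : ∀ e ∈ matching π, ∀ f ∈ matching π, e ≠ f → ∀ s t x,
      momentOp hR k₀ ε η p q e s (momentOp hR k₀ ε η p q f t x)
        = momentOp hR k₀ ε η p q f t (momentOp hR k₀ ε η p q e s x) := by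
    intro e he f hf hne s t x
    obtain ⟨j, rfl⟩ := mem_matching.1 he
    obtain ⟨j', rfl⟩ := mem_matching.1 hf
    refine edgeOp_comm _ _ _ _ _ ((not_isBad_iff _).2 ⟨_, _, rfl⟩)
      ((not_isBad_iff _).2 ⟨_, _, rfl⟩) hne (fun h => ?_) s t x
    rcases h.2 with h | h
    · apply hne
      have : j = j' := by simpa using h
      rw [this]
    · apply hne
      have : j = j' := by simpa using h
      rw [this]
  rw [exactFlow_list _ _ (nodup_matching π) hcomm hz]
  have e1 : (List.ofFn fun j : Fin p => ((damping k₀ η R z : ℝ) : ℂ) •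
      (pairPropagator (p := p) (q := q) k₀ ε η R j (π j) z - 1))
      = (matching π).map fun e => ((damping k₀ η R z : ℝ) : ℂ) •
        (setFlow (strongFamily_momentOp hR k₀ ε η) {e} z - 1).toLinearMap := by
    rw [matching, List.map_ofFn]
    congr 1
    ext1 j
    rw [pairPropagator_eq hR k₀ ε η j (π j) hz]
    rfl
  rw [e1]
  refine (list_prod_map_smul (A := Module.End ℂ (ComplexMeasure (Dual d p q))) _
    (fun e => (setFlow (strongFamily_momentOp hR k₀ ε η) {e} z - 1).toLinearMap) _).trans ?_
  congr 1
  · rw [matching, List.length_ofFn, ← Complex.ofReal_pow, damping, totalDamping, ← Real.exp_nat_mul]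
    congr 2
    rw [← hpq]
    push_cast
    rcases eq_or_ne η 0 with rfl | hη
    · simp
    field_simp
    ring
  · have := map_list_prod (ContinuousLinearMap.toLinearMapRingHom :
      (ComplexMeasure (Dual d p q) →L[ℂ] ComplexMeasure (Dual d p q)) →+* _) ((matching π).map fun e =>
        setFlow (strongFamily_momentOp hR k₀ ε η) {e} z - 1)
    rw [List.map_map] at this
    exact this.symm

/-- The exact parts do not depend on the set of factors `T`. They enter for `T` only through the
condition that their pairs lie in `T`, so inclusion-exclusion over `T` selects the sets of pairs
that leave no factor alone. -/
lemma centeredFlow_eq (hR : IsCovariance R) (k₀ ε η : ℝ) (z : ℝ) :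
    centeredFlow hR k₀ ε η p q z
      = ∑ M ∈ (Finset.univ : Finset (Fin p ⊕ Fin q)).offDiag.powerset with
          vertices M = Finset.univ, exactFlow (strongFamily_momentOp hR k₀ ε η) M z := by
  rw [centeredFlow, ← altSum_sum_offDiag]
  congr 1
  ext1 T
  rw [sum_exactFlow]

/-- The resonant covering sets are the matchings and cancel against `centeredOperator`. What remains
is a sum of non-resonant parts, at most `2^N` in number with `N` the squared number of factors,
multiplied by a damping at most `1`. -/
lemma norm_errorOp_le (hR : IsCovariance R) {k₀ ε η Z κ : ℝ} (hκ : 0 ≤ κ) (hZ : 1 ≤ Z)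
    (h : OscillationBound (fun k => (spec R k : ℂ)) (η / (k₀ * ε)) Z κ) {z : ℝ}
    (hz : z ∈ Icc 0 Z) (ρ : ComplexMeasure (Dual d p q)) :
    ‖errorOp hR k₀ ε η p q z ρ‖ ≤ 2 ^ (Fintype.card (Fin p ⊕ Fin q)) ^ 2 *
      (((k₀ ^ 2 / (4 * η ^ 2)) + (k₀ ^ 2 / (4 * η ^ 2)) ^ 2) * κ *
        Real.exp (momentBound R k₀ η * Z) ^ (6 * ((Fintype.card (Fin p ⊕ Fin q)) ^ 2 + 1) ^ 2)) *
      ‖ρ‖ := by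
  classical
  set g := k₀ ^ 2 / (4 * η ^ 2) with hg
  set hL := strongFamily_momentOp (p := p) (q := q) hR k₀ ε η
  set N := Fintype.card (Fin p ⊕ Fin q) ^ 2 with hN
  set B := Real.exp (momentBound R k₀ η * Z) with hB
  have hg0 : 0 ≤ g := by positivity
  have hosc := oscillating_edgeOp (integrable_spec hR).ofReal (measurable_spec hR)
    (factorSign p q) g (η / (k₀ * ε)) hg0 hκ factorSign_eq h
  have hB1 : 1 ≤ B := Real.one_le_exp (mul_nonneg
    (zero_le_one.trans (one_le_momentBound k₀ η)) (zero_le_one.trans hZ))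
  set U : Finset ((Fin p ⊕ Fin q) × (Fin p ⊕ Fin q)) := Finset.univ.offDiag with hU
  have hUN : U.card ≤ N := by
    rw [hU, Finset.offDiag_card, hN, Finset.card_univ, sq]
    exact Nat.sub_le _ _
  have hsplit : (errorOp hR k₀ ε η p q z) ρ = ((totalDamping R k₀ η p q z : ℝ) : ℂ) •
      ∑ M ∈ U.powerset with (vertices M = Finset.univ ∧
        ¬ Resonant (IsBad (factorSign p q)) Conflict M), exactFlow hL M z ρ := by
    have e1 : (errorOp hR k₀ ε η p q z) ρ = ((totalDamping R k₀ η p q z : ℝ) : ℂ) •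
        (centeredFlow hR k₀ ε η p q z ρ - ∑ π : Fin p ≃ Fin q,
          exactFlow hL (matching π).toFinset z ρ) := by
      rw [errorOp, centeredOperator_eq hR k₀ ε η hz.1, LinearMap.sub_apply, LinearMap.smul_apply,
        LinearMap.smul_apply, LinearMap.sum_apply, ← smul_sub]
      rfl
    rw [e1, centeredFlow_eq, _root_.sum_apply]
    congr 1
    rw [sub_eq_iff_eq_add', ← Finset.sum_image (f := fun M => exactFlow hL M z ρ)
      (g := fun π : Fin p ≃ Fin q => (matching π).toFinset) (fun _ _ _ _ h => injective_matching h),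
      ← resonant_covering_eq,
      ← Finset.sum_filter_add_sum_filter_not _
        (fun M => Resonant (IsBad (factorSign p q)) Conflict M), Finset.filter_filter,
      Finset.filter_filter]
  rw [hsplit, norm_smul, Complex.norm_real, Real.norm_of_nonneg (show 0 ≤ totalDamping R k₀ η p q z from (Real.exp_pos _).le)]
  have hb : ∀ M ∈ {M ∈ U.powerset | vertices M = Finset.univ ∧
      ¬ Resonant (IsBad (factorSign p q)) Conflict M}, ‖exactFlow hL M z ρ‖
        ≤ (g + g ^ 2) * κ * B ^ (6 * (N + 1) ^ 2) * ‖ρ‖ := by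
    intro M hM
    obtain ⟨hMU, -, hres⟩ := Finset.mem_filter.1 hM
    have h1 := norm_exactFlow_le_of_not_resonant hL hosc (by positivity)
      (one_le_momentBound k₀ η) hZ M hres hz
    refine ((exactFlow hL M z).le_of_opNorm_le h1 ρ).trans ?_
    have hMN : M.card ≤ N := (Finset.card_le_card (Finset.mem_powerset.1 hMU)).trans hUN
    gcongr
  calc totalDamping R k₀ η p q z * _ ≤ 1 * ((2 : ℝ) ^ N * ((g + g ^ 2) * κ *
        B ^ (6 * (N + 1) ^ 2) * ‖ρ‖)) := by
        gcongr
        · exact totalDamping_le_one hR k₀ η p q hz.1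
        · refine (norm_sum_le _ _).trans ((Finset.sum_le_card_nsmul _ _ _ hb).trans ?_)
          rw [nsmul_eq_mul]
          gcongr
          have : (Finset.filter (fun M => vertices M = Finset.univ ∧
              ¬ Resonant (IsBad (factorSign p q)) Conflict M) U.powerset).card ≤ 2 ^ N := by
            refine (Finset.card_filter_le _ _).trans ?_
            rw [Finset.card_powerset]
            exact Nat.pow_le_pow_right (by norm_num) hUN
          exact_mod_cast this
    _ = _ := by ring

end ErrorOperator

/-! ### Conjugation according to a sign -/

/-- The identity of `ℂ` if `s = 1`, the conjugation otherwise. -/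
noncomputable def conjSign (s : ℝ) : ℂ →L[ℝ] ℂ :=
  if s = 1 then ContinuousLinearMap.id ℝ ℂ else (Complex.conjCLE : ℂ →L[ℝ] ℂ)

lemma conjSign_one (z : ℂ) : conjSign 1 z = z := by simp [conjSign]

lemma conjSign_neg_one (z : ℂ) : conjSign (-1) z = conj z := by
  rw [conjSign, if_neg (by norm_num)]; rfl

lemma conjSign_mul (s : ℝ) (z w : ℂ) : conjSign s (z * w) = conjSign s z * conjSign s w := by
  by_cases h : s = 1 <;> simp [conjSign, h]

lemma conjSign_conjSign (s : ℝ) (z : ℂ) : conjSign s (conjSign s z) = z := by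
  by_cases h : s = 1 <;> simp [conjSign, h]

lemma norm_conjSign (s : ℝ) (z : ℂ) : ‖conjSign s z‖ = ‖z‖ := by
  by_cases h : s = 1 <;> simp [conjSign, h]

lemma conjSign_ofReal (s t : ℝ) : conjSign s (t : ℂ) = t := by
  by_cases h : s = 1 <;> simp [conjSign, h]

lemma conjSign_I {s : ℝ} (hs : s = 1 ∨ s = -1) : conjSign s Complex.I = s * Complex.I := by
  rcases hs with rfl | rfl
  · simp [conjSign_one]
  · simp [conjSign_neg_one]

lemma conjSign_osc {s : ℝ} (hs : s = 1 ∨ s = -1) (t : ℝ) :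
    conjSign s (Complex.exp (Complex.I * (t : ℝ))) = Complex.exp (Complex.I * ((s * t : ℝ) : ℂ)) := by
  rcases hs with rfl | rfl
  · simp [conjSign_one]
  · rw [conjSign_neg_one, ← Complex.exp_conj]; simp

lemma conjSign_integral {X : Type*} [MeasurableSpace X] {μ : Measure X} (s : ℝ) (f : X → ℂ) :
    conjSign s (∫ x, f x ∂μ) = ∫ x, conjSign s (f x) ∂μ := by
  by_cases h : s = 1
  · simp [conjSign, h]
  · simpa [conjSign, h] using (integral_conj (f := f) (μ := μ)).symm

/-! ### Amplitudes of a wave tested against functions of the dual variable -/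

section Amplitude

variable {d : ℕ}

lemma two_pi_inv_ne_zero : ((2 * Real.pi)⁻¹ : ℝ) ≠ 0 := by positivity

lemma quasiMeasurePreserving_smul {c : ℝ} (hc : c ≠ 0) :
    Measure.QuasiMeasurePreserving (fun x : Lat d => c • x) volume volume :=
  ⟨measurable_const_smul c, by
    rw [Measure.map_addHaar_smul volume hc]
    exact Measure.smul_absolutelyContinuous⟩

lemma fourierL2_sub (w w' : Lp ℂ 2 (volume : Measure (Lat d))) :
    fourierL2 (w - w') =ᵐ[volume] fun ξ => fourierL2 w ξ - fourierL2 w' ξ := by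
  have h : ((𝓕 (w - w') : Lp ℂ 2 (volume : Measure (Lat d))) : Lat d → ℂ)
      =ᵐ[volume] fun y => (𝓕 w : Lp ℂ 2 (volume : Measure (Lat d))) y
        - (𝓕 w' : Lp ℂ 2 (volume : Measure (Lat d))) y := by
    have e : (𝓕 (w - w') : Lp ℂ 2 (volume : Measure (Lat d))) = 𝓕 w - 𝓕 w' := by
      exact map_sub (Lp.fourierTransformₗᵢ (Lat d) ℂ) w w'
    rw [e]
    exact Lp.coeFn_sub _ _
  exact (quasiMeasurePreserving_smul two_pi_inv_ne_zero).ae_eq_comp h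

lemma memLp_fourierL2 (w : Lp ℂ 2 (volume : Measure (Lat d))) : MemLp (fourierL2 w) 2 := by
  have h := Lp.memLp (𝓕 w : Lp ℂ 2 (volume : Measure (Lat d)))
  have h2 : MemLp (𝓕 w : Lp ℂ 2 (volume : Measure (Lat d))) 2
      (Measure.map (fun x : Lat d => (2 * Real.pi)⁻¹ • x) volume) := by
    rw [Measure.map_addHaar_smul volume two_pi_inv_ne_zero]
    exact h.smul_measure ENNReal.ofReal_ne_top
  exact h2.comp_of_map (measurable_const_smul _).aemeasurable

/-- The norm of `w ↦ fourierL2 w`. -/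
noncomputable def fourierConst (d : ℕ) : ℝ :=
  (ENNReal.ofReal |((2 * Real.pi)⁻¹ ^ d)⁻¹| ^ (1 / 2 : ℝ)).toReal

lemma eLpNorm_fourierL2 (w : Lp ℂ 2 (volume : Measure (Lat d))) :
    (eLpNorm (fourierL2 w) 2 volume).toReal = fourierConst d * ‖w‖ := by
  have h := Lp.memLp (𝓕 w : Lp ℂ 2 (volume : Measure (Lat d)))
  have e := eLpNorm_map_measure (p := 2) (f := fun x : Lat d => (2 * Real.pi)⁻¹ • x) (μ := volume)
    (g := (𝓕 w : Lp ℂ 2 (volume : Measure (Lat d))))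
    (by rw [Measure.map_addHaar_smul volume two_pi_inv_ne_zero]
        exact h.1.smul_measure _) (measurable_const_smul _).aemeasurable
  rw [Measure.map_addHaar_smul volume two_pi_inv_ne_zero,
    eLpNorm_smul_measure_of_ne_top (by norm_num)] at e
  have e2 : eLpNorm (fourierL2 w) 2 volume
    = eLpNorm ((𝓕 w : Lp ℂ 2 (volume : Measure (Lat d))) ∘ fun x : Lat d => (2 * Real.pi)⁻¹ • x) 2
      volume := rfl
  rw [e2, ← e, smul_eq_mul, ENNReal.toReal_mul, ← Lp.norm_def, Lp.norm_fourier_eq, fourierConst]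
  simp

lemma fourierConst_nonneg (d : ℕ) : 0 ≤ fourierConst d := ENNReal.toReal_nonneg

/-- The square integral norm of a function. -/
noncomputable def l2 (χ : Lat d → ℂ) : ℝ := (eLpNorm χ 2 volume).toReal

lemma l2_nonneg (χ : Lat d → ℂ) : 0 ≤ l2 χ := ENNReal.toReal_nonneg

/-- The integral of `û χ` (or of `û^* χ`) for `u = w`. -/
noncomputable def amp (s : ℝ) (w : Lp ℂ 2 (volume : Measure (Lat d))) (χ : Lat d → ℂ) : ℂ :=
  ∫ ξ, conjSign s (fourierL2 w ξ) * χ ξ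

lemma memLp_conjSign (s : ℝ) {f : Lat d → ℂ} (hf : MemLp f 2) :
    MemLp (fun ξ => conjSign s (f ξ)) 2 := by
  refine hf.of_le ((conjSign s).continuous.comp_aestronglyMeasurable hf.1) ?_
  exact ae_of_all _ fun x => (norm_conjSign _ _).le

lemma integrable_amp (s : ℝ) (w : Lp ℂ 2 (volume : Measure (Lat d))) {χ : Lat d → ℂ}
    (hχ : MemLp χ 2) : Integrable (fun ξ => conjSign s (fourierL2 w ξ) * χ ξ) :=
  (memLp_conjSign s (memLp_fourierL2 w)).integrable_mul hχ

lemma norm_integral_mul_le {f g : Lat d → ℂ} (hf : MemLp f 2) (hg : MemLp g 2) :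
    ‖∫ ξ, f ξ * g ξ‖ ≤ l2 f * l2 g := by
  have h := eLpNorm_smul_le_mul_eLpNorm (p := 2) (q := 2) (r := 1) (μ := (volume : Measure (Lat d)))
    hg.1 hf.1
  have h1 : ‖∫ ξ, f ξ * g ξ‖ₑ ≤ eLpNorm (f • g) 1 volume := by
    rw [eLpNorm_one_eq_lintegral_enorm]
    exact enorm_integral_le_lintegral_enorm _
  have h2 := ENNReal.toReal_mono (ENNReal.mul_ne_top hf.2.ne hg.2.ne) (h1.trans h)
  rwa [toReal_enorm, ENNReal.toReal_mul] at h2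

lemma norm_amp_le (s : ℝ) (w : Lp ℂ 2 (volume : Measure (Lat d))) {χ : Lat d → ℂ}
    (hχ : MemLp χ 2) : ‖amp s w χ‖ ≤ fourierConst d * ‖w‖ * l2 χ := by
  refine (norm_integral_mul_le (memLp_conjSign s (memLp_fourierL2 w)) hχ).trans_eq ?_
  rw [← eLpNorm_fourierL2, l2]
  congr 2
  exact eLpNorm_congr_norm_ae (ae_of_all _ fun x => norm_conjSign _ _)

lemma amp_sub_left (s : ℝ) (w w' : Lp ℂ 2 (volume : Measure (Lat d))) {χ : Lat d → ℂ}
    (hχ : MemLp χ 2) : amp s (w - w') χ = amp s w χ - amp s w' χ := by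
  rw [amp, amp, amp, ← integral_sub (integrable_amp s w hχ) (integrable_amp s w' hχ)]
  refine integral_congr_ae ?_
  filter_upwards [fourierL2_sub w w'] with ξ h
  rw [h, map_sub, sub_mul]

lemma continuous_amp (s : ℝ) {χ : Lat d → ℂ} (hχ : MemLp χ 2) :
    Continuous fun w : Lp ℂ 2 (volume : Measure (Lat d)) => amp s w χ := by
  refine continuous_iff_continuousAt.2 fun w => ?_
  rw [ContinuousAt, tendsto_iff_norm_sub_tendsto_zero]
  have h : Tendsto (fun w' => fourierConst d * ‖w' - w‖ * l2 χ) (𝓝 w)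
      (𝓝 (fourierConst d * ‖w - w‖ * l2 χ)) :=
    ((continuous_const.mul (continuous_id.sub continuous_const).norm).mul
      continuous_const).tendsto w
  rw [sub_self, norm_zero, mul_zero, zero_mul] at h
  refine squeeze_zero (fun _ => norm_nonneg _) (fun w' => ?_) h
  rw [← amp_sub_left s _ _ hχ]
  exact norm_amp_le s _ hχ

/-! ### Test functions -/

/-- Smooth functions with compact support. -/
def IsTest (χ : Lat d → ℂ) : Prop := ContDiff ℝ (⊤ : ℕ∞) χ ∧ HasCompactSupport χ

lemma IsTest.mul {χ : Lat d → ℂ} (h : IsTest χ) {g : Lat d → ℂ} (hg : ContDiff ℝ (⊤ : ℕ∞) g) :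
    IsTest fun ξ => g ξ * χ ξ :=
  ⟨hg.mul h.1, h.2.mul_left⟩

lemma IsTest.shift {χ : Lat d → ℂ} (h : IsTest χ) (a : Lat d) : IsTest fun ξ => χ (ξ + a) :=
  ⟨h.1.comp (contDiff_id.add contDiff_const), h.2.comp_homeomorph (Homeomorph.addRight a)⟩

lemma IsTest.smul {χ : Lat d → ℂ} (h : IsTest χ) {c : ℝ} (hc : c ≠ 0) : IsTest fun ξ => χ (c • ξ) :=
  ⟨h.1.comp (contDiff_const_smul c), h.2.comp_homeomorph (Homeomorph.smulOfNeZero c hc)⟩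

lemma IsTest.conjSign {χ : Lat d → ℂ} (h : IsTest χ) (s : ℝ) :
    IsTest fun ξ => conjSign s (χ ξ) :=
  ⟨(ItoSchrodinger.conjSign s).contDiff.comp h.1, h.2.comp_left (map_zero _)⟩

lemma IsTest.memLp {χ : Lat d → ℂ} (h : IsTest χ) (p : ℝ≥0∞) : MemLp χ p :=
  h.1.continuous.memLp_of_hasCompactSupport h.2

lemma contDiff_osc_comp {g : Lat d → ℝ} (hg : ContDiff ℝ (⊤ : ℕ∞) g) (r : ℝ) :
    ContDiff ℝ (⊤ : ℕ∞) fun ξ => osc r (g ξ) := by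
  unfold osc
  refine ContDiff.cexp (contDiff_const.mul ?_)
  exact Complex.ofRealCLM.contDiff.comp (contDiff_const.mul hg)

/-- The rescaled test function whose Fourier transform is `waveTest`. -/
noncomputable def dualTest (s : ℝ) {χ : Lat d → ℂ} (h : IsTest χ) : 𝓢(Lat d, ℂ) :=
  HasCompactSupport.toSchwartzMap
    (((h.conjSign s).smul (c := 2 * Real.pi) (by positivity)).mul
      (contDiff_const (c := ((2 * Real.pi) ^ d : ℂ)))).2
    (((h.conjSign s).smul (c := 2 * Real.pi) (by positivity)).mul
      (contDiff_const (c := ((2 * Real.pi) ^ d : ℂ)))).1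

lemma dualTest_apply (s : ℝ) {χ : Lat d → ℂ} (h : IsTest χ) (y : Lat d) :
    dualTest s h y = (2 * Real.pi) ^ d * conjSign s (χ ((2 * Real.pi) • y)) := rfl

/-- The function `∫ χ(ξ) e^{-i x·ξ} dξ` (or with the conjugate of `χ`). -/
noncomputable def waveTest (s : ℝ) {χ : Lat d → ℂ} (h : IsTest χ) : 𝓢(Lat d, ℂ) :=
  𝓕 (dualTest s h)

lemma pairing_fourier (w : Lp ℂ 2 (volume : Measure (Lat d))) (Ψ : 𝓢(Lat d, ℂ)) :
    pairing w (𝓕 Ψ) = ∫ y, (𝓕 w : Lp ℂ 2 (volume : Measure (Lat d))) y * Ψ y := by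
  have h1 := congrArg (fun T => T Ψ) (Lp.fourier_toTemperedDistribution_eq w)
  simp only [TemperedDistribution.fourier_apply, Lp.toTemperedDistribution_apply] at h1
  rw [pairing]
  simpa [smul_eq_mul, mul_comm] using h1

lemma integral_comp_two_pi_smul (f : Lat d → ℂ) :
    ∫ y : Lat d, (2 * Real.pi : ℂ) ^ d * f ((2 * Real.pi) • y) = ∫ ξ, f ξ := by
  rw [integral_const_mul, Measure.integral_comp_smul]
  simp only [finrank_euclideanSpace, Fintype.card_fin, abs_inv, abs_pow, Complex.real_smul]
  rw [abs_of_pos (by positivity : (0 : ℝ) < 2 * Real.pi)]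
  push_cast
  rw [← mul_assoc, mul_inv_cancel₀ (pow_ne_zero _ (by
    exact_mod_cast (by positivity : (2 * Real.pi) ≠ 0))), one_mul]

/-- By `∫ w 𝓕Ψ = ∫ 𝓕w Ψ`, an amplitude in the dual variable is a linear functional of the wave of
the kind admitted in the martingale problem. For `s = -1` the conjugation of `χ` in `waveTest` is
undone by the outer one. -/
lemma conjSign_pairing_waveTest (s : ℝ) (w : Lp ℂ 2 (volume : Measure (Lat d))) {χ : Lat d → ℂ}
    (h : IsTest χ) : conjSign s (pairing w (waveTest s h)) = amp s w χ := by
  rw [waveTest, pairing_fourier, amp,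
    ← integral_comp_two_pi_smul (fun ξ => conjSign s (fourierL2 w ξ) * χ ξ), conjSign_integral]
  refine integral_congr_ae (ae_of_all _ fun y => ?_)
  simp only [dualTest_apply, conjSign_mul, conjSign_conjSign, fourierL2]
  rw [smul_smul, inv_mul_cancel₀ (by positivity), one_smul]
  have : conjSign s ((2 * Real.pi : ℂ) ^ d) = (2 * Real.pi : ℂ) ^ d := by
    exact_mod_cast conjSign_ofReal s ((2 * Real.pi) ^ d)
  rw [this]; ring

lemma IsTest.normSq_mul {χ : Lat d → ℂ} (h : IsTest χ) :
    IsTest fun ξ => ((-‖ξ‖ ^ 2 : ℝ) : ℂ) * χ ξ :=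
  h.mul (Complex.ofRealCLM.contDiff.comp (contDiff_norm_sq ℝ).neg)

/-- The Laplacian is a Fourier multiplier, and applying the transform twice is the reflection, under
which `|y|²` is invariant. -/
lemma laplacian_fourier (Ψ : 𝓢(Lat d, ℂ)) :
    Δ (𝓕 Ψ) = 𝓕 (-((2 * Real.pi) ^ 2 : ℝ) • SchwartzMap.smulLeftCLM ℂ
      (fun y : Lat d => ((‖y‖ ^ 2 : ℝ) : ℂ)) Ψ) := by
  have hg : (fun y : Lat d => ((‖y‖ ^ 2 : ℝ) : ℂ)).HasTemperateGrowth := by fun_prop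
  have hg' : (fun y : Lat d => ‖y‖ ^ 2).HasTemperateGrowth := by fun_prop
  have h2 : ∀ y, 𝓕 (𝓕 Ψ) y = Ψ (-y) := fun y => by
    have := congrArg (fun f : 𝓢(Lat d, ℂ) => f (-y)) (FourierTransform.fourierInv_fourier_eq (F := 𝓢(Lat d, ℂ)) Ψ)
    simp only [SchwartzMap.fourierInv_apply_eq] at this
    simpa using this
  have h3 : SchwartzMap.smulLeftCLM ℂ (fun y : Lat d => ‖y‖ ^ 2) (𝓕 (𝓕 Ψ))
      = SchwartzMap.compCLMOfContinuousLinearEquiv ℂ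
        (LinearIsometryEquiv.neg ℝ (E := Lat d)).toContinuousLinearEquiv (SchwartzMap.smulLeftCLM ℂ
          (fun y : Lat d => ((‖y‖ ^ 2 : ℝ) : ℂ)) Ψ) := by
    ext y
    rw [SchwartzMap.smulLeftCLM_apply_apply hg', h2,
      SchwartzMap.compCLMOfContinuousLinearEquiv_apply, Function.comp,
      SchwartzMap.smulLeftCLM_apply_apply hg]
    simp
  rw [SchwartzMap.laplacian_eq_fourierMultiplierCLM, FourierTransform.fourier_smul, neg_smul,
    neg_smul]
  congr 2
  rw [SchwartzMap.fourierMultiplierCLM_apply]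
  change 𝓕⁻ (SchwartzMap.smulLeftCLM ℂ (fun y : Lat d => ‖y‖ ^ 2) (𝓕 (𝓕 Ψ))) = _
  rw [h3]
  ext x
  rw [SchwartzMap.fourierInv_coe, Real.fourierInv_eq_fourier_neg, SchwartzMap.fourier_coe]
  have := Real.fourier_comp_linearIsometry (LinearIsometryEquiv.neg ℝ (E := Lat d))
    (SchwartzMap.smulLeftCLM ℂ (fun y : Lat d => ((‖y‖ ^ 2 : ℝ) : ℂ)) Ψ) (-x)
  simpa [Function.comp_def] using this

lemma laplacian_waveTest (s : ℝ) {χ : Lat d → ℂ} (h : IsTest χ) :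
    Δ (waveTest s h) = waveTest s h.normSq_mul := by
  rw [waveTest, laplacian_fourier, waveTest]
  congr 1
  ext y
  have hg : (fun y : Lat d => ((‖y‖ ^ 2 : ℝ) : ℂ)).HasTemperateGrowth := by fun_prop
  rw [_root_.smul_apply, SchwartzMap.smulLeftCLM_apply_apply hg, dualTest_apply,
    dualTest_apply, conjSign_mul, conjSign_ofReal, norm_smul, Real.norm_of_nonneg (by positivity)]
  simp only [smul_eq_mul, Complex.real_smul]
  push_cast
  ring

lemma waveTest_apply (s : ℝ) {χ : Lat d → ℂ} (h : IsTest χ) (x : Lat d) :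
    waveTest s h x = ∫ ξ, Complex.exp (Complex.I * ((-⟪ξ, x⟫ : ℝ) : ℂ)) * conjSign s (χ ξ) := by
  rw [waveTest, SchwartzMap.fourier_coe, Real.fourier_eq',
    ← integral_comp_two_pi_smul (fun ξ => Complex.exp (Complex.I * ((-⟪ξ, x⟫ : ℝ) : ℂ))
      * conjSign s (χ ξ))]
  refine integral_congr_ae (ae_of_all _ fun y => ?_)
  simp only [dualTest_apply, smul_eq_mul, inner_smul_left]
  have : ((-2 * Real.pi * ⟪y, x⟫ : ℝ) : ℂ) * Complex.I
      = Complex.I * ((-((starRingEnd ℝ) (2 * Real.pi) * ⟪y, x⟫) : ℝ) : ℂ) := by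
    simp; ring
  rw [this]
  ring

lemma waveTest_shift (s : ℝ) {χ : Lat d → ℂ} (h : IsTest χ) (k x : Lat d) :
    waveTest s (h.shift (s • k)) x
      = waveTest s h x * Complex.exp (Complex.I * ((s * ⟪k, x⟫ : ℝ) : ℂ)) := by
  rw [waveTest_apply, waveTest_apply, ← integral_mul_const,
    ← integral_add_right_eq_self (fun ξ => Complex.exp (Complex.I * ((-⟪ξ, x⟫ : ℝ) : ℂ))
      * conjSign s (χ ξ) * _) (s • k)]
  refine integral_congr_ae (ae_of_all _ fun ξ => ?_)
  simp only []
  have : Complex.exp (Complex.I * ((-⟪ξ, x⟫ : ℝ) : ℂ))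
      = Complex.exp (Complex.I * ((-⟪ξ + s • k, x⟫ : ℝ) : ℂ))
        * Complex.exp (Complex.I * ((s * ⟪k, x⟫ : ℝ) : ℂ)) := by
    rw [← Complex.exp_add, inner_add_left, real_inner_smul_left]
    congr 1
    push_cast
    ring
  rw [this]
  ring

/-- A plane wave of frequency `k` in the noise acts on an amplitude by a translation of its test
function by `s k`. This is the origin of the frequency exchange. -/
lemma integral_waveTest_mul (s : ℝ) (hs : s = 1 ∨ s = -1) (w : Lp ℂ 2 (volume : Measure (Lat d)))
    {χ : Lat d → ℂ} (h : IsTest χ) (k : Lat d) :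
    ∫ x, conjSign s (w x * waveTest s h x) * Complex.exp (Complex.I * (⟪k, x⟫ : ℝ))
      = amp s w fun ξ => χ (ξ + s • k) := by
  rw [← conjSign_pairing_waveTest s w (h.shift (s • k)), pairing, conjSign_integral]
  refine integral_congr_ae (ae_of_all _ fun x => ?_)
  simp only []
  rw [waveTest_shift s h, ← mul_assoc, conjSign_mul s (w x * _), conjSign_osc hs, ← mul_assoc]
  rcases hs with rfl | rfl <;> simp

end Amplitude

/-! ### The generator on cylinder functions -/

section Quadratic

variable {d : ℕ} {R : Lat d → ℝ} {V : Type*} [NormedAddCommGroup V] [NormedSpace ℝ V]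
  {G : Type*} [NormedAddCommGroup G] [NormedSpace ℝ G] [CompleteSpace G]

/-- The contraction of a bilinear map with the covariance of the noise. -/
noncomputable def covForm (R : Lat d → ℝ) (B : V →L[ℝ] V →L[ℝ] G) (a b : Lat d → V) : G :=
  ∫ x, ∫ y, R (x - y) • B (a x) (b y)

lemma integrable_covForm (hR : IsCovariance R) (B : V →L[ℝ] V →L[ℝ] G) {a b : Lat d → V}
    (ha : Integrable a) (hb : Integrable b) :
    Integrable (fun z : Lat d × Lat d => R (z.1 - z.2) • B (a z.1) (b z.2))
      (volume.prod volume) := by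
  obtain ⟨C, hC⟩ := hR.bounded
  have h1 : Integrable (fun z : Lat d × Lat d => ‖B‖ * (‖a z.1‖ * ‖b z.2‖))
      (volume.prod volume) := (ha.norm.mul_prod hb.norm).const_mul _
  have h2 : Integrable (fun z : Lat d × Lat d => B (a z.1) (b z.2)) (volume.prod volume) := by
    refine h1.mono' ?_ (ae_of_all _ fun z => ?_)
    · exact B.aestronglyMeasurable_comp₂ (ha.1.comp_fst) (hb.1.comp_snd)
    · refine (B.le_opNorm₂ _ _).trans_eq (by ring)
  refine h2.bdd_smul C ?_ (ae_of_all _ fun z => hC _)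
  exact (hR.continuous.comp (continuous_fst.sub continuous_snd)).aestronglyMeasurable

lemma covForm_eq (hR : IsCovariance R) (B : V →L[ℝ] V →L[ℝ] G) {a b : Lat d → V}
    (ha : Integrable a) (hb : Integrable b) :
    covForm R B a b = ∫ z : Lat d × Lat d, R (z.1 - z.2) • B (a z.1) (b z.2)
      ∂(volume.prod volume) :=
  (integral_prod _ (integrable_covForm hR B ha hb)).symm

lemma norm_covForm_le {C : ℝ} (hC : ∀ x, |R x| ≤ C)
    (B : V →L[ℝ] V →L[ℝ] G) {a b : Lat d → V} (ha : Integrable a) (hb : Integrable b) :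
    ‖covForm R B a b‖ ≤ C * ‖B‖ * (∫ x, ‖a x‖) * ∫ y, ‖b y‖ := by
  have h1 : ∀ x, ‖∫ y, R (x - y) • B (a x) (b y)‖ ≤ C * ‖B‖ * ‖a x‖ * ∫ y, ‖b y‖ := fun x => by
    rw [← integral_const_mul]
    refine norm_integral_le_of_norm_le (hb.norm.const_mul _) (ae_of_all _ fun y => ?_)
    rw [norm_smul]
    calc ‖R (x - y)‖ * ‖B (a x) (b y)‖ ≤ C * (‖B‖ * ‖a x‖ * ‖b y‖) :=
          mul_le_mul (hC _) (B.le_opNorm₂ _ _) (norm_nonneg _) ((abs_nonneg _).trans (hC 0))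
      _ = _ := by ring
  refine (norm_integral_le_of_norm_le ((ha.norm.const_mul (C * ‖B‖)).mul_const _)
    (ae_of_all _ h1)).trans_eq ?_
  rw [integral_mul_const, integral_const_mul]

/-- Telescoping in the three arguments. It serves the continuity of the second order term when both
the Hessian and the noise direction move with the wave. -/
lemma covForm_sub (hR : IsCovariance R) (B B' : V →L[ℝ] V →L[ℝ] G) {a a' : Lat d → V}
    (ha : Integrable a) (ha' : Integrable a') :
    covForm R B' a' a' - covForm R B a a = covForm R (B' - B) a' a'
      + (covForm R B (fun x => a' x - a x) a' + covForm R B a (fun x => a' x - a x)) := by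
  have hs : Integrable (fun x => a' x - a x) := ha'.sub ha
  rw [covForm_eq hR _ ha' ha', covForm_eq hR _ ha ha, covForm_eq hR _ ha' ha',
    covForm_eq hR _ hs ha', covForm_eq hR _ ha hs,
    ← integral_sub (integrable_covForm hR _ ha' ha') (integrable_covForm hR _ ha ha),
    ← integral_add (integrable_covForm hR _ hs ha') (integrable_covForm hR _ ha hs),
    ← integral_add (integrable_covForm hR _ ha' ha')
      ((integrable_covForm hR _ hs ha').add (integrable_covForm hR _ ha hs))]
  refine integral_congr_ae (ae_of_all _ fun z => ?_)
  simp only [_root_.sub_apply, map_sub, smul_sub]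
  abel

lemma norm_covForm_sub_le (hR : IsCovariance R) {C : ℝ} (hC : ∀ x, |R x| ≤ C)
    (B B' : V →L[ℝ] V →L[ℝ] G) {a a' : Lat d → V} (ha : Integrable a) (ha' : Integrable a') :
    ‖covForm R B' a' a' - covForm R B a a‖ ≤
      C * ‖B' - B‖ * ((∫ x, ‖a x‖) + ∫ x, ‖a' x - a x‖) ^ 2
      + (C * ‖B‖ * (∫ x, ‖a' x - a x‖) * ((∫ x, ‖a x‖) + ∫ x, ‖a' x - a x‖)
        + C * ‖B‖ * (∫ x, ‖a x‖) * ∫ x, ‖a' x - a x‖) := by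
  have hC0 : 0 ≤ C := (abs_nonneg _).trans (hC 0)
  have hs : Integrable (fun x => a' x - a x) := ha'.sub ha
  have p2 : 0 ≤ ∫ x, ‖a' x‖ := integral_nonneg fun _ => norm_nonneg _
  have p3 : 0 ≤ ∫ x, ‖a' x - a x‖ := integral_nonneg fun _ => norm_nonneg _
  have b2 : ∫ x, ‖a' x‖ ≤ (∫ x, ‖a x‖) + ∫ x, ‖a' x - a x‖ := by
    rw [← integral_add ha.norm hs.norm]
    refine integral_mono ha'.norm (ha.norm.add hs.norm) fun x => ?_
    simpa using norm_add_le (a x) (a' x - a x)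
  rw [covForm_sub hR B B' ha ha']
  refine (norm_add_le _ _).trans (add_le_add ((norm_covForm_le hC _ ha' ha').trans ?_)
      ((norm_add_le _ _).trans (add_le_add ((norm_covForm_le hC _ hs ha').trans ?_)
      (norm_covForm_le hC _ ha hs))))
  · rw [mul_assoc, ← sq]
    refine mul_le_mul_of_nonneg_left ?_ (mul_nonneg hC0 (norm_nonneg (B' - B)))
    exact pow_le_pow_left₀ p2 b2 2
  · exact mul_le_mul_of_nonneg_left b2 (mul_nonneg (mul_nonneg hC0 (norm_nonneg B)) p3)

lemma tendsto_norm_sub {E W : Type*} [SeminormedAddCommGroup E] {l : Filter W} {B : W → E} {B₀ : E}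
    (h : Tendsto B l (𝓝 B₀)) : Tendsto (fun w => ‖B w - B₀‖) l (𝓝 0) :=
  tendsto_iff_norm_sub_tendsto_zero.1 h

lemma tendsto_covForm {W : Type*} {l : Filter W} (hR : IsCovariance R)
    {B : W → V →L[ℝ] V →L[ℝ] G} {B₀ : V →L[ℝ] V →L[ℝ] G} {a : W → Lat d → V} {a₀ : Lat d → V}
    (hB : Tendsto (fun w => ‖B w - B₀‖) l (𝓝 0)) (ha : ∀ w, Integrable (a w)) (ha₀ : Integrable a₀)
    (hc : Tendsto (fun w => ∫ x, ‖a w x - a₀ x‖) l (𝓝 0)) :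
    Tendsto (fun w => covForm R (B w) (a w) (a w)) l (𝓝 (covForm R B₀ a₀ a₀)) := by
  obtain ⟨C, hC⟩ := hR.bounded
  rw [tendsto_iff_norm_sub_tendsto_zero]
  have h1 := (hB.const_mul C).mul ((hc.const_add (∫ x, ‖a₀ x‖)).pow 2)
  have h2 := (hc.const_mul (C * ‖B₀‖)).mul (hc.const_add (∫ x, ‖a₀ x‖))
  have h3 := hc.const_mul (C * ‖B₀‖ * (∫ x, ‖a₀ x‖))
  have h4 := h1.add (h2.add h3)
  rw [mul_zero, mul_zero, zero_mul, zero_mul, mul_zero, add_zero, add_zero] at h4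
  refine squeeze_zero (fun _ => norm_nonneg _) (fun w => ?_) h4
  exact norm_covForm_sub_le hR hC B₀ (B w) ha₀ (ha w)

end Quadratic

/-! ### Continuity and growth of the generator on cylinder functions -/

section Generator

variable {d n : ℕ} {R : Lat d → ℝ}

lemma integral_norm_mul_norm_le {f g : Lat d → ℂ} (hf : MemLp f 2) (hg : MemLp g 2) :
    ∫ ξ, ‖f ξ‖ * ‖g ξ‖ ≤ l2 f * l2 g := by
  have h := norm_integral_mul_le (f := fun ξ => (‖f ξ‖ : ℂ)) (g := fun ξ => (‖g ξ‖ : ℂ))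
    hf.norm.ofReal hg.norm.ofReal
  have e : ∫ ξ, (‖f ξ‖ : ℂ) * (‖g ξ‖ : ℂ) = ((∫ ξ, ‖f ξ‖ * ‖g ξ‖ : ℝ) : ℂ) := by
    rw [← integral_complex_ofReal]; congr 1; ext ξ; push_cast; rfl
  rw [e, Complex.norm_real, Real.norm_of_nonneg (integral_nonneg fun _ => by positivity)] at h
  refine h.trans_eq ?_
  rw [l2, l2, l2, l2]
  congr 2 <;> exact eLpNorm_congr_norm_ae (ae_of_all _ fun x => by simp)

lemma l2_coe (w : Lp ℂ 2 (volume : Measure (Lat d))) : l2 w = ‖w‖ := (Lp.norm_def w).symm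

lemma norm_pairing_le (w : Lp ℂ 2 (volume : Measure (Lat d))) (φ : 𝓢(Lat d, ℂ)) :
    ‖pairing w φ‖ ≤ ‖w‖ * l2 φ := by
  rw [← l2_coe]
  exact norm_integral_mul_le (Lp.memLp w) (φ.memLp 2)

lemma pairing_sub (w w' : Lp ℂ 2 (volume : Measure (Lat d))) (φ : 𝓢(Lat d, ℂ)) :
    pairing (w - w') φ = pairing w φ - pairing w' φ := by
  have h1 : Integrable fun x => w x * φ x := (Lp.memLp w).integrable_mul (φ.memLp 2)
  have h2 : Integrable fun x => w' x * φ x := (Lp.memLp w').integrable_mul (φ.memLp 2)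
  rw [pairing, pairing, pairing, ← integral_sub h1 h2]
  refine integral_congr_ae ?_
  filter_upwards [Lp.coeFn_sub w w'] with x h
  rw [h, Pi.sub_apply, sub_mul]

lemma continuous_pairing (φ : 𝓢(Lat d, ℂ)) :
    Continuous fun w : Lp ℂ 2 (volume : Measure (Lat d)) => pairing w φ := by
  refine continuous_iff_continuousAt.2 fun w => ?_
  rw [ContinuousAt, tendsto_iff_norm_sub_tendsto_zero]
  have h : Tendsto (fun w' => ‖w' - w‖ * l2 φ) (𝓝 w) (𝓝 (‖w - w‖ * l2 φ)) :=
    ((continuous_id.sub continuous_const).norm.mul continuous_const).tendsto w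
  rw [sub_self, norm_zero, zero_mul] at h
  refine squeeze_zero (fun _ => norm_nonneg _) (fun w' => ?_) h
  rw [← pairing_sub]
  exact norm_pairing_le _ _

lemma continuous_drift (k₀ ε η : ℝ) (R : Lat d → ℝ) (φ : 𝓢(Lat d, ℂ)) :
    Continuous fun w => drift k₀ ε η R w φ :=
  (continuous_const.mul (continuous_pairing _)).sub (continuous_const.mul (continuous_pairing _))

lemma exists_norm_drift_le (k₀ ε η : ℝ) (R : Lat d → ℝ) (φ : 𝓢(Lat d, ℂ)) :
    ∃ C, 0 ≤ C ∧ ∀ w, ‖drift k₀ ε η R w φ‖ ≤ C * ‖w‖ := by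
  refine ⟨‖(Complex.I * η / (2 * k₀ * ε))‖ * l2 (Δ φ : 𝓢(Lat d, ℂ))
    + ‖((k₀ ^ 2 * R 0 / (8 * η ^ 2) : ℝ) : ℂ)‖ * l2 φ,
    add_nonneg (mul_nonneg (norm_nonneg _) (l2_nonneg _))
      (mul_nonneg (norm_nonneg _) (l2_nonneg _)), fun w => ?_⟩
  refine (norm_sub_le _ _).trans ?_
  rw [norm_mul, norm_mul, add_mul]
  have h1 := norm_pairing_le w (Δ φ : 𝓢(Lat d, ℂ))
  have h2 := norm_pairing_le w φ
  rw [mul_comm] at h1 h2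
  refine add_le_add ?_ ?_
  · exact (mul_le_mul_of_nonneg_left h1 (norm_nonneg _)).trans_eq (mul_assoc _ _ _).symm
  · exact (mul_le_mul_of_nonneg_left h2 (norm_nonneg _)).trans_eq (mul_assoc _ _ _).symm

/-- The direction `(i w(x) φ_j(x))_j` in which the noise at `x` moves a cylinder function. -/
noncomputable def noiseDir (w : Lp ℂ 2 (volume : Measure (Lat d))) (φ : Fin n → 𝓢(Lat d, ℂ))
    (x : Lat d) : Fin n → ℂ := fun j => Complex.I * w x * φ j x

lemma norm_noiseDir_le (w : Lp ℂ 2 (volume : Measure (Lat d))) (φ : Fin n → 𝓢(Lat d, ℂ))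
    (x : Lat d) : ‖noiseDir w φ x‖ ≤ ∑ j, ‖w x‖ * ‖φ j x‖ := by
  refine (pi_norm_le_iff_of_nonneg (Finset.sum_nonneg fun _ _ => by positivity)).2 fun j => ?_
  refine le_trans (le_of_eq ?_)
    (Finset.single_le_sum (fun i _ => by positivity) (Finset.mem_univ j))
  simp [noiseDir]

lemma integrable_norm_mul_norm (w : Lp ℂ 2 (volume : Measure (Lat d))) (φ : 𝓢(Lat d, ℂ)) :
    Integrable fun x => ‖w x‖ * ‖φ x‖ :=
  (Lp.memLp w).norm.integrable_mul (φ.memLp 2).norm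

lemma integrable_noiseDir (w : Lp ℂ 2 (volume : Measure (Lat d))) (φ : Fin n → 𝓢(Lat d, ℂ)) :
    Integrable (noiseDir w φ) := by
  refine (integrable_finsetSum Finset.univ fun j _ => integrable_norm_mul_norm w (φ j)).mono' ?_
    (ae_of_all _ fun x => norm_noiseDir_le w φ x)
  refine AEMeasurable.aestronglyMeasurable (aemeasurable_pi_lambda _ fun j => ?_)
  exact ((Lp.aestronglyMeasurable w).aemeasurable.const_mul _).mul
    (φ j).continuous.measurable.aemeasurable

/-- The size of a family of test functions. -/
noncomputable def testSize (φ : Fin n → 𝓢(Lat d, ℂ)) : ℝ := ∑ j, l2 (φ j)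

lemma testSize_nonneg (φ : Fin n → 𝓢(Lat d, ℂ)) : 0 ≤ testSize φ :=
  Finset.sum_nonneg fun _ _ => l2_nonneg _

lemma integral_norm_noiseDir_le (w : Lp ℂ 2 (volume : Measure (Lat d)))
    (φ : Fin n → 𝓢(Lat d, ℂ)) : ∫ x, ‖noiseDir w φ x‖ ≤ ‖w‖ * testSize φ := by
  refine (integral_mono (integrable_noiseDir w φ).norm
    (integrable_finsetSum Finset.univ fun j _ => integrable_norm_mul_norm w (φ j))
    (fun x => norm_noiseDir_le w φ x)).trans ?_
  rw [integral_finsetSum _ fun j _ => integrable_norm_mul_norm w (φ j), testSize, Finset.mul_sum]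
  refine Finset.sum_le_sum fun j _ => ?_
  rw [← l2_coe]
  exact integral_norm_mul_norm_le (Lp.memLp w) ((φ j).memLp 2)

lemma noiseDir_sub (w w' : Lp ℂ 2 (volume : Measure (Lat d))) (φ : Fin n → 𝓢(Lat d, ℂ)) :
    noiseDir (w - w') φ =ᵐ[volume] fun x => noiseDir w φ x - noiseDir w' φ x := by
  filter_upwards [Lp.coeFn_sub w w'] with x h
  ext j
  simp only [noiseDir, h, Pi.sub_apply]
  ring

variable {G : Type*} [NormedAddCommGroup G] [NormedSpace ℝ G] [CompleteSpace G]

/-- The values of a wave on a family of test functions. -/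
noncomputable def pairings (φ : Fin n → 𝓢(Lat d, ℂ)) (w : Lp ℂ 2 (volume : Measure (Lat d))) :
    Fin n → ℂ := fun j => pairing w (φ j)

/-- The generator, for cylinder functions with values in a Banach space. -/
noncomputable def cylGenerator (k₀ ε η : ℝ) (R : Lat d → ℝ) (f : (Fin n → ℂ) → G)
    (φ : Fin n → 𝓢(Lat d, ℂ)) (w : Lp ℂ 2 (volume : Measure (Lat d))) : G :=
  fderiv ℝ f (pairings φ w) (fun j => drift k₀ ε η R w (φ j))
    + ((1 / 2) * (k₀ ^ 2 / (4 * η ^ 2))) •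
      covForm R (fderiv ℝ (fderiv ℝ f) (pairings φ w)) (noiseDir w φ) (noiseDir w φ)

lemma continuous_pairings (φ : Fin n → 𝓢(Lat d, ℂ)) : Continuous (pairings φ) :=
  continuous_pi fun _ => continuous_pairing _

lemma norm_pairings_le (φ : Fin n → 𝓢(Lat d, ℂ)) (w : Lp ℂ 2 (volume : Measure (Lat d))) :
    ‖pairings φ w‖ ≤ ‖w‖ * testSize φ := by
  refine (pi_norm_le_iff_of_nonneg (mul_nonneg (norm_nonneg _) (testSize_nonneg _))).2 fun j => ?_
  refine (norm_pairing_le _ _).trans (mul_le_mul_of_nonneg_left ?_ (norm_nonneg _))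
  exact Finset.single_le_sum (f := fun j => l2 (φ j)) (fun i _ => l2_nonneg _) (Finset.mem_univ j)

lemma cylGenerator_congr {k₀ ε η : ℝ} {f f' : (Fin n → ℂ) → G} {φ : Fin n → 𝓢(Lat d, ℂ)}
    {w : Lp ℂ 2 (volume : Measure (Lat d))} (h : f =ᶠ[𝓝 (pairings φ w)] f') :
    cylGenerator k₀ ε η R f φ w = cylGenerator k₀ ε η R f' φ w := by
  rw [cylGenerator, cylGenerator, h.fderiv_eq, h.fderiv.fderiv_eq]

/-- The drift is linear in the wave and the noise term quadratic. The constant does not depend on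
`f`, which is needed for uniformity along the cutoffs in the Dynkin formula. -/
lemma exists_norm_cylGenerator_le (hR : IsCovariance R) (k₀ ε η : ℝ) (φ : Fin n → 𝓢(Lat d, ℂ)) :
    ∃ C, 0 ≤ C ∧ ∀ (f : (Fin n → ℂ) → G) w, ‖cylGenerator k₀ ε η R f φ w‖ ≤
      C * (‖fderiv ℝ f (pairings φ w)‖ + ‖fderiv ℝ (fderiv ℝ f) (pairings φ w)‖)
        * (1 + ‖w‖) ^ 2 := by
  choose C hC0 hC using fun j => exists_norm_drift_le k₀ ε η R (φ j)
  obtain ⟨M, hM⟩ := hR.bounded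
  have hM0 : 0 ≤ M := (abs_nonneg _).trans (hM 0)
  set g : ℝ := (1 / 2) * (k₀ ^ 2 / (4 * η ^ 2))
  have hg : 0 ≤ g := by positivity
  have hS : 0 ≤ ∑ j, C j := Finset.sum_nonneg fun j _ => hC0 j
  have hT := testSize_nonneg φ
  refine ⟨∑ j, C j + g * (M * testSize φ ^ 2), by positivity, fun f w => ?_⟩
  set A := ‖fderiv ℝ f (pairings φ w)‖
  set B := ‖fderiv ℝ (fderiv ℝ f) (pairings φ w)‖
  have hA : 0 ≤ A := norm_nonneg _
  have hB : 0 ≤ B := norm_nonneg (fderiv ℝ (fderiv ℝ f) (pairings φ w))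
  have hw : 0 ≤ ‖w‖ := norm_nonneg _
  have h1 : ‖fderiv ℝ f (pairings φ w) (fun j => drift k₀ ε η R w (φ j))‖
      ≤ A * ((∑ j, C j) * ‖w‖) := by
    refine (ContinuousLinearMap.le_opNorm _ _).trans (mul_le_mul_of_nonneg_left ?_ hA)
    refine (pi_norm_le_iff_of_nonneg (by positivity)).2 fun j => (hC j w).trans ?_
    exact mul_le_mul_of_nonneg_right
      (Finset.single_le_sum (fun i _ => hC0 i) (Finset.mem_univ j)) hw
  have h2 : ‖covForm R (fderiv ℝ (fderiv ℝ f) (pairings φ w)) (noiseDir w φ) (noiseDir w φ)‖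
      ≤ M * B * (‖w‖ * testSize φ) * (‖w‖ * testSize φ) := by
    refine (norm_covForm_le hM _ (integrable_noiseDir w φ) (integrable_noiseDir w φ)).trans ?_
    have := integral_norm_noiseDir_le w φ
    have h0 : 0 ≤ ∫ x, ‖noiseDir w φ x‖ := integral_nonneg fun _ => norm_nonneg _
    gcongr
  have h3 := norm_add_le (fderiv ℝ f (pairings φ w) (fun j => drift k₀ ε η R w (φ j)))
    (g • covForm R (fderiv ℝ (fderiv ℝ f) (pairings φ w)) (noiseDir w φ) (noiseDir w φ))
  rw [norm_smul, Real.norm_of_nonneg hg] at h3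
  refine h3.trans ?_
  have h4 : ‖w‖ ≤ (1 + ‖w‖) ^ 2 := by nlinarith
  have h5 : ‖w‖ ^ 2 ≤ (1 + ‖w‖) ^ 2 := by nlinarith
  calc _ ≤ A * ((∑ j, C j) * ‖w‖) + g * (M * B * (‖w‖ * testSize φ) * (‖w‖ * testSize φ)) :=
        add_le_add h1 (mul_le_mul_of_nonneg_left h2 hg)
    _ = (∑ j, C j) * A * ‖w‖ + g * (M * testSize φ ^ 2) * B * ‖w‖ ^ 2 := by ring
    _ ≤ (∑ j, C j) * A * (1 + ‖w‖) ^ 2 + g * (M * testSize φ ^ 2) * B * (1 + ‖w‖) ^ 2 := by gcongr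
    _ ≤ _ := by
        have e1 : 0 ≤ (∑ j, C j) * B * (1 + ‖w‖) ^ 2 := by positivity
        have e2 : 0 ≤ g * (M * testSize φ ^ 2) * A * (1 + ‖w‖) ^ 2 := by positivity
        linarith

lemma continuous_cylGenerator (hR : IsCovariance R) (k₀ ε η : ℝ) {f : (Fin n → ℂ) → G}
    (hf : ContDiff ℝ 2 f) (φ : Fin n → 𝓢(Lat d, ℂ)) :
    Continuous (cylGenerator k₀ ε η R f φ) := by
  have hf1 : ContDiff ℝ 1 (fderiv ℝ f) := hf.fderiv_right (by norm_num)
  have hU := continuous_pairings φ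
  refine Continuous.add ?_ (Continuous.const_smul ?_ _)
  · exact (hf1.continuous.comp hU).clm_apply (continuous_pi fun j => continuous_drift k₀ ε η R _)
  · have hB : Continuous fun w => fderiv ℝ (fderiv ℝ f) (pairings φ w) :=
      (hf1.continuous_fderiv (by norm_num)).comp hU
    refine continuous_iff_continuousAt.2 fun w => ?_
    refine tendsto_covForm hR
      (tendsto_norm_sub (E := (Fin n → ℂ) →L[ℝ] (Fin n → ℂ) →L[ℝ] G) (hB.tendsto w))
      (fun w => integrable_noiseDir w φ) (integrable_noiseDir w φ) ?_
    have h : Tendsto (fun w' => ‖w' - w‖ * testSize φ) (𝓝 w) (𝓝 (‖w - w‖ * testSize φ)) :=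
      ((continuous_id.sub continuous_const).norm.mul continuous_const).tendsto w
    rw [sub_self, norm_zero, zero_mul] at h
    refine squeeze_zero (fun _ => integral_nonneg fun _ => norm_nonneg _) (fun w' => ?_) h
    refine le_trans (le_of_eq (integral_congr_ae ?_)) (integral_norm_noiseDir_le (w' - w) φ)
    filter_upwards [noiseDir_sub w' w φ] with x h
    simp only [h]

end Generator

/-! ### Expectations along a solution -/

section Expectation

variable {d : ℕ} {R : Lat d → ℝ} {k₀ ε η : ℝ} {u₀ : Lp ℂ 2 (volume : Measure (Lat d))}
  {Ω : Type*} {mΩ : MeasurableSpace Ω} {P : Measure Ω} [IsProbabilityMeasure P]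
  {ℱ : Filtration ℝ≥0 mΩ} {u : ℝ≥0 → Ω → Lp ℂ 2 (volume : Measure (Lat d))}
  {G : Type*} [NormedAddCommGroup G] [NormedSpace ℝ G] [CompleteSpace G]

lemma IsSolution.stronglyMeasurable (S : IsSolution k₀ ε η R u₀ P ℱ u) (z : ℝ≥0) :
    StronglyMeasurable (u z) := (S.adapted z).mono (ℱ.le z)

lemma IsSolution.stronglyMeasurable_uncurry (S : IsSolution k₀ ε η R u₀ P ℱ u) :
    StronglyMeasurable (fun x : ℝ × Ω => u x.1.toNNReal x.2) := by
  have h := stronglyMeasurable_uncurry_of_continuous_of_stronglyMeasurable S.continuous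
    S.stronglyMeasurable
  have hm : Measurable fun x : ℝ × Ω => (x.1.toNNReal, x.2) :=
    (measurable_real_toNNReal.comp measurable_fst).prodMk measurable_snd
  exact h.comp_measurable hm

lemma IsSolution.exists_moment_le (S : IsSolution k₀ ε η R u₀ P ℱ u) (n : ℕ) (Z : ℝ≥0) :
    ∃ C : ℝ, 0 ≤ C ∧ ∀ z ≤ Z, Integrable (fun ω => (1 + ‖u z ω‖) ^ n) P ∧
      ∫ ω, (1 + ‖u z ω‖) ^ n ∂P ≤ C := by
  obtain ⟨C, hC⟩ := S.moments n Z
  have hi : ∀ z ≤ Z, Integrable (fun ω => ‖u z ω‖ ^ n) P ∧ ∫ ω, ‖u z ω‖ ^ n ∂P ≤ C := by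
    intro z hz
    have hm : AEStronglyMeasurable (fun ω => ‖u z ω‖ ^ n) P :=
      ((S.stronglyMeasurable z).norm.pow n).aestronglyMeasurable
    have he : ∫⁻ ω, ENNReal.ofReal (‖u z ω‖ ^ n) ∂P ≤ C := by
      refine le_trans (le_of_eq (lintegral_congr fun ω => ?_)) (hC z hz)
      rw [ENNReal.ofReal_pow (norm_nonneg _), ofReal_norm]
    have hint : Integrable (fun ω => ‖u z ω‖ ^ n) P := by
      refine ⟨hm, (hasFiniteIntegral_iff_ofReal (ae_of_all _ fun ω => by positivity)).2 ?_⟩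
      exact he.trans_lt ENNReal.coe_lt_top
    refine ⟨hint, ?_⟩
    rw [integral_eq_lintegral_of_nonneg_ae (ae_of_all _ fun ω => by positivity) hm]
    exact ENNReal.toReal_le_coe_of_le_coe he
  have hb : ∀ x : ℝ, 0 ≤ x → (1 + x) ^ n ≤ 2 ^ n * (1 + x ^ n) := by
    intro x hx
    rcases le_total x 1 with h | h
    · calc (1 + x) ^ n ≤ 2 ^ n := pow_le_pow_left₀ (by linarith) (by linarith) n
        _ ≤ 2 ^ n * (1 + x ^ n) := le_mul_of_one_le_right (by positivity)
            (le_add_of_nonneg_right (by positivity))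
    · calc (1 + x) ^ n ≤ (2 * x) ^ n := pow_le_pow_left₀ (by linarith) (by linarith) n
        _ = 2 ^ n * x ^ n := mul_pow _ _ _
        _ ≤ 2 ^ n * (1 + x ^ n) := by gcongr; linarith
  refine ⟨2 ^ n * (1 + C), by positivity, fun z hz => ?_⟩
  have h2 : Integrable (fun ω => 2 ^ n * (1 + ‖u z ω‖ ^ n)) P :=
    ((integrable_const _).add (hi z hz).1).const_mul _
  have h3 : Integrable (fun ω => (1 + ‖u z ω‖) ^ n) P := by
    refine h2.mono' ?_ (ae_of_all _ fun ω => ?_)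
    · exact (((S.stronglyMeasurable z).norm.const_add 1).pow n).aestronglyMeasurable
    · rw [Real.norm_of_nonneg (by positivity)]
      exact hb _ (norm_nonneg _)
  refine ⟨h3, (integral_mono h3 h2 fun ω => hb _ (norm_nonneg _)).trans ?_⟩
  rw [integral_const_mul, integral_add (integrable_const _) (hi z hz).1]
  simp only [integral_const, probReal_univ, smul_eq_mul, mul_one]
  gcongr
  exact (hi z hz).2

lemma IsSolution.integrable_comp (S : IsSolution k₀ ε η R u₀ P ℱ u)
    {Ψ : Lp ℂ 2 (volume : Measure (Lat d)) → G} (hΨ : Continuous Ψ) {C : ℝ} {n : ℕ}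
    (hb : ∀ w, ‖Ψ w‖ ≤ C * (1 + ‖w‖) ^ n) (z : ℝ≥0) : Integrable (fun ω => Ψ (u z ω)) P := by
  obtain ⟨D, -, hD⟩ := S.exists_moment_le n z
  exact ((hD z le_rfl).1.const_mul C).mono'
    (hΨ.comp_stronglyMeasurable (S.stronglyMeasurable z)).aestronglyMeasurable
    (ae_of_all _ fun ω => hb _)

lemma IsSolution.exists_norm_expect_le (S : IsSolution k₀ ε η R u₀ P ℱ u) (n : ℕ) (Z : ℝ≥0) :
    ∃ D : ℝ, 0 ≤ D ∧ ∀ (Ψ : Lp ℂ 2 (volume : Measure (Lat d)) → G) (C : ℝ), 0 ≤ C →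
      (∀ w, ‖Ψ w‖ ≤ C * (1 + ‖w‖) ^ n) → ∀ z ≤ Z, ‖∫ ω, Ψ (u z ω) ∂P‖ ≤ C * D := by
  obtain ⟨D, hD0, hD⟩ := S.exists_moment_le n Z
  refine ⟨D, hD0, fun Ψ C hC hb z hz => ?_⟩
  refine (norm_integral_le_of_norm_le ((hD z hz).1.const_mul C) (ae_of_all _ fun ω => hb _)).trans ?_
  rw [integral_const_mul]
  exact mul_le_mul_of_nonneg_left (hD z hz).2 hC

lemma IsSolution.integral_swap (S : IsSolution k₀ ε η R u₀ P ℱ u)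
    {Ψ : Lp ℂ 2 (volume : Measure (Lat d)) → G} (hΨ : Continuous Ψ) {C : ℝ} {n : ℕ} (hC : 0 ≤ C)
    (hb : ∀ w, ‖Ψ w‖ ≤ C * (1 + ‖w‖) ^ n) (z : ℝ≥0) :
    Integrable (fun ω => ∫ s in (0 : ℝ)..z, Ψ (u s.toNNReal ω)) P ∧
      ∫ ω, (∫ s in (0 : ℝ)..z, Ψ (u s.toNNReal ω)) ∂P
        = ∫ s in (0 : ℝ)..z, ∫ ω, Ψ (u s.toNNReal ω) ∂P := by
  obtain ⟨D, hD0, hD⟩ := S.exists_norm_expect_le (G := ℝ) n z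
  have hm : StronglyMeasurable fun x : ℝ × Ω => Ψ (u x.1.toNNReal x.2) :=
    hΨ.comp_stronglyMeasurable S.stronglyMeasurable_uncurry
  have hint : Integrable (fun x : ℝ × Ω => Ψ (u x.1.toNNReal x.2))
      ((volume.restrict (Ioc (0 : ℝ) z)).prod P) := by
    rw [integrable_prod_iff hm.aestronglyMeasurable]
    refine ⟨ae_of_all _ fun s => S.integrable_comp hΨ hb s.toNNReal, ?_⟩
    refine Integrable.of_bound (C := C * D) (hm.norm.integral_prod_right').aestronglyMeasurable ?_
    filter_upwards [ae_restrict_mem measurableSet_Ioc] with s hs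
    refine hD (fun w => ‖Ψ w‖) C hC (fun w => by simpa using hb w) _ ?_
    rw [← Real.toNNReal_coe (r := z)]
    exact Real.toNNReal_le_toNNReal hs.2
  simp only [intervalIntegral.integral_of_le (NNReal.coe_nonneg z)]
  exact ⟨hint.integral_prod_right, (integral_integral_swap hint).symm⟩

lemma IsSolution.continuous_expect_of_bounded {Y : Type*} [TopologicalSpace Y]
    [FirstCountableTopology Y]
    (S : IsSolution k₀ ε η R u₀ P ℱ u) {Ψ : Y → Lp ℂ 2 (volume : Measure (Lat d)) → G}
    (hΨ : Continuous (Function.uncurry Ψ)) {C : ℝ} (hb : ∀ y w, ‖Ψ y w‖ ≤ C) :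
    Continuous fun x : Y × ℝ≥0 => ∫ ω, Ψ x.1 (u x.2 ω) ∂P := by
  refine continuous_of_dominated (bound := fun _ => C) (fun x => ?_)
    (fun x => ae_of_all _ fun ω => hb _ _) (integrable_const _) (ae_of_all _ fun ω => ?_)
  · have : Continuous (Ψ x.1) := hΨ.comp (by fun_prop : Continuous fun w => (x.1, w))
    exact (this.comp_stronglyMeasurable (S.stronglyMeasurable _)).aestronglyMeasurable
  · exact hΨ.comp (continuous_fst.prodMk ((S.continuous ω).comp continuous_snd))

lemma norm_sub_truncate_le {v : G} {a C M : ℝ} (hM : 0 < M) (ha : 0 < a) (hv : ‖v‖ ≤ C * a) :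
    ‖v - (M / (M + a)) • v‖ ≤ C / M * (a * a) := by
  have hp : 0 < M + a := add_pos hM ha
  have e : v - (M / (M + a)) • v = (a / (M + a)) • v := by
    nth_rewrite 1 [← one_smul ℝ v]
    rw [← sub_smul]; congr 1; field_simp; ring
  rw [e, norm_smul, Real.norm_of_nonneg (div_nonneg ha.le hp.le)]
  calc a / (M + a) * ‖v‖ ≤ a / M * (C * a) := by
        refine mul_le_mul ?_ hv (norm_nonneg _) (div_nonneg ha.le hM.le)
        exact div_le_div_of_nonneg_left ha.le hM (by linarith)
    _ = _ := by ring

lemma norm_truncate_le {v : G} {a C M : ℝ} (hM : 0 < M) (ha : 0 < a) (hC : 0 ≤ C)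
    (hv : ‖v‖ ≤ C * a) : ‖(M / (M + a)) • v‖ ≤ C * M := by
  have hp : 0 < M + a := add_pos hM ha
  rw [norm_smul, Real.norm_of_nonneg (div_nonneg hM.le hp.le), div_mul_eq_mul_div, div_le_iff₀ hp]
  calc M * ‖v‖ ≤ M * (C * a) := mul_le_mul_of_nonneg_left hv hM.le
    _ = C * M * a := by ring
    _ ≤ C * M * (M + a) := by gcongr; linarith

/-- The moments are bounded locally uniformly in time, but no integrable bound of the supremum over
times is available, so dominated convergence does not apply directly. The integrand is multiplied by
`M/(M + a)` with `a = (1 + ‖w‖)^n`. The result is bounded, and the error is at most `(C/M) a²`,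
controlled by a moment of twice the order. -/
lemma IsSolution.continuous_expect {Y : Type*} [TopologicalSpace Y] [FirstCountableTopology Y]
    (S : IsSolution k₀ ε η R u₀ P ℱ u) {Ψ : Y → Lp ℂ 2 (volume : Measure (Lat d)) → G}
    (hΨ : Continuous (Function.uncurry Ψ)) {C : ℝ} {n : ℕ} (hC : 0 ≤ C)
    (hb : ∀ y w, ‖Ψ y w‖ ≤ C * (1 + ‖w‖) ^ n) :
    Continuous fun x : Y × ℝ≥0 => ∫ ω, Ψ x.1 (u x.2 ω) ∂P := by
  refine continuous_iff_continuousAt.2 fun x₀ => Metric.tendsto_nhds.2 fun δ hδ => ?_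
  obtain ⟨D, hD0, hD⟩ := S.exists_norm_expect_le (G := G) (n + n) (x₀.2 + 1)
  obtain ⟨M, hM, hMδ⟩ : ∃ M : ℝ, 0 < M ∧ C / M * D < δ / 3 := by
    refine ⟨3 * (C * D + 1) / δ, by positivity, ?_⟩
    have h0 : 0 ≤ C * D := mul_nonneg hC hD0
    rw [div_mul_eq_mul_div, div_lt_iff₀ (by positivity)]
    field_simp
    linarith
  have ha : ∀ w : Lp ℂ 2 (volume : Measure (Lat d)), 0 < (1 + ‖w‖) ^ n := fun w => by positivity
  have hyc : ∀ y, Continuous (Ψ y) := fun y => hΨ.comp (by fun_prop : Continuous fun w => (y, w))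
  obtain ⟨Φ, hΦdef⟩ : ∃ Φ : Y → Lp ℂ 2 (volume : Measure (Lat d)) → G,
    ∀ y w, Φ y w = (M / (M + (1 + ‖w‖) ^ n)) • Ψ y w := ⟨_, fun _ _ => rfl⟩
  have hΦ : Continuous (Function.uncurry Φ) := by
    have e : Function.uncurry Φ = fun x => (M / (M + (1 + ‖x.2‖) ^ n)) • Function.uncurry Ψ x := by
      ext x; exact hΦdef _ _
    rw [e]
    refine Continuous.smul ?_ hΨ
    exact continuous_const.div (by fun_prop) fun x => (add_pos hM (ha _)).ne'
  have hΦy : ∀ y, Continuous (Φ y) := fun y => hΦ.comp (by fun_prop : Continuous fun w => (y, w))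
  have hΦb : ∀ y w, ‖Φ y w‖ ≤ C * M := fun y w => by
    rw [hΦdef]; exact norm_truncate_le hM (ha w) hC (hb y w)
  have hdiff : ∀ y w, ‖Ψ y w - Φ y w‖ ≤ C / M * (1 + ‖w‖) ^ (n + n) := fun y w => by
    rw [hΦdef, pow_add]; exact norm_sub_truncate_le hM (ha w) (hb y w)
  have hclose : ∀ y, ∀ z ≤ x₀.2 + 1, dist (∫ ω, Ψ y (u z ω) ∂P) (∫ ω, Φ y (u z ω) ∂P) < δ / 3 := by
    intro y z hz
    rw [dist_eq_norm, ← integral_sub (S.integrable_comp (hyc y) (hb y) z)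
      (S.integrable_comp (hΦy y) (C := C * M) (n := 0) (fun w => by simpa using hΦb y w) z)]
    exact (hD (fun w => Ψ y w - Φ y w) (C / M) (by positivity) (hdiff y) z hz).trans_lt hMδ
  have hlim := (S.continuous_expect_of_bounded hΦ hΦb).tendsto x₀
  have hnear : ∀ᶠ x : Y × ℝ≥0 in 𝓝 x₀, x.2 ≤ x₀.2 + 1 := by
    have : ∀ᶠ z in 𝓝 x₀.2, z ≤ x₀.2 + 1 := Iic_mem_nhds (lt_add_of_pos_right _ one_pos)
    exact continuous_snd.continuousAt.eventually this
  filter_upwards [Metric.tendsto_nhds.1 hlim (δ / 3) (by positivity), hnear] with x h1 h2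
  have h3 := hclose x.1 x.2 h2
  have h4 := hclose x₀.1 x₀.2 (le_add_of_nonneg_right zero_le_one)
  rw [dist_comm] at h4
  have t1 := dist_triangle (∫ ω, Ψ x.1 (u x.2 ω) ∂P) (∫ ω, Φ x.1 (u x.2 ω) ∂P)
    (∫ ω, Ψ x₀.1 (u x₀.2 ω) ∂P)
  have t2 := dist_triangle (∫ ω, Φ x.1 (u x.2 ω) ∂P) (∫ ω, Φ x₀.1 (u x₀.2 ω) ∂P)
    (∫ ω, Ψ x₀.1 (u x₀.2 ω) ∂P)
  linarith

/-! ### The Dynkin formula -/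

lemma IsSolution.dynkin_of_hasCompactSupport (S : IsSolution k₀ ε η R u₀ P ℱ u) {n : ℕ}
    (φ : Fin n → 𝓢(Lat d, ℂ)) {f : (Fin n → ℂ) → ℝ} (hf : ContDiff ℝ (⊤ : ℕ∞) f)
    (hs : HasCompactSupport f) (z : ℝ≥0) :
    Integrable (fun ω => f (pairings φ (u z ω))
      - ∫ s in (0 : ℝ)..z, cylGenerator k₀ ε η R f φ (u s.toNNReal ω)) P ∧
    ∫ ω, (f (pairings φ (u z ω))
      - ∫ s in (0 : ℝ)..z, cylGenerator k₀ ε η R f φ (u s.toNNReal ω)) ∂P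
        = f (pairings φ u₀) := by
  have hM := S.martingale n φ f hf hs
  refine ⟨hM.integrable z, ?_⟩
  have h := hM.setIntegral_eq (zero_le : 0 ≤ z) (s := univ) MeasurableSet.univ
  simp only [Measure.restrict_univ] at h
  refine h.symm.trans ?_
  simp only [NNReal.coe_zero, intervalIntegral.integral_same, sub_zero]
  have e : (fun ω => f fun j => pairing (u 0 ω) (φ j)) =ᵐ[P] fun _ => f (pairings φ u₀) := by
    filter_upwards [S.initial] with ω h
    rw [h]; rfl
  rw [integral_congr_ae e]
  simp

/-- Derivatives of `θ(c U)` produce powers of `c ≤ 1`, so the Leibniz rule gives bounds that are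
uniform in the cutoff. -/
lemma exists_norm_cutoff_le {V : Type*} [NormedAddCommGroup V] [NormedSpace ℝ V] {f θ : V → ℝ}
    (hf : f.HasTemperateGrowth) (hθ : θ.HasTemperateGrowth) :
    ∃ (k : ℕ) (C : ℝ), 0 ≤ C ∧ ∀ c : ℝ, 0 ≤ c → c ≤ 1 → ∀ j ≤ 2, ∀ U,
      ‖iteratedFDeriv ℝ j (fun U => θ (c • U) * f U) U‖ ≤ C * (1 + ‖U‖) ^ k := by
  obtain ⟨k, C, hC, hk⟩ := hf.norm_iteratedFDeriv_le_uniform 2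
  obtain ⟨k', C', hC', hk'⟩ := hθ.norm_iteratedFDeriv_le_uniform 2
  refine ⟨k' + k, 4 * (C' * C), by positivity, fun c hc hc1 j hj U => ?_⟩
  have hθc : ContDiff ℝ (⊤ : ℕ∞) fun U => θ (c • U) := hθ.1.comp (contDiff_const_smul c)
  refine (norm_iteratedFDeriv_mul_le (N := (⊤ : ℕ∞)) hθc hf.1 U (n := j)
    (by exact_mod_cast le_top)).trans ?_
  have hb : ∀ i ∈ Finset.range (j + 1), (j.choose i : ℝ) *
      ‖iteratedFDeriv ℝ i (fun U => θ (c • U)) U‖ * ‖iteratedFDeriv ℝ (j - i) f U‖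
      ≤ (j.choose i : ℝ) * (C' * C * (1 + ‖U‖) ^ (k' + k)) := by
    intro i hi
    have hi' : i ≤ 2 := (Nat.lt_succ_iff.1 (Finset.mem_range.1 hi)).trans hj
    have h1 : ‖iteratedFDeriv ℝ i (fun U => θ (c • U)) U‖ ≤ C' * (1 + ‖U‖) ^ k' := by
      rw [iteratedFDeriv_comp_const_smul c (hθ.1.of_le (by exact_mod_cast le_top)), norm_smul]
      have h2 : ‖c ^ i‖ ≤ 1 := by
        rw [norm_pow, Real.norm_of_nonneg hc]; exact pow_le_one₀ hc hc1
      have h3 : ‖c • U‖ ≤ ‖U‖ := by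
        rw [norm_smul, Real.norm_of_nonneg hc]; exact mul_le_of_le_one_left (norm_nonneg _) hc1
      calc _ ≤ 1 * (C' * (1 + ‖c • U‖) ^ k') :=
            mul_le_mul h2 (hk' i hi' _) (norm_nonneg _) zero_le_one
        _ ≤ _ := by rw [one_mul]; gcongr
    rw [mul_assoc, pow_add]
    refine mul_le_mul_of_nonneg_left ?_ (Nat.cast_nonneg _)
    calc _ ≤ (C' * (1 + ‖U‖) ^ k') * (C * (1 + ‖U‖) ^ k) :=
          mul_le_mul h1 (hk _ ((Nat.sub_le _ _).trans hj) U) (norm_nonneg _) (by positivity)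
      _ = _ := by ring
  refine (Finset.sum_le_sum hb).trans ?_
  rw [← Finset.sum_mul]
  have h4 : (∑ i ∈ Finset.range (j + 1), (j.choose i : ℝ)) ≤ 4 := by
    have := Nat.sum_range_choose j
    have h5 : 2 ^ j ≤ 2 ^ 2 := Nat.pow_le_pow_right (by norm_num) hj
    exact_mod_cast this.trans_le h5
  calc _ ≤ 4 * (C' * C * (1 + ‖U‖) ^ (k' + k)) := by gcongr
    _ = _ := by ring

end Expectation

/-! ### The Dynkin formula for functions of polynomial growth -/

section Dynkin

variable {d : ℕ} {R : Lat d → ℝ} {k₀ ε η : ℝ} {u₀ : Lp ℂ 2 (volume : Measure (Lat d))}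
  {Ω : Type*} {mΩ : MeasurableSpace Ω} {P : Measure Ω} [IsProbabilityMeasure P]
  {ℱ : Filtration ℝ≥0 mΩ} {u : ℝ≥0 → Ω → Lp ℂ 2 (volume : Measure (Lat d))}
  {G : Type*} [NormedAddCommGroup G] [NormedSpace ℝ G] [CompleteSpace G] {n : ℕ}

lemma exists_cylinder_bound (hR : IsCovariance R) (k₀ ε η : ℝ) (φ : Fin n → 𝓢(Lat d, ℂ))
    (C : ℝ) (hC : 0 ≤ C) (k : ℕ) : ∃ D : ℝ, 0 ≤ D ∧ ∀ f : (Fin n → ℂ) → G,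
      (∀ j ≤ 2, ∀ U, ‖iteratedFDeriv ℝ j f U‖ ≤ C * (1 + ‖U‖) ^ k) →
      ∀ w, ‖f (pairings φ w)‖ ≤ D * (1 + ‖w‖) ^ (k + 2) ∧
        ‖cylGenerator k₀ ε η R f φ w‖ ≤ D * (1 + ‖w‖) ^ (k + 2) := by
  obtain ⟨A, hA, hA'⟩ := exists_norm_cylGenerator_le (G := G) hR k₀ ε η φ
  set T := testSize φ
  have hT : 0 ≤ T := testSize_nonneg φ
  refine ⟨C * (1 + T) ^ k * (1 + 2 * A), by positivity, fun f hf w => ?_⟩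
  have hw : 0 ≤ ‖w‖ := norm_nonneg w
  have h1 : 1 + ‖pairings φ w‖ ≤ (1 + T) * (1 + ‖w‖) := by
    have := norm_pairings_le φ w
    nlinarith
  have h2 : C * (1 + ‖pairings φ w‖) ^ k ≤ C * (1 + T) ^ k * (1 + ‖w‖) ^ k := by
    rw [mul_assoc, ← mul_pow]
    gcongr
  have f0 := (hf 0 (by norm_num) (pairings φ w)).trans h2
  have f1 := (hf 1 (by norm_num) (pairings φ w)).trans h2
  have f2 := (hf 2 le_rfl (pairings φ w)).trans h2
  rw [norm_iteratedFDeriv_zero] at f0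
  rw [norm_iteratedFDeriv_one] at f1
  rw [← norm_iteratedFDeriv_fderiv, norm_iteratedFDeriv_one] at f2
  have hp : (1 + ‖w‖) ^ k ≤ (1 + ‖w‖) ^ (k + 2) := pow_le_pow_right₀ (by linarith) (by omega)
  set B := C * (1 + T) ^ k
  have hB : 0 ≤ B := by positivity
  constructor
  · calc _ ≤ B * (1 + ‖w‖) ^ k := f0
      _ ≤ B * (1 + 2 * A) * (1 + ‖w‖) ^ (k + 2) := by
        gcongr
        exact le_mul_of_one_le_right hB (by linarith)
  · refine (hA' f w).trans ?_
    calc _ ≤ A * (B * (1 + ‖w‖) ^ k + B * (1 + ‖w‖) ^ k) * (1 + ‖w‖) ^ 2 := by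
          refine mul_le_mul_of_nonneg_right (mul_le_mul_of_nonneg_left (add_le_add f1 f2) hA)
            (by positivity)
      _ = B * (2 * A) * (1 + ‖w‖) ^ (k + 2) := by ring
      _ ≤ _ := by gcongr; linarith

/-- The martingale problem only admits compactly supported functions. Cutoffs at radius of order `N`
agree with `f` near any given point for large `N`, together with their generators, and obey
polynomial bounds uniform in `N`. The moment hypothesis then allows the passage to the limit. -/
lemma IsSolution.dynkin_real (S : IsSolution k₀ ε η R u₀ P ℱ u) (hR : IsCovariance R)
    (φ : Fin n → 𝓢(Lat d, ℂ)) {f : (Fin n → ℂ) → ℝ} (hf : f.HasTemperateGrowth) (z : ℝ≥0) :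
    ∫ ω, f (pairings φ (u z ω)) ∂P = f (pairings φ u₀)
      + ∫ s in (0 : ℝ)..z, ∫ ω, cylGenerator k₀ ε η R f φ (u s.toNNReal ω) ∂P := by
  obtain ⟨θ, hθs, hθc, hθ1⟩ : ∃ θ : (Fin n → ℂ) → ℝ, ContDiff ℝ (⊤ : ℕ∞) θ ∧ HasCompactSupport θ ∧
      ∀ U, ‖U‖ ≤ 1 → θ U = 1 := by
    let b : ContDiffBump (0 : Fin n → ℂ) := ⟨1, 2, one_pos, one_lt_two⟩
    exact ⟨b, b.contDiff, b.hasCompactSupport, fun U hU => b.one_of_mem_closedBall (by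
      simpa using hU)⟩
  obtain ⟨k, C, hC, hcut⟩ := exists_norm_cutoff_le hf (hθc.hasTemperateGrowth hθs)
  obtain ⟨D, hD, hbound⟩ := exists_cylinder_bound (G := ℝ) hR k₀ ε η φ C hC k
  have hc0 : ∀ N : ℕ, 0 < ((N : ℝ) + 1)⁻¹ := fun N => by positivity
  have hc1 : ∀ N : ℕ, ((N : ℝ) + 1)⁻¹ ≤ 1 := fun N => inv_le_one_of_one_le₀ (by
    have : (0 : ℝ) ≤ N := Nat.cast_nonneg N
    linarith)
  let F : ℕ → (Fin n → ℂ) → ℝ := fun N U => θ (((N : ℝ) + 1)⁻¹ • U) * f U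
  have hFs : ∀ N, ContDiff ℝ (⊤ : ℕ∞) (F N) := fun N =>
    (hθs.comp (contDiff_const_smul _)).mul hf.1
  have hFc : ∀ N, HasCompactSupport (F N) := fun N =>
    (hθc.comp_homeomorph (Homeomorph.smulOfNeZero _ (hc0 N).ne')).mul_right
  have hFb := fun N => hbound (F N) (hcut _ (hc0 N).le (hc1 N))
  have hloc : ∀ U, ∀ᶠ N : ℕ in atTop, F N =ᶠ[𝓝 U] f := fun U => by
    filter_upwards [eventually_gt_atTop ⌈‖U‖⌉₊] with N hN
    have hlt : ‖U‖ < (N : ℝ) + 1 := by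
      have := Nat.le_ceil ‖U‖
      have h2 : ((⌈‖U‖⌉₊ : ℕ) : ℝ) < N := by exact_mod_cast hN
      linarith
    have : {U' : Fin n → ℂ | ‖U'‖ < (N : ℝ) + 1} ∈ 𝓝 U :=
      (isOpen_lt continuous_norm continuous_const).mem_nhds hlt
    filter_upwards [this] with U' hU'
    have h1 : θ (((N : ℝ) + 1)⁻¹ • U') = 1 := by
      refine hθ1 _ ?_
      rw [norm_smul, Real.norm_of_nonneg (hc0 N).le, inv_mul_le_iff₀ (by positivity), mul_one]
      exact hU'.le
    simp only [F, h1, one_mul]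
  have hval : ∀ w, ∀ᶠ N in atTop, F N (pairings φ w) = f (pairings φ w) := fun w =>
    (hloc _).mono fun N h => h.self_of_nhds
  have hgen : ∀ w, ∀ᶠ N in atTop,
      cylGenerator k₀ ε η R (F N) φ w = cylGenerator k₀ ε η R f φ w := fun w =>
    (hloc _).mono fun N h => cylGenerator_congr h
  have hfb : ∀ w, ‖f (pairings φ w)‖ ≤ D * (1 + ‖w‖) ^ (k + 2) := fun w => by
    obtain ⟨N, hN⟩ := (hval w).exists
    rw [← hN]; exact (hFb N w).1
  have hgb : ∀ w, ‖cylGenerator k₀ ε η R f φ w‖ ≤ D * (1 + ‖w‖) ^ (k + 2) := fun w => by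
    obtain ⟨N, hN⟩ := (hgen w).exists
    rw [← hN]; exact (hFb N w).2
  have hgc : ∀ {f' : (Fin n → ℂ) → ℝ}, ContDiff ℝ (⊤ : ℕ∞) f' →
      Continuous (cylGenerator k₀ ε η R f' φ) := fun h =>
    continuous_cylGenerator hR k₀ ε η (contDiff_infty.1 h 2) φ
  have hfc : Continuous fun w => f (pairings φ w) :=
    hf.1.continuous.comp (continuous_pairings φ)
  have hpath : ∀ ω, Continuous fun s : ℝ => u s.toNNReal ω := fun ω =>
    (S.continuous ω).comp continuous_real_toNNReal
  have hpow : ∀ ω, Continuous fun s : ℝ => D * (1 + ‖u s.toNNReal ω‖) ^ (k + 2) := fun ω =>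
    continuous_const.mul ((continuous_const.add (hpath ω).norm).pow _)
  have hdom := S.integral_swap (G := ℝ) (Ψ := fun w => D * (1 + ‖w‖) ^ (k + 2)) (by fun_prop) hD
    (fun w => by rw [Real.norm_of_nonneg (by positivity)]) z
  have hdom2 : Integrable (fun ω => D * (1 + ‖u z ω‖) ^ (k + 2)) P :=
    S.integrable_comp (G := ℝ) (Ψ := fun w => D * (1 + ‖w‖) ^ (k + 2)) (by fun_prop)
      (fun w => by rw [Real.norm_of_nonneg (by positivity)]) z
  have hz : (0 : ℝ) ≤ z := z.coe_nonneg
  have hlim : Tendsto (fun N => ∫ ω, (F N (pairings φ (u z ω))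
      - ∫ s in (0 : ℝ)..z, cylGenerator k₀ ε η R (F N) φ (u s.toNNReal ω)) ∂P) atTop
      (𝓝 (∫ ω, (f (pairings φ (u z ω))
      - ∫ s in (0 : ℝ)..z, cylGenerator k₀ ε η R f φ (u s.toNNReal ω)) ∂P)) := by
    refine tendsto_integral_of_dominated_convergence
      (fun ω => D * (1 + ‖u z ω‖) ^ (k + 2)
        + ∫ s in (0 : ℝ)..z, D * (1 + ‖u s.toNNReal ω‖) ^ (k + 2))
      (fun N => (S.dynkin_of_hasCompactSupport φ (hFs N) (hFc N) z).1.1)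
      (hdom2.add hdom.1) (fun N => ae_of_all _ fun ω => ?_) (ae_of_all _ fun ω => ?_)
    · refine (norm_sub_le _ _).trans (add_le_add (hFb N _).1 ?_)
      refine intervalIntegral.norm_integral_le_of_norm_le hz
        (ae_of_all _ fun s _ => (hFb N _).2) ?_
      exact Continuous.intervalIntegrable (hpow ω) _ _
    · refine Tendsto.sub ?_ ?_
      · exact tendsto_const_nhds.congr' ((hval _).mono fun N h => h.symm)
      · refine intervalIntegral.tendsto_integral_filter_of_dominated_convergence
          (fun s => D * (1 + ‖u s.toNNReal ω‖) ^ (k + 2)) (Eventually.of_forall fun N => ?_)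
          (Eventually.of_forall fun N => ae_of_all _ fun s _ => (hFb N _).2) ?_
          (ae_of_all _ fun s _ => ?_)
        · exact ((hgc (hFs N)).comp (hpath ω)).aestronglyMeasurable
        · exact Continuous.intervalIntegrable (hpow ω) _ _
        · exact tendsto_const_nhds.congr' ((hgen _).mono fun N h => h.symm)
  have hlim2 : Tendsto (fun N => ∫ ω, (F N (pairings φ (u z ω))
      - ∫ s in (0 : ℝ)..z, cylGenerator k₀ ε η R (F N) φ (u s.toNNReal ω)) ∂P) atTop
      (𝓝 (f (pairings φ u₀))) := by
    refine tendsto_const_nhds.congr' ((hval u₀).mono fun N h => ?_)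
    simp only []
    rw [(S.dynkin_of_hasCompactSupport φ (hFs N) (hFc N) z).2, h]
  have heq := tendsto_nhds_unique hlim hlim2
  have hsw := S.integral_swap (hgc hf.1) hD hgb z
  rw [integral_sub (S.integrable_comp hfc hfb z) hsw.1, hsw.2] at heq
  linarith

lemma covForm_comp_left {V : Type*} [NormedAddCommGroup V] [NormedSpace ℝ V]
    {H : Type*} [NormedAddCommGroup H] [NormedSpace ℝ H] [CompleteSpace H]
    (hR : IsCovariance R) (L : G →L[ℝ] H) (B : V →L[ℝ] V →L[ℝ] G) (B' : V →L[ℝ] V →L[ℝ] H)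
    (hB : ∀ x y, B' x y = L (B x y)) {a b : Lat d → V}
    (ha : Integrable a) (hb : Integrable b) : covForm R B' a b = L (covForm R B a b) := by
  rw [covForm_eq hR _ ha hb, covForm_eq hR _ ha hb,
    ← L.integral_comp_comm (integrable_covForm hR B ha hb)]
  refine integral_congr_ae (ae_of_all _ fun z => ?_)
  simp only [hB, map_smul]

lemma cylGenerator_comp_left {H : Type*} [NormedAddCommGroup H] [NormedSpace ℝ H] [CompleteSpace H]
    (hR : IsCovariance R) (k₀ ε η : ℝ) (L : G →L[ℝ] H) {f : (Fin n → ℂ) → G} (hf : ContDiff ℝ 2 f)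
    (φ : Fin n → 𝓢(Lat d, ℂ)) (w : Lp ℂ 2 (volume : Measure (Lat d))) :
    cylGenerator k₀ ε η R (fun U => L (f U)) φ w = L (cylGenerator k₀ ε η R f φ w) := by
  have hf1 : ContDiff ℝ 1 (fderiv ℝ f) := hf.fderiv_right (by norm_num)
  have e1 : fderiv ℝ (fun U => L (f U)) = fun U => L.comp (fderiv ℝ f U) := by
    ext1 U
    exact (L.hasFDerivAt.comp U (hf.differentiable (by norm_num) U).hasFDerivAt).fderiv
  have e2 : ∀ U x y, fderiv ℝ (fderiv ℝ (fun U => L (f U))) U x y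
      = L (fderiv ℝ (fderiv ℝ f) U x y) := fun U x y => by
    have h1 := (hf1.differentiable (by norm_num) U).hasFDerivAt
    have h2 := ((ContinuousLinearMap.compL ℝ (Fin n → ℂ) G H L).hasFDerivAt
      (x := fderiv ℝ f U)).comp U h1
    rw [e1]
    have h3 := congrArg (fun T => T x y) h2.fderiv
    exact h3
  rw [cylGenerator, cylGenerator, map_add, map_smul,
    ← covForm_comp_left hR L _ _ (e2 _) (integrable_noiseDir w φ) (integrable_noiseDir w φ), e1]
  rfl

lemma IsSolution.dynkin (S : IsSolution k₀ ε η R u₀ P ℱ u) (hR : IsCovariance R)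
    (φ : Fin n → 𝓢(Lat d, ℂ)) {f : (Fin n → ℂ) → ℂ} (hf : f.HasTemperateGrowth) (z : ℝ≥0) :
    ∫ ω, f (pairings φ (u z ω)) ∂P = f (pairings φ u₀)
      + ∫ s in (0 : ℝ)..z, ∫ ω, cylGenerator k₀ ε η R f φ (u s.toNNReal ω) ∂P := by
  obtain ⟨k, C, hC, hb⟩ := hf.norm_iteratedFDeriv_le_uniform 2
  obtain ⟨D, hD, hbound⟩ := exists_cylinder_bound (G := ℂ) hR k₀ ε η φ C hC k
  have hf2 : ContDiff ℝ 2 f := contDiff_infty.1 hf.1 2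
  have hgc : Continuous (cylGenerator k₀ ε η R f φ) := continuous_cylGenerator hR k₀ ε η hf2 φ
  have hi1 : Integrable (fun ω => f (pairings φ (u z ω))) P := S.integrable_comp (hf.1.continuous.comp (continuous_pairings φ))
    (fun w => (hbound f hb w).1) z
  have hi2 := fun s : ℝ => S.integrable_comp hgc (fun w => (hbound f hb w).2) s.toNNReal
  have hi3 : IntervalIntegrable (fun s : ℝ => ∫ ω, cylGenerator k₀ ε η R f φ (u s.toNNReal ω) ∂P)
      volume 0 z := by
    have := S.continuous_expect (Y := Unit) (Ψ := fun _ => cylGenerator k₀ ε η R f φ)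
      (hgc.comp continuous_snd) hD (fun _ w => (hbound f hb w).2)
    exact (this.comp (by fun_prop : Continuous fun s : ℝ => (((), s.toNNReal) : Unit × ℝ≥0)))
      |>.intervalIntegrable _ _
  -- The martingale problem concerns real functions. The complex formula follows by testing with
  -- real linear functionals, which commute with the generator.
  have key : ∀ L : ℂ →L[ℝ] ℝ, L (∫ ω, f (pairings φ (u z ω)) ∂P) = L (f (pairings φ u₀)
      + ∫ s in (0 : ℝ)..z, ∫ ω, cylGenerator k₀ ε η R f φ (u s.toNNReal ω) ∂P) := fun L => by
    have h := S.dynkin_real hR φ (f := fun U => L (f U)) (L.hasTemperateGrowth.comp hf) z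
    simp only [cylGenerator_comp_left hR k₀ ε η L hf2] at h
    rw [map_add, ← L.integral_comp_comm hi1, ← L.intervalIntegral_comp_comm hi3]
    refine h.trans ?_
    congr 2
    ext s
    exact L.integral_comp_comm (hi2 s)
  exact Complex.ext (key Complex.reCLM) (key Complex.imCLM)

end Dynkin

/-! ### The generator on products of amplitudes -/

section ProductAmplitude

variable {d : ℕ} {R : Lat d → ℝ}

/-- Writing `R(x - y)` as a superposition of `e^{ik·x} e^{-ik·y}` decouples the two space variables,
so that each factor of a product sees a plane wave. -/
lemma covForm_mul_eq (hR : IsCovariance R) {α β : Lat d → ℂ} (hα : Integrable α)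
    (hβ : Integrable β) : covForm R (ContinuousLinearMap.mul ℝ ℂ) α β =
      ∫ k, (spec R k : ℂ) * ((∫ x, α x * Complex.exp (Complex.I * (⟪k, x⟫ : ℝ))) *
        ∫ y, β y * Complex.exp (Complex.I * (⟪-k, y⟫ : ℝ))) := by
  have hs : Integrable fun k : Lat d => (spec R k : ℂ) := (integrable_spec hR).ofReal
  have h1 : Integrable (fun p : (Lat d × Lat d) × Lat d => (α p.1.1 * β p.1.2) * (spec R p.2 : ℂ))
      ((volume.prod volume).prod volume) := (hα.mul_prod hβ).mul_prod hs
  have h2 : Integrable (fun p : (Lat d × Lat d) × Lat d => (α p.1.1 * β p.1.2) *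
      (spec R p.2 : ℂ) * Complex.exp (Complex.I * (⟪p.2, p.1.1 - p.1.2⟫ : ℝ)))
      ((volume.prod volume).prod volume) := by
    refine h1.mul_bdd (c := 1) ?_ (ae_of_all _ fun p => ?_)
    · exact Continuous.aestronglyMeasurable (by fun_prop)
    · rw [mul_comm, Complex.norm_exp_ofReal_mul_I]
  calc covForm R (ContinuousLinearMap.mul ℝ ℂ) α β
      = ∫ z : Lat d × Lat d, (∫ k : Lat d, (α z.1 * β z.2) * (spec R k : ℂ)
          * Complex.exp (Complex.I * (⟪k, z.1 - z.2⟫ : ℝ))) ∂(volume.prod volume) := by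
        rw [covForm_eq hR _ hα hβ]
        refine integral_congr_ae (ae_of_all _ fun z => ?_)
        simp only [ContinuousLinearMap.mul_apply', Complex.real_smul]
        rw [covariance_eq_integral hR, mul_comm, ← integral_const_mul]
        simp only [mul_assoc]
    _ = ∫ k, ∫ z : Lat d × Lat d, (α z.1 * β z.2) * (spec R k : ℂ)
          * Complex.exp (Complex.I * (⟪k, z.1 - z.2⟫ : ℝ)) ∂(volume.prod volume) :=
        integral_integral_swap h2
    _ = _ := by
        refine integral_congr_ae (ae_of_all _ fun k => ?_)
        simp only []
        rw [← integral_prod_mul, ← integral_const_mul]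
        refine integral_congr_ae (ae_of_all _ fun z => ?_)
        have : Complex.exp (Complex.I * (⟪k, z.1 - z.2⟫ : ℝ))
          = Complex.exp (Complex.I * (⟪k, z.1⟫ : ℝ)) * Complex.exp (Complex.I * (⟪-k, z.2⟫ : ℝ)) := by
          rw [← Complex.exp_add, inner_sub_right, inner_neg_left]
          congr 1; push_cast; ring
        simp only [this]
        ring

variable {ι : Type*} [Fintype ι] [DecidableEq ι] {σ : ι → ℝ} (hσ : ∀ i, σ i = 1 ∨ σ i = -1)

/-- The product of the amplitudes in `T`. -/
noncomputable def prodAmp (σ : ι → ℝ) (T : Finset ι) (w : Lp ℂ 2 (volume : Measure (Lat d)))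
    (χ : ι → Lat d → ℂ) : ℂ := ∏ i ∈ T, amp (σ i) w (χ i)

/-- Multiplication by `-|ξ|²`. -/
noncomputable def negSq (χ : Lat d → ℂ) (ξ : Lat d) : ℂ := ((-‖ξ‖ ^ 2 : ℝ) : ℂ) * χ ξ

/-- The action of the interaction `e` on test functions, without its phase. -/
noncomputable def edgeTest (σ : ι → ℝ) (e : ι × ι) (k : Lat d) (χ : ι → Lat d → ℂ) (m : ι)
    (ξ : Lat d) : ℂ :=
  χ m (ξ + (if m = e.1 then σ e.1 • k else 0) - (if m = e.2 then σ e.2 • k else 0))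

lemma IsTest.edgeTest {χ : ι → Lat d → ℂ} (h : ∀ i, IsTest (χ i)) (σ : ι → ℝ) (e : ι × ι)
    (k : Lat d) (m : ι) : IsTest (edgeTest σ e k χ m) := by
  unfold ItoSchrodinger.edgeTest
  simp only [add_sub_assoc]
  exact (h m).shift _

/-- The coordinates on which products of amplitudes depend. -/
noncomputable def signCoord (σ : ι → ℝ) (i : ι) : (Fin (Fintype.card ι) → ℂ) →L[ℝ] ℂ :=
  (conjSign (σ i)).comp (ContinuousLinearMap.proj (Fintype.equivFin ι i))

/-- The product of the coordinates in `T`. -/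
noncomputable def signProd (σ : ι → ℝ) (T : Finset ι) (U : Fin (Fintype.card ι) → ℂ) : ℂ :=
  ∏ i ∈ T, signCoord σ i U

/-- The family of wave test functions of a family of test functions. -/
noncomputable def waveTests (σ : ι → ℝ) {χ : ι → Lat d → ℂ} (h : ∀ i, IsTest (χ i))
    (j : Fin (Fintype.card ι)) : 𝓢(Lat d, ℂ) :=
  waveTest (σ ((Fintype.equivFin ι).symm j)) (h ((Fintype.equivFin ι).symm j))

lemma waveTests_equivFin (σ : ι → ℝ) {χ : ι → Lat d → ℂ} (h : ∀ i, IsTest (χ i)) (i : ι) :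
    waveTests σ h (Fintype.equivFin ι i) = waveTest (σ i) (h i) := by
  have : ∀ i', i' = i → waveTest (σ i') (h i') = waveTest (σ i) (h i) := by rintro _ rfl; rfl
  exact this _ (Equiv.symm_apply_apply _ _)

lemma signCoord_pairings (σ : ι → ℝ) {χ : ι → Lat d → ℂ} (h : ∀ i, IsTest (χ i)) (i : ι)
    (w : Lp ℂ 2 (volume : Measure (Lat d))) :
    signCoord σ i (pairings (waveTests σ h) w) = amp (σ i) w (χ i) := by
  rw [← conjSign_pairing_waveTest (σ i) w (h i), ← waveTests_equivFin]
  rfl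

lemma signProd_pairings (σ : ι → ℝ) (T : Finset ι) {χ : ι → Lat d → ℂ} (h : ∀ i, IsTest (χ i))
    (w : Lp ℂ 2 (volume : Measure (Lat d))) :
    signProd σ T (pairings (waveTests σ h) w) = prodAmp σ T w χ :=
  Finset.prod_congr rfl fun i _ => signCoord_pairings σ h i w

lemma hasTemperateGrowth_signProd (σ : ι → ℝ) (T : Finset ι) :
    (signProd σ T).HasTemperateGrowth := by
  induction T using Finset.induction_on with
  | empty =>
    have : signProd σ (∅ : Finset ι) = fun _ => 1 := by ext; simp [signProd]
    rw [this]; exact .const 1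
  | insert a T ha ih =>
    have : signProd σ (insert a T) = (fun U => signCoord σ a U) * signProd σ T := by
      ext U; simp [signProd, Finset.prod_insert ha]
    rw [this]
    exact (signCoord σ a).hasTemperateGrowth.mul ih

lemma hasFDerivAt_signProd (σ : ι → ℝ) (T : Finset ι) (U : Fin (Fintype.card ι) → ℂ) :
    HasFDerivAt (signProd σ T) (∑ i ∈ T, signProd σ (T.erase i) U • signCoord σ i) U :=
  HasFDerivAt.finsetProd fun i _ => (signCoord σ i).hasFDerivAt

lemma fderiv_signProd (σ : ι → ℝ) (T : Finset ι) :
    fderiv ℝ (signProd σ T) = fun U => ∑ i ∈ T, signProd σ (T.erase i) U • signCoord σ i :=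
  funext fun U => (hasFDerivAt_signProd σ T U).fderiv

lemma fderiv_fderiv_signProd (σ : ι → ℝ) (T : Finset ι) (U x y : Fin (Fintype.card ι) → ℂ) :
    fderiv ℝ (fderiv ℝ (signProd σ T)) U x y = ∑ e ∈ T.offDiag,
      signProd σ ((T.erase e.2).erase e.1) U * (signCoord σ e.1 x * signCoord σ e.2 y) := by
  have h : HasFDerivAt (fun U => ∑ i ∈ T, signProd σ (T.erase i) U • signCoord σ i)
      (∑ i ∈ T, (∑ j ∈ T.erase i, signProd σ ((T.erase i).erase j) U • signCoord σ j).smulRight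
        (signCoord σ i)) U :=
    HasFDerivAt.fun_sum fun i _ => HasFDerivAt.smul_const
      (F := (Fin (Fintype.card ι) → ℂ) →L[ℝ] ℂ) (hasFDerivAt_signProd σ (T.erase i) U)
      (signCoord σ i)
  rw [fderiv_signProd, h.fderiv]
  rw [Finset.sum_finset_product_right' T.offDiag T (fun i => T.erase i)
    (f := fun j i => signProd σ ((T.erase i).erase j) U * (signCoord σ j x * signCoord σ i y))
    (fun p => by simp [Finset.mem_offDiag]; tauto)]
  simp only [_root_.sum_apply, ContinuousLinearMap.smulRight_apply, _root_.smul_apply, smul_eq_mul,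
    Finset.sum_mul, mul_assoc]

lemma prodAmp_update (T : Finset ι) (w : Lp ℂ 2 (volume : Measure (Lat d))) (χ : ι → Lat d → ℂ)
    {i : ι} (hi : i ∈ T) (χ' : Lat d → ℂ) :
    prodAmp σ T w (Function.update χ i χ') = prodAmp σ (T.erase i) w χ * amp (σ i) w χ' := by
  rw [prodAmp, ← Finset.prod_erase_mul _ _ hi, Function.update_self, prodAmp]
  congr 1
  refine Finset.prod_congr rfl fun j hj => ?_
  rw [Function.update_of_ne (Finset.ne_of_mem_erase hj)]

lemma prodAmp_edgeTest (T : Finset ι) (w : Lp ℂ 2 (volume : Measure (Lat d))) (χ : ι → Lat d → ℂ)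
    {e : ι × ι} (he : e ∈ T.offDiag) (k : Lat d) :
    prodAmp σ T w (edgeTest σ e k χ) = prodAmp σ ((T.erase e.2).erase e.1) w χ *
      (amp (σ e.1) w (fun ξ => χ e.1 (ξ + σ e.1 • k)) *
        amp (σ e.2) w (fun ξ => χ e.2 (ξ + σ e.2 • -k))) := by
  rw [Finset.mem_offDiag] at he
  have h1 : e.1 ∈ T.erase e.2 := Finset.mem_erase.2 ⟨he.2.2, he.1⟩
  rw [prodAmp, ← Finset.prod_erase_mul _ _ he.2.1, ← Finset.prod_erase_mul _ _ h1, prodAmp,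
    mul_assoc]
  congr 1
  · refine Finset.prod_congr rfl fun j hj => ?_
    have hj1 := Finset.ne_of_mem_erase hj
    have hj2 := Finset.ne_of_mem_erase (Finset.mem_of_mem_erase hj)
    congr 1
    ext ξ
    simp [edgeTest, hj1, hj2]
  · congr 2 <;> ext ξ <;> simp [edgeTest, he.2.2, he.2.2.symm, sub_eq_add_neg]

include hσ in
lemma conjSign_drift (k₀ ε η : ℝ) (i : ι) (w : Lp ℂ 2 (volume : Measure (Lat d))) {χ : Lat d → ℂ}
    (h : IsTest χ) : conjSign (σ i) (drift k₀ ε η R w (waveTest (σ i) h)) =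
      σ i * Complex.I * ((η / (k₀ * ε) / 2 : ℝ) : ℂ) * amp (σ i) w (negSq χ)
        - ((k₀ ^ 2 * R 0 / (8 * η ^ 2) : ℝ) : ℂ) * amp (σ i) w χ := by
  rw [drift, map_sub, conjSign_mul, conjSign_mul, conjSign_ofReal, laplacian_waveTest,
    conjSign_pairing_waveTest, conjSign_pairing_waveTest]
  have e : Complex.I * η / (2 * k₀ * ε) = Complex.I * ((η / (k₀ * ε) / 2 : ℝ) : ℂ) := by
    push_cast
    rw [div_div, mul_div_assoc]
    congr 2; ring
  rw [e, conjSign_mul, conjSign_I (hσ i), conjSign_ofReal]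
  rfl

lemma continuous_signCoord_noiseDir (σ : ι → ℝ) {χ : ι → Lat d → ℂ} (h : ∀ i, IsTest (χ i))
    (w : Lp ℂ 2 (volume : Measure (Lat d))) (i : ι) :
    Integrable fun x => signCoord σ i (noiseDir w (waveTests σ h) x) :=
  (signCoord σ i).integrable_comp (integrable_noiseDir w _)

include hσ in
lemma integral_signCoord_noiseDir {χ : ι → Lat d → ℂ} (h : ∀ i, IsTest (χ i))
    (w : Lp ℂ 2 (volume : Measure (Lat d))) (i : ι) (k : Lat d) :
    ∫ x, signCoord σ i (noiseDir w (waveTests σ h) x) * Complex.exp (Complex.I * (⟪k, x⟫ : ℝ))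
      = σ i * Complex.I * amp (σ i) w (fun ξ => χ i (ξ + σ i • k)) := by
  rw [← integral_waveTest_mul (σ i) (hσ i) w (h i), ← integral_const_mul]
  refine integral_congr_ae (ae_of_all _ fun x => ?_)
  have e : signCoord σ i (noiseDir w (waveTests σ h) x)
      = conjSign (σ i) (Complex.I * (w x * waveTest (σ i) (h i) x)) := by
    rw [← waveTests_equivFin, ← mul_assoc]; rfl
  simp only [e]
  rw [conjSign_mul, conjSign_I (hσ i), mul_assoc]

include hσ in
-- The Hessian of a product is a sum over ordered pairs of factors. Each factor of the pair
-- contributes `σ i` from the noise and a translated test function; the sign comes from `i² = -1`.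
lemma covForm_signProd (hR : IsCovariance R) (T : Finset ι) {χ : ι → Lat d → ℂ}
    (h : ∀ i, IsTest (χ i)) (w : Lp ℂ 2 (volume : Measure (Lat d))) :
    covForm R (fderiv ℝ (fderiv ℝ (signProd σ T)) (pairings (waveTests σ h) w))
      (noiseDir w (waveTests σ h)) (noiseDir w (waveTests σ h))
      = ∑ e ∈ T.offDiag, ((-(σ e.1 * σ e.2) : ℝ) : ℂ) *
          ∫ k, (spec R k : ℂ) * prodAmp σ T w (edgeTest σ e k χ) := by
  have hi := integrable_noiseDir w (waveTests σ h)
  have hc := continuous_signCoord_noiseDir σ h w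
  rw [covForm_eq hR _ hi hi]
  have e1 : ∀ z : Lat d × Lat d, R (z.1 - z.2) •
      fderiv ℝ (fderiv ℝ (signProd σ T)) (pairings (waveTests σ h) w)
        (noiseDir w (waveTests σ h) z.1) (noiseDir w (waveTests σ h) z.2)
      = ∑ e ∈ T.offDiag, prodAmp σ ((T.erase e.2).erase e.1) w χ *
        (R (z.1 - z.2) • ContinuousLinearMap.mul ℝ ℂ
          (signCoord σ e.1 (noiseDir w (waveTests σ h) z.1))
          (signCoord σ e.2 (noiseDir w (waveTests σ h) z.2))) := fun z => by
    rw [fderiv_fderiv_signProd, Finset.smul_sum]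
    refine Finset.sum_congr rfl fun e _ => ?_
    rw [signProd_pairings, mul_smul_comm]
    rfl
  simp only [e1]
  rw [integral_finsetSum _ fun e _ =>
    (integrable_covForm hR (ContinuousLinearMap.mul ℝ ℂ) (hc e.1) (hc e.2)).const_mul _]
  refine Finset.sum_congr rfl fun e he => ?_
  rw [integral_const_mul, ← covForm_eq hR _ (hc e.1) (hc e.2), covForm_mul_eq hR (hc e.1) (hc e.2),
    ← integral_const_mul, ← integral_const_mul]
  refine integral_congr_ae (ae_of_all _ fun k => ?_)
  simp only [integral_signCoord_noiseDir hσ, prodAmp_edgeTest T w χ he]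
  push_cast
  linear_combination (spec R k : ℂ) * prodAmp σ ((T.erase e.2).erase e.1) w χ * σ e.1 * σ e.2 *
    amp (σ e.1) w (fun ξ => χ e.1 (ξ + σ e.1 • k)) *
    amp (σ e.2) w (fun ξ => χ e.2 (ξ + σ e.2 • -k)) * Complex.I_mul_I

include hσ in
-- Explains the values of `edgeCoef`. For opposite types the two orders contribute `1` each, carried
-- here by one order alone. For equal types the total `-2` is shared as twice `-1/2`, with the
-- factor `2` in front.
lemma sum_offDiag_sign (T : Finset ι) (Q : ι × ι → ℂ) (hQ : ∀ e, Q e.swap = Q e) :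
    ∑ e ∈ T.offDiag, ((-(σ e.1 * σ e.2) : ℝ) : ℂ) * Q e
      = 2 * ∑ e ∈ T.offDiag, (edgeCoef σ e : ℂ) * Q e := by
  have hs : ∑ e ∈ T.offDiag, (edgeCoef σ e : ℂ) * Q e
      = ∑ e ∈ T.offDiag, (edgeCoef σ e.swap : ℂ) * Q e := by
    refine Finset.sum_nbij' Prod.swap Prod.swap ?_ ?_ ?_ ?_ ?_
    · intro e he; simp only [Finset.mem_offDiag, Prod.fst_swap, Prod.snd_swap] at he ⊢
      exact ⟨he.2.1, he.1, he.2.2.symm⟩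
    · intro e he; simp only [Finset.mem_offDiag, Prod.fst_swap, Prod.snd_swap] at he ⊢
      exact ⟨he.2.1, he.1, he.2.2.symm⟩
    · intro e _; simp
    · intro e _; simp
    · intro e _; rw [Prod.swap_swap, hQ]
  rw [two_mul]
  nth_rewrite 2 [hs]
  rw [← Finset.sum_add_distrib]
  refine Finset.sum_congr rfl fun e _ => ?_
  rw [← add_mul, ← Complex.ofReal_add]
  congr 2
  simp only [edgeCoef, Prod.fst_swap, Prod.snd_swap]
  rcases hσ e.1 with h1 | h1 <;> rcases hσ e.2 with h2 | h2 <;> norm_num [h1, h2]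

lemma integral_edgeTest_swap (hR : IsCovariance R) (T : Finset ι) (χ : ι → Lat d → ℂ)
    (w : Lp ℂ 2 (volume : Measure (Lat d))) (e : ι × ι) :
    ∫ k, (spec R k : ℂ) * prodAmp σ T w (edgeTest σ e.swap k χ)
      = ∫ k, (spec R k : ℂ) * prodAmp σ T w (edgeTest σ e k χ) := by
  rw [← integral_neg_eq_self]
  refine integral_congr_ae (ae_of_all _ fun k => ?_)
  simp only [spec_neg hR]
  congr 2
  ext m ξ
  simp only [edgeTest, Prod.fst_swap, Prod.snd_swap]
  congr 1
  split_ifs <;> simp [sub_eq_add_neg]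
  abel

include hσ in
/-- The generator on a product of amplitudes. -/
lemma cylGenerator_signProd (hR : IsCovariance R) (k₀ ε η : ℝ) (T : Finset ι) {χ : ι → Lat d → ℂ}
    (h : ∀ i, IsTest (χ i)) (w : Lp ℂ 2 (volume : Measure (Lat d))) :
    cylGenerator k₀ ε η R (signProd σ T) (waveTests σ h) w =
      (∑ i ∈ T, (σ i * Complex.I * ((η / (k₀ * ε) / 2 : ℝ) : ℂ) *
          prodAmp σ T w (Function.update χ i (negSq (χ i)))
        - ((k₀ ^ 2 * R 0 / (8 * η ^ 2) : ℝ) : ℂ) * prodAmp σ T w χ))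
      + ∑ e ∈ T.offDiag, ((k₀ ^ 2 / (4 * η ^ 2) * edgeCoef σ e : ℝ) : ℂ) *
          ∫ k, (spec R k : ℂ) * prodAmp σ T w (edgeTest σ e k χ) := by
  rw [cylGenerator, covForm_signProd hσ hR,
    sum_offDiag_sign hσ T (fun e => ∫ k, (spec R k : ℂ) * prodAmp σ T w (edgeTest σ e k χ))
      (integral_edgeTest_swap hR T χ w)]
  congr 1
  · rw [fderiv_signProd, _root_.sum_apply]
    refine Finset.sum_congr rfl fun i hi => ?_
    rw [_root_.smul_apply, smul_eq_mul, signProd_pairings, prodAmp_update T w χ hi]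
    have e1 : signCoord σ i (fun j => drift k₀ ε η R w (waveTests σ h j))
        = conjSign (σ i) (drift k₀ ε η R w (waveTest (σ i) (h i))) := by
      rw [← waveTests_equivFin]; rfl
    have e2 : prodAmp σ T w χ = prodAmp σ (T.erase i) w χ * amp (σ i) w (χ i) :=
      (Finset.prod_erase_mul _ _ hi).symm
    rw [e1, conjSign_drift hσ, e2]
    ring
  · rw [Complex.real_smul, ← mul_assoc, Finset.mul_sum]
    refine Finset.sum_congr rfl fun e _ => ?_
    push_cast
    ring

end ProductAmplitude

/-! ### Removal of the free evolution from the test functions -/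

section Rotation

variable {d : ℕ}

/-- Multiplication by the free phase. -/
noncomputable def rot (s c b : ℝ) (χ : Lat d → ℂ) (ξ : Lat d) : ℂ :=
  osc b (s * c / 2 * ‖ξ‖ ^ 2) * χ ξ

lemma IsTest.rot {χ : Lat d → ℂ} (h : IsTest χ) (s c b : ℝ) : IsTest (rot s c b χ) :=
  h.mul (contDiff_osc_comp (contDiff_const.mul (contDiff_norm_sq ℝ)) b)

lemma IsTest.negSq {χ : Lat d → ℂ} (h : IsTest χ) : IsTest (negSq χ) := h.normSq_mul

lemma negSq_rot (s c b : ℝ) (χ : Lat d → ℂ) : negSq (rot s c b χ) = rot s c b (negSq χ) := by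
  ext ξ; simp only [negSq, rot]; ring

lemma rot_zero (s c : ℝ) (χ : Lat d → ℂ) : rot s c 0 χ = χ := by
  ext ξ; simp [rot, osc]

lemma l2_congr {f g : Lat d → ℂ} (h : ∀ ξ, ‖f ξ‖ = ‖g ξ‖) : l2 f = l2 g :=
  congrArg ENNReal.toReal (eLpNorm_congr_norm_ae (ae_of_all _ h))

lemma l2_rot (s c b : ℝ) (χ : Lat d → ℂ) : l2 (rot s c b χ) = l2 χ :=
  l2_congr fun ξ => by rw [rot, norm_mul, norm_osc, one_mul]

lemma l2_shift {χ : Lat d → ℂ} (h : IsTest χ) (a : Lat d) : l2 (fun ξ => χ (ξ + a)) = l2 χ :=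
  congrArg ENNReal.toReal (eLpNorm_comp_measurePreserving h.1.continuous.aestronglyMeasurable
    (measurePreserving_add_right volume a))

lemma norm_osc_sub_le (r r' θ : ℝ) : ‖osc r θ - osc r' θ‖ ≤ |r - r'| * |θ| := by
  have h := Real.norm_exp_I_mul_ofReal_sub_one_le (x := (r - r') * θ)
  have e : osc r θ - osc r' θ = osc r' θ * (Complex.exp (Complex.I * ((r - r') * θ : ℝ)) - 1) := by
    rw [mul_sub, mul_one, osc, osc, ← Complex.exp_add]
    congr 2
    push_cast; ring
  rw [e, norm_mul, norm_osc, one_mul, ← abs_mul]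
  simpa using h

lemma l2_rot_sub_le {χ : Lat d → ℂ} (h : IsTest χ) (s c b b' : ℝ) :
    l2 (fun ξ => rot s c b χ ξ - rot s c b' χ ξ) ≤ |b - b'| * |s * c / 2| * l2 (negSq χ) := by
  have h1 : ∀ ξ, ‖rot s c b χ ξ - rot s c b' χ ξ‖ ≤ |b - b'| * |s * c / 2| * ‖negSq χ ξ‖ := fun ξ => by
    rw [rot, rot, ← sub_mul, norm_mul, negSq, norm_mul, Complex.norm_real, ← mul_assoc]
    refine mul_le_mul_of_nonneg_right ((norm_osc_sub_le _ _ _).trans_eq ?_) (norm_nonneg _)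
    rw [abs_mul (s * c / 2), norm_neg, norm_pow, norm_norm, abs_pow, abs_norm, mul_assoc]
  have h2 := eLpNorm_le_mul_eLpNorm_of_ae_le_mul (p := 2) (μ := (volume : Measure (Lat d)))
    (ae_of_all _ h1)
  have h4 := ENNReal.toReal_mono
    (ENNReal.mul_ne_top ENNReal.ofReal_ne_top (h.negSq.memLp 2).2.ne) h2
  rw [ENNReal.toReal_mul, ENNReal.toReal_ofReal (by positivity)] at h4
  exact h4

lemma amp_sub_right (s : ℝ) (w : Lp ℂ 2 (volume : Measure (Lat d))) {χ χ' : Lat d → ℂ}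
    (h : MemLp χ 2) (h' : MemLp χ' 2) :
    amp s w (fun ξ => χ ξ - χ' ξ) = amp s w χ - amp s w χ' := by
  rw [amp, amp, amp, ← integral_sub (integrable_amp s w h) (integrable_amp s w h')]
  simp only [mul_sub]

lemma continuous_amp_shift {s : ℝ} (hs : s = 1 ∨ s = -1) (w : Lp ℂ 2 (volume : Measure (Lat d)))
    {χ : Lat d → ℂ} (h : IsTest χ) :
    Continuous fun k : Lat d => amp s w fun ξ => χ (ξ + s • k) := by
  simp only [← integral_waveTest_mul s hs w h]
  have hi : Integrable fun x => conjSign s (w x * waveTest s h x) :=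
    (conjSign s).integrable_comp ((Lp.memLp w).integrable_mul ((waveTest s h).memLp 2))
  refine continuous_of_dominated (bound := fun x => ‖conjSign s (w x * waveTest s h x)‖)
    (fun k => ?_) (fun k => ae_of_all _ fun x => ?_) hi.norm (ae_of_all _ fun x => ?_)
  · exact hi.1.mul (Continuous.aestronglyMeasurable (by fun_prop))
  · rw [norm_mul, mul_comm Complex.I, Complex.norm_exp_ofReal_mul_I, mul_one]
  · fun_prop

/-- The changes of the wave and of the phase are controlled in `L²` uniformly in the shift.
Continuity in the shift at the limiting wave and phase comes from the position representation, where
the shift is multiplication by a plane wave. -/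
lemma continuous_amp_rot_shift {s : ℝ} (hs : s = 1 ∨ s = -1) (c : ℝ) {χ : Lat d → ℂ}
    (h : IsTest χ) : Continuous fun x : (ℝ × Lat d) × Lp ℂ 2 (volume : Measure (Lat d)) =>
      amp s x.2 fun ξ => rot s c x.1.1 χ (ξ + s • x.1.2) := by
  refine continuous_iff_continuousAt.2 fun x₀ => ?_
  rw [ContinuousAt, tendsto_iff_norm_sub_tendsto_zero]
  set C := fourierConst d
  have hC : 0 ≤ C := fourierConst_nonneg d
  have hk := continuous_amp_shift hs x₀.2 (h.rot s c x₀.1.1)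
  have hlim : Continuous fun x : (ℝ × Lat d) × Lp ℂ 2 (volume : Measure (Lat d)) =>
      C * ‖x.2 - x₀.2‖ * l2 χ + C * ‖x₀.2‖ * (|x.1.1 - x₀.1.1| * |s * c / 2| * l2 (negSq χ))
      + ‖(amp s x₀.2 fun ξ => rot s c x₀.1.1 χ (ξ + s • x.1.2))
        - amp s x₀.2 fun ξ => rot s c x₀.1.1 χ (ξ + s • x₀.1.2)‖ := by
    have : Continuous fun x : (ℝ × Lat d) × Lp ℂ 2 (volume : Measure (Lat d)) =>
      amp s x₀.2 fun ξ => rot s c x₀.1.1 χ (ξ + s • x.1.2) :=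
      hk.comp (continuous_snd.comp continuous_fst)
    fun_prop
  have hlim2 := hlim.tendsto x₀
  simp only [sub_self, norm_zero, abs_zero, mul_zero, zero_mul, add_zero] at hlim2
  refine squeeze_zero (fun _ => norm_nonneg _) (fun x => ?_) hlim2
  have t1 := ((h.rot s c x.1.1).shift (s • x.1.2)).memLp 2
  have t2 := ((h.rot s c x₀.1.1).shift (s • x.1.2)).memLp 2
  have e : (amp s x.2 fun ξ => rot s c x.1.1 χ (ξ + s • x.1.2))
      - (amp s x₀.2 fun ξ => rot s c x₀.1.1 χ (ξ + s • x₀.1.2))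
      = amp s (x.2 - x₀.2) (fun ξ => rot s c x.1.1 χ (ξ + s • x.1.2))
        + amp s x₀.2 (fun ξ => rot s c x.1.1 χ (ξ + s • x.1.2) - rot s c x₀.1.1 χ (ξ + s • x.1.2))
        + ((amp s x₀.2 fun ξ => rot s c x₀.1.1 χ (ξ + s • x.1.2))
        - amp s x₀.2 fun ξ => rot s c x₀.1.1 χ (ξ + s • x₀.1.2)) := by
    rw [amp_sub_left s _ _ t1, amp_sub_right s _ t1 t2]
    ring
  rw [e]
  refine (norm_add_le _ _).trans (add_le_add ((norm_add_le _ _).trans (add_le_add ?_ ?_)) le_rfl)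
  · refine (norm_amp_le s _ t1).trans_eq ?_
    rw [l2_shift (h.rot s c x.1.1), l2_rot]
  · refine (norm_amp_le s _ (t1.sub t2)).trans ?_
    refine mul_le_mul_of_nonneg_left ?_ (mul_nonneg hC (norm_nonneg _))
    have ht : IsTest fun ξ => rot s c x.1.1 χ ξ - rot s c x₀.1.1 χ ξ :=
      ⟨(h.rot s c _).1.sub (h.rot s c _).1, (h.rot s c _).2.sub (h.rot s c _).2⟩
    exact (l2_shift ht (s • x.1.2)).trans_le (l2_rot_sub_le h s c _ _)

lemma hasDerivAt_amp_rot (s c : ℝ) (w : Lp ℂ 2 (volume : Measure (Lat d))) {χ : Lat d → ℂ}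
    (h : IsTest χ) (b : ℝ) : HasDerivAt (fun b => amp s w (rot s c b χ))
      (-(s * Complex.I * ((c / 2 : ℝ) : ℂ)) * amp s w (negSq (rot s c b χ))) b := by
  have hN : ∀ b, MemLp (negSq (rot s c b χ)) 2 := fun b => (h.rot s c b).negSq.memLp 2
  have hd := hasDerivAt_integral_of_dominated_loc_of_deriv_le (μ := (volume : Measure (Lat d)))
    (F := fun b ξ => conjSign s (fourierL2 w ξ) * rot s c b χ ξ)
    (F' := fun b ξ => -(s * Complex.I * ((c / 2 : ℝ) : ℂ)) *
      (conjSign s (fourierL2 w ξ) * negSq (rot s c b χ) ξ))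
    (x₀ := b) (s := univ) (bound := fun ξ => ‖(-(s * Complex.I * ((c / 2 : ℝ) : ℂ)))‖ *
      ‖conjSign s (fourierL2 w ξ) * negSq χ ξ‖) univ_mem
    (Eventually.of_forall fun b => (integrable_amp s w ((h.rot s c b).memLp 2)).1)
    (integrable_amp s w ((h.rot s c b).memLp 2))
    ((integrable_amp s w (hN b)).const_mul _).1
    (ae_of_all _ fun ξ b _ => ?_) ((integrable_amp s w (h.negSq.memLp 2)).norm.const_mul _)
    (ae_of_all _ fun ξ b _ => ?_)
  · have := hd.2
    rw [integral_const_mul] at this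
    exact this
  · rw [norm_mul, norm_mul (conjSign s _), norm_mul (conjSign s _), negSq_rot, rot, norm_mul (osc _ _),
      norm_osc, one_mul]
  · have h1 : HasDerivAt (fun b : ℝ => osc b (s * c / 2 * ‖ξ‖ ^ 2))
        (osc b (s * c / 2 * ‖ξ‖ ^ 2) * (Complex.I * ((s * c / 2 * ‖ξ‖ ^ 2 : ℝ) : ℂ))) b := by
      unfold osc
      have h2 : HasDerivAt (fun b : ℝ => Complex.I * ((b * (s * c / 2 * ‖ξ‖ ^ 2) : ℝ) : ℂ))
          (Complex.I * ((s * c / 2 * ‖ξ‖ ^ 2 : ℝ) : ℂ)) b := by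
        have h3 := ((hasDerivAt_id b).mul_const (s * c / 2 * ‖ξ‖ ^ 2)).ofReal_comp
        simpa using h3.const_mul Complex.I
      exact h2.cexp
    have h4 := (h1.mul_const (χ ξ)).const_mul (conjSign s (fourierL2 w ξ))
    refine h4.congr_deriv ?_
    simp only [negSq, rot]
    push_cast
    ring

end Rotation

/-! ### Differentiation on the diagonal -/

lemma hasDerivAt_integral_diag {f : ℝ → ℝ → ℂ} (hf : Continuous (Function.uncurry f)) (z : ℝ) :
    HasDerivAt (fun y => ∫ s in z..y, f s y) (f z z) z := by
  rw [hasDerivAt_iff_isLittleO, Asymptotics.isLittleO_iff]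
  intro δ hδ
  have h1 := Metric.tendsto_nhds.1 (hf.tendsto (z, z)) δ hδ
  obtain ⟨r, hr, hball⟩ := Metric.eventually_nhds_iff.1 h1
  filter_upwards [Metric.ball_mem_nhds z hr] with y hy
  rw [intervalIntegral.integral_same, sub_zero]
  have hc : Continuous fun s => f s y := hf.comp (by fun_prop : Continuous fun s => (s, y))
  have e : (∫ s in z..y, f s y) - (y - z) • f z z = ∫ s in z..y, (f s y - f z z) := by
    rw [intervalIntegral.integral_sub (hc.intervalIntegrable _ _) (by simp),
      intervalIntegral.integral_const]
  rw [e, Real.norm_eq_abs]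
  refine intervalIntegral.norm_integral_le_of_norm_le_const fun s hs => ?_
  have hsz : dist s z ≤ dist y z := by
    have := abs_sub_left_of_mem_uIcc (uIoc_subset_uIcc hs)
    rw [Real.dist_eq, Real.dist_eq]; exact this
  have h2 : dist (s, y) (z, z) < r := by
    rw [Prod.dist_eq]
    exact max_lt (hsz.trans_lt hy) hy
  have := hball h2
  rw [dist_eq_norm] at this
  exact this.le

/-- Time enters twice: through the wave (first argument, known in integrated form) and through the
phase of the test functions (second argument). This is the chain rule on the diagonal; the
derivative in the phase is needed only at the fixed first argument `z`. -/
lemma hasDerivWithinAt_diag {F F₁ : ℝ → ℝ → ℂ} {F₀ : ℝ → ℂ} {F₂ : ℂ} {z : ℝ} (hz : 0 ≤ z)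
    (hF₁ : Continuous (Function.uncurry F₁))
    (hF : ∀ a, 0 ≤ a → ∀ b, F a b = F₀ b + ∫ s in (0 : ℝ)..a, F₁ s b)
    (hd : HasDerivAt (F z) F₂ z) : HasDerivWithinAt (fun y => F y y) (F₂ + F₁ z z) (Ici z) z := by
  have h1 := hd.fun_add (hasDerivAt_integral_diag hF₁ z)
  have h2 : ∀ y ∈ Ici z, F y y = F z y + ∫ s in z..y, F₁ s y := by
    intro y hy
    have hcy : Continuous fun s => F₁ s y := hF₁.comp (by fun_prop : Continuous fun s : ℝ => (s, y))
    rw [hF y (hz.trans hy), hF z hz, ← intervalIntegral.integral_add_adjacent_intervals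
      (hcy.intervalIntegrable 0 z) (hcy.intervalIntegrable z y)]
    ring
  exact h1.hasDerivWithinAt.congr h2 (h2 z self_mem_Ici)

/-! ### The moment equation -/

section Moment

variable {d : ℕ} {R : Lat d → ℝ} {k₀ ε η : ℝ} {u₀ : Lp ℂ 2 (volume : Measure (Lat d))}
  {Ω : Type*} {mΩ : MeasurableSpace Ω} {P : Measure Ω} [IsProbabilityMeasure P]
  {ℱ : Filtration ℝ≥0 mΩ} {u : ℝ≥0 → Ω → Lp ℂ 2 (volume : Measure (Lat d))}
  {ι : Type*} [Fintype ι] [DecidableEq ι] {σ : ι → ℝ}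

/-- The expectation of a product of amplitudes. -/
noncomputable def momentFn (P : Measure Ω) (u : ℝ≥0 → Ω → Lp ℂ 2 (volume : Measure (Lat d)))
    (σ : ι → ℝ) (T : Finset ι) (a : ℝ≥0) (χ : ι → Lat d → ℂ) : ℂ :=
  ∫ ω, prodAmp σ T (u a ω) χ ∂P

/-- The free phases applied to all test functions. -/
noncomputable def rots (σ : ι → ℝ) (c b : ℝ) (χ : ι → Lat d → ℂ) (i : ι) : Lat d → ℂ :=
  rot (σ i) c b (χ i)

/-- A bound of a product of amplitudes. -/
noncomputable def ampBound (T : Finset ι) (χ : ι → Lat d → ℂ) : ℝ :=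
  ∏ i ∈ T, fourierConst d * l2 (χ i)

lemma ampBound_nonneg (T : Finset ι) (χ : ι → Lat d → ℂ) : 0 ≤ ampBound T χ :=
  Finset.prod_nonneg fun _ _ => mul_nonneg (fourierConst_nonneg d) (l2_nonneg _)

lemma norm_prodAmp_le (σ : ι → ℝ) (T : Finset ι) (w : Lp ℂ 2 (volume : Measure (Lat d)))
    {χ : ι → Lat d → ℂ} (h : ∀ i, IsTest (χ i)) :
    ‖prodAmp σ T w χ‖ ≤ ampBound T χ * (1 + ‖w‖) ^ T.card := by
  rw [prodAmp, norm_prod, ampBound, ← Finset.prod_const, ← Finset.prod_mul_distrib]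
  refine Finset.prod_le_prod (fun _ _ => norm_nonneg _) fun i _ => ?_
  refine (norm_amp_le (σ i) w ((h i).memLp 2)).trans ?_
  have h1 := mul_nonneg (fourierConst_nonneg d) (l2_nonneg (χ i))
  nlinarith [norm_nonneg w]

lemma continuous_prodAmp (σ : ι → ℝ) (T : Finset ι) {χ : ι → Lat d → ℂ} (h : ∀ i, IsTest (χ i)) :
    Continuous fun w => prodAmp σ T w χ :=
  continuous_finsetProd _ fun i _ => continuous_amp (σ i) ((h i).memLp 2)

lemma edgeTest_eq (σ : ι → ℝ) {e : ι × ι} (he : e.1 ≠ e.2) (k : Lat d) (χ : ι → Lat d → ℂ) (m : ι) :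
    edgeTest σ e k χ m = fun ξ => χ m (ξ + σ m •
      (((if m = e.1 then 1 else 0) - (if m = e.2 then 1 else 0) : ℝ) • k)) := by
  ext ξ
  rw [edgeTest, add_sub_assoc]
  congr 2
  by_cases h1 : m = e.1
  · subst h1; simp [he]
  · by_cases h2 : m = e.2
    · subst h2; simp [h1]
    · simp [h1, h2]

lemma ampBound_edgeTest (T : Finset ι) {χ : ι → Lat d → ℂ} (h : ∀ i, IsTest (χ i)) {e : ι × ι}
    (he : e.1 ≠ e.2) (k : Lat d) : ampBound T (edgeTest σ e k χ) = ampBound T χ := by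
  refine Finset.prod_congr rfl fun m _ => ?_
  rw [edgeTest_eq σ he, l2_shift (h m)]

lemma ampBound_rots (T : Finset ι) (c b : ℝ) (χ : ι → Lat d → ℂ) :
    ampBound T (rots σ c b χ) = ampBound T χ :=
  Finset.prod_congr rfl fun m _ => by rw [rots, l2_rot]

lemma IsTest.rots {χ : ι → Lat d → ℂ} (h : ∀ i, IsTest (χ i)) (σ : ι → ℝ) (c b : ℝ) (i : ι) :
    IsTest (rots σ c b χ i) := (h i).rot _ _ _

lemma rots_zero (c : ℝ) (χ : ι → Lat d → ℂ) : rots σ c 0 χ = χ :=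
  funext fun _ => rot_zero _ _ _

lemma IsTest.update_negSq {χ : ι → Lat d → ℂ} (h : ∀ i, IsTest (χ i)) (i j : ι) :
    IsTest (Function.update χ i (ItoSchrodinger.negSq (χ i)) j) := by
  by_cases hj : j = i
  · subst hj; rw [Function.update_self]; exact (h j).negSq
  · rw [Function.update_of_ne hj]; exact h j

lemma update_rots (c b : ℝ) (χ : ι → Lat d → ℂ) (i : ι) :
    Function.update (rots σ c b χ) i (negSq (rots σ c b χ i))
      = rots σ c b (Function.update χ i (negSq (χ i))) := by
  ext1 j
  by_cases hj : j = i
  · subst hj; rw [Function.update_self, rots, negSq_rot, rots, Function.update_self]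
  · rw [Function.update_of_ne hj, rots, rots, Function.update_of_ne hj]

variable (hσ : ∀ i, σ i = 1 ∨ σ i = -1)

include hσ in
lemma continuous_prodAmp_edgeTest (T : Finset ι) (c : ℝ) {χ : ι → Lat d → ℂ}
    (h : ∀ i, IsTest (χ i)) {e : ι × ι} (he : e.1 ≠ e.2) :
    Continuous fun x : (ℝ × Lat d) × Lp ℂ 2 (volume : Measure (Lat d)) =>
      prodAmp σ T x.2 (edgeTest σ e x.1.2 (rots σ c x.1.1 χ)) := by
  refine continuous_finsetProd _ fun m _ => ?_
  simp only [edgeTest_eq σ he]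
  exact (continuous_amp_rot_shift (hσ m) c (h m)).comp
    (by fun_prop : Continuous fun x : (ℝ × Lat d) × Lp ℂ 2 (volume : Measure (Lat d)) =>
      (((x.1.1, ((if m = e.1 then 1 else 0) - (if m = e.2 then 1 else 0) : ℝ) • x.1.2) : ℝ × Lat d),
        x.2))

include hσ in
lemma continuous_prodAmp_rots (T : Finset ι) (c : ℝ) {χ : ι → Lat d → ℂ}
    (h : ∀ i, IsTest (χ i)) :
    Continuous fun x : ℝ × Lp ℂ 2 (volume : Measure (Lat d)) =>
      prodAmp σ T x.2 (rots σ c x.1 χ) := by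
  refine continuous_finsetProd _ fun m _ => ?_
  have := (continuous_amp_rot_shift (hσ m) c (h m)).comp
    (by fun_prop : Continuous fun x : ℝ × Lp ℂ 2 (volume : Measure (Lat d)) =>
      (((x.1, 0) : ℝ × Lat d), x.2))
  simp only [Function.comp_def, smul_zero, add_zero] at this
  exact this

include hσ in
lemma IsSolution.continuous_momentFn_edgeTest (S : IsSolution k₀ ε η R u₀ P ℱ u) (T : Finset ι)
    (c : ℝ) {χ : ι → Lat d → ℂ} (h : ∀ i, IsTest (χ i)) {e : ι × ι} (he : e.1 ≠ e.2) :
    Continuous fun x : (ℝ × Lat d) × ℝ≥0 =>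
      momentFn P u σ T x.2 (edgeTest σ e x.1.2 (rots σ c x.1.1 χ)) := by
  refine S.continuous_expect (Y := ℝ × Lat d)
    (Ψ := fun y w => prodAmp σ T w (edgeTest σ e y.2 (rots σ c y.1 χ)))
    (continuous_prodAmp_edgeTest hσ T c h he) (C := ampBound T χ) (n := T.card)
    (ampBound_nonneg T χ) fun y w => ?_
  refine (norm_prodAmp_le σ T w (IsTest.edgeTest (IsTest.rots h σ c y.1) σ e y.2)).trans_eq ?_
  rw [ampBound_edgeTest T (IsTest.rots h σ c y.1) he, ampBound_rots]

include hσ in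
lemma IsSolution.continuous_momentFn_rots (S : IsSolution k₀ ε η R u₀ P ℱ u) (T : Finset ι)
    (c : ℝ) {χ : ι → Lat d → ℂ} (h : ∀ i, IsTest (χ i)) :
    Continuous fun x : ℝ × ℝ≥0 => momentFn P u σ T x.2 (rots σ c x.1 χ) := by
  refine S.continuous_expect (Y := ℝ)
    (Ψ := fun y w => prodAmp σ T w (rots σ c y χ))
    (continuous_prodAmp_rots hσ T c h) (C := ampBound T χ) (n := T.card)
    (ampBound_nonneg T χ) fun y w => ?_
  refine (norm_prodAmp_le σ T w (IsTest.rots h σ c y)).trans_eq ?_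
  rw [ampBound_rots]

lemma IsSolution.exists_norm_momentFn_le (S : IsSolution k₀ ε η R u₀ P ℱ u) (σ : ι → ℝ)
    (T : Finset ι) (Z : ℝ≥0) : ∃ D : ℝ, 0 ≤ D ∧ ∀ χ : ι → Lat d → ℂ, (∀ i, IsTest (χ i)) →
      ∀ a ≤ Z, ‖momentFn P u σ T a χ‖ ≤ ampBound T χ * D := by
  obtain ⟨D, hD, hb⟩ := S.exists_norm_expect_le (G := ℂ) T.card Z
  exact ⟨D, hD, fun χ h a ha => hb _ _ (ampBound_nonneg T χ) (fun w => norm_prodAmp_le σ T w h) a ha⟩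

include hσ in
lemma IsSolution.integral_spec_swap (S : IsSolution k₀ ε η R u₀ P ℱ u) (hR : IsCovariance R)
    (T : Finset ι) {χ : ι → Lat d → ℂ} (h : ∀ i, IsTest (χ i)) {e : ι × ι} (he : e.1 ≠ e.2)
    (a : ℝ≥0) :
    Integrable (fun ω => ∫ k, (spec R k : ℂ) * prodAmp σ T (u a ω) (edgeTest σ e k χ)) P ∧
    ∫ ω, (∫ k, (spec R k : ℂ) * prodAmp σ T (u a ω) (edgeTest σ e k χ)) ∂P
      = ∫ k, (spec R k : ℂ) * momentFn P u σ T a (edgeTest σ e k χ) := by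
  obtain ⟨D, -, hD⟩ := S.exists_moment_le T.card a
  have hs : Integrable fun k : Lat d => (spec R k : ℂ) := (integrable_spec hR).ofReal
  have hcont : Continuous fun x : Lat d × Lp ℂ 2 (volume : Measure (Lat d)) =>
      prodAmp σ T x.2 (edgeTest σ e x.1 χ) := by
    have := (continuous_prodAmp_edgeTest hσ T 0 h he).comp
      (by fun_prop : Continuous fun x : Lat d × Lp ℂ 2 (volume : Measure (Lat d)) =>
        (((0, x.1) : ℝ × Lat d), x.2))
    simpa only [Function.comp_def, rots_zero] using this
  have hm : StronglyMeasurable fun p : Ω × Lat d => prodAmp σ T (u a p.1) (edgeTest σ e p.2 χ) :=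
    hcont.comp_stronglyMeasurable (f := fun p : Ω × Lat d => (p.2, u a p.1))
      (measurable_snd.stronglyMeasurable.prodMk
        ((S.stronglyMeasurable a).comp_measurable measurable_fst))
  have hb : Integrable (fun p : Ω × Lat d => (ampBound T χ * (1 + ‖u a p.1‖) ^ T.card)
      * ‖(spec R p.2 : ℂ)‖) (P.prod volume) :=
    ((hD a le_rfl).1.const_mul _).mul_prod hs.norm
  have hint : Integrable (fun p : Ω × Lat d => (spec R p.2 : ℂ) *
      prodAmp σ T (u a p.1) (edgeTest σ e p.2 χ)) (P.prod volume) := by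
    refine hb.mono' (hs.1.comp_snd.mul hm.aestronglyMeasurable) (ae_of_all _ fun p => ?_)
    rw [norm_mul, mul_comm]
    refine mul_le_mul_of_nonneg_right ?_ (norm_nonneg _)
    refine (norm_prodAmp_le σ T _ (IsTest.edgeTest h σ e p.2)).trans_eq ?_
    rw [ampBound_edgeTest T h he]
  refine ⟨hint.integral_prod_left, ?_⟩
  rw [integral_integral_swap hint]
  refine integral_congr_ae (ae_of_all _ fun k => ?_)
  simp only [momentFn]
  rw [integral_const_mul]

/-- The rate of change of the expectation of a product of amplitudes. -/
noncomputable def momentRate (k₀ ε η : ℝ) (R : Lat d → ℝ) (P : Measure Ω)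
    (u : ℝ≥0 → Ω → Lp ℂ 2 (volume : Measure (Lat d))) (σ : ι → ℝ) (T : Finset ι) (a : ℝ≥0)
    (χ : ι → Lat d → ℂ) : ℂ :=
  (∑ i ∈ T, (σ i * Complex.I * ((η / (k₀ * ε) / 2 : ℝ) : ℂ) *
      momentFn P u σ T a (Function.update χ i (negSq (χ i)))
    - ((k₀ ^ 2 * R 0 / (8 * η ^ 2) : ℝ) : ℂ) * momentFn P u σ T a χ))
  + ∑ e ∈ T.offDiag, ((k₀ ^ 2 / (4 * η ^ 2) * edgeCoef σ e : ℝ) : ℂ) *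
      ∫ k, (spec R k : ℂ) * momentFn P u σ T a (edgeTest σ e k χ)

lemma IsSolution.integrable_prodAmp (S : IsSolution k₀ ε η R u₀ P ℱ u) (σ : ι → ℝ) (T : Finset ι)
    {χ : ι → Lat d → ℂ} (h : ∀ i, IsTest (χ i)) (a : ℝ≥0) :
    Integrable (fun ω => prodAmp σ T (u a ω) χ) P :=
  S.integrable_comp (continuous_prodAmp σ T h) (fun w => norm_prodAmp_le σ T w h) a

include hσ in
lemma IsSolution.momentFn_eq (S : IsSolution k₀ ε η R u₀ P ℱ u) (hR : IsCovariance R)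
    (T : Finset ι) {χ : ι → Lat d → ℂ} (h : ∀ i, IsTest (χ i)) (z : ℝ≥0) :
    momentFn P u σ T z χ = prodAmp σ T u₀ χ
      + ∫ s in (0 : ℝ)..z, momentRate k₀ ε η R P u σ T s.toNNReal χ := by
  have hd := S.dynkin hR (waveTests σ h) (hasTemperateGrowth_signProd σ T) z
  simp only [signProd_pairings, cylGenerator_signProd hσ hR] at hd
  refine hd.trans ?_
  congr 2
  ext s
  have i1 : ∀ i ∈ T, Integrable (fun ω => σ i * Complex.I * ((η / (k₀ * ε) / 2 : ℝ) : ℂ) *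
      prodAmp σ T (u s.toNNReal ω) (Function.update χ i (negSq (χ i)))
      - ((k₀ ^ 2 * R 0 / (8 * η ^ 2) : ℝ) : ℂ) * prodAmp σ T (u s.toNNReal ω) χ) P := fun i _ =>
    ((S.integrable_prodAmp σ T (IsTest.update_negSq h i) _).const_mul _).sub
      ((S.integrable_prodAmp σ T h _).const_mul _)
  have i2 : ∀ e ∈ T.offDiag, Integrable (fun ω => ((k₀ ^ 2 / (4 * η ^ 2) * edgeCoef σ e : ℝ) : ℂ) *
      ∫ k, (spec R k : ℂ) * prodAmp σ T (u s.toNNReal ω) (edgeTest σ e k χ)) P := fun e he =>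
    (S.integral_spec_swap hσ hR T h (Finset.mem_offDiag.1 he).2.2 _).1.const_mul _
  rw [integral_add (integrable_finsetSum _ i1) (integrable_finsetSum _ i2),
    integral_finsetSum _ i1, integral_finsetSum _ i2, momentRate]
  congr 1
  · refine Finset.sum_congr rfl fun i _ => ?_
    rw [integral_sub ((S.integrable_prodAmp σ T (IsTest.update_negSq h i) _).const_mul _)
      ((S.integrable_prodAmp σ T h _).const_mul _), integral_const_mul, integral_const_mul]
    rfl
  · refine Finset.sum_congr rfl fun e he => ?_
    rw [integral_const_mul,
      (S.integral_spec_swap hσ hR T h (Finset.mem_offDiag.1 he).2.2 _).2]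

include hσ in
lemma IsSolution.continuous_integral_spec (S : IsSolution k₀ ε η R u₀ P ℱ u) (hR : IsCovariance R)
    (T : Finset ι) (c : ℝ) {χ : ι → Lat d → ℂ} (h : ∀ i, IsTest (χ i)) {e : ι × ι}
    (he : e.1 ≠ e.2) : Continuous fun x : ℝ × ℝ≥0 =>
      ∫ k, (spec R k : ℂ) * momentFn P u σ T x.2 (edgeTest σ e k (rots σ c x.1 χ)) := by
  refine continuous_iff_continuousAt.2 fun x₀ => ?_
  obtain ⟨D, hD, hb⟩ := S.exists_norm_momentFn_le σ T (x₀.2 + 1)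
  have hs : Integrable fun k : Lat d => (spec R k : ℂ) := (integrable_spec hR).ofReal
  have hc := S.continuous_momentFn_edgeTest hσ T c h he
  have hnear : ∀ᶠ x : ℝ × ℝ≥0 in 𝓝 x₀, x.2 ≤ x₀.2 + 1 := by
    have : ∀ᶠ z in 𝓝 x₀.2, z ≤ x₀.2 + 1 := Iic_mem_nhds (lt_add_of_pos_right _ one_pos)
    exact continuous_snd.continuousAt.eventually this
  refine continuousAt_of_dominated (bound := fun k => ‖(spec R k : ℂ)‖ * (ampBound T χ * D))
    (Eventually.of_forall fun x => ?_) ?_ (hs.norm.mul_const _) (ae_of_all _ fun k => ?_)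
  · exact hs.1.mul (hc.comp (by fun_prop : Continuous fun k : Lat d =>
      (((x.1, k), x.2) : (ℝ × Lat d) × ℝ≥0))).aestronglyMeasurable
  · filter_upwards [hnear] with x hx
    refine ae_of_all _ fun k => ?_
    rw [norm_mul]
    refine mul_le_mul_of_nonneg_left ?_ (norm_nonneg _)
    refine (hb _ (IsTest.edgeTest (IsTest.rots h σ c x.1) σ e k) _ hx).trans_eq ?_
    rw [ampBound_edgeTest T (IsTest.rots h σ c x.1) he, ampBound_rots]
  · exact (continuous_const.mul (hc.comp (by fun_prop : Continuous fun x : ℝ × ℝ≥0 =>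
      (((x.1, k), x.2) : (ℝ × Lat d) × ℝ≥0)))).continuousAt

include hσ in
lemma IsSolution.continuous_momentRate (S : IsSolution k₀ ε η R u₀ P ℱ u) (hR : IsCovariance R)
    (T : Finset ι) (c : ℝ) {χ : ι → Lat d → ℂ} (h : ∀ i, IsTest (χ i)) :
    Continuous fun x : ℝ × ℝ≥0 => momentRate k₀ ε η R P u σ T x.2 (rots σ c x.1 χ) := by
  unfold momentRate
  simp only [update_rots]
  refine Continuous.add (continuous_finsetSum _ fun i _ => Continuous.sub ?_ ?_)
    (continuous_finsetSum _ fun e he => ?_)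
  · exact continuous_const.mul (S.continuous_momentFn_rots hσ T c (IsTest.update_negSq h i))
  · exact continuous_const.mul (S.continuous_momentFn_rots hσ T c h)
  · exact continuous_const.mul
      (S.continuous_integral_spec hσ hR T c h (Finset.mem_offDiag.1 he).2.2)

lemma hasDerivAt_prodAmp_rots (T : Finset ι) (c : ℝ) {χ : ι → Lat d → ℂ} (h : ∀ i, IsTest (χ i))
    (w : Lp ℂ 2 (volume : Measure (Lat d))) (b : ℝ) :
    HasDerivAt (fun b => prodAmp σ T w (rots σ c b χ))
      (∑ i ∈ T, -(σ i * Complex.I * ((c / 2 : ℝ) : ℂ)) *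
        prodAmp σ T w (rots σ c b (Function.update χ i (negSq (χ i))))) b := by
  have h1 := HasDerivAt.fun_finsetProd (u := T) (f := fun i b => amp (σ i) w (rots σ c b χ i))
    (f' := fun i => -(σ i * Complex.I * ((c / 2 : ℝ) : ℂ)) * amp (σ i) w (negSq (rots σ c b χ i)))
    (x := b) fun i _ => hasDerivAt_amp_rot (σ i) c w (h i) b
  refine h1.congr_deriv (Finset.sum_congr rfl fun i hi => ?_)
  rw [← update_rots, prodAmp_update T w _ hi, smul_eq_mul, prodAmp]
  ring

include hσ in
lemma IsSolution.hasDerivAt_momentFn_rots (S : IsSolution k₀ ε η R u₀ P ℱ u)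
    (T : Finset ι) (c : ℝ) {χ : ι → Lat d → ℂ} (h : ∀ i, IsTest (χ i)) (a : ℝ≥0) (b : ℝ) :
    HasDerivAt (fun b => momentFn P u σ T a (rots σ c b χ))
      (∑ i ∈ T, -(σ i * Complex.I * ((c / 2 : ℝ) : ℂ)) *
        momentFn P u σ T a (rots σ c b (Function.update χ i (negSq (χ i))))) b := by
  have ht := fun b => IsTest.rots h σ c b
  have ht' := fun i b => IsTest.rots (IsTest.update_negSq h i) σ c b
  obtain ⟨D, -, hD⟩ := S.exists_moment_le T.card a
  have hi : ∀ b, ∀ i ∈ T, Integrable (fun ω => -(σ i * Complex.I * ((c / 2 : ℝ) : ℂ)) *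
      prodAmp σ T (u a ω) (rots σ c b (Function.update χ i (negSq (χ i))))) P := fun b i _ =>
    (S.integrable_prodAmp σ T (ht' i b) a).const_mul _
  have hd := hasDerivAt_integral_of_dominated_loc_of_deriv_le (μ := P)
    (F := fun b ω => prodAmp σ T (u a ω) (rots σ c b χ))
    (F' := fun b ω => ∑ i ∈ T, -(σ i * Complex.I * ((c / 2 : ℝ) : ℂ)) *
        prodAmp σ T (u a ω) (rots σ c b (Function.update χ i (negSq (χ i)))))
    (x₀ := b) (s := univ) (bound := fun ω => ∑ i ∈ T, ‖(-(σ i * Complex.I * ((c / 2 : ℝ) : ℂ)))‖ *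
      (ampBound T (Function.update χ i (negSq (χ i))) * (1 + ‖u a ω‖) ^ T.card)) univ_mem
    (Eventually.of_forall fun b => (S.integrable_prodAmp σ T (ht b) a).1)
    (S.integrable_prodAmp σ T (ht b) a) (integrable_finsetSum _ (hi b)).1
    (ae_of_all _ fun ω b _ => ?_)
    (integrable_finsetSum _ fun i _ => ((hD a le_rfl).1.const_mul _).const_mul _)
    (ae_of_all _ fun ω b _ => hasDerivAt_prodAmp_rots T c h _ b)
  · refine hd.2.congr_deriv ?_
    rw [integral_finsetSum _ (hi b)]
    refine Finset.sum_congr rfl fun i _ => ?_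
    rw [integral_const_mul]
    rfl
  · refine (norm_sum_le _ _).trans (Finset.sum_le_sum fun i _ => ?_)
    rw [norm_mul]
    refine mul_le_mul_of_nonneg_left ((norm_prodAmp_le σ T _ (ht' i b)).trans_eq ?_) (norm_nonneg _)
    rw [ampBound_rots]

include hσ in
/-- The moment equation after removal of the free evolution. -/
lemma IsSolution.hasDerivWithinAt_momentFn_rots (S : IsSolution k₀ ε η R u₀ P ℱ u)
    (hR : IsCovariance R) (T : Finset ι) {χ : ι → Lat d → ℂ} (h : ∀ i, IsTest (χ i)) {z : ℝ}
    (hz : 0 ≤ z) :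
    HasDerivWithinAt (fun y : ℝ => momentFn P u σ T y.toNNReal (rots σ (η / (k₀ * ε)) y χ))
      (-((T.card * (k₀ ^ 2 * R 0 / (8 * η ^ 2)) : ℝ) : ℂ) *
          momentFn P u σ T z.toNNReal (rots σ (η / (k₀ * ε)) z χ)
        + ∑ e ∈ T.offDiag, ((k₀ ^ 2 / (4 * η ^ 2) * edgeCoef σ e : ℝ) : ℂ) *
          ∫ k, (spec R k : ℂ) *
            momentFn P u σ T z.toNNReal (edgeTest σ e k (rots σ (η / (k₀ * ε)) z χ))) (Ici z) z := by
  generalize hc : η / (k₀ * ε) = c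
  obtain ⟨F, hFd⟩ : ∃ F : ℝ → ℝ → ℂ, ∀ a b, F a b = momentFn P u σ T a.toNNReal (rots σ c b χ) :=
    ⟨_, fun _ _ => rfl⟩
  obtain ⟨F₁, hF₁d⟩ : ∃ F₁ : ℝ → ℝ → ℂ, ∀ s b,
      F₁ s b = momentRate k₀ ε η R P u σ T s.toNNReal (rots σ c b χ) := ⟨_, fun _ _ => rfl⟩
  have hF₁ : Continuous (Function.uncurry F₁) := by
    have e : Function.uncurry F₁
        = (fun x : ℝ × ℝ≥0 => momentRate k₀ ε η R P u σ T x.2 (rots σ c x.1 χ)) ∘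
          fun x : ℝ × ℝ => ((x.2, x.1.toNNReal) : ℝ × ℝ≥0) := by
      ext x; exact hF₁d _ _
    rw [e]
    exact (S.continuous_momentRate hσ hR T c h).comp (by fun_prop)
  have hF : ∀ a, 0 ≤ a → ∀ b, F a b = prodAmp σ T u₀ (rots σ c b χ)
      + ∫ s in (0 : ℝ)..a, F₁ s b := by
    intro a ha b
    have := S.momentFn_eq hσ hR T (IsTest.rots h σ c b) a.toNNReal
    rw [Real.coe_toNNReal _ ha] at this
    rw [hFd, this]
    simp only [hF₁d]
  have hd : HasDerivAt (F z) (∑ i ∈ T, -(σ i * Complex.I * ((c / 2 : ℝ) : ℂ)) *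
        momentFn P u σ T z.toNNReal (rots σ c z (Function.update χ i (negSq (χ i))))) z := by
    have e : F z = fun b => momentFn P u σ T z.toNNReal (rots σ c b χ) := funext fun b => hFd _ _
    rw [e]
    exact S.hasDerivAt_momentFn_rots hσ T c h z.toNNReal z
  have h1 := hasDerivWithinAt_diag hz hF₁ hF hd
  simp only [hFd, hF₁d] at h1
  refine h1.congr_deriv ?_
  rw [momentRate, ← add_assoc, ← Finset.sum_add_distrib]
  congr 1
  -- The derivative of the phase cancels the Laplacian factor by factor; only the damping survives.
  have h3 : ∀ i ∈ T, -(σ i * Complex.I * ((c / 2 : ℝ) : ℂ)) *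
        momentFn P u σ T z.toNNReal (rots σ c z (Function.update χ i (negSq (χ i))))
      + (σ i * Complex.I * ((η / (k₀ * ε) / 2 : ℝ) : ℂ) *
      momentFn P u σ T z.toNNReal (Function.update (rots σ c z χ) i (negSq (rots σ c z χ i)))
      - ((k₀ ^ 2 * R 0 / (8 * η ^ 2) : ℝ) : ℂ) * momentFn P u σ T z.toNNReal (rots σ c z χ))
      = -((k₀ ^ 2 * R 0 / (8 * η ^ 2) : ℝ) : ℂ) * momentFn P u σ T z.toNNReal (rots σ c z χ) := by
    intro i _
    rw [update_rots, hc]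
    ring
  rw [Finset.sum_congr rfl h3, Finset.sum_const, nsmul_eq_mul]
  push_cast
  ring

end Moment

/-! ### Uniqueness for the moment hierarchy -/

/-- A bounded solution of a linear hierarchy with zero initial values vanishes. -/
lemma eq_zero_of_hierarchy {𝒳 : Type*} (Q : Set 𝒳) {D D' : ℝ → 𝒳 → ℂ} {K B Z : ℝ}
    (h0 : ∀ χ ∈ Q, D 0 χ = 0) (hc : ∀ χ ∈ Q, ContinuousOn (fun z => D z χ) (Icc 0 Z))
    (hd : ∀ χ ∈ Q, ∀ z ∈ Ico 0 Z, HasDerivWithinAt (fun z => D z χ) (D' z χ) (Ici z) z)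
    (hb : ∀ χ ∈ Q, ∀ z ∈ Icc 0 Z, ‖D z χ‖ ≤ B)
    (hD' : ∀ M, ∀ z ∈ Ico 0 Z, (∀ χ ∈ Q, ‖D z χ‖ ≤ M) → ∀ χ ∈ Q, ‖D' z χ‖ ≤ K * M) {χ : 𝒳}
    (hχ : χ ∈ Q) {z : ℝ} (hz : z ∈ Icc 0 Z) : D z χ = 0 := by
  -- The derivative at one `χ` is controlled only by the values at all `χ ∈ Q`, so the Picard
  -- iteration is run simultaneously over `Q`.
  have key : ∀ n : ℕ, ∀ χ ∈ Q, ∀ z ∈ Icc 0 Z, ‖D z χ‖ ≤ B * (K * z) ^ n / n.factorial := by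
    intro n
    induction n with
    | zero => simpa using hb
    | succ n ih =>
      intro χ hχ
      have hB : ∀ x : ℝ, HasDerivAt (fun z => B * (K * z) ^ (n + 1) / (n + 1).factorial)
          (K * (B * (K * x) ^ n / n.factorial)) x := by
        intro x
        have h1 := ((((hasDerivAt_id x).const_mul K).pow (n + 1)).const_mul B).div_const
          ((n + 1).factorial : ℝ)
        refine h1.congr_deriv ?_
        have : ((n : ℝ) + 1) ≠ 0 := by positivity
        have h2 : (n.factorial : ℝ) ≠ 0 := by positivity
        rw [Nat.factorial_succ]
        push_cast
        simp only [id]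
        field_simp
      refine image_norm_le_of_norm_deriv_right_le_deriv_boundary (hc χ hχ) (hd χ hχ) ?_ hB ?_
      · rw [h0 χ hχ]; simp
      · exact fun x hx => hD' _ x hx (fun χ' hχ' => ih χ' hχ' x ⟨hx.1, hx.2.le⟩) χ hχ
  have ht : Tendsto (fun n : ℕ => B * (K * z) ^ n / n.factorial) atTop (𝓝 0) := by
    have := (FloorSemiring.tendsto_pow_div_factorial_atTop (K * z)).const_mul B
    simpa only [mul_zero, mul_div_assoc] using this
  exact norm_le_zero_iff.1 (ge_of_tendsto' ht fun n => key n χ hχ z hz)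

/-! ### Duality between the pair operators and products of test functions -/

section Products

variable {d : ℕ} {ι : Type*} [Fintype ι] [DecidableEq ι] {σ : ι → ℝ}

/-- The tensor product of test functions. -/
noncomputable def prodTest (χ : ι → Lat d → ℂ) (v : ι → Lat d) : ℂ := ∏ i, χ i (v i)

/-- The action of the interaction `e` on test functions, with its phase. -/
noncomputable def twist (σ : ι → ℝ) (c z : ℝ) (e : ι × ι) (k : Lat d) (χ : ι → Lat d → ℂ) :
    ι → Lat d → ℂ := rots σ c (-z) (edgeTest σ e k (rots σ c z χ))

lemma osc_neg_mul (r θ : ℝ) : osc (-r) θ * osc r θ = 1 := by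
  rw [osc, osc, ← Complex.exp_add, ← Complex.exp_zero]
  congr 1
  push_cast; ring

lemma rots_neg (c b : ℝ) (χ : ι → Lat d → ℂ) : rots σ c b (rots σ c (-b) χ) = χ := by
  funext i ξ
  rw [rots, rot, rots, rot, ← mul_assoc, mul_comm (osc b _), osc_neg_mul, one_mul]

lemma rots_twist (c z : ℝ) (e : ι × ι) (k : Lat d) (χ : ι → Lat d → ℂ) :
    rots σ c z (twist σ c z e k χ) = edgeTest σ e k (rots σ c z χ) := rots_neg _ _ _

lemma norm_twist (c z : ℝ) (e : ι × ι) (k : Lat d) (χ : ι → Lat d → ℂ) (i : ι) (ξ : Lat d) :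
    ‖twist σ c z e k χ i ξ‖ = ‖edgeTest σ e k χ i ξ‖ := by
  rw [twist, rots, rot, norm_mul, norm_osc, one_mul, edgeTest, rots, rot, norm_mul, norm_osc,
    one_mul, edgeTest]

lemma twist_of_ne (c z : ℝ) {e : ι × ι} (k : Lat d) (χ : ι → Lat d → ℂ) {i : ι} (h1 : i ≠ e.1)
    (h2 : i ≠ e.2) : twist σ c z e k χ i = χ i := by
  funext ξ
  rw [twist, rots, rot, edgeTest, if_neg h1, if_neg h2, add_zero, sub_zero, rots, rot, ← mul_assoc,
    osc_neg_mul, one_mul]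

lemma IsTest.twist {χ : ι → Lat d → ℂ} (h : ∀ i, IsTest (χ i)) (c z : ℝ) (e : ι × ι) (k : Lat d)
    (i : ι) : IsTest (twist σ c z e k χ i) :=
  IsTest.rots (IsTest.edgeTest (IsTest.rots h σ c z) σ e k) σ c (-z) i

lemma l2_twist {χ : ι → Lat d → ℂ} (h : ∀ i, IsTest (χ i)) (c z : ℝ) {e : ι × ι} (he : e.1 ≠ e.2)
    (k : Lat d) (i : ι) : l2 (twist σ c z e k χ i) = l2 (χ i) := by
  rw [l2_congr (norm_twist c z e k χ i), edgeTest_eq σ he, l2_shift (h i)]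

lemma osc_add (r θ θ' : ℝ) : osc r (θ + θ') = osc r θ * osc r θ' := by
  rw [osc, osc, osc, ← Complex.exp_add]; congr 1; push_cast; ring

lemma prod_osc (r : ℝ) (θ : ι → ℝ) : ∏ i, osc r (θ i) = osc r (∑ i, θ i) := by
  simp only [osc]
  rw [← Complex.exp_sum, Finset.mul_sum]
  push_cast
  rw [Finset.mul_sum]

lemma osc_neg (r θ : ℝ) : osc (-r) θ = osc r (-θ) := by
  rw [osc, osc, neg_mul, mul_neg]

variable (hσ : ∀ i, σ i = 1 ∨ σ i = -1)

include hσ in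
-- The rate of the phase of an interaction is the change of the total free energy caused by the
-- transfer. The signs disappear from the linear part because `σ² = 1`.
lemma sum_normSq_edgeShift {e : ι × ι} (he : e.1 ≠ e.2) (k : Lat d) (v : ι → Lat d) :
    ∑ i, (σ i / 2 * ‖edgeShift σ e (k, v) i‖ ^ 2 - σ i / 2 * ‖v i‖ ^ 2) = edgePhase σ e (k, v) := by
  have hs : ∀ i, σ i * σ i = 1 := fun i => by rcases hσ i with h | h <;> rw [h] <;> norm_num
  rw [Finset.sum_eq_add_of_mem e.1 e.2 (Finset.mem_univ _) (Finset.mem_univ _) he]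
  · simp only [edgeShift, edgePhase, if_true, if_neg he, if_neg he.symm, sub_zero, add_zero]
    rw [norm_add_sq_real, norm_sub_sq_real, norm_smul, norm_smul, inner_smul_right,
      inner_smul_right, mul_pow, mul_pow, inner_sub_right, real_inner_comm k, real_inner_comm k,
      Real.norm_eq_abs, Real.norm_eq_abs, sq_abs, sq_abs]
    linear_combination (⟪k, v e.1⟫ + σ e.1 * ‖k‖ ^ 2 / 2) * hs e.1
      + (-⟪k, v e.2⟫ + σ e.2 * ‖k‖ ^ 2 / 2) * hs e.2
  · intro i _ h
    simp [edgeShift, h.1, h.2]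

include hσ in
lemma prodTest_twist (c z : ℝ) {e : ι × ι} (he : e.1 ≠ e.2) (k : Lat d) (χ : ι → Lat d → ℂ)
    (v : ι → Lat d) : prodTest (twist σ c z e k χ) v
      = prodTest χ (edgeShift σ e (k, v)) * osc z (c * edgePhase σ e (k, v)) := by
  have h1 : ∀ i, twist σ c z e k χ i (v i) = χ i (edgeShift σ e (k, v) i) *
      osc z (c * (σ i / 2 * ‖edgeShift σ e (k, v) i‖ ^ 2 - σ i / 2 * ‖v i‖ ^ 2)) := by
    intro i
    have h2 : edgeTest σ e k (rots σ c z χ) i (v i)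
        = rot (σ i) c z (χ i) (edgeShift σ e (k, v) i) := rfl
    rw [twist, rots, rot, h2, rot, osc_neg, ← mul_assoc, ← osc_add, mul_comm]
    congr 2
    ring
  rw [prodTest, Finset.prod_congr rfl fun i _ => h1 i, Finset.prod_mul_distrib, prod_osc,
    ← Finset.mul_sum, sum_normSq_edgeShift hσ he, prodTest]

lemma measurable_prodTest {χ : ι → Lat d → ℂ} (h : ∀ i, IsTest (χ i)) : Measurable (prodTest χ) :=
  (continuous_finsetProd _ fun i _ =>
    (h i).1.continuous.comp (continuous_apply i)).measurable

lemma norm_prodTest_le {χ : ι → Lat d → ℂ} {b : ℝ} (h : ∀ i ξ, ‖χ i ξ‖ ≤ b) (v : ι → Lat d) :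
    ‖prodTest χ v‖ ≤ b ^ Fintype.card ι := by
  rw [prodTest, norm_prod]
  refine (Finset.prod_le_prod (fun _ _ => norm_nonneg _) fun i _ => h i (v i)).trans_eq ?_
  rw [Finset.prod_const, Finset.card_univ]

lemma IsTest.exists_bound {χ : ι → Lat d → ℂ} (h : ∀ i, IsTest (χ i)) :
    ∃ b, 0 ≤ b ∧ ∀ i, l2 (χ i) ≤ b ∧ ∀ ξ, ‖χ i ξ‖ ≤ b := by
  choose C hC using fun i => (h i).1.continuous.bounded_above_of_compact_support (h i).2
  refine ⟨∑ i, (l2 (χ i) + |C i|),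
    Finset.sum_nonneg fun i _ => add_nonneg (l2_nonneg _) (abs_nonneg _), fun i => ?_⟩
  have h1 := Finset.single_le_sum (f := fun i => l2 (χ i) + |C i|)
    (fun i _ => add_nonneg (l2_nonneg _) (abs_nonneg _)) (Finset.mem_univ i)
  have h2 := l2_nonneg (χ i)
  have h3 := abs_nonneg (C i)
  beta_reduce at h1
  exact ⟨by linarith, fun ξ => (hC i ξ).trans ((le_abs_self _).trans (by linarith))⟩

include hσ in
-- The adjoint of an interaction maps a product of test functions to a superposition over `k` of
-- such products. The evolution of measures therefore obeys, on products, the same hierarchy as the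
-- moments.
lemma cint_edgeAdj_prodTest {w : Lat d → ℂ} (hw : Integrable w) (hwm : Measurable w) (c z : ℝ)
    {e : ι × ι} (he : e.1 ≠ e.2) {χ : ι → Lat d → ℂ} (h : ∀ i, IsTest (χ i))
    (ρ : ComplexMeasure (ι → Lat d)) :
    Integrable (fun k => w k * cint ρ (prodTest (twist σ c z e k χ))) ∧
    cint ρ (edgeAdj w σ c e z (prodTest χ)) = ∫ k, w k * cint ρ (prodTest (twist σ c z e k χ)) := by
  obtain ⟨b, -, hb⟩ := IsTest.exists_bound h
  have hm := measurable_prodTest h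
  have hB := norm_prodTest_le fun i => (hb i).2
  obtain ⟨g, hg, ig, -, hI⟩ := cint_eq_integral ρ
  have hB' : ∀ k v, ‖prodTest (twist σ c z e k χ) v‖ ≤ b ^ Fintype.card ι := fun k v => by
    rw [prodTest_twist hσ c z he, norm_mul, norm_osc, mul_one]; exact hB _
  rw [hI _ (measurable_edgeAdj σ c hwm e z hm) _ (norm_edgeAdj_le σ c hw e z hB)]
  have e1 : ∀ k, w k * cint ρ (prodTest (twist σ c z e k χ))
      = ∫ v, prodTest χ (edgeShift σ e (k, v)) * osc z (c * edgePhase σ e (k, v)) * w k * g v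
        ∂ρ.variation := fun k => by
    rw [hI _ (measurable_prodTest (IsTest.twist h c z e k)) _ (hB' k), ← integral_const_mul]
    refine integral_congr_ae (ae_of_all _ fun v => ?_)
    simp only [prodTest_twist hσ c z he]
    ring
  simp only [e1, edgeAdj, kernelAdj, ← integral_mul_const]
  suffices hint : Integrable (Function.uncurry fun v k => prodTest χ (edgeShift σ e (k, v)) *
      osc z (c * edgePhase σ e (k, v)) * w k * g v) (ρ.variation.prod volume) from
    ⟨hint.integral_prod_right, integral_integral_swap hint⟩
  have i1 : Integrable (fun p : (ι → Lat d) × Lat d => g p.1 * w p.2)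
      (ρ.variation.prod volume) := ig.mul_prod hw
  have m1 : Measurable fun p : (ι → Lat d) × Lat d => prodTest χ (edgeShift σ e (p.2, p.1)) *
      osc z (c * edgePhase σ e (p.2, p.1)) :=
    (hm.comp ((continuous_edgeShift σ e).measurable.comp measurable_swap)).mul
      ((measurable_osc_edgePhase σ c e z).comp measurable_swap)
  refine (i1.bdd_mul (c := b ^ Fintype.card ι) m1.aestronglyMeasurable
    (ae_of_all _ fun p => ?_)).congr (ae_of_all _ fun p => ?_)
  · rw [norm_mul, norm_osc, mul_one]; exact hB _
  · simp only [Function.uncurry]; ring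

end Products

/-! ### Identification of the moments with the evolution of measures -/

section Comparison

variable {d p q : ℕ} {R : Lat d → ℝ} {k₀ ε η : ℝ} {u₀ : Lp ℂ 2 (volume : Measure (Lat d))}
  {Ω : Type*} {mΩ : MeasurableSpace Ω} {P : Measure Ω} [IsProbabilityMeasure P]
  {ℱ : Filtration ℝ≥0 mΩ} {u : ℝ≥0 → Ω → Lp ℂ 2 (volume : Measure (Lat d))}

lemma hasDerivAt_cint_setFlow (hR : IsCovariance R) (T : Finset (Fin p ⊕ Fin q))
    (ρ : ComplexMeasure (Dual d p q)) {χ : Fin p ⊕ Fin q → Lat d → ℂ} (h : ∀ i, IsTest (χ i))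
    (z : ℝ) :
    HasDerivAt (fun z => cint (setFlow (strongFamily_momentOp hR k₀ ε η) T.offDiag z ρ) (prodTest χ))
      (∑ e ∈ T.offDiag, ((k₀ ^ 2 / (4 * η ^ 2) * edgeCoef (factorSign p q) e : ℝ) : ℂ) *
        ∫ k, (spec R k : ℂ) * cint (setFlow (strongFamily_momentOp hR k₀ ε η) T.offDiag z ρ)
          (prodTest (twist (factorSign p q) (η / (k₀ * ε)) z e k χ))) z := by
  obtain ⟨b, -, hb⟩ := IsTest.exists_bound h
  have hm := measurable_prodTest h
  have hB := norm_prodTest_le fun i => (hb i).2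
  have h1 := ((cintCLM hm hB).restrictScalars ℝ).hasFDerivAt.comp_hasDerivAt z
    (hasDerivAt_setFlow (strongFamily_momentOp hR k₀ ε η) T.offDiag ρ z)
  refine h1.congr_deriv ?_
  simp only [ContinuousLinearMap.coe_restrictScalars', map_sum]
  refine Finset.sum_congr rfl fun e he => ?_
  rw [cintCLM_apply, momentOp, cint_edgeOp _ _ _ _ _ _ _ _ hm hB]
  exact congrArg _ (cint_edgeAdj_prodTest factorSign_eq (integrable_spec hR).ofReal
    (measurable_spec hR) _ _ (Finset.mem_offDiag.1 he).2.2 h _).2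

/-- The expectation of a product of amplitudes, with the free evolution and the damping removed,
times the initial amplitudes of the other factors. -/
noncomputable def freeMoment (k₀ ε η : ℝ) (R : Lat d → ℝ) (P : Measure Ω)
    (u : ℝ≥0 → Ω → Lp ℂ 2 (volume : Measure (Lat d))) (u₀ : Lp ℂ 2 (volume : Measure (Lat d)))
    (T : Finset (Fin p ⊕ Fin q)) (z : ℝ) (χ : Fin p ⊕ Fin q → Lat d → ℂ) : ℂ :=
  Real.exp (T.card * (k₀ ^ 2 * R 0 / (8 * η ^ 2)) * z) *
    momentFn P u (factorSign p q) T z.toNNReal (rots (factorSign p q) (η / (k₀ * ε)) z χ) *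
    prodAmp (factorSign p q) Tᶜ u₀ χ

/-- An interaction inside `T` leaves the test functions of the other factors unchanged. The moments
for different `T` can therefore all be followed on one space of measures, with the initial wave in
the idle factors. -/
lemma prodAmp_compl_twist (c z : ℝ) (T : Finset (Fin p ⊕ Fin q)) {e} (he : e ∈ T.offDiag) (k : Lat d)
    (χ : Fin p ⊕ Fin q → Lat d → ℂ) : prodAmp (factorSign p q) Tᶜ u₀
      (twist (factorSign p q) c z e k χ) = prodAmp (factorSign p q) Tᶜ u₀ χ := by
  rw [Finset.mem_offDiag] at he
  refine Finset.prod_congr rfl fun i hi => ?_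
  rw [Finset.mem_compl] at hi
  rw [twist_of_ne]
  · rintro rfl; exact hi he.1
  · rintro rfl; exact hi he.2.1

lemma IsSolution.hasDerivWithinAt_freeMoment (S : IsSolution k₀ ε η R u₀ P ℱ u)
    (hR : IsCovariance R) (T : Finset (Fin p ⊕ Fin q)) {χ : Fin p ⊕ Fin q → Lat d → ℂ}
    (h : ∀ i, IsTest (χ i)) {z : ℝ} (hz : 0 ≤ z) :
    HasDerivWithinAt (fun z => freeMoment k₀ ε η R P u u₀ T z χ)
      (∑ e ∈ T.offDiag, ((k₀ ^ 2 / (4 * η ^ 2) * edgeCoef (factorSign p q) e : ℝ) : ℂ) *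
        ∫ k, (spec R k : ℂ) * freeMoment k₀ ε η R P u u₀ T z
          (twist (factorSign p q) (η / (k₀ * ε)) z e k χ)) (Ici z) z := by
  have h1 := S.hasDerivWithinAt_momentFn_rots factorSign_eq hR T h hz
  set γ : ℝ := T.card * (k₀ ^ 2 * R 0 / (8 * η ^ 2)) with hγ
  have h2 : HasDerivAt (fun z : ℝ => ((Real.exp (γ * z) : ℝ) : ℂ)) ((Real.exp (γ * z) * γ : ℝ) : ℂ) z := by
    have := (((hasDerivAt_id z).const_mul γ).exp).ofReal_comp
    simpa using this
  have h3 := (h2.hasDerivWithinAt.mul h1).mul_const (prodAmp (factorSign p q) Tᶜ u₀ χ)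
  refine h3.congr_deriv ?_
  have h4 : ∀ e ∈ T.offDiag, ((k₀ ^ 2 / (4 * η ^ 2) * edgeCoef (factorSign p q) e : ℝ) : ℂ) *
        ∫ k, (spec R k : ℂ) * freeMoment k₀ ε η R P u u₀ T z
          (twist (factorSign p q) (η / (k₀ * ε)) z e k χ)
      = Real.exp (γ * z) * prodAmp (factorSign p q) Tᶜ u₀ χ *
        (((k₀ ^ 2 / (4 * η ^ 2) * edgeCoef (factorSign p q) e : ℝ) : ℂ) * ∫ k, (spec R k : ℂ) *
        momentFn P u (factorSign p q) T z.toNNReal (edgeTest (factorSign p q) e k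
          (rots (factorSign p q) (η / (k₀ * ε)) z χ))) := by
    intro e he
    have : ∀ k, (spec R k : ℂ) * freeMoment k₀ ε η R P u u₀ T z
          (twist (factorSign p q) (η / (k₀ * ε)) z e k χ)
        = Real.exp (γ * z) * prodAmp (factorSign p q) Tᶜ u₀ χ * ((spec R k : ℂ) *
        momentFn P u (factorSign p q) T z.toNNReal (edgeTest (factorSign p q) e k
          (rots (factorSign p q) (η / (k₀ * ε)) z χ))) := fun k => by
      rw [freeMoment, prodAmp_compl_twist _ _ _ he, rots_twist]
      ring
    simp only [this]
    rw [integral_const_mul]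
    ring
  rw [Finset.sum_congr rfl h4, ← Finset.mul_sum]
  push_cast
  ring

lemma IsSolution.continuous_freeMoment (S : IsSolution k₀ ε η R u₀ P ℱ u)
    (T : Finset (Fin p ⊕ Fin q)) {χ : Fin p ⊕ Fin q → Lat d → ℂ} (h : ∀ i, IsTest (χ i)) :
    Continuous fun z => freeMoment k₀ ε η R P u u₀ T z χ := by
  have h1 := (S.continuous_momentFn_rots factorSign_eq T (η / (k₀ * ε)) h).comp
    (by fun_prop : Continuous fun z : ℝ => ((z, z.toNNReal) : ℝ × ℝ≥0))
  unfold freeMoment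
  exact ((by fun_prop : Continuous fun z : ℝ => ((Real.exp (T.card * (k₀ ^ 2 * R 0 / (8 * η ^ 2)) * z)
    : ℝ) : ℂ)).mul h1).mul continuous_const

lemma IsSolution.continuous_freeMoment_twist (S : IsSolution k₀ ε η R u₀ P ℱ u)
    {u₀' : Lp ℂ 2 (volume : Measure (Lat d))} (T : Finset (Fin p ⊕ Fin q)) (s : ℝ) {e}
    (he : e ∈ T.offDiag) {χ : Fin p ⊕ Fin q → Lat d → ℂ} (h : ∀ i, IsTest (χ i)) :
    Continuous fun k => freeMoment k₀ ε η R P u u₀' T s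
      (twist (factorSign p q) (η / (k₀ * ε)) s e k χ) := by
  have h1 := (S.continuous_momentFn_edgeTest factorSign_eq T (η / (k₀ * ε)) h
    (Finset.mem_offDiag.1 he).2.2).comp
      (by fun_prop : Continuous fun k : Lat d => (((s, k), s.toNNReal) : (ℝ × Lat d) × ℝ≥0))
  have h2 : ∀ k, freeMoment k₀ ε η R P u u₀' T s
      (twist (factorSign p q) (η / (k₀ * ε)) s e k χ) =
      Real.exp (T.card * (k₀ ^ 2 * R 0 / (8 * η ^ 2)) * s) * momentFn P u (factorSign p q) T
        s.toNNReal (edgeTest (factorSign p q) e k (rots (factorSign p q) (η / (k₀ * ε)) s χ)) *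
        prodAmp (factorSign p q) Tᶜ u₀' χ := fun k => by
    rw [freeMoment, prodAmp_compl_twist _ _ _ he, rots_twist]
  simp only [h2]
  exact (continuous_const.mul h1).mul continuous_const

lemma IsSolution.momentFn_zero (S : IsSolution k₀ ε η R u₀ P ℱ u) {ι : Type*} [Fintype ι]
    [DecidableEq ι] (σ : ι → ℝ) (T : Finset ι) (χ : ι → Lat d → ℂ) :
    momentFn P u σ T 0 χ = prodAmp σ T u₀ χ := by
  rw [momentFn, integral_congr_ae (g := fun _ => prodAmp σ T u₀ χ), integral_const]
  · simp
  · filter_upwards [S.initial] with ω hω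
    rw [hω]

lemma initialMoment_eq (v : Dual d p q) : initialMoment u₀ p q v
    = ∏ i, conjSign (factorSign p q i) (fourierL2 u₀ (v i)) := by
  rw [Fintype.prod_sum_type, initialMoment]
  simp only [factorSign, Sum.elim_inl, Sum.elim_inr, conjSign_one, conjSign_neg_one]

lemma integrable_initialMoment (hu : Integrable (fourierL2 u₀)) :
    Integrable (initialMoment u₀ p q) := by
  have : initialMoment u₀ p q = fun v => ∏ i, conjSign (factorSign p q i) (fourierL2 u₀ (v i)) :=
    funext initialMoment_eq
  rw [this]
  exact Integrable.fintype_prod fun i => (conjSign _).integrable_comp hu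

lemma cint_initialMoment (hu : Integrable (fourierL2 u₀)) {χ : Fin p ⊕ Fin q → Lat d → ℂ}
    (h : ∀ i, IsTest (χ i)) : cint (volume.withDensityᵥ (initialMoment u₀ p q)) (prodTest χ)
      = prodAmp (factorSign p q) Finset.univ u₀ χ := by
  obtain ⟨b, -, hb⟩ := IsTest.exists_bound h
  rw [cint_withDensity (integrable_initialMoment hu) (measurable_prodTest h)
    (norm_prodTest_le fun i => (hb i).2), prodAmp]
  simp only [amp]
  rw [← integral_fintype_prod_volume_eq_prod
    (fun i ξ => conjSign (factorSign p q i) (fourierL2 u₀ ξ) * χ i ξ)]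
  refine integral_congr_ae (ae_of_all _ fun v => ?_)
  simp only [initialMoment_eq, prodTest]
  rw [← Finset.prod_mul_distrib]
  exact Finset.prod_congr rfl fun i _ => mul_comm _ _

/-- The moments are described by the evolutions `setFlow`. -/
theorem IsSolution.freeMoment_eq (S : IsSolution k₀ ε η R u₀ P ℱ u) (hR : IsCovariance R)
    (hu : Integrable (fourierL2 u₀)) (T : Finset (Fin p ⊕ Fin q))
    {χ : Fin p ⊕ Fin q → Lat d → ℂ} (h : ∀ i, IsTest (χ i)) {z : ℝ} (hz : 0 ≤ z) :
    freeMoment k₀ ε η R P u u₀ T z χ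
      = cint (setFlow (strongFamily_momentOp hR k₀ ε η) T.offDiag z
          (volume.withDensityᵥ (initialMoment u₀ p q))) (prodTest χ) := by
  set ψ : ComplexMeasure (Dual d p q) := volume.withDensityᵥ (initialMoment u₀ p q) with hψ
  set hL := strongFamily_momentOp (p := p) (q := q) hR k₀ ε η
  obtain ⟨b, hb0, hb⟩ := IsTest.exists_bound h
  obtain ⟨D, hD0, hD⟩ := S.exists_norm_momentFn_le (factorSign p q) T z.toNNReal
  -- Shifts and phases preserve both norms, so `Q` is stable under all interactions. The `L²` bound
  -- controls the moments, the sup bound the integrals against measures.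
  set Q : Set (Fin p ⊕ Fin q → Lat d → ℂ) :=
    {χ | ∀ i, IsTest (χ i) ∧ l2 (χ i) ≤ b ∧ ∀ ξ, ‖χ i ξ‖ ≤ b} with hQ
  have hs : Integrable fun k : Lat d => (spec R k : ℂ) := (integrable_spec hR).ofReal
  have hQt : ∀ χ ∈ Q, ∀ e ∈ T.offDiag, ∀ s k, twist (factorSign p q) (η / (k₀ * ε)) s e k χ ∈ Q := by
    intro χ hχ e he s k i
    refine ⟨IsTest.twist (fun i => (hχ i).1) (η / (k₀ * ε)) s e k i, ?_, fun ξ => ?_⟩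
    · rw [l2_twist (fun i => (hχ i).1) _ s (Finset.mem_offDiag.1 he).2.2]; exact (hχ i).2.1
    · rw [norm_twist]; exact (hχ i).2.2 _
  refine sub_eq_zero.1 (eq_zero_of_hierarchy Q (χ := χ)
    (D := fun s χ => freeMoment k₀ ε η R P u u₀ T s χ
      - cint (setFlow hL T.offDiag s ψ) (prodTest χ))
    (K := ∑ e ∈ T.offDiag, ‖((k₀ ^ 2 / (4 * η ^ 2) * edgeCoef (factorSign p q) e : ℝ) : ℂ)‖ *
      ∫ k, ‖(spec R k : ℂ)‖)
    (B := Real.exp (T.card * (k₀ ^ 2 * R 0 / (8 * η ^ 2)) * z) * ((∏ i ∈ T, fourierConst d * b) * D)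
        * (∏ i ∈ Tᶜ, fourierConst d * ‖u₀‖ * b)
      + b ^ Fintype.card (Fin p ⊕ Fin q) *
        (Real.exp (T.offDiag.card * momentBound R k₀ η * z) * ‖ψ‖)) (Z := z)
    ?_ ?_ (fun χ hχ s hs => (S.hasDerivWithinAt_freeMoment hR T (fun i => (hχ i).1) hs.1).sub
      (hasDerivAt_cint_setFlow hR T ψ (fun i => (hχ i).1) s).hasDerivWithinAt) ?_ ?_
    (fun i => ⟨h i, hb i⟩) ⟨hz, le_rfl⟩)
  · intro χ hχ
    rw [setFlow_zero, one_apply_eq_self, cint_initialMoment hu fun i => (hχ i).1,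
      freeMoment, rots_zero, Real.toNNReal_zero, S.momentFn_zero, mul_zero, Real.exp_zero,
      Complex.ofReal_one, one_mul, sub_eq_zero]
    exact Finset.prod_mul_prod_compl T _
  · intro χ hχ
    refine ((S.continuous_freeMoment T fun i => (hχ i).1).sub
      (continuous_iff_continuousAt.2 fun s => ?_)).continuousOn
    exact (hasDerivAt_cint_setFlow hR T ψ (fun i => (hχ i).1) s).continuousAt
  · intro χ hχ s hs
    have hF := fourierConst_nonneg d
    refine (norm_sub_le _ _).trans (add_le_add ?_ ?_)
    · rw [freeMoment, norm_mul, norm_mul, Complex.norm_real, Real.norm_of_nonneg (Real.exp_nonneg _)]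
      have hR0 := covariance_zero_nonneg hR
      have hp : 0 ≤ ∏ i ∈ T, fourierConst d * b := Finset.prod_nonneg fun i _ => by positivity
      gcongr ?_ * ?_ * ?_
      · refine Real.exp_le_exp.2 ?_
        gcongr
        exact hs.2
      · refine (hD _ (IsTest.rots (fun i => (hχ i).1) (factorSign p q) (η / (k₀ * ε)) s) _
          (Real.toNNReal_le_toNNReal hs.2)).trans ?_
        rw [ampBound_rots]
        refine mul_le_mul_of_nonneg_right (Finset.prod_le_prod (fun i _ => ?_) fun i _ => ?_) hD0
        · exact mul_nonneg hF (l2_nonneg _)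
        · exact mul_le_mul_of_nonneg_left (hχ i).2.1 hF
      · rw [prodAmp, norm_prod]
        refine Finset.prod_le_prod (fun i _ => norm_nonneg _) fun i _ => ?_
        refine (norm_amp_le _ _ ((hχ i).1.memLp 2)).trans ?_
        exact mul_le_mul_of_nonneg_left (hχ i).2.1 (mul_nonneg hF (norm_nonneg _))
    · refine (norm_cint_le _ (norm_prodTest_le fun i => (hχ i).2.2)).trans ?_
      gcongr
      refine ((setFlow hL T.offDiag s).le_opNorm ψ).trans ?_
      gcongr
      refine (norm_setFlow_le hL _ hs.1).trans (Real.exp_le_exp.2 ?_)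
      have := one_le_momentBound (R := R) k₀ η
      gcongr
      exact hs.2
  · intro M s hs' hM χ hχ
    have ht := fun i => (hχ i).1
    rw [← Finset.sum_sub_distrib, Finset.sum_mul]
    refine (norm_sum_le _ _).trans (Finset.sum_le_sum fun e he => ?_)
    have he' := (Finset.mem_offDiag.1 he).2.2
    rw [← mul_sub, norm_mul, mul_assoc]
    refine mul_le_mul_of_nonneg_left ?_ (norm_nonneg _)
    have i2 := (cint_edgeAdj_prodTest factorSign_eq hs (measurable_spec hR) (η / (k₀ * ε)) s he' ht
      (setFlow hL T.offDiag s ψ)).1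
    have i1 : Integrable fun k => (spec R k : ℂ) * freeMoment k₀ ε η R P u u₀ T s
        (twist (factorSign p q) (η / (k₀ * ε)) s e k χ) := by
      have hcont := S.continuous_freeMoment_twist (u₀' := u₀) T s he ht
      refine hs.mul_bdd (c := M + b ^ Fintype.card (Fin p ⊕ Fin q) * ‖setFlow hL T.offDiag s ψ‖)
        hcont.aestronglyMeasurable (ae_of_all _ fun k => ?_)
      have h1 := hM _ (hQt χ hχ e he s k)
      have h2 := norm_cint_le (setFlow hL T.offDiag s ψ)
        (norm_prodTest_le fun i => (hQt χ hχ e he s k i).2.2)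
      exact (norm_le_norm_sub_add _ _).trans (add_le_add h1 h2)
    rw [← integral_sub i1 i2, ← integral_mul_const]
    refine norm_integral_le_of_norm_le (hs.norm.mul_const _) (ae_of_all _ fun k => ?_)
    rw [← mul_sub, norm_mul]
    exact mul_le_mul_of_nonneg_left (hM _ (hQt χ hχ e he s k)) (norm_nonneg _)

end Comparison

/-! ### Complex measures are determined by products of test functions -/

section Determination

lemma tendsto_cint {X : Type*} [MeasurableSpace X] (ρ : ComplexMeasure X) {F : ℕ → X → ℂ}
    {F₀ : X → ℂ} (hF : ∀ n, Measurable (F n)) (hF₀ : Measurable F₀) {C : ℝ}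
    (hC : ∀ n x, ‖F n x‖ ≤ C) (hC₀ : ∀ x, ‖F₀ x‖ ≤ C)
    (h : ∀ x, Tendsto (fun n => F n x) atTop (𝓝 (F₀ x))) :
    Tendsto (fun n => cint ρ (F n)) atTop (𝓝 (cint ρ F₀)) := by
  obtain ⟨g, hg, ig, -, hI⟩ := cint_eq_integral ρ
  rw [hI _ hF₀ C hC₀]
  simp only [fun n => hI _ (hF n) C (hC n)]
  refine tendsto_integral_of_dominated_convergence (fun x => C * ‖g x‖)
    (fun n => ((hF n).mul hg).aestronglyMeasurable) (ig.norm.const_mul C) (fun n => ae_of_all _ fun x => ?_)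
    (ae_of_all _ fun x => (h x).mul_const _)
  rw [norm_mul]
  exact mul_le_mul_of_nonneg_right (hC n x) (norm_nonneg _)

variable {d : ℕ} {ι : Type*} [Fintype ι] [DecidableEq ι]

/-- An open set is the support of a smooth nonnegative function `f`. A smooth step applied to `n f`
saturates at `1` on `U`, and a growing bump makes the support compact. -/
lemma exists_tests_indicator {U : Set (Lat d)} (hU : IsOpen U) : ∃ f : ℕ → Lat d → ℂ,
    (∀ n, IsTest (f n)) ∧ (∀ n ξ, ‖f n ξ‖ ≤ 1) ∧
      ∀ ξ, Tendsto (fun n => f n ξ) atTop (𝓝 (U.indicator (fun _ => 1) ξ)) := by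
  obtain ⟨f, hfU, hf, hf1⟩ := hU.exists_contDiff_support_eq (n := ⊤)
  have hf0 : ∀ ξ, 0 ≤ f ξ := fun ξ => (hf1 (mem_range_self ξ)).1
  let b : ∀ n : ℕ, ContDiffBump (0 : Lat d) := fun n =>
    ⟨n + 1, n + 2, by positivity, by linarith⟩
  refine ⟨fun n ξ => ((Real.smoothTransition (n * f ξ) : ℝ) : ℂ) * ((b n ξ : ℝ) : ℂ), fun n => ?_,
    fun n ξ => ?_, fun ξ => ?_⟩
  · have h1 : IsTest fun ξ => ((b n ξ : ℝ) : ℂ) :=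
      ⟨Complex.ofRealCLM.contDiff.comp (b n).contDiff,
        (b n).hasCompactSupport.comp_left Complex.ofReal_zero⟩
    exact h1.mul (Complex.ofRealCLM.contDiff.comp
      (Real.smoothTransition.contDiff.comp (contDiff_const.mul hf)))
  · rw [norm_mul, Complex.norm_real, Complex.norm_real, Real.norm_of_nonneg (b n).nonneg,
      Real.norm_of_nonneg (Real.smoothTransition.nonneg _)]
    exact mul_le_one₀ (Real.smoothTransition.le_one _) (b n).nonneg (b n).le_one
  · refine tendsto_const_nhds.congr' ?_
    by_cases hξ : ξ ∈ U
    · have hpos : 0 < f ξ := lt_of_le_of_ne (hf0 ξ) (by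
        rw [← hfU] at hξ; exact (Function.mem_support.1 hξ).symm)
      filter_upwards [eventually_ge_atTop ⌈(f ξ)⁻¹⌉₊, eventually_ge_atTop ⌈‖ξ‖⌉₊] with n hn hn'
      have h1 : 1 ≤ n * f ξ := by
        have := mul_le_mul_of_nonneg_right (Nat.ceil_le.1 hn) hpos.le
        rwa [inv_mul_cancel₀ hpos.ne'] at this
      have h2 : b n ξ = 1 := (b n).one_of_mem_closedBall (by
        rw [mem_closedBall_zero_iff]
        exact (Nat.ceil_le.1 hn').trans (le_add_of_nonneg_right zero_le_one))
      rw [indicator_of_mem hξ, Real.smoothTransition.one_of_one_le h1, h2]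
      simp
    · have hz : f ξ = 0 := by
        rw [← hfU] at hξ; simpa using hξ
      refine Eventually.of_forall fun n => ?_
      simp only [indicator_of_notMem hξ, hz, mul_zero, Real.smoothTransition.zero_of_nonpos le_rfl,
        Complex.ofReal_zero, zero_mul]

lemma prod_indicator_pi (s : ι → Set (Lat d)) (v : ι → Lat d) :
    ∏ i, (s i).indicator (fun _ => (1 : ℂ)) (v i) = (univ.pi s).indicator (fun _ => 1) v := by
  by_cases hv : v ∈ univ.pi s
  · rw [indicator_of_mem hv]
    exact Finset.prod_eq_one fun i _ => indicator_of_mem (hv i (mem_univ i)) _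
  · rw [indicator_of_notMem hv]
    obtain ⟨i, hi⟩ : ∃ i, v i ∉ s i := by simpa using hv
    exact Finset.prod_eq_zero (Finset.mem_univ i) (indicator_of_notMem hi _)

/-- Indicators of boxes of open sets are bounded limits of products of test functions, and these
boxes form a π-system that generates the product σ-algebra. -/
lemma ext_prodTest {μ ν : ComplexMeasure (ι → Lat d)} (h : ∀ χ : ι → Lat d → ℂ,
    (∀ i, IsTest (χ i)) → cint μ (prodTest χ) = cint ν (prodTest χ)) : μ = ν := by
  have hopen : ∀ s ∈ univ.pi '' univ.pi fun _ : ι => {s : Set (Lat d) | IsOpen s}, μ s = ν s := by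
    rintro _ ⟨s, hs, rfl⟩
    have hs : ∀ i, IsOpen (s i) := fun i => by simpa using hs i (mem_univ i)
    choose f hf hf1 hft using fun i => exists_tests_indicator (hs i)
    have hm : MeasurableSet (univ.pi s) :=
      MeasurableSet.univ_pi fun i => (hs i).measurableSet
    have key : ∀ ρ : ComplexMeasure (ι → Lat d), Tendsto
        (fun n => cint ρ (prodTest fun i => f i n)) atTop (𝓝 (ρ (univ.pi s))) := by
      intro ρ
      rw [← one_mul (ρ _), ← cint_indicator_one ρ hm]
      refine tendsto_cint ρ (C := 1) (fun n => measurable_prodTest fun i => hf i n)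
        (measurable_const.indicator hm) (fun n x => ?_) (fun x => ?_) fun x => ?_
      · exact (norm_prodTest_le (fun i => hf1 i n) x).trans_eq (one_pow _)
      · by_cases hx : x ∈ univ.pi s <;> simp only [indicator, hx] <;> simp
      · rw [← prod_indicator_pi]
        exact tendsto_finsetProd _ fun i _ => hft i (x i)
    refine tendsto_nhds_unique (key μ) ?_
    simp only [h _ fun i => hf i _]
    exact key ν
  refine VectorMeasure.ext_of_generateFrom (univ.pi '' univ.pi fun _ : ι => {s : Set (Lat d) | IsOpen s})
    hopen ?_ (IsPiSystem.pi fun _ => isPiSystem_isOpen)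
    (hopen univ ⟨fun _ => univ, fun _ _ => by simp, pi_univ _⟩)
  rw [← generateFrom_pi_eq]
  · congr 1
    ext1 i
    exact (BorelSpace.measurable_eq (α := Lat d))
  · exact fun _ => ⟨fun _ => univ, fun _ => by simp, iUnion_const _⟩

/-- A positive weight. -/
noncomputable def gauss (ξ : Lat d) : ℝ := Real.exp (-‖ξ‖ ^ 2)

lemma gauss_pos (ξ : Lat d) : 0 < gauss ξ := Real.exp_pos _

lemma gauss_le_one (ξ : Lat d) : gauss ξ ≤ 1 :=
  Real.exp_le_one_iff.2 (neg_nonpos.2 (by positivity))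

lemma contDiff_gauss : ContDiff ℝ (⊤ : ℕ∞) fun ξ : Lat d => (gauss ξ : ℂ) :=
  Complex.ofRealCLM.contDiff.comp (Real.contDiff_exp.comp (contDiff_norm_sq ℝ).neg)

lemma memLp_gauss : MemLp (fun ξ : Lat d => (gauss ξ : ℂ)) 2 := by
  rw [memLp_two_iff_integrable_sq_norm contDiff_gauss.continuous.aestronglyMeasurable]
  have h := (GaussianFourier.integrable_cexp_neg_mul_sq_norm_add (V := Lat d) (b := 2)
    (by norm_num) 0 0).norm
  refine h.congr (ae_of_all _ fun ξ => ?_)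
  simp only [gauss]
  rw [Complex.norm_exp, Complex.norm_real, Real.norm_of_nonneg (Real.exp_nonneg _),
    ← Real.exp_nat_mul]
  congr 1
  simp
  norm_cast

/-- The product of the weights. -/
noncomputable def gaussProd (v : ι → Lat d) : ℝ := ∏ i, gauss (v i)

lemma gaussProd_pos (v : ι → Lat d) : 0 < gaussProd v := Finset.prod_pos fun _ _ => gauss_pos _

lemma gaussProd_le_one (v : ι → Lat d) : gaussProd v ≤ 1 :=
  Finset.prod_le_one (fun _ _ => (gauss_pos _).le) fun _ _ => gauss_le_one _

lemma continuous_gaussProd : Continuous (gaussProd : (ι → Lat d) → ℝ) :=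
  continuous_finsetProd _ fun i _ => by unfold gauss; fun_prop

/-- A locally integrable function which acts like a finite complex measure on products of test
functions is its density. -/
lemma withDensity_eq_of_prodTest {h : (ι → Lat d) → ℂ} (hm : Measurable h)
    (hg : Integrable fun v => (gaussProd v : ℂ) * h v) (μ : ComplexMeasure (ι → Lat d))
    (heq : ∀ χ : ι → Lat d → ℂ, (∀ i, IsTest (χ i)) →
      ∫ v, prodTest χ v * h v = cint μ (prodTest χ)) :
    Integrable h ∧ volume.withDensityᵥ h = μ := by
  have hGm : Measurable fun v : ι → Lat d => (gaussProd v : ℂ) :=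
    (Complex.continuous_ofReal.comp continuous_gaussProd).measurable
  have hG1 : ∀ v : ι → Lat d, ‖(gaussProd v : ℂ)‖ ≤ 1 := fun v => by
    rw [Complex.norm_real, Real.norm_of_nonneg (gaussProd_pos v).le]; exact gaussProd_le_one v
  -- Integrability of `h` is not yet known. After multiplication by the Gaussian weight both sides
  -- are finite measures, and the weight can be absorbed in the test functions.
  have h1 : volume.withDensityᵥ (fun v => (gaussProd v : ℂ) * h v)
      = mulDensity (fun v => (gaussProd v : ℂ)) μ := by
    refine ext_prodTest fun χ hχ => ?_
    obtain ⟨b, -, hb⟩ := IsTest.exists_bound hχ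
    have hpm := measurable_prodTest hχ
    have hpb := norm_prodTest_le fun i => (hb i).2
    rw [cint_withDensity hg hpm hpb, cint_mulDensity μ hGm hG1 hpm hpb]
    have e : (fun v => prodTest χ v * (gaussProd v : ℂ))
        = prodTest fun i ξ => (gauss ξ : ℂ) * χ i ξ := by
      funext v
      rw [prodTest, prodTest, Finset.prod_mul_distrib, gaussProd, mul_comm]
      push_cast
      rfl
    rw [e, ← heq _ fun i => (hχ i).mul contDiff_gauss, ← e]
    simp only [mul_assoc]
  -- On these sets, which exhaust the space, the weight is bounded below and can be divided out.
  set A : ℕ → Set (ι → Lat d) := fun n => {v | 1 ≤ (n + 1) * gaussProd v} with hA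
  have hAm : ∀ n, MeasurableSet (A n) := fun n =>
    measurableSet_le measurable_const (measurable_const.mul continuous_gaussProd.measurable)
  have hAe : ∀ v, ∀ᶠ n in atTop, v ∈ A n := fun v => by
    filter_upwards [eventually_ge_atTop ⌈(gaussProd v)⁻¹⌉₊] with n hn
    have := mul_le_mul_of_nonneg_right (Nat.ceil_le.1 hn) (gaussProd_pos v).le
    rw [inv_mul_cancel₀ (gaussProd_pos v).ne'] at this
    have h2 := gaussProd_pos v
    simp only [hA, mem_ofPred_eq]
    linarith
  have key : ∀ n, ∀ F : (ι → Lat d) → ℂ, Measurable F → (∀ v, ‖F v‖ ≤ 1) →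
      cint μ ((A n).indicator F) = ∫ v in A n, F v * h v := by
    intro n F hF hF1
    set F' : (ι → Lat d) → ℂ := (A n).indicator fun v => F v * (gaussProd v : ℂ)⁻¹ with hF'
    have hF'm : Measurable F' := (hF.mul hGm.inv).indicator (hAm n)
    have hF'b : ∀ v, ‖F' v‖ ≤ n + 1 := fun v => by
      by_cases hv : v ∈ A n
      · rw [hF', indicator_of_mem hv, norm_mul, norm_inv, Complex.norm_real,
          Real.norm_of_nonneg (gaussProd_pos v).le]
        refine (mul_le_of_le_one_left (by have := gaussProd_pos v; positivity) (hF1 v)).trans ?_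
        exact (inv_le_iff_one_le_mul₀ (gaussProd_pos v)).2 hv
      · rw [hF', indicator_of_notMem hv, norm_zero]; positivity
    have h2 := congrArg (fun ρ => cint ρ F') h1
    beta_reduce at h2
    rw [cint_withDensity hg hF'm hF'b, cint_mulDensity μ hGm hG1 hF'm hF'b] at h2
    have e1 : (fun v => F' v * (gaussProd v : ℂ)) = (A n).indicator F := by
      funext v
      have := (gaussProd_pos v).ne'
      by_cases hv : v ∈ A n
      · rw [hF', indicator_of_mem hv, indicator_of_mem hv, mul_assoc, inv_mul_cancel₀
          (by exact_mod_cast this), mul_one]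
      · rw [hF', indicator_of_notMem hv, indicator_of_notMem hv, zero_mul]
    rw [← e1, ← h2, ← integral_indicator (hAm n)]
    congr 1
    funext v
    rw [← mul_assoc, congrFun e1 v]
    by_cases hv : v ∈ A n <;> simp [hv]
  have hcov : AECover volume atTop A := ⟨ae_of_all _ hAe, hAm⟩
  have hint : Integrable h := by
    refine hcov.integrable_of_integral_norm_bounded ‖μ‖ (fun n => ?_)
      (Eventually.of_forall fun n => ?_)
    · have h3 : IntegrableOn (fun v => ((n : ℂ) + 1) * ((gaussProd v : ℂ) * h v)) (A n) :=
        (hg.const_mul _).integrableOn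
      refine Integrable.mono h3 hm.aestronglyMeasurable (ae_restrict_of_forall_mem (hAm n) fun v hv => ?_)
      have hn : ‖(n : ℂ) + 1‖ = n + 1 := by exact_mod_cast Complex.norm_natCast (n + 1)
      rw [norm_mul, norm_mul, Complex.norm_real, Real.norm_of_nonneg (gaussProd_pos v).le, hn,
        ← mul_assoc]
      exact le_mul_of_one_le_left (norm_nonneg _) hv
    -- Testing with the conjugate phase of `h` bounds `∫_{A n} ‖h‖` by `‖μ‖` uniformly in `n`, which
    -- gives integrability on the whole space.
    · set F : (ι → Lat d) → ℂ := fun v => (‖h v‖⁻¹ : ℝ) * conj (h v) with hF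
      have hF1 : ∀ v, ‖F v‖ ≤ 1 := fun v => by
        simp only [hF, norm_mul, Complex.norm_real, norm_inv, norm_norm, RCLike.norm_conj]
        exact inv_mul_le_one
      have hFm : Measurable F := (Complex.measurable_ofReal.comp hm.norm.inv).mul
        (Complex.continuous_conj.measurable.comp hm)
      have h2 : ∀ v, F v * h v = (‖h v‖ : ℂ) := fun v => by
        simp only [hF]
        rw [mul_assoc, Complex.conj_mul']
        by_cases hx : ‖h v‖ = 0
        · simp [hx]
        · have : (‖h v‖ : ℂ) ≠ 0 := by exact_mod_cast hx
          push_cast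
          field_simp
      have h3 := key n F hFm hF1
      simp only [h2] at h3
      rw [integral_complex_ofReal] at h3
      have h4 := norm_cint_le μ (F := (A n).indicator F) (C := 1) fun v =>
        (norm_indicator_le_norm_self _ _).trans (hF1 v)
      rw [h3, Complex.norm_real, one_mul] at h4
      exact (le_abs_self _).trans h4
  refine ⟨hint, ext_cint fun F hF hF1 => ?_⟩
  rw [cint_withDensity hint hF hF1]
  have t1 := hcov.integral_tendsto_of_countably_generated
    (hint.bdd_mul hF.aestronglyMeasurable (ae_of_all _ hF1))
  have t2 := tendsto_cint μ (F := fun n => (A n).indicator F) (F₀ := F) (C := 1)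
    (fun n => hF.indicator (hAm n)) hF
    (fun n v => (norm_indicator_le_norm_self _ _).trans (hF1 v)) hF1 fun v =>
      tendsto_const_nhds.congr' ((hAe v).mono fun n hn => (indicator_of_mem hn F).symm)
  simp only [key _ F hF hF1] at t2
  exact tendsto_nhds_unique t1 t2

end Determination

/-! ### Centered products of the Fourier transform -/

section CenteredField

variable {d p q : ℕ} {R : Lat d → ℝ} {k₀ ε η : ℝ} {u₀ : Lp ℂ 2 (volume : Measure (Lat d))}
  {Ω : Type*} {mΩ : MeasurableSpace Ω} {P : Measure Ω} [IsProbabilityMeasure P]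
  {ℱ : Filtration ℝ≥0 mΩ} {u : ℝ≥0 → Ω → Lp ℂ 2 (volume : Measure (Lat d))} {z : ℝ≥0}
  {uhat : Lat d → Ω → ℂ}

lemma integral_norm_sq_eq {f : Lat d → ℂ} (hf : MemLp f 2) : ∫ ξ, ‖f ξ‖ ^ 2 = l2 f ^ 2 := by
  have h0 : 0 ≤ ∫ ξ, ‖f ξ‖ ^ 2 := integral_nonneg fun _ => by positivity
  rw [l2, hf.eLpNorm_eq_integral_rpow_norm (by norm_num) (by norm_num)]
  simp only [ENNReal.toReal_ofNat, Real.rpow_ofNat]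
  rw [ENNReal.toReal_ofReal (Real.rpow_nonneg h0 _), ← Real.rpow_mul_natCast h0]
  norm_num

lemma integral_norm_mul_le {f g : Lat d → ℂ} (hf : MemLp f 2) (hg : MemLp g 2) :
    ∫ ξ, ‖f ξ * g ξ‖ ≤ l2 f * l2 g := by
  have h := norm_integral_mul_le (f := fun ξ => (‖f ξ‖ : ℂ)) (g := fun ξ => (‖g ξ‖ : ℂ))
    hf.norm.ofReal hg.norm.ofReal
  rw [l2_congr (f := fun ξ => (‖f ξ‖ : ℂ)) (g := f) fun ξ => by simp,
    l2_congr (f := fun ξ => (‖g ξ‖ : ℂ)) (g := g) fun ξ => by simp] at h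
  have e : ∀ ξ, (‖f ξ‖ : ℂ) * (‖g ξ‖ : ℂ) = ((‖f ξ * g ξ‖ : ℝ) : ℂ) := fun ξ => by
    rw [norm_mul]; push_cast; rfl
  simp only [e] at h
  rw [integral_complex_ofReal, Complex.norm_real] at h
  exact (le_abs_self _).trans h

lemma l2_sub_le {f g : Lat d → ℂ} (hf : MemLp f 2) (hg : MemLp g 2) :
    l2 (fun ξ => f ξ - g ξ) ≤ l2 f + l2 g := by
  rw [l2, l2, l2, ← ENNReal.toReal_add hf.eLpNorm_ne_top hg.eLpNorm_ne_top]
  exact ENNReal.toReal_mono (ENNReal.add_ne_top.2 ⟨hf.eLpNorm_ne_top, hg.eLpNorm_ne_top⟩)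
    (eLpNorm_sub_le hf.1 hg.1 one_le_two)

lemma IsFourierField.memLp (S : IsSolution k₀ ε η R u₀ P ℱ u) (hF : IsFourierField P (u z) uhat) :
    MemLp (Function.uncurry uhat) 2 (volume.prod P) := by
  rw [memLp_two_iff_integrable_sq_norm hF.1.aestronglyMeasurable,
    integrable_prod_iff' (hF.1.norm.pow_const 2).aestronglyMeasurable]
  have h1 : ∀ᵐ ω ∂P, MemLp (fun ξ => uhat ξ ω) 2 ∧ l2 (fun ξ => uhat ξ ω) = fourierConst d * ‖u z ω‖ := by
    filter_upwards [hF.2] with ω hω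
    refine ⟨(memLp_congr_ae hω).2 (memLp_fourierL2 _), ?_⟩
    rw [← eLpNorm_fourierL2, l2, eLpNorm_congr_ae hω]
  refine ⟨?_, ?_⟩
  · filter_upwards [h1] with ω hω
    exact (memLp_two_iff_integrable_sq_norm hω.1.1).1 hω.1
  · obtain ⟨C, -, hC⟩ := S.exists_moment_le 2 z
    have h2 : Integrable (fun ω => (fourierConst d * ‖u z ω‖) ^ 2) P := by
      refine ((hC z le_rfl).1.const_mul (fourierConst d ^ 2)).mono'
        (((S.stronglyMeasurable z).norm.const_mul _).pow 2).aestronglyMeasurable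
        (ae_of_all _ fun ω => ?_)
      rw [Real.norm_of_nonneg (by positivity), mul_pow]
      gcongr
      linarith
    refine h2.congr ?_
    filter_upwards [h1] with ω hω
    simp only [Function.uncurry, norm_pow, norm_norm]
    rw [integral_norm_sq_eq hω.1, hω.2]

/-- The mean field. -/
noncomputable def meanField (P : Measure Ω) (uhat : Lat d → Ω → ℂ) (ξ : Lat d) : ℂ := ∫ ω, uhat ξ ω ∂P

lemma IsFourierField.measurable_meanField (hF : IsFourierField P (u z) uhat) :
    Measurable (meanField P uhat) :=
  (hF.1.stronglyMeasurable.integral_prod_right (ν := P)).measurable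

lemma IsFourierField.ae_memLp (S : IsSolution k₀ ε η R u₀ P ℱ u)
    (hF : IsFourierField P (u z) uhat) : ∀ᵐ ξ, MemLp (uhat ξ) 2 P := by
  filter_upwards [((memLp_two_iff_integrable_sq_norm hF.1.aestronglyMeasurable).1
    (hF.memLp S)).prod_right_ae] with ξ hξ
  exact (memLp_two_iff_integrable_sq_norm
    (hF.1.comp measurable_prodMk_left).aestronglyMeasurable).2 hξ

lemma IsFourierField.memLp_meanField (S : IsSolution k₀ ε η R u₀ P ℱ u)
    (hF : IsFourierField P (u z) uhat) : MemLp (meanField P uhat) 2 := by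
  rw [memLp_two_iff_integrable_sq_norm hF.measurable_meanField.aestronglyMeasurable]
  refine ((memLp_two_iff_integrable_sq_norm hF.1.aestronglyMeasurable).1
    (hF.memLp S)).integral_prod_left.mono'
    (hF.measurable_meanField.norm.pow_const 2).aestronglyMeasurable ?_
  filter_upwards [hF.ae_memLp S] with ξ hξ
  rw [Real.norm_of_nonneg (by positivity)]
  -- Jensen's inequality for the square, read off from the nonnegativity of the variance.
  have h1 := variance_nonneg (fun ω => ‖uhat ξ ω‖) P
  rw [variance_eq_sub hξ.norm] at h1
  have h2 : ‖meanField P uhat ξ‖ ^ 2 ≤ (∫ ω, ‖uhat ξ ω‖ ∂P) ^ 2 :=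
    pow_le_pow_left₀ (norm_nonneg _) (norm_integral_le_integral_norm _) 2
  refine h2.trans ?_
  have h3 := sub_nonneg.1 h1
  simpa [Function.uncurry] using h3

lemma centeredProduct_eq (v : Dual d p q) (ω : Ω) : centeredProduct P uhat p q v ω
    = ∏ i, conjSign (factorSign p q i) (uhat (v i) ω - meanField P uhat (v i)) := by
  rw [Fintype.prod_sum_type, centeredProduct]
  simp only [factorSign, Sum.elim_inl, Sum.elim_inr, conjSign_one, conjSign_neg_one, meanField]

lemma IsFourierField.measurable_centeredProduct (hF : IsFourierField P (u z) uhat) :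
    Measurable fun x : Dual d p q × Ω => centeredProduct P uhat p q x.1 x.2 := by
  simp only [centeredProduct_eq]
  refine Finset.measurable_prod _ fun i _ => (conjSign _).continuous.measurable.comp ?_
  have h1 : Measurable fun x : Dual d p q × Ω => (x.1 i, x.2) := by fun_prop
  exact (hF.1.comp h1).sub (hF.measurable_meanField.comp (by fun_prop))

lemma IsFourierField.ae_sub_memLp (S : IsSolution k₀ ε η R u₀ P ℱ u)
    (hF : IsFourierField P (u z) uhat) : ∀ᵐ ω ∂P,
      MemLp (fun ξ => uhat ξ ω - meanField P uhat ξ) 2 ∧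
      l2 (fun ξ => uhat ξ ω - meanField P uhat ξ)
        ≤ (fourierConst d + l2 (meanField P uhat)) * (1 + ‖u z ω‖) := by
  have hm := hF.memLp_meanField S
  filter_upwards [hF.2] with ω hω
  have h1 : MemLp (fun ξ => uhat ξ ω) 2 := (memLp_congr_ae hω).2 (memLp_fourierL2 _)
  have h2 : l2 (fun ξ => uhat ξ ω) = fourierConst d * ‖u z ω‖ := by
    rw [← eLpNorm_fourierL2, l2, eLpNorm_congr_ae hω]
  refine ⟨h1.sub hm, (l2_sub_le h1 hm).trans ?_⟩
  rw [h2]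
  nlinarith [fourierConst_nonneg d, l2_nonneg (meanField P uhat), norm_nonneg (u z ω),
    mul_nonneg (l2_nonneg (meanField P uhat)) (norm_nonneg (u z ω))]

/-- For a fixed realization the integral over the dual variables factorizes, and Cauchy-Schwarz
bounds each factor by a multiple of `1 + ‖u‖`; the moment hypothesis integrates the product. Square
integrable test functions are allowed, in particular the Gaussian weight. -/
lemma IsFourierField.integrable_centeredProduct (S : IsSolution k₀ ε η R u₀ P ℱ u)
    (hF : IsFourierField P (u z) uhat) {χ : Fin p ⊕ Fin q → Lat d → ℂ} (hm : ∀ i, Measurable (χ i))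
    (h : ∀ i, MemLp (χ i) 2) : Integrable (fun x : Dual d p q × Ω =>
      prodTest χ x.1 * centeredProduct P uhat p q x.1 x.2) (volume.prod P) := by
  have hmeas : StronglyMeasurable (fun x : Dual d p q × Ω =>
      prodTest χ x.1 * centeredProduct P uhat p q x.1 x.2) := by
    refine (Measurable.mul ?_ hF.measurable_centeredProduct).stronglyMeasurable
    exact Finset.measurable_prod _ fun i _ => (hm i).comp (by fun_prop)
  have e : ∀ (v : Dual d p q) (ω : Ω), prodTest χ v * centeredProduct P uhat p q v ω
      = ∏ i, (χ i (v i) *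
        conjSign (factorSign p q i) (uhat (v i) ω - meanField P uhat (v i))) := fun v ω => by
    rw [centeredProduct_eq, prodTest, Finset.prod_mul_distrib]
  rw [integrable_prod_iff' hmeas.aestronglyMeasurable]
  simp only [e]
  refine ⟨?_, ?_⟩
  · filter_upwards [hF.ae_sub_memLp S] with ω hω
    exact Integrable.fintype_prod fun i => (h i).integrable_mul (memLp_conjSign _ hω.1)
  · obtain ⟨C, -, hC⟩ := S.exists_moment_le (Fintype.card (Fin p ⊕ Fin q)) z
    refine ((hC z le_rfl).1.const_mul
      (∏ i, l2 (χ i) * (fourierConst d + l2 (meanField P uhat)))).mono'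
      ?_ ?_
    · have := hmeas.norm.integral_prod_left' (μ := volume)
      simp only [e] at this
      exact this.aestronglyMeasurable
    · filter_upwards [hF.ae_sub_memLp S] with ω hω
      rw [Real.norm_of_nonneg (integral_nonneg fun _ => norm_nonneg _)]
      simp only [norm_prod]
      rw [integral_fintype_prod_volume_eq_prod (fun i ξ => ‖χ i ξ *
        conjSign (factorSign p q i) (uhat ξ ω - meanField P uhat ξ)‖), ← Finset.card_univ,
        ← Finset.prod_const, ← Finset.prod_mul_distrib]
      refine Finset.prod_le_prod (fun i _ => integral_nonneg fun _ => norm_nonneg _) fun i _ => ?_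
      refine (integral_norm_mul_le (h i) (memLp_conjSign _ hω.1)).trans ?_
      rw [l2_congr fun ξ => norm_conjSign _ _, mul_assoc]
      exact mul_le_mul_of_nonneg_left hω.2 (l2_nonneg _)

lemma measurable_gauss : Measurable fun ξ : Lat d => (gauss ξ : ℂ) :=
  contDiff_gauss.continuous.measurable

lemma IsFourierField.integrable_gaussProd_mul (S : IsSolution k₀ ε η R u₀ P ℱ u)
    (hF : IsFourierField P (u z) uhat) : Integrable (fun x : Dual d p q × Ω =>
      (gaussProd x.1 : ℂ) * centeredProduct P uhat p q x.1 x.2) (volume.prod P) := by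
  have h := hF.integrable_centeredProduct (p := p) (q := q) S (χ := fun _ ξ => (gauss ξ : ℂ))
    (fun _ => measurable_gauss) fun _ => memLp_gauss
  refine h.congr (ae_of_all _ fun x => ?_)
  simp only [prodTest, gaussProd]
  push_cast
  rfl

lemma IsFourierField.ae_integrable_centeredProduct (S : IsSolution k₀ ε η R u₀ P ℱ u)
    (hF : IsFourierField P (u z) uhat) :
    ∀ᵐ v, Integrable (centeredProduct P uhat p q v) P := by
  filter_upwards [(hF.integrable_gaussProd_mul (p := p) (q := q) S).prod_right_ae] with v hv
  have h0 : (gaussProd v : ℂ) ≠ 0 := by exact_mod_cast (gaussProd_pos v).ne'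
  refine (hv.const_mul (gaussProd v : ℂ)⁻¹).congr (ae_of_all _ fun ω => ?_)
  simp only []
  rw [← mul_assoc, inv_mul_cancel₀ h0, one_mul]

lemma IsFourierField.integrable_gaussProd_centeredMoment (S : IsSolution k₀ ε η R u₀ P ℱ u)
    (hF : IsFourierField P (u z) uhat) :
    Integrable fun v => (gaussProd v : ℂ) * centeredMoment P uhat p q v := by
  refine (hF.integrable_gaussProd_mul (p := p) (q := q) S).integral_prod_left.congr
    (ae_of_all _ fun v => ?_)
  simp only [centeredMoment]
  rw [integral_const_mul]

lemma IsFourierField.measurable_centeredMoment (hF : IsFourierField P (u z) uhat) :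
    Measurable (centeredMoment P uhat p q) :=
  (StronglyMeasurable.integral_prod_right (ν := P)
    (f := centeredProduct P uhat p q) hF.measurable_centeredProduct.stronglyMeasurable).measurable

/-! ### Identification of the centered moments -/

lemma IsFourierField.amp_eq (hF : IsFourierField P (u z) uhat) (s : ℝ) (χ : Lat d → ℂ) :
    ∀ᵐ ω ∂P, amp s (u z ω) χ = ∫ ξ, conjSign s (uhat ξ ω) * χ ξ := by
  filter_upwards [hF.2] with ω hω
  refine integral_congr_ae ?_
  filter_upwards [hω] with ξ hξ
  rw [← hξ]

lemma IsFourierField.integral_meanField (S : IsSolution k₀ ε η R u₀ P ℱ u)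
    (hF : IsFourierField P (u z) uhat) (s : ℝ) {χ : Lat d → ℂ} (h : IsTest χ) :
    ∫ ξ, conjSign s (meanField P uhat ξ) * χ ξ = ∫ ω, amp s (u z ω) χ ∂P := by
  rw [integral_congr_ae (hF.amp_eq s χ)]
  have h1 : MemLp (fun x : Lat d × Ω => conjSign s (uhat x.1 x.2)) 2 (volume.prod P) :=
    (hF.memLp S).of_le (((conjSign s).continuous.measurable.comp hF.1).aestronglyMeasurable)
      (ae_of_all _ fun x => (norm_conjSign _ _).le)
  have h2 : Integrable (fun x : Lat d × Ω => conjSign s (uhat x.1 x.2) * χ x.1) (volume.prod P) :=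
    h1.integrable_mul ((h.memLp 2).comp_fst P)
  rw [← integral_integral_swap (f := fun ξ ω => conjSign s (uhat ξ ω) * χ ξ) h2]
  refine integral_congr_ae (ae_of_all _ fun ξ => ?_)
  simp only [meanField]
  rw [conjSign_integral, integral_mul_const]

/-- A single factor has no partner, so its moment equation contains the damping alone. -/
lemma IsSolution.integral_amp_rot (S : IsSolution k₀ ε η R u₀ P ℱ u) (hR : IsCovariance R)
    {χ : Fin p ⊕ Fin q → Lat d → ℂ} (h : ∀ i, IsTest (χ i)) (i : Fin p ⊕ Fin q) (z : ℝ≥0) :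
    ∫ ω, amp (factorSign p q i) (u z ω) (rots (factorSign p q) (η / (k₀ * ε)) z χ i) ∂P
      = Real.exp (-((k₀ ^ 2 * R 0 / (8 * η ^ 2)) * z)) * amp (factorSign p q i) u₀ (χ i) := by
  set γ : ℝ := k₀ ^ 2 * R 0 / (8 * η ^ 2) with hγ
  have hsing : ∀ (y : ℝ≥0) χ, momentFn P u (factorSign p q) {i} y χ
      = ∫ ω, amp (factorSign p q i) (u y ω) (χ i) ∂P := fun y χ => by simp [momentFn, prodAmp]
  have hcont := (S.continuous_momentFn_rots factorSign_eq {i} (η / (k₀ * ε)) h).comp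
    (by fun_prop : Continuous fun y : ℝ => ((y, y.toNNReal) : ℝ × ℝ≥0))
  have h2 : ∀ y : ℝ, HasDerivAt (fun y : ℝ => ((Real.exp (γ * y) : ℝ) : ℂ))
      ((Real.exp (γ * y) * γ : ℝ) : ℂ) y := fun y => by
    have := (((hasDerivAt_id y).const_mul γ).exp).ofReal_comp
    simpa using this
  have h3 := constant_of_has_deriv_right_zero (a := 0) (b := z)
    (f := fun y : ℝ => ((Real.exp (γ * y) : ℝ) : ℂ) * momentFn P u (factorSign p q) {i} y.toNNReal
      (rots (factorSign p q) (η / (k₀ * ε)) y χ))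
    ((by fun_prop : Continuous fun y : ℝ => ((Real.exp (γ * y) : ℝ) : ℂ)).mul hcont).continuousOn
    (fun y hy => by
      refine ((h2 y).hasDerivWithinAt.mul
        (S.hasDerivWithinAt_momentFn_rots factorSign_eq hR {i} h hy.1)).congr_deriv ?_
      rw [Finset.offDiag_singleton, Finset.sum_empty, Finset.card_singleton,
        Nat.cast_one, one_mul, ← hγ]
      push_cast
      ring) z ⟨z.2, le_rfl⟩
  beta_reduce at h3
  rw [Real.toNNReal_coe, mul_zero, Real.exp_zero, Complex.ofReal_one, one_mul, Real.toNNReal_zero,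
    S.momentFn_zero, rots_zero, hsing] at h3
  have h4 : prodAmp (factorSign p q) {i} u₀ χ = amp (factorSign p q i) u₀ (χ i) := by
    simp [prodAmp]
  rw [← h4, ← h3, ← mul_assoc, ← Complex.ofReal_mul, ← Real.exp_add, neg_add_cancel, Real.exp_zero,
    Complex.ofReal_one, one_mul]

/-- The phase is a product over the factors, and undoing the rotation of the test functions amounts
to multiplying the measure by it. -/
lemma phase_eq (k₀ ε η : ℝ) (z : ℝ) (χ : Fin p ⊕ Fin q → Lat d → ℂ) (v : Dual d p q) :
    prodTest χ v * phase k₀ ε η p q z v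
      = prodTest (rots (factorSign p q) (η / (k₀ * ε)) (-z) χ) v := by
  have h1 : phase k₀ ε η p q z v
      = ∏ i, osc (-z) (factorSign p q i * (η / (k₀ * ε)) / 2 * ‖v i‖ ^ 2) := by
    rw [prod_osc, phase, osc, Fintype.sum_sum_type]
    congr 1
    simp only [factorSign, Sum.elim_inl, Sum.elim_inr]
    rw [← Finset.mul_sum, ← Finset.mul_sum, neg_mul, ← mul_neg, ← Complex.ofReal_neg]
    congr 2
    have : z * η / (2 * k₀ * ε) = z * (η / (k₀ * ε) / 2) := by
      rw [div_div, mul_div_assoc]; congr 2; ring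
    rw [this]
    ring
  rw [h1, mul_comm, prodTest, ← Finset.prod_mul_distrib]
  rfl

lemma measurable_phase (k₀ ε η : ℝ) (p q : ℕ) (z : ℝ) :
    Measurable (phase (d := d) k₀ ε η p q z) := by
  unfold phase
  exact Continuous.measurable (by fun_prop)

lemma norm_phase (k₀ ε η : ℝ) (z : ℝ) (v : Dual d p q) : ‖phase k₀ ε η p q z v‖ = 1 := by
  rw [phase, neg_mul, mul_comm, ← neg_mul, ← Complex.ofReal_neg]
  exact Complex.norm_exp_ofReal_mul_I _

end CenteredField

/-! ### The centered moments as densities of the centered evolution -/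

section Identification

variable {d p q : ℕ} {R : Lat d → ℝ} {k₀ ε η : ℝ} {u₀ : Lp ℂ 2 (volume : Measure (Lat d))}
  {Ω : Type*} {mΩ : MeasurableSpace Ω} {P : Measure Ω} [IsProbabilityMeasure P]
  {ℱ : Filtration ℝ≥0 mΩ} {u : ℝ≥0 → Ω → Lp ℂ 2 (volume : Measure (Lat d))} {z : ℝ≥0}
  {uhat : Lat d → Ω → ℂ}

lemma IsFourierField.ae_integral_centeredProduct (S : IsSolution k₀ ε η R u₀ P ℱ u)
    (hF : IsFourierField P (u z) uhat) {χ : Fin p ⊕ Fin q → Lat d → ℂ} (h : ∀ i, IsTest (χ i)) :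
    ∀ᵐ ω ∂P, ∫ v, prodTest χ v * centeredProduct P uhat p q v ω
      = ∏ i, (amp (factorSign p q i) (u z ω) (χ i)
        - ∫ ω, amp (factorSign p q i) (u z ω) (χ i) ∂P) := by
  filter_upwards [hF.2, ae_all_iff.2 fun i => hF.amp_eq (factorSign p q i) (χ i)] with ω hω hamp
  have e : ∀ v : Dual d p q, prodTest χ v * centeredProduct P uhat p q v ω
      = ∏ i, (χ i (v i) *
        conjSign (factorSign p q i) (uhat (v i) ω - meanField P uhat (v i))) := fun v => by
    rw [centeredProduct_eq, prodTest, Finset.prod_mul_distrib]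
  simp only [e]
  rw [integral_fintype_prod_volume_eq_prod (fun i ξ => χ i ξ *
        conjSign (factorSign p q i) (uhat ξ ω - meanField P uhat ξ))]
  refine Finset.prod_congr rfl fun i _ => ?_
  have hm : MemLp (fun ξ => uhat ξ ω) 2 := (memLp_congr_ae hω).2 (memLp_fourierL2 _)
  have i1 : Integrable fun ξ => conjSign (factorSign p q i) (uhat ξ ω) * χ i ξ :=
    (memLp_conjSign _ hm).integrable_mul ((h i).memLp 2)
  have i2 : Integrable fun ξ => conjSign (factorSign p q i) (meanField P uhat ξ) * χ i ξ :=
    (memLp_conjSign _ (hF.memLp_meanField S)).integrable_mul ((h i).memLp 2)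
  rw [hamp i, ← hF.integral_meanField S _ (h i), ← integral_sub i1 i2]
  refine integral_congr_ae (ae_of_all _ fun ξ => ?_)
  simp only [map_sub]
  ring

/-- Expanding the product of differences: `T` is the set of factors in which the random amplitude,
not its mean, is chosen. -/
lemma IsSolution.integral_prod_sub (S : IsSolution k₀ ε η R u₀ P ℱ u)
    {χ : Fin p ⊕ Fin q → Lat d → ℂ} (h : ∀ i, IsTest (χ i)) (a : Fin p ⊕ Fin q → ℂ) (z : ℝ≥0) :
    ∫ ω, ∏ i, (amp (factorSign p q i) (u z ω) (χ i) - a i) ∂P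
      = altSum (fun T => momentFn P u (factorSign p q) T z χ * ∏ i ∈ Tᶜ, a i) Finset.univ := by
  have e : ∀ ω, ∏ i, (amp (factorSign p q i) (u z ω) (χ i) - a i)
      = ∑ T ∈ Finset.univ.powerset, prodAmp (factorSign p q) T (u z ω) χ *
        ((-1) ^ (Finset.univ \ T).card * ∏ i ∈ Tᶜ, a i) := fun ω => by
    simp only [sub_eq_add_neg]
    rw [Finset.prod_add]
    refine Finset.sum_congr rfl fun T _ => ?_
    rw [Finset.prod_neg]
    rfl
  simp only [e]
  rw [integral_finsetSum _ fun T _ => (S.integrable_prodAmp _ T h z).mul_const _, altSum]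
  refine Finset.sum_congr rfl fun T _ => ?_
  rw [integral_mul_const, momentFn, smul_eq_mul]
  ring

/-- In the term of index `T` the factors outside `T` are replaced by their means, which are damped
initial amplitudes. This is the form of `freeMoment`, so the alternating sum of moments becomes the
alternating sum of flows. -/
lemma IsFourierField.integral_prodTest_rots (S : IsSolution k₀ ε η R u₀ P ℱ u)
    (hR : IsCovariance R) (hu : Integrable (fourierL2 u₀)) (hF : IsFourierField P (u z) uhat)
    {χ : Fin p ⊕ Fin q → Lat d → ℂ} (h : ∀ i, IsTest (χ i)) :
    ∫ v, prodTest (rots (factorSign p q) (η / (k₀ * ε)) z χ) v * centeredMoment P uhat p q v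
      = totalDamping R k₀ η p q z * cint (centeredFlow hR k₀ ε η p q z
          (volume.withDensityᵥ (initialMoment u₀ p q))) (prodTest χ) := by
  have ht := IsTest.rots h (factorSign p q) (η / (k₀ * ε)) z
  have hint := hF.integrable_centeredProduct S (fun i => (ht i).1.continuous.measurable)
    fun i => (ht i).memLp 2
  have e1 : ∀ v, prodTest (rots (factorSign p q) (η / (k₀ * ε)) z χ) v *
      centeredMoment P uhat p q v = ∫ ω, prodTest (rots (factorSign p q) (η / (k₀ * ε)) z χ) v *
        centeredProduct P uhat p q v ω ∂P := fun v => by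
    rw [integral_const_mul]; rfl
  simp only [e1]
  rw [integral_integral_swap hint, integral_congr_ae (hF.ae_integral_centeredProduct S ht),
    S.integral_prod_sub ht]
  obtain ⟨b, -, hb⟩ := IsTest.exists_bound h
  have hm := measurable_prodTest h
  have hB := norm_prodTest_le fun i => (hb i).2
  rw [← cintCLM_apply hm hB, centeredFlow]
  simp only [altSum]
  rw [_root_.sum_apply, map_sum, Finset.mul_sum]
  refine Finset.sum_congr rfl fun T _ => ?_
  rw [_root_.smul_apply, map_smul, smul_eq_mul, smul_eq_mul, cintCLM_apply,
    ← S.freeMoment_eq hR hu T h z.coe_nonneg, freeMoment]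
  simp only [S.integral_amp_rot hR h]
  have hc : ((p + q : ℕ) : ℝ) = T.card + Tᶜ.card := by
    rw [← Nat.cast_add, Finset.card_add_card_compl]; simp
  -- The means carry the damping of `Tᶜ`, and `freeMoment` has the damping of `T` removed. Together
  -- they leave the damping of all factors, a prefactor independent of `T`.
  have key : ((Real.exp (-(k₀ ^ 2 * R 0 / (8 * η ^ 2) * z)) : ℝ) : ℂ) ^ Tᶜ.card
      = totalDamping R k₀ η p q z * Real.exp (T.card * (k₀ ^ 2 * R 0 / (8 * η ^ 2)) * z) := by
    rw [totalDamping, ← Complex.ofReal_mul, ← Real.exp_add, ← Complex.ofReal_pow,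
      ← Real.exp_nat_mul, hc]
    congr 2
    ring
  rw [Finset.prod_mul_distrib, Finset.prod_const, ← prodAmp, Real.toNNReal_coe, key]
  ring

/-- The centered moments are the densities of the evolved initial moments. -/
theorem IsFourierField.centeredMoment_eq (S : IsSolution k₀ ε η R u₀ P ℱ u)
    (hR : IsCovariance R) (hu : Integrable (fourierL2 u₀)) (hF : IsFourierField P (u z) uhat) :
    Integrable (centeredMoment P uhat p q) ∧
    volume.withDensityᵥ (centeredMoment P uhat p q) = mulDensity (phase k₀ ε η p q z)
      (((totalDamping R k₀ η p q z : ℝ) : ℂ) • centeredFlow hR k₀ ε η p q z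
          (volume.withDensityᵥ (initialMoment u₀ p q))) := by
  refine withDensity_eq_of_prodTest hF.measurable_centeredMoment
    (hF.integrable_gaussProd_centeredMoment S) _ fun χ h => ?_
  obtain ⟨b, -, hb⟩ := IsTest.exists_bound h
  have ht := IsTest.rots h (factorSign p q) (η / (k₀ * ε)) (-(z : ℝ))
  obtain ⟨b', -, hb'⟩ := IsTest.exists_bound ht
  rw [cint_mulDensity _ (measurable_phase _ _ _ _ _ _) (fun v => (norm_phase _ _ _ _ v).le)
    (measurable_prodTest h) (norm_prodTest_le fun i => (hb i).2)]
  simp only [phase_eq]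
  rw [cint_smul _ _ (measurable_prodTest ht) (norm_prodTest_le fun i => (hb' i).2),
    ← hF.integral_prodTest_rots S hR hu ht, rots_neg]

end Identification

/-! ### Smallness of the error -/

/-- With `t = -ln ε` the claim is `ln A + B (1 + ln t)² ≤ (2/5 - 1/3) t = t/15`, true for large `t`
because powers of the logarithm are `o(t)`. -/
lemma exists_forall_exp_mul_rpow_le {A : ℝ} (hA : 0 < A) (B : ℝ) : ∃ ε₀ : ℝ, 0 < ε₀ ∧ ∀ ε : ℝ, 0 < ε →
    ε < ε₀ → 0 < Real.log |Real.log ε| ∧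
      A * Real.exp (B * (1 + Real.log |Real.log ε|) ^ 2) * ε ^ (2 / 5 : ℝ) ≤ ε ^ (1 / 3 : ℝ) := by
  have h1 : ∀ᶠ t : ℝ in atTop, Real.log A + B * (1 + Real.log t) ^ 2 ≤ t / 15 := by
    have e1 : ∀ n : ℕ, Tendsto (fun t : ℝ => Real.log t ^ n / t) atTop (𝓝 0) := fun n =>
      (Real.isLittleO_pow_log_id_atTop (n := n)).tendsto_div_nhds_zero
    have h2 : Tendsto (fun t : ℝ => (Real.log A + B) * (Real.log t ^ 0 / t)
        + 2 * B * (Real.log t ^ 1 / t) + B * (Real.log t ^ 2 / t)) atTop (𝓝 0) := by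
      simpa using (((e1 0).const_mul (Real.log A + B)).add ((e1 1).const_mul (2 * B))).add
        ((e1 2).const_mul B)
    filter_upwards [h2.eventually_le_const (show (0 : ℝ) < 1 / 15 by norm_num),
      eventually_gt_atTop 0] with t ht ht0
    have e2 : (Real.log A + B) * (Real.log t ^ 0 / t) + 2 * B * (Real.log t ^ 1 / t)
        + B * (Real.log t ^ 2 / t) = (Real.log A + B * (1 + Real.log t) ^ 2) / t := by
      field_simp
      ring
    rw [e2, div_le_iff₀ ht0] at ht
    linarith
  obtain ⟨T, hT⟩ := eventually_atTop.1 h1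
  -- The bound `ε₀ ≤ 1/e` makes `|ln ε| > 1`, hence the iterated logarithm positive.
  refine ⟨Real.exp (-max T 1), Real.exp_pos _, fun ε hε hε' => ?_⟩
  have h2 : Real.log ε < -max T 1 := by rwa [Real.log_lt_iff_lt_exp hε]
  have h3 : max T 1 < -Real.log ε := by linarith
  have h4 : 1 < -Real.log ε := (le_max_right _ _).trans_lt h3
  have h5 : |Real.log ε| = -Real.log ε := abs_of_neg (by linarith)
  rw [h5]
  refine ⟨Real.log_pos h4, ?_⟩
  have h6 := hT (-Real.log ε) ((le_max_left _ _).trans h3.le)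
  rw [Real.rpow_def_of_pos hε, Real.rpow_def_of_pos hε, ← Real.exp_log hA, ← Real.exp_add,
    ← Real.exp_add]
  exact Real.exp_le_exp.2 (by linarith)

section Smallness

variable {d p q : ℕ} {R : Lat d → ℝ}

/-- The exponent `α = 2/5` lies below `1/2`, as the small denominators require, and above the
desired `1/3`, which leaves room for the constants. The variable `y` bounds both `1` and `1/η`, so
that all dependence on `η` is collected in `exp(B y²)` and both regimes are covered at once. -/
lemma tvNorm_errorOp_le (hd : 1 ≤ d) (hR : IsCovariance R) {k₀ : ℝ} (hk₀ : 0 < k₀) {Z : ℝ}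
    (hZ : 1 ≤ Z) : ∃ A B : ℝ, 0 < A ∧ ∀ ε η y : ℝ, 0 < ε → 0 < η → 1 ≤ y → η⁻¹ ≤ y →
      ∀ z ∈ Icc 0 Z, ∀ ρ : ComplexMeasure (Dual d p q),
        tvNorm (errorOp hR k₀ ε η p q z ρ)
          ≤ A * Real.exp (B * y ^ 2) * ε ^ (2 / 5 : ℝ) * tvNorm ρ := by
  obtain ⟨C, hC, hosc⟩ := oscillationBound_spec hd hR (α := 2 / 5) (by norm_num) (by norm_num)
  set N := 2 ^ (Fintype.card (Fin p ⊕ Fin q)) ^ 2 with hN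
  set M := 6 * ((Fintype.card (Fin p ⊕ Fin q)) ^ 2 + 1) ^ 2 with hM
  set I := ∫ k, ‖(spec R k : ℂ)‖ with hI
  have hI0 : 0 ≤ I := integral_nonneg fun _ => norm_nonneg _
  have hZ0 : 0 ≤ Z := zero_le_one.trans hZ
  refine ⟨4 * N * (C * Z) * Real.exp (M * Z) + 1,
    k₀ ^ 2 / 4 + k₀ + M * (k₀ ^ 2 / 4 * I * Z), by positivity, ?_⟩
  intro ε η y hε hη hy hηy z hz ρ
  have hc : 0 < η / (k₀ * ε) := by positivity
  have hκ : 0 ≤ C * Z * (η / (k₀ * ε)) ^ (-(2 / 5) : ℝ) := by positivity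
  have hy2 : y ≤ y ^ 2 := by nlinarith
  set g := k₀ ^ 2 / (4 * η ^ 2) with hg
  have hg0 : 0 ≤ g := by positivity
  have hgy : g ≤ k₀ ^ 2 / 4 * y ^ 2 := by
    have : g = k₀ ^ 2 / 4 * η⁻¹ ^ 2 := by rw [hg]; field_simp
    rw [this]
    have : 0 ≤ η⁻¹ := by positivity
    gcongr
  -- From `1 + g + g²/2 ≤ e^g`.
  have hg1 : g + g ^ 2 ≤ 2 * Real.exp (k₀ ^ 2 / 4 * y ^ 2) := by
    have h1 := Real.quadratic_le_exp_of_nonneg hg0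
    have h2 := Real.exp_le_exp.2 hgy
    nlinarith
  have hk : (η / (k₀ * ε)) ^ (-(2 / 5) : ℝ) ≤ Real.exp (k₀ * y ^ 2) * ε ^ (2 / 5 : ℝ) := by
    have e1 : (η / (k₀ * ε)) ^ (-(2 / 5) : ℝ) = (k₀ * η⁻¹) ^ (2 / 5 : ℝ) * ε ^ (2 / 5 : ℝ) := by
      rw [Real.rpow_neg hc.le, ← Real.inv_rpow hc.le, ← Real.mul_rpow (by positivity) hε.le]
      congr 1
      field_simp
    rw [e1]
    refine mul_le_mul_of_nonneg_right ?_ (by positivity)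
    have h0 : 0 ≤ k₀ * η⁻¹ := by positivity
    calc (k₀ * η⁻¹) ^ (2 / 5 : ℝ) ≤ (k₀ * η⁻¹ + 1) ^ (2 / 5 : ℝ) :=
          Real.rpow_le_rpow h0 (by linarith) (by norm_num)
      _ ≤ k₀ * η⁻¹ + 1 := Real.rpow_le_self_of_one_le (by linarith) (by norm_num)
      _ ≤ Real.exp (k₀ * η⁻¹) := Real.add_one_le_exp _
      _ ≤ Real.exp (k₀ * y ^ 2) := Real.exp_le_exp.2 (by gcongr; exact hηy.trans hy2)
  have hB : Real.exp (momentBound R k₀ η * Z) ^ M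
      ≤ Real.exp (M * Z) * Real.exp (M * (k₀ ^ 2 / 4 * I * Z) * y ^ 2) := by
    rw [← Real.exp_nat_mul, ← Real.exp_add, momentBound, ← hg, ← hI]
    refine Real.exp_le_exp.2 ?_
    have : g * I * Z ≤ k₀ ^ 2 / 4 * y ^ 2 * I * Z := by gcongr
    have hM0 : (0 : ℝ) ≤ M := by positivity
    nlinarith
  have hexp : Real.exp ((k₀ ^ 2 / 4 + k₀ + M * (k₀ ^ 2 / 4 * I * Z)) * y ^ 2)
      = Real.exp (k₀ ^ 2 / 4 * y ^ 2) * Real.exp (k₀ * y ^ 2) *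
        Real.exp (M * (k₀ ^ 2 / 4 * I * Z) * y ^ 2) := by
    rw [← Real.exp_add, ← Real.exp_add]; congr 1; ring
  have hmain := norm_errorOp_le hR hκ hZ (hosc _ Z hc hZ) hz ρ
  calc tvNorm (errorOp hR k₀ ε η p q z ρ) ≤ 2 * ‖errorOp hR k₀ ε η p q z ρ‖ := tvNorm_le _
    _ ≤ 2 * (N * ((g + g ^ 2) * (C * Z * (η / (k₀ * ε)) ^ (-(2 / 5) : ℝ)) *
          Real.exp (momentBound R k₀ η * Z) ^ M) * ‖ρ‖) := by
        refine mul_le_mul_of_nonneg_left (hmain.trans_eq ?_) zero_le_two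
        rw [hN]; push_cast; rfl
    _ ≤ 2 * (N * ((2 * Real.exp (k₀ ^ 2 / 4 * y ^ 2)) *
          (C * Z * (Real.exp (k₀ * y ^ 2) * ε ^ (2 / 5 : ℝ))) *
          (Real.exp (M * Z) * Real.exp (M * (k₀ ^ 2 / 4 * I * Z) * y ^ 2))) * tvNorm ρ) := by
        gcongr
        exact norm_le_tvNorm ρ
    _ = 4 * N * (C * Z) * Real.exp (M * Z) *
          Real.exp ((k₀ ^ 2 / 4 + k₀ + M * (k₀ ^ 2 / 4 * I * Z)) * y ^ 2) * ε ^ (2 / 5 : ℝ) *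
          tvNorm ρ := by rw [hexp]; ring
    _ ≤ _ := by
        have := (norm_nonneg ρ).trans (norm_le_tvNorm ρ)
        gcongr
        linarith

end Smallness

end ItoSchrodinger
-- The theorem
theorem corollary4p8 {d : ℕ} (hd : 1 ≤ d) {k₀ : ℝ} (hk₀ : 0 < k₀)
    {R : ItoSchrodinger.Lat d → ℝ} (hR : ItoSchrodinger.IsCovariance R)
    (η : ℝ → ℝ)
    (hη : (∀ ε, η ε = 1) ∨ (∀ ε, η ε = (Real.log |Real.log ε|)⁻¹))
    (p q : ℕ) :
    (∀ ε : ℝ, 0 < ε → ε < 1 → 0 < η ε → ∀ (j : Fin p) (l : Fin q),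
      ItoSchrodinger.IsSolutionOperator (ItoSchrodinger.pairScattering k₀ ε (η ε) R j l)
        (ItoSchrodinger.pairPropagator k₀ ε (η ε) R j l)) ∧
    ∃ Etilde : ℝ → ℝ → Module.End ℂ (ComplexMeasure (ItoSchrodinger.Dual d p q)),
      (∀ z : ℝ, 0 ≤ z → ∃ ε₀ : ℝ, 0 < ε₀ ∧ ∀ ε : ℝ, 0 < ε → ε < ε₀ →
        ∀ z' ∈ Icc 0 z, ∀ ρ : ComplexMeasure (ItoSchrodinger.Dual d p q),
          ItoSchrodinger.tvNorm (Etilde ε z' ρ) ≤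
            ε ^ (1 / 3 : ℝ) * ItoSchrodinger.tvNorm ρ) ∧
      ∀ ε : ℝ, 0 < ε → ε < 1 → 0 < η ε →
        ∀ (u₀ : Lp ℂ 2 (volume : Measure (ItoSchrodinger.Lat d))),
          Integrable (ItoSchrodinger.fourierL2 u₀) →
        ∀ {Ω : Type*} {mΩ : MeasurableSpace Ω} (P : Measure Ω) [IsProbabilityMeasure P]
          (ℱ : Filtration ℝ≥0 mΩ)
          (u : ℝ≥0 → Ω → Lp ℂ 2 (volume : Measure (ItoSchrodinger.Lat d))),
          ItoSchrodinger.IsSolution k₀ ε (η ε) R u₀ P ℱ u →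
        ∀ (z : ℝ≥0) (uhat : ItoSchrodinger.Lat d → Ω → ℂ),
          ItoSchrodinger.IsFourierField P (u z) uhat →
          (∀ᵐ ξ, Integrable (uhat ξ) P) ∧
          (∀ᵐ v, Integrable (ItoSchrodinger.centeredProduct P uhat p q v) P) ∧
          Integrable (ItoSchrodinger.centeredMoment P uhat p q) ∧
          volume.withDensityᵥ (ItoSchrodinger.centeredMoment P uhat p q) =
            ItoSchrodinger.mulDensity (ItoSchrodinger.phase k₀ ε (η ε) p q z)
              (ItoSchrodinger.centeredOperator k₀ ε (η ε) R p q z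
                  (volume.withDensityᵥ (ItoSchrodinger.initialMoment u₀ p q)) +
                Etilde ε z (volume.withDensityᵥ (ItoSchrodinger.initialMoment u₀ p q))) := by
  refine ⟨fun ε _ _ _ j l => ItoSchrodinger.isSolutionOperator_pairPropagator hR k₀ ε (η ε) j l,
    fun ε z => ItoSchrodinger.errorOp hR k₀ ε (η ε) p q z, fun z _ => ?_, ?_⟩
  -- The horizon is enlarged to `max 1 z`, since the estimates assume it is at least `1`.
  · obtain ⟨A, B, hA, h⟩ := ItoSchrodinger.tvNorm_errorOp_le (p := p) (q := q) hd hR hk₀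
      (le_max_left 1 z)
    obtain ⟨ε₀, hε₀, h₀⟩ := ItoSchrodinger.exists_forall_exp_mul_rpow_le hA B
    refine ⟨ε₀, hε₀, fun ε hε hlt z' hz' ρ => ?_⟩
    obtain ⟨hlog, hle⟩ := h₀ ε hε hlt
    -- The choice `y = 1 + ln|ln ε|` dominates `1/η` in the kinetic and in the diffusive regime.
    have hη' : 0 < η ε ∧ (η ε)⁻¹ ≤ 1 + Real.log |Real.log ε| := by
      rcases hη with hη | hη
      · rw [hη ε, inv_one]; exact ⟨one_pos, by linarith⟩
      · rw [hη ε, inv_inv]; exact ⟨inv_pos.2 hlog, by linarith⟩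
    refine (h ε (η ε) _ hε hη'.1 (by linarith) hη'.2 z' ⟨hz'.1, hz'.2.trans (le_max_right 1 z)⟩
      ρ).trans ?_
    exact mul_le_mul_of_nonneg_right hle
      ((norm_nonneg ρ).trans (ItoSchrodinger.norm_le_tvNorm ρ))
  · intro ε _ _ _ u₀ hu Ω mΩ P _ ℱ u S z uhat hF
    obtain ⟨h1, h2⟩ := hF.centeredMoment_eq (p := p) (q := q) S hR hu
    refine ⟨?_, hF.ae_integrable_centeredProduct S, h1, h2.trans ?_⟩
    · filter_upwards [hF.ae_memLp S] with ξ hξ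
      exact hξ.integrable one_le_two
    · congr 1
      simp only [ItoSchrodinger.errorOp, LinearMap.sub_apply, add_sub_cancel]
      rfl
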